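/- Let $d\ge 1$, $m\ge 0$, and let $\mathbf X=(\mathbf X_t)_{t\ge0}$ be an $\mathbb R^d$-valued (càdlàg, started at $0$) Lévy process on a filtered probability space $(\Omega,\mathcal F,(\mathcal F_t)_{t\ge 0},\mathbb P)$, i.e. $\mathbf X$ is adapted and $\mathbf X_t-\mathbf X_s$ is independent of $\mathcal F_s$ for $s\le t$, whose components $X^{(1)},\dots,X^{(d)}$ are independent and identically distributed processes. Let $(a_n)_{n\ge1}$ be real numbers and $g:\mathbb R^d\times(\mathbb R^d)^{m+1}\to\mathbb R$. For $i,n\ge1$ put $$\mathcal I_{i,n}=\Big(a_n(\mathbf X_{\frac in}-\mathbf X_{\frac{i-1}n}),\dots,a_n(\mathbf X_{\frac{i+m}n}-\mathbf X_{\frac{i+m-1}n})\Big),$$ $$Z^{(n)}_t=\frac1{\sqrt n}\sum_{i=1}^{\lfloor nt\rfloor}\Big(g(\mathbf X_{\frac{i-1}n},\mathcal I_{i,n})-\mathbb E\big[g(\mathbf X_{\frac{i-1}n},\mathcal I_{i,n})\,\big|\,\mathcal F_{\frac{i-1}n}\big]\Big),\qquad t\ge0 .$$ Assume that hypothesis $\mathbf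 H_1(\alpha)$ holds for some $\alpha\in(0,2)$, that is: - $g=g(x,y)$ is of class $C^3$, and $g$, $\partial g/\partial x_i$, $\partial^2 g/\partial x_i\partial x_j$ are bounded for all $i,j=1,\dots,d$; - $\lim_{n}\operatorname{Var}[g(\mathbf x,\mathcal I_{i,n})]$ exists in $\mathbb R$ for every $\mathbf x\in\mathbb R^d$ (by stationarity of the increments the variance does not depend on $i$); - there is $\kappa>0$ such that $\mathbb P[|X^{(1)}_t|\ge s]\le\kappa\,t\,s^{-\alpha}$ for all $t\ge0$ and $s>0$. Let $\tilde{\mathbf X}^{(l)}$, $l\in\mathbb Z$, be independent copies of $\mathbf X$, let $$\mathfrak g_n(\mathbf x)=\sum_{j=-m}^m\operatorname{Cov}\Big(g\big(\mathbf x,a_n\tilde{\mathbf X}^{(1)}_{\frac1n},\dots,a_n\tilde{\mathbf X}^{(m+1)}_{\frac1n}\big),\,g\big(\mathbf x,a_n\tilde{\mathbf X}^{(j+1)}_{\frac1n},\dots,a_n\tilde{\mathbf X}^{(j+m+1)}_{\frac1n}\big)\Big),$$ and assume that the pointwise limit $\mathfrak g(\mathbf x)=\lim_n\mathfrak g_n(\mathbf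 x)\in\mathbb R$ exists for every $\mathbf x\in\mathbb R^d$ and that $$\sup_{\mathbf x\in\mathbb R^d}|\mathfrak g_n(\mathbf x)-\mathfrak g(\mathbf x)|\longrightarrow0\qquad(n\to\infty).$$ Then there exist an extension $(\Omega',\mathcal F',(\mathcal F'_t)_{t\ge0},\mathbb P')$ of the filtered probability space and an $(\mathcal F'_t)$-Brownian motion $W$ on it, independent of $\mathbf X$, such that, with $A_s=\mathfrak g(\mathbf X_s)$, $\mathcal G=\sigma(\mathbf X_t:t\ge0)$ and the Itô integral $\int_0^t\sqrt{A_s}\,dW_s$, the processes $Z^{(n)}$ converge $\mathcal G$-stably in law, in the sense of finite-dimensional distributions, to $\big(\int_0^t\sqrt{A_s}\,dW_s\big)_{t\ge0}$. That is, for all $r\ge1$, $t_1,\dots,t_r\ge0$, every bounded continuous $f:\mathbb R^r\to\mathbb R$ and every bounded $\mathcal G$-measurable random variable $F$, $$\lim_{n\to\infty}\mathbb E\big[F\,f(Z^{(n)}_{t_1},\dots,Z^{(n)}_{t_r})\big]=\mathbb E'\Big[F\,f\Big(\int_0^{t_1}\sqrt{A_s}\,dW_s,\dots,\int_0^{t_r}\sqrt{A_s}\,dW_s\Big)\Big].$$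 Here an extension is a filtered probability space with a measure-preserving map $\pi:\Omega'\to\Omega$ such that $\pi^{-1}(\mathcal F_t)\subseteq\mathcal F'_t$ for all $t$, and random variables on $\Omega$ are regarded as random variables on $\Omega'$ by composition with $\pi$. -/

import Mathlib

open MeasureTheory ProbabilityTheory Filter Topology
open scoped NNReal ENNReal

universe u

noncomputable section

namespace LevyHF

/-! ### Lévy processes -/

/-- `X` is an `E`-valued Lévy process on `(Ω, F, (ℱ_t), P)`: it is adapted, starts at `0`,
has increments that are independent of the past and stationary, and has càdlàg paths. -/
structure IsLevyProcess {Ω : Type*} {mΩ : MeasurableSpace Ω} {E : Type*} [NormedAddCommGroup E]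
    [MeasurableSpace E] (ℱ : Filtration ℝ≥0 mΩ) (X : ℝ≥0 → Ω → E) (P : Measure Ω) : Prop where
  adapted : Adapted ℱ X
  zero : ∀ᵐ ω ∂P, X 0 ω = 0
  indep_increments : ∀ s t : ℝ≥0, s ≤ t →
    Indep (MeasurableSpace.comap (fun ω => X t ω - X s ω) inferInstance) (ℱ s) P
  stationary : ∀ s h : ℝ≥0, IdentDistrib (fun ω => X (s + h) ω - X s ω) (X h) P P
  cadlag : ∀ᵐ ω ∂P, ∀ t : ℝ≥0, ContinuousWithinAt (fun s => X s ω) (Set.Ici t) t ∧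
    ∃ l : E, Tendsto (fun s => X s ω) (𝓝[<] t) (𝓝 l)

/-- The coordinate processes of `X` are independent and identically distributed (as processes). -/
structure HasIIDComponents {Ω : Type*} {mΩ : MeasurableSpace Ω} {d : ℕ}
    (X : ℝ≥0 → Ω → EuclideanSpace ℝ (Fin d)) (P : Measure Ω) : Prop where
  indep : iIndepFun (fun (j : Fin d) (ω : Ω) (t : ℝ≥0) => X t ω j) P
  identDistrib : ∀ i j : Fin d,
    IdentDistrib (fun (ω : Ω) (t : ℝ≥0) => X t ω i) (fun (ω : Ω) (t : ℝ≥0) => X t ω j) P P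

/-! ### The statistic -/

/-- The vector of the `m + 1` normalised increments of `X` over the intervals
`[(i+k)/n, (i+k+1)/n]`, `k = 0, …, m`. With `i = 0, 1, …` counted from zero, this is
`𝓘_{i+1,n}`. -/
def increments {Ω : Type*} {d : ℕ} (X : ℝ≥0 → Ω → EuclideanSpace ℝ (Fin d)) (a : ℕ → ℝ) (m : ℕ)
    (n i : ℕ) (ω : Ω) : Fin (m + 1) → EuclideanSpace ℝ (Fin d) :=
  fun k => a n • (X (((i + k + 1 : ℕ) : ℝ≥0) / n) ω - X (((i + k : ℕ) : ℝ≥0) / n) ω)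

/-- `Z_t^{(n)} = n^{-1/2} ∑_{i=1}^{⌊nt⌋} (g(X_{(i-1)/n}, 𝓘_{i,n})
- E[g(X_{(i-1)/n}, 𝓘_{i,n}) | ℱ_{(i-1)/n}])`, with the summation index shifted by one. -/
def statZ {Ω : Type*} {mΩ : MeasurableSpace Ω} (P : Measure Ω) (ℱ : Filtration ℝ≥0 mΩ) {d m : ℕ}
    (X : ℝ≥0 → Ω → EuclideanSpace ℝ (Fin d)) (a : ℕ → ℝ)
    (g : EuclideanSpace ℝ (Fin d) → (Fin (m + 1) → EuclideanSpace ℝ (Fin d)) → ℝ)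
    (n : ℕ) (t : ℝ≥0) (ω : Ω) : ℝ :=
  (Real.sqrt n)⁻¹ * ∑ i ∈ Finset.range ⌊(n : ℝ≥0) * t⌋₊,
    (g (X ((i : ℝ≥0) / n) ω) (increments X a m n i ω)
      - (P[fun ω' => g (X ((i : ℝ≥0) / n) ω') (increments X a m n i ω') | ℱ ((i : ℝ≥0) / n)]) ω)

/-- `𝔤_n(x) = ∑_{j=-m}^{m} Cov(g(x, a_n X̃^{(1)}_{1/n}, …, a_n X̃^{(m+1)}_{1/n}),
g(x, a_n X̃^{(j+1)}_{1/n}, …, a_n X̃^{(j+m+1)}_{1/n}))`, where the `X̃^{(l)}_{1/n}`, `l ∈ ℤ`, are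
independent copies of `X_{1/n}`, realised as the coordinates of a product space. -/
def gn {Ω : Type*} {mΩ : MeasurableSpace Ω} (P : Measure Ω) {d m : ℕ}
    (X : ℝ≥0 → Ω → EuclideanSpace ℝ (Fin d)) (a : ℕ → ℝ)
    (g : EuclideanSpace ℝ (Fin d) → (Fin (m + 1) → EuclideanSpace ℝ (Fin d)) → ℝ)
    (n : ℕ) (x : EuclideanSpace ℝ (Fin d)) : ℝ :=
  ∑ j ∈ Finset.Icc (-(m : ℤ)) (m : ℤ),
    covariance
      (fun c : ℤ → EuclideanSpace ℝ (Fin d) => g x (fun k : Fin (m + 1) => a n • c (1 + (k : ℕ))))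
      (fun c : ℤ → EuclideanSpace ℝ (Fin d) =>
        g x (fun k : Fin (m + 1) => a n • c (j + 1 + (k : ℕ))))
      (Measure.infinitePi (fun _ : ℤ => P.map (X (1 / (n : ℝ≥0)))))

/-! ### The hypothesis `H₁(α)` -/

/-- The partial derivative of `g(x, y)` in the `i`-th coordinate of `x`. -/
def partialX {d m : ℕ}
    (g : EuclideanSpace ℝ (Fin d) → (Fin (m + 1) → EuclideanSpace ℝ (Fin d)) → ℝ) (i : Fin d) :
    EuclideanSpace ℝ (Fin d) → (Fin (m + 1) → EuclideanSpace ℝ (Fin d)) → ℝ :=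
  fun x y => fderiv ℝ (fun z => g z y) x (EuclideanSpace.single i 1)

/-- Hypothesis `H₁(α)`: regularity of `g`, existence of the limiting variance, tails of `X`.
By stationarity of the increments the law of `increments X a m n i` does not depend on `i`. -/
structure HypothesisH1 {Ω : Type*} {mΩ : MeasurableSpace Ω} (P : Measure Ω) {d m : ℕ}
    (X : ℝ≥0 → Ω → EuclideanSpace ℝ (Fin d)) (a : ℕ → ℝ)
    (g : EuclideanSpace ℝ (Fin d) → (Fin (m + 1) → EuclideanSpace ℝ (Fin d)) → ℝ)
    (α : ℝ) : Prop where
  contDiff : ContDiff ℝ 3 (Function.uncurry g)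
  bounded : ∃ C : ℝ, ∀ x y, |g x y| ≤ C
  bounded_deriv : ∀ i, ∃ C : ℝ, ∀ x y, |partialX g i x y| ≤ C
  bounded_deriv₂ : ∀ i j, ∃ C : ℝ, ∀ x y, |partialX (partialX g j) i x y| ≤ C
  variance_limit : ∀ x, ∃ v : ℝ,
    Tendsto (fun n => variance (fun ω => g x (increments X a m n 0 ω)) P) atTop (𝓝 v)
  tail : ∃ κ : ℝ, 0 < κ ∧ ∀ (j : Fin d) (t : ℝ≥0) (s : ℝ), 0 < s →
    P.real {ω | s ≤ |X t ω j|} ≤ κ * t * s ^ (-α)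

/-! ### Stable convergence -/

/-- `𝒢`-stable convergence in law of `ℝ^r`-valued random variables `Y n` on `(Ω, P)` to `Y'`,
which lives on the extension `(Ω', P')` of `(Ω, P)` with projection `π : Ω' → Ω`. A random variable
`F` on `Ω` is identified with `F ∘ π` on `Ω'`. -/
structure StablyConverges {Ω Ω' : Type*} (𝒢 : MeasurableSpace Ω) {mΩ : MeasurableSpace Ω}
    {mΩ' : MeasurableSpace Ω'} (P : Measure Ω) (P' : Measure Ω') (π : Ω' → Ω) {r : ℕ}
    (Y : ℕ → Ω → Fin r → ℝ) (Y' : Ω' → Fin r → ℝ) : Prop where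
  extension : MeasurePreserving π P' P
  aemeasurable : ∀ n, AEMeasurable (Y n) P
  aemeasurable_limit : AEMeasurable Y' P'
  tendsto : ∀ (f : BoundedContinuousFunction (Fin r → ℝ) ℝ) (F : Ω → ℝ),
    Measurable[𝒢] F → (∃ C : ℝ, ∀ ω, |F ω| ≤ C) →
    Tendsto (fun n => ∫ ω, F ω * f (Y n ω) ∂P) atTop (𝓝 (∫ ω', F (π ω') * f (Y' ω') ∂P'))

/-! ### Brownian motion and the Itô integral -/

/-- `W` is a standard Brownian motion with respect to the filtration `ℋ`. -/
structure IsBrownianFor {Ω : Type*} {mΩ : MeasurableSpace Ω} (ℋ : Filtration ℝ≥0 mΩ)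
    (W : ℝ≥0 → Ω → ℝ) (P : Measure Ω) : Prop where
  isBrownian : IsBrownianReal W P
  adapted : Adapted ℋ W
  indep_increments : ∀ s t : ℝ≥0, s ≤ t →
    Indep (MeasurableSpace.comap (fun ω => W t ω - W s ω) inferInstance) (ℋ s) P

/-- Simple predictable processes `∑_{k < N} ξ_k 1_{(t_k, t_{k+1}]}` with bounded
`ℋ_{t_k}`-measurable `ξ_k`. -/
structure SimpleProcess {Ω : Type*} {mΩ : MeasurableSpace Ω} (ℋ : Filtration ℝ≥0 mΩ) where
  N : ℕ
  time : ℕ → ℝ≥0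
  time_mono : Monotone time
  coef : ℕ → Ω → ℝ
  coef_measurable : ∀ k, Measurable[ℋ (time k)] (coef k)
  coef_bounded : ∀ k, ∃ C : ℝ, ∀ ω, |coef k ω| ≤ C

/-- The value at time `s` of a simple process. -/
def SimpleProcess.value {Ω : Type*} {mΩ : MeasurableSpace Ω} {ℋ : Filtration ℝ≥0 mΩ}
    (S : SimpleProcess ℋ) (s : ℝ≥0) (ω : Ω) : ℝ :=
  ∑ k ∈ Finset.range S.N, (Set.Ioc (S.time k) (S.time (k + 1))).indicator (fun _ => S.coef k ω) s

/-- `∫_0^t S dW = ∑_{k < N} ξ_k (W_{t_{k+1} ∧ t} - W_{t_k ∧ t})` for a simple process. -/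
def SimpleProcess.integral {Ω : Type*} {mΩ : MeasurableSpace Ω} {ℋ : Filtration ℝ≥0 mΩ}
    (S : SimpleProcess ℋ) (W : ℝ≥0 → Ω → ℝ) (t : ℝ≥0) (ω : Ω) : ℝ :=
  ∑ k ∈ Finset.range S.N, S.coef k ω * (W (min (S.time (k + 1)) t) ω - W (min (S.time k) t) ω)

/-- `I_t = ∫_0^t H_s dW_s` for all `t ≥ 0`, in the sense of Itô's `L²` theory: there are simple
processes `S_k` with `E ∫_0^t |S_k - H|² ds → 0` and `E |∫_0^t S_k dW - I_t|² → 0` for all `t`.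
If `W` is an `ℋ`-Brownian motion, this determines every `I_t` almost surely, by the Itô
isometry. -/
def IsItoIntegral {Ω : Type*} {mΩ : MeasurableSpace Ω} (ℋ : Filtration ℝ≥0 mΩ)
    (W H I : ℝ≥0 → Ω → ℝ) (P : Measure Ω) : Prop :=
  (∀ t : ℝ≥0, AEStronglyMeasurable (fun p : ℝ × Ω => H p.1.toNNReal p.2)
      ((volume.restrict (Set.Icc 0 (t : ℝ))).prod P) ∧ AEStronglyMeasurable (I t) P) ∧
  ∃ S : ℕ → SimpleProcess ℋ, ∀ t : ℝ≥0,
    Tendsto (fun k => eLpNorm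
        (fun p : ℝ × Ω => (S k).value p.1.toNNReal p.2 - H p.1.toNNReal p.2) 2
        ((volume.restrict (Set.Icc 0 (t : ℝ))).prod P)) atTop (𝓝 0) ∧
    Tendsto (fun k => eLpNorm (fun ω => (S k).integral W t ω - I t ω) 2 P) atTop (𝓝 0)

end LevyHF

end

/-! Stable convergence reduces to weighted characteristic functions. For bounded σ(X)-measurable F
one needs E[F exp(i ∑ u_j Z_{τ_j})] → E[F exp(-Q/2)], where Q = ∑ u_j u_l ∫_0^{τ_j ∧ τ_l} 𝔤(X_s) ds.
Indeed, an Itô integral against a Brownian motion independent of X is, given X, Gaussian with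
exactly this variance (`integral_cexp_itoIntegral`). Shifting and normalising F turns it into a
density, and Lévy's continuity theorem applies (`stablyConverges_of_charFun`).

For the limit it suffices that E[Φ (exp(Q/2 + i ∑ u_j Z_{τ_j}) - 1)] → 0, with Φ = F exp(-Q/2). The
second factor is bounded and the exponentials exp(i ∑ ⟨v_t, X_t⟩) span a dense subspace of L²(σ(X)),
so only these need to be tested (`tendsto_integral_mul_zero_of_phaseExp`). For them everything
factorises along time.

The grid of mesh 1/n is cut into blocks of p steps. In each block X is frozen at the left end and
the last m windows are dropped, so that a block sum reads only increments inside its block. The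
errors made are orthogonal at distance more than m, hence the cost in L¹ is O(p^{-1/2}) for large n
(`exists_integral_centredSum_sub_le`). What remains is E[∏ e_b (∏ y_b - 1)], with e_b the phase of
the increment of X over block b and y_b the exponential of the block sum, compensated by half its
limiting variance.

As e_b is independent of the past, telescoping (`norm_integral_prod_sub_prod_integral_le`) leaves
about nT/p errors E[H e_b (y_b - 1)] with H determined by the past, and each is O(1/n) with a
constant free of p (`exists_norm_integral_block_le`). Write e_b = 1 + (e_b - 1). The conditional
mean of y_b - 1 is O(1/n): the block sum has variance (p - m) 𝔤_n(x) + O(1), and uniform convergence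
of 𝔤_n makes this p 𝔤(x) + O(1) for large n. In the cross term |y_b - 1| = O(n^{-1/2}) uniformly,
while E|e_b - 1| is controlled by E min(1, |ΔX|) = O(n^{-γ}) with γ > 1/2. This is where α < 2
enters, and why the limiting noise is independent of X. The total error is O(1/p); first n and then
p tends to infinity.

The extension is the product of Ω with a space carrying a Brownian motion, built from the Schauder
expansion of the Brownian bridge. The Itô integral is an L² limit of left-endpoint sums; with the
path of X frozen these are Wiener integrals of step functions, so isometry and characteristic
function are computed path by path. -/

namespace LevyHF

/-! ### Existence of Brownian motion -/

/-- The tent function supported on `[0, 1]`. -/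
noncomputable def tent (x : ℝ) : ℝ := max 0 (min x (1 - x))

/-- Projection of the real line onto `[0, 1]`. -/
noncomputable def clip (x : ℝ) : ℝ := max 0 (min 1 x)

/-- The covariance of the Brownian bridge on `[0, 1]`, extended by zero. -/
noncomputable def bridgeCov (x y : ℝ) : ℝ := min (clip x) (clip y) - clip x * clip y

lemma clip_tent_cases (x : ℝ) :
    (x ≤ 0 ∧ clip x = 0 ∧ clip (2 * x) = 0 ∧ clip (2 * x - 1) = 0 ∧ tent x = 0) ∨
    (0 ≤ x ∧ x ≤ 1 / 2 ∧ clip x = x ∧ clip (2 * x) = 2 * x ∧ clip (2 * x - 1) = 0 ∧ tent x = x) ∨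
    (1 / 2 ≤ x ∧ x ≤ 1 ∧ clip x = x ∧ clip (2 * x) = 1 ∧ clip (2 * x - 1) = 2 * x - 1 ∧
      tent x = 1 - x) ∨
    (1 ≤ x ∧ clip x = 1 ∧ clip (2 * x) = 1 ∧ clip (2 * x - 1) = 1 ∧ tent x = 0) := by
  unfold clip tent
  rcases le_total x 0 with h0 | h0
  · left; grind
  rcases le_total x (1 / 2) with h1 | h1
  · right; left; grind
  rcases le_total x 1 with h2 | h2
  · right; right; left; grind
  · right; right; right; grind

/-- A bridge on [0, 1] is its value at 1/2 carried by a tent, plus two independent bridges on the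
two halves with variance scaled by 1/2. After the case split on both arguments every `clip` and
`tent` is linear. -/
lemma bridgeCov_rec (x y : ℝ) : bridgeCov x y =
    tent x * tent y + 1 / 2 * (bridgeCov (2 * x) (2 * y) + bridgeCov (2 * x - 1) (2 * y - 1)) := by
  unfold bridgeCov
  rcases clip_tent_cases x with ⟨h, a, b, c, e⟩ | ⟨h, h', a, b, c, e⟩ | ⟨h, h', a, b, c, e⟩ |
    ⟨h, a, b, c, e⟩ <;>
  rcases clip_tent_cases y with ⟨k, a', b', c', e'⟩ | ⟨k, k', a', b', c', e'⟩ |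
    ⟨k, k', a', b', c', e'⟩ | ⟨k, a', b', c', e'⟩ <;>
  rw [a, b, c, e, a', b', c', e'] <;> simp only [min_def] <;> split_ifs <;>
  first | (exfalso; linarith) | nlinarith

lemma tent_nonneg (x : ℝ) : 0 ≤ tent x := le_max_left _ _

lemma tent_le_one (x : ℝ) : tent x ≤ 1 := by unfold tent; grind

lemma tent_eq_zero {x : ℝ} (h : x ≤ 0 ∨ 1 ≤ x) : tent x = 0 := by unfold tent; grind

lemma continuous_tent : Continuous tent := by unfold tent; fun_prop

lemma bridgeCov_eq_zero {x : ℝ} (h : x ≤ 0 ∨ 1 ≤ x) (y : ℝ) : bridgeCov x y = 0 := by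
  have h0 : 0 ≤ clip y := by unfold clip; grind
  have h1 : clip y ≤ 1 := by unfold clip; grind
  rcases h with h | h
  · have : clip x = 0 := by unfold clip; grind
    simp [bridgeCov, this, h0]
  · have : clip x = 1 := by unfold clip; grind
    simp [bridgeCov, this, h1]

lemma abs_bridgeCov_le (x y : ℝ) : |bridgeCov x y| ≤ 1 := by
  have h0 : 0 ≤ clip y := by unfold clip; grind
  have h1 : clip y ≤ 1 := by unfold clip; grind
  have h2 : 0 ≤ clip x := by unfold clip; grind
  have h3 : clip x ≤ 1 := by unfold clip; grind
  unfold bridgeCov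
  rw [abs_le]
  rcases le_total (clip x) (clip y) with h | h
  · rw [min_eq_left h]; constructor <;> nlinarith
  · rw [min_eq_right h]; constructor <;> nlinarith

/-- At most one natural number k satisfies k < x < k + 1, so at most one summand is nonzero. -/
lemma abs_sum_le_of_support {x C : ℝ} (hC : 0 ≤ C) {F : ℕ → ℝ} (M : ℕ)
    (h0 : ∀ k : ℕ, x ≤ k ∨ (k : ℝ) + 1 ≤ x → F k = 0) (hF : ∀ k < M, |F k| ≤ C) :
    |∑ k ∈ Finset.range M, F k| ≤ C := by
  by_cases h : ∃ k ∈ Finset.range M, F k ≠ 0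
  · obtain ⟨k, hk, hne⟩ := h
    have hk' : (k : ℝ) < x ∧ x < k + 1 := by
      by_contra hcon
      exact hne (h0 k (by by_contra! h'; exact hcon ⟨h'.1, h'.2⟩))
    rw [Finset.sum_eq_single k]
    · exact hF k (Finset.mem_range.1 hk)
    · intro j _ hj
      apply h0
      rcases lt_or_gt_of_ne hj with h | h
      · right
        have : (j : ℝ) + 1 ≤ k := by exact_mod_cast h
        linarith
      · left
        have : (k : ℝ) + 1 ≤ j := by exact_mod_cast h
        linarith
    · exact fun h => absurd hk h
  · push Not at h
    rw [Finset.sum_eq_zero h]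
    simpa using hC

lemma sum_range_two_mul (f : ℕ → ℝ) (M : ℕ) :
    ∑ k ∈ Finset.range (2 * M), f k = ∑ k ∈ Finset.range M, (f (2 * k) + f (2 * k + 1)) := by
  induction M with
  | zero => simp
  | succ M ih => rw [Finset.sum_range_succ, ← ih, mul_add, mul_one, Finset.sum_range_succ,
      Finset.sum_range_succ]; ring

/-- `∑_{n < N} 2^{-n} ∑_{k < 2^n} T(2^n x - k) T(2^n y - k)`, with `T` the tent function. -/
noncomputable def schauderCov (N : ℕ) (x y : ℝ) : ℝ :=
  ∑ n ∈ Finset.range N, (1 / 2 : ℝ) ^ n *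
    ∑ k ∈ Finset.range (2 ^ n), tent (2 ^ n * x - k) * tent (2 ^ n * y - k)

/-- Iteration of `bridgeCov_rec`: cell k of level N splits into the cells 2k and 2k + 1 of level N +
1. -/
lemma bridgeCov_eq_schauderCov_add (N : ℕ) (x y : ℝ) : bridgeCov x y = schauderCov N x y +
    (1 / 2 : ℝ) ^ N * ∑ k ∈ Finset.range (2 ^ N), bridgeCov (2 ^ N * x - k) (2 ^ N * y - k) := by
  induction N with
  | zero => simp [schauderCov]
  | succ N ih =>
    rw [ih, schauderCov, schauderCov, Finset.sum_range_succ, add_assoc, pow_succ 2 N,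
      mul_comm (2 ^ N) 2, sum_range_two_mul, pow_succ, mul_assoc ((1 / 2 : ℝ) ^ N), ← mul_add]
    congr 2
    rw [Finset.mul_sum, ← Finset.sum_add_distrib]
    refine Finset.sum_congr rfl fun k _ => ?_
    rw [bridgeCov_rec]
    congr 2
    push_cast
    congr 2 <;> ring

/-- The remainder carries a factor 2^{-N}, and of its 2^N terms only one is nonzero, bounded by 1.
-/
lemma tendsto_schauderCov (x y : ℝ) :
    Tendsto (fun N => schauderCov N x y) atTop (𝓝 (bridgeCov x y)) := by
  rw [tendsto_iff_dist_tendsto_zero]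
  refine squeeze_zero (fun _ => dist_nonneg) (g := fun N => (1 / 2 : ℝ) ^ N) (fun N => ?_)
    (tendsto_pow_atTop_nhds_zero_of_lt_one (by norm_num) (by norm_num))
  rw [bridgeCov_eq_schauderCov_add N x y, dist_comm, Real.dist_eq, add_sub_cancel_left, abs_mul,
    abs_of_nonneg (by positivity)]
  refine mul_le_of_le_one_right (by positivity)
    (abs_sum_le_of_support (x := 2 ^ N * x) zero_le_one _ (fun k hk => ?_)
      fun k _ => abs_bridgeCov_le _ _)
  exact bridgeCov_eq_zero (by rcases hk with h | h; (left; linarith); (right; linarith)) _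

/-! ### The Schauder series with Gaussian coefficients -/

/-- The law of a doubly indexed sequence of independent standard Gaussian variables. -/
noncomputable def gaussianSeq : Measure (ℕ × ℕ → ℝ) :=
  Measure.infinitePi (fun _ => gaussianReal 0 1)

instance : IsProbabilityMeasure gaussianSeq := by unfold gaussianSeq; infer_instance

/-- The fourth root of `1 / 2`. -/
noncomputable def qRoot : ℝ := √√(1 / 2)

/-- With q = 2^{-1/4} the Schauder coefficient 2^{-n/2} is q^{2n}, and the number 2^n of terms in a
level is q^{-4n}. All later estimates become powers of q. -/
lemma qRoot_pow_four : qRoot ^ 4 = 1 / 2 := by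
  have h : qRoot ^ 4 = (qRoot ^ 2) ^ 2 := by ring
  rw [h, qRoot, Real.sq_sqrt (by positivity), Real.sq_sqrt (by positivity)]

lemma qRoot_pos : 0 < qRoot := by unfold qRoot; positivity

lemma qRoot_lt_one : qRoot < 1 := by
  by_contra! h
  have : 1 ≤ qRoot ^ 4 := one_le_pow₀ h
  rw [qRoot_pow_four] at this
  norm_num at this

/-- The `n`-th level of the Schauder expansion of the Brownian bridge. -/
noncomputable def schauder (n : ℕ) (x : ℝ) (ω : ℕ × ℕ → ℝ) : ℝ :=
  ∑ k ∈ Finset.range (2 ^ n), (qRoot ^ (2 * n) * tent (2 ^ n * x - k)) * ω (n, k)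

lemma integral_cexp_sum_gaussianSeq (s : Finset (ℕ × ℕ)) (b : ℕ × ℕ → ℝ) :
    ∫ ω, Complex.exp (((∑ p ∈ s, b p * ω p : ℝ) : ℂ) * Complex.I) ∂gaussianSeq
      = Complex.exp (-((∑ p ∈ s, b p ^ 2 : ℝ) : ℂ) / 2) := by
  have hind : iIndepFun (fun (p : ℕ × ℕ) (ω : ℕ × ℕ → ℝ) => b p * ω p) gaussianSeq :=
    iIndepFun_infinitePi (X := fun p x => b p * x) (fun p => by fun_prop)
  have h1 := (hind.restrict s).charFunDual_map_fun_finsetSum_eq_prod (X := fun (p : ℕ × ℕ) (ω : ℕ × ℕ → ℝ) => b p * ω p)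
    (s := s)
    (fun i _ => (show Measurable fun ω : ℕ × ℕ → ℝ => b i * ω i by fun_prop).aemeasurable)
  have h2 := congrFun h1 (ContinuousLinearMap.id ℝ ℝ)
  rw [charFunDual_apply, integral_map (Measurable.aemeasurable (by fun_prop)) (by fun_prop)] at h2
  simp only [ContinuousLinearMap.coe_id', id_eq] at h2
  rw [h2, Finset.prod_apply]
  have : ∀ p, charFunDual (gaussianSeq.map (fun ω => b p * ω p)) (ContinuousLinearMap.id ℝ ℝ)
      = Complex.exp (-((b p ^ 2 : ℝ) : ℂ) / 2) := fun p => by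
    have e : gaussianSeq.map (fun ω => b p * ω p) = (gaussianReal 0 1).map (fun x => b p * x) := by
      have := Measure.map_map (μ := gaussianSeq) (g := fun x : ℝ => b p * x)
        (f := fun ω : ℕ × ℕ → ℝ => ω p) (by fun_prop) (by fun_prop)
      rw [gaussianSeq, Measure.infinitePi_map_eval] at this
      rw [this]; rfl
    rw [e, gaussianReal_map_const_mul, charFunDual_eq_charFun_map_one]
    simp only [ContinuousLinearMap.coe_id', Measure.map_id]
    rw [charFun_gaussianReal]
    simp [neg_div]
  simp_rw [this]
  rw [← Complex.exp_sum]
  congr 1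
  push_cast
  rw [← Finset.sum_div, Finset.sum_neg_distrib]

/-- A majorant of `|schauder n x ω|`. -/
noncomputable def schauderBound (n : ℕ) (ω : ℕ × ℕ → ℝ) : ℝ :=
  qRoot ^ n + qRoot ^ (5 * n) * ∑ k ∈ Finset.range (2 ^ n), ω (n, k) ^ 4

lemma schauderBound_nonneg (n : ℕ) (ω : ℕ × ℕ → ℝ) : 0 ≤ schauderBound n ω := by
  have := qRoot_pos
  unfold schauderBound
  positivity

/-- If l z ≤ 1 the first term suffices, otherwise the second, which is (l z)³ z. This trades the
maximum over a level for a sum of fourth powers, whose mean is explicit. -/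
lemma le_inv_add_pow_four {z l : ℝ} (hz : 0 ≤ z) (hl : 0 < l) : z ≤ l⁻¹ + l ^ 3 * z ^ 4 := by
  rcases le_total (l * z) 1 with h | h
  · have : z ≤ l⁻¹ := by rw [← one_div, le_div_iff₀ hl]; linarith
    have : 0 ≤ l ^ 3 * z ^ 4 := by positivity
    linarith
  · have h3 : 1 ≤ (l * z) ^ 3 := one_le_pow₀ h
    have : l ^ 3 * z ^ 4 = (l * z) ^ 3 * z := by ring
    have : 0 < l⁻¹ := by positivity
    nlinarith

/-- Only one k contributes at a given x. Taking l = q^n in `le_inv_add_pow_four` turns q^{2n} |ω|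
into q^n + q^{5n} ω⁴, and summing over k removes the dependence on x. -/
lemma abs_schauder_le (n : ℕ) (x : ℝ) (ω : ℕ × ℕ → ℝ) : |schauder n x ω| ≤ schauderBound n ω := by
  have hq := qRoot_pos
  refine abs_sum_le_of_support (x := 2 ^ n * x) (schauderBound_nonneg n ω) _ (fun k hk => ?_)
    fun k hk => ?_
  · rw [tent_eq_zero (by rcases hk with h | h; (left; linarith); (right; linarith))]
    simp
  · have h1 := le_inv_add_pow_four (abs_nonneg (ω (n, k))) (pow_pos hq n)
    have h2 : ω (n, k) ^ 4 ≤ ∑ k ∈ Finset.range (2 ^ n), ω (n, k) ^ 4 :=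
      Finset.single_le_sum (f := fun k => ω (n, k) ^ 4) (fun _ _ => by positivity)
        (Finset.mem_range.2 hk)
    have h4 : |ω (n, k)| ^ 4 = ω (n, k) ^ 4 := by
      rw [show 4 = 2 * 2 from rfl, pow_mul, pow_mul, sq_abs]
    rw [abs_mul, abs_of_nonneg (mul_nonneg (by positivity) (tent_nonneg _))]
    calc qRoot ^ (2 * n) * tent (2 ^ n * x - k) * |ω (n, k)|
        ≤ qRoot ^ (2 * n) * 1 * ((qRoot ^ n)⁻¹ + (qRoot ^ n) ^ 3 * |ω (n, k)| ^ 4) := by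
          gcongr; exact tent_le_one _
      _ = qRoot ^ n + qRoot ^ (5 * n) * ω (n, k) ^ 4 := by
          rw [h4, mul_one, mul_add, two_mul, pow_add, mul_assoc, mul_inv_cancel₀ (by positivity),
            show 5 * n = n + n + n * 3 by ring, pow_add, pow_add, pow_mul]
          ring
      _ ≤ schauderBound n ω := by unfold schauderBound; gcongr

/-- The event that the majorants of the Schauder levels are summable. -/
def schauderGood : Set (ℕ × ℕ → ℝ) := {ω | ∑' n, ENNReal.ofReal (schauderBound n ω) ≠ ⊤}

lemma measurable_schauderBound (n : ℕ) : Measurable (schauderBound n) := by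
  unfold schauderBound; fun_prop

lemma measurableSet_schauderGood : MeasurableSet schauderGood := by
  have : Measurable fun ω => ∑' n, ENNReal.ofReal (schauderBound n ω) :=
    Measurable.tsum fun n => (measurable_schauderBound n).ennreal_ofReal
  exact (this (measurableSet_singleton ⊤)).compl

lemma summable_schauderBound {ω : ℕ × ℕ → ℝ} (h : ω ∈ schauderGood) :
    Summable fun n => schauderBound n ω := by
  have := ENNReal.summable_toReal h
  simpa [ENNReal.toReal_ofReal (schauderBound_nonneg _ ω)] using this

lemma integrable_pow_four_gaussianSeq (p : ℕ × ℕ) : Integrable (fun ω => ω p ^ 4) gaussianSeq ∧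
    ∫ ω, ω p ^ 4 ∂gaussianSeq = ∫ x, x ^ 4 ∂(gaussianReal 0 1) := by
  have hm : gaussianSeq.map (fun ω => ω p) = gaussianReal 0 1 := Measure.infinitePi_map_eval _ p
  have hint : Integrable (fun x : ℝ => x ^ 4) (gaussianReal 0 1) := by
    have := (memLp_id_gaussianReal (μ := 0) (v := 1) 4).integrable_norm_pow (by norm_num)
    refine this.congr (ae_of_all _ fun x => ?_)
    simp only [id_eq, Real.norm_eq_abs]
    rw [show 4 = 2 * 2 from rfl, pow_mul, pow_mul, sq_abs]
  have hp : AEMeasurable (fun ω : ℕ × ℕ → ℝ => ω p) gaussianSeq :=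
    (measurable_pi_apply p).aemeasurable
  constructor
  · rw [← hm] at hint
    exact hint.comp_aemeasurable hp
  · rw [← hm, integral_map hp (by fun_prop)]

/-- Since q^{5n} 2^n = q^n, the n-th majorant has mean (1 + c) q^n, with c the fourth Gaussian
moment. A series of nonnegative variables with summable means converges almost surely. -/
lemma ae_schauderGood : ∀ᵐ ω ∂gaussianSeq, ω ∈ schauderGood := by
  have hq := qRoot_pos
  refine (ae_lt_top' (Measurable.tsum fun n =>
    (measurable_schauderBound n).ennreal_ofReal).aemeasurable ?_).mono fun ω h => h.ne
  rw [lintegral_tsum fun n => (measurable_schauderBound n).ennreal_ofReal.aemeasurable]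
  set c := ∫ x, x ^ 4 ∂(gaussianReal 0 1)
  have hint : ∀ n, Integrable (schauderBound n) gaussianSeq := fun n =>
    (integrable_const _).add ((integrable_finsetSum _ fun k _ =>
      (integrable_pow_four_gaussianSeq (n, k)).1).const_mul _)
  have hval : ∀ n, ∫ ω, schauderBound n ω ∂gaussianSeq = (1 + c) * qRoot ^ n := fun n => by
    unfold schauderBound
    rw [integral_add (integrable_const _) ((integrable_finsetSum _ fun k _ =>
      (integrable_pow_four_gaussianSeq (n, k)).1).const_mul _), integral_const_mul,
      integral_finsetSum _ fun k _ => (integrable_pow_four_gaussianSeq (n, k)).1]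
    simp_rw [(integrable_pow_four_gaussianSeq _).2]
    have : qRoot ^ (5 * n) = qRoot ^ n * (1 / 2) ^ n := by
      rw [← qRoot_pow_four, ← pow_mul, ← pow_add]; congr 1; ring
    simp only [integral_const, probReal_univ, smul_eq_mul, one_mul, Finset.sum_const,
      Finset.card_range, nsmul_eq_mul, Nat.cast_pow, Nat.cast_ofNat, this]
    have h2 : (1 / 2 : ℝ) ^ n * 2 ^ n = 1 := by rw [← mul_pow]; norm_num
    linear_combination qRoot ^ n * c * h2
  have : ∀ n, ∫⁻ ω, ENNReal.ofReal (schauderBound n ω) ∂gaussianSeq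
      = ENNReal.ofReal ((1 + c) * qRoot ^ n) := fun n => by
    rw [← hval n, ofReal_integral_eq_lintegral_ofReal (hint n)
      (ae_of_all _ (schauderBound_nonneg n))]
  simp_rw [this]
  have hs : Summable fun n => (1 + c) * qRoot ^ n :=
    (summable_geometric_of_lt_one hq.le qRoot_lt_one).mul_left _
  exact hs.tsum_ofReal_ne_top

/-- The Brownian bridge on `[0, 1]`. -/
noncomputable def bridge (x : ℝ) (ω : ℕ × ℕ → ℝ) : ℝ :=
  schauderGood.indicator (fun ω => ∑' n, schauder n x ω) ω

lemma tendsto_bridge {ω : ℕ × ℕ → ℝ} (h : ω ∈ schauderGood) (x : ℝ) :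
    Tendsto (fun N => ∑ n ∈ Finset.range N, schauder n x ω) atTop (𝓝 (bridge x ω)) := by
  rw [bridge, Set.indicator_of_mem h]
  exact (Summable.of_norm_bounded (summable_schauderBound h)
    fun n => abs_schauder_le n x ω).hasSum.tendsto_sum_nat

lemma measurable_bridge (x : ℝ) : Measurable (bridge x) := by
  refine measurable_of_tendsto_metrizable (f := fun N => schauderGood.indicator
    (fun ω => ∑ n ∈ Finset.range N, schauder n x ω)) (fun N => ?_) ?_
  · refine Measurable.indicator ?_ measurableSet_schauderGood
    unfold schauder
    fun_prop
  · rw [tendsto_pi_nhds]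
    intro ω
    by_cases h : ω ∈ schauderGood
    · simpa only [Set.indicator_of_mem h] using tendsto_bridge h x
    · simp [bridge, h]

lemma continuous_bridge (ω : ℕ × ℕ → ℝ) : Continuous fun x => bridge x ω := by
  by_cases h : ω ∈ schauderGood
  · simp only [bridge, Set.indicator_of_mem h]
    refine continuous_tsum (fun n => ?_) (summable_schauderBound h)
      fun n x => abs_schauder_le n x ω
    unfold schauder
    have := continuous_tent
    fun_prop
  · simp only [bridge, Set.indicator_of_notMem h]
    exact continuous_const

/-- Partial sums of the series are finite combinations of independent Gaussians with covariance
`schauderCov`. The limit is taken by dominated convergence on one side and by `tendsto_schauderCov`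
on the other. -/
lemma integral_cexp_sum_bridge {ι : Type*} (s : Finset ι) (c x : ι → ℝ) :
    ∫ ω, Complex.exp (((∑ i ∈ s, c i * bridge (x i) ω : ℝ) : ℂ) * Complex.I) ∂gaussianSeq
      = Complex.exp (-((∑ i ∈ s, ∑ j ∈ s, c i * c j * bridgeCov (x i) (x j) : ℝ) : ℂ) / 2) := by
  have hlim : Tendsto (fun N => ∫ ω, Complex.exp (((∑ i ∈ s, c i *
      ∑ n ∈ Finset.range N, schauder n (x i) ω : ℝ) : ℂ) * Complex.I) ∂gaussianSeq) atTop
      (𝓝 (∫ ω, Complex.exp (((∑ i ∈ s, c i * bridge (x i) ω : ℝ) : ℂ) * Complex.I)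
        ∂gaussianSeq)) := by
    refine tendsto_integral_of_dominated_convergence (fun _ => 1) (fun N => ?_)
      (integrable_const _) (fun N => ae_of_all _ fun ω => ?_) ?_
    · unfold schauder
      refine Measurable.aestronglyMeasurable ?_
      fun_prop
    · rw [Complex.norm_exp_ofReal_mul_I]
    · filter_upwards [ae_schauderGood] with ω hω
      refine (Complex.continuous_exp.tendsto _).comp (Tendsto.mul_const _ ?_)
      refine (Complex.continuous_ofReal.tendsto _).comp ?_
      exact tendsto_finsetSum _ fun i _ => (tendsto_bridge hω (x i)).const_mul _
  refine tendsto_nhds_unique hlim ?_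
  have hrew : ∀ (N : ℕ), ∫ ω, Complex.exp (((∑ i ∈ s, c i *
      ∑ n ∈ Finset.range N, schauder n (x i) ω : ℝ) : ℂ) * Complex.I) ∂gaussianSeq =
      Complex.exp (-((∑ i ∈ s, ∑ j ∈ s, c i * c j * schauderCov N (x i) (x j) : ℝ) : ℂ) / 2) := by
    intro N
    -- All coordinates used by the first N levels, so that the double sum over n and k is one sum of
    -- independent Gaussians.
    set S : Finset (ℕ × ℕ) := (Finset.range N).biUnion
      fun n => (Finset.range (2 ^ n)).image fun k => (n, k)
    have hS : ∀ F : ℕ × ℕ → ℝ, ∑ p ∈ S, F p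
        = ∑ n ∈ Finset.range N, ∑ k ∈ Finset.range (2 ^ n), F (n, k) := fun F => by
      rw [Finset.sum_biUnion]
      · refine Finset.sum_congr rfl fun n _ => ?_
        rw [Finset.sum_image]
        intro a _ b _ h
        simpa using h
      · intro a _ b _ hab
        simp only [Function.onFun, Finset.disjoint_left, Finset.mem_image, not_exists, not_and]
        rintro p ⟨k, _, rfl⟩ l _ hl
        exact hab (by simpa using (congrArg Prod.fst hl).symm)
    set b : ℕ × ℕ → ℝ := fun p => ∑ i ∈ s, c i *
      (qRoot ^ (2 * p.1) * tent (2 ^ p.1 * x i - p.2))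
    have e1 : ∀ ω : ℕ × ℕ → ℝ, ∑ i ∈ s, c i * ∑ n ∈ Finset.range N, schauder n (x i) ω
        = ∑ p ∈ S, b p * ω p := fun ω => by
      rw [hS]
      simp only [b, schauder, Finset.mul_sum, Finset.sum_mul]
      rw [Finset.sum_comm]
      refine Finset.sum_congr rfl fun n _ => ?_
      rw [Finset.sum_comm]
      refine Finset.sum_congr rfl fun k _ => Finset.sum_congr rfl fun i _ => ?_
      ring
    have e2 : ∑ p ∈ S, b p ^ 2 = ∑ i ∈ s, ∑ j ∈ s, c i * c j * schauderCov N (x i) (x j) := by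
      rw [hS]
      have hq : ∀ n, (1 / 2 : ℝ) ^ n = qRoot ^ (2 * n) * qRoot ^ (2 * n) := fun n => by
        rw [← qRoot_pow_four, ← pow_mul, ← pow_add]; congr 1; ring
      simp only [b, schauderCov, Finset.mul_sum, sq, Finset.sum_mul, hq]
      have : ∀ F : ι → ι → ℕ → ℕ → ℝ, ∑ i ∈ s, ∑ j ∈ s, ∑ n ∈ Finset.range N,
          ∑ k ∈ Finset.range (2 ^ n), F i j n k = ∑ n ∈ Finset.range N,
          ∑ k ∈ Finset.range (2 ^ n), ∑ i ∈ s, ∑ j ∈ s, F i j n k := fun F => by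
        simp_rw [Finset.sum_comm (s := s) (t := Finset.range N)]
        refine Finset.sum_congr rfl fun n _ => ?_
        simp_rw [Finset.sum_comm (s := s) (t := Finset.range (2 ^ n))]
      rw [this]
      refine Finset.sum_congr rfl fun n _ => Finset.sum_congr rfl fun k _ => ?_
      rw [Finset.sum_comm]
      refine Finset.sum_congr rfl fun i _ => Finset.sum_congr rfl fun j _ => ?_
      ring
    simp_rw [e1]
    rw [integral_cexp_sum_gaussianSeq, e2]
  simp_rw [hrew]
  refine (Complex.continuous_exp.tendsto _).comp (Tendsto.div_const (Tendsto.neg ?_) _)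
  refine (Complex.continuous_ofReal.tendsto _).comp ?_
  exact tendsto_finsetSum _ fun i _ => tendsto_finsetSum _ fun j _ =>
    (tendsto_schauderCov _ _).const_mul _

/-- A Brownian motion on `[0, ∞)`, obtained from the Brownian bridge by a change of time. -/
noncomputable def brownian (t : ℝ≥0) (ω : ℕ × ℕ → ℝ) : ℝ := (1 + t) * bridge (t / (1 + t)) ω

lemma measurable_brownian (t : ℝ≥0) : Measurable (brownian t) :=
  (measurable_bridge _).const_mul _

/-- For s ≤ t the bridge covariance is s/(1+s) · (1 - t/(1+t)) = s / ((1+s)(1+t)). -/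
lemma brownian_cov (s t : ℝ≥0) :
    (1 + s) * (1 + t) * bridgeCov (s / (1 + s)) (t / (1 + t)) = (min s t : ℝ) := by
  wlog h : s ≤ t generalizing s t
  · rw [min_comm, ← this t s (le_of_not_ge h)]
    simp only [bridgeCov, min_comm]
    ring
  have hc : ∀ r : ℝ≥0, clip (r / (1 + r)) = r / (1 + r) := fun r => by
    have h1 : (r : ℝ) / (1 + r) ≤ 1 := by
      rw [div_le_one (by positivity)]; linarith
    rw [clip, min_eq_right h1, max_eq_right (by positivity)]
  have h' : (s : ℝ) ≤ t := h
  rw [bridgeCov, hc, hc, min_eq_left h', min_eq_left]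
  · field_simp
    ring
  · rw [div_le_div_iff₀ (by positivity) (by positivity)]
    nlinarith

lemma integral_cexp_sum_brownian {ι : Type*} (s : Finset ι) (c : ι → ℝ) (x : ι → ℝ≥0) :
    ∫ ω, Complex.exp (((∑ i ∈ s, c i * brownian (x i) ω : ℝ) : ℂ) * Complex.I) ∂gaussianSeq
      = Complex.exp (-((∑ i ∈ s, ∑ j ∈ s, c i * c j * min (x i : ℝ) (x j) : ℝ) : ℂ) / 2) := by
  have := integral_cexp_sum_bridge s (fun i => c i * (1 + x i)) (fun i => (x i : ℝ) / (1 + x i))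
  convert this using 6
  · exact Finset.sum_congr rfl fun i _ => by rw [brownian]; ring
  · refine Finset.sum_congr rfl fun j _ => ?_
    rw [← brownian_cov]
    ring

/-- Finite-dimensional laws are compared through characteristic functions: for a functional with
coefficients l_i both sides are centred Gaussian with variance ∑ l_i l_j min(i, j). Continuity comes
from the uniform convergence of the Schauder series. -/
lemma isBrownianReal_brownian : IsBrownianReal brownian gaussianSeq where
  hasLaw I := by
    have hm : AEMeasurable (fun ω => I.restrict (brownian · ω)) gaussianSeq :=
      aemeasurable_pi_lambda _ fun i => (measurable_brownian i).aemeasurable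
    refine ⟨hm, ?_⟩
    have := Measure.isProbabilityMeasure_map hm
    refine Measure.ext_of_charFunDual (funext fun L => ?_)
    rw [charFunDual_apply, integral_map hm (by fun_prop), IsGaussian.charFunDual_eq]
    obtain ⟨l, hL⟩ : ∃ l : I → ℝ, ∀ y : I → ℝ, L y = ∑ i, l i * y i := by
      refine ⟨fun i => L (Pi.single i 1), fun y => ?_⟩
      conv_lhs => rw [← Finset.univ_sum_single y, map_sum]
      refine Finset.sum_congr rfl fun i _ => ?_
      have : Pi.single i (y i) = y i • (Pi.single i 1 : I → ℝ) := by
        rw [← Pi.single_smul]; simp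
      rw [this, map_smul, smul_eq_mul, mul_comm]
    have h2 : ∀ i : I, MemLp (fun y : I → ℝ => l i * y i) 2
        (BrownianReal.projectiveFamily I) := fun i =>
      (IsGaussian.hasGaussianLaw_id.eval i).memLp_two.const_mul _
    have hmean : ∫ y, L y ∂(BrownianReal.projectiveFamily I) = 0 := by
      rw [ContinuousLinearMap.integral_comp_id_comm IsGaussian.integrable_id]
      simp
    have hvar : Var[L; BrownianReal.projectiveFamily I]
        = ∑ i : I, ∑ j : I, l i * l j * min (i : ℝ) j := by
      rw [← covariance_self (by fun_prop)]
      have : (L : (I → ℝ) → ℝ) = fun y => ∑ i, l i * y i := funext hL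
      rw [this, covariance_fun_sum_fun_sum h2 h2]
      refine Finset.sum_congr rfl fun i _ => Finset.sum_congr rfl fun j _ => ?_
      rw [covariance_const_mul_left, covariance_const_mul_right,
        BrownianReal.covariance_eval_projectiveFamily]
      push_cast
      ring
    rw [integral_complex_ofReal, hmean, hvar]
    simp_rw [hL]
    simp only [Finset.restrict_def]
    rw [integral_cexp_sum_brownian Finset.univ (fun i : I => l i) (fun i : I => i)]
    congr 1
    push_cast
    ring
  cont := ae_of_all _ fun ω => by
    unfold brownian
    have := continuous_bridge ω
    have h : Continuous fun t : ℝ≥0 => (t : ℝ) / (1 + t) :=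
      Continuous.div (by fun_prop) (by fun_prop) fun t => by positivity
    exact (by fun_prop : Continuous fun t : ℝ≥0 => 1 + (t : ℝ)).mul (this.comp h)

end LevyHF

namespace LevyHF

/-! ### Wiener integrals of step functions -/

/-- The linear functional `∑ c_τ W_τ` of the Brownian motion. -/
noncomputable def wienerSum (c : ℝ≥0 →₀ ℝ) (ω : ℕ × ℕ → ℝ) : ℝ := c.sum fun τ a => a * brownian τ ω

/-- The step function `∑ c_τ 1_{(0, τ]}`. -/
noncomputable def stepSum (c : ℝ≥0 →₀ ℝ) (s : ℝ) : ℝ :=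
  c.sum fun τ a => a * (Set.Ioc (0 : ℝ) τ).indicator 1 s

lemma wienerSum_add (c e : ℝ≥0 →₀ ℝ) (ω : ℕ × ℕ → ℝ) :
    wienerSum (c + e) ω = wienerSum c ω + wienerSum e ω :=
  Finsupp.sum_add_index' (by simp) fun _ _ _ => by ring

lemma wienerSum_smul (r : ℝ) (c : ℝ≥0 →₀ ℝ) (ω : ℕ × ℕ → ℝ) :
    wienerSum (r • c) ω = r * wienerSum c ω := by
  rw [wienerSum, Finsupp.sum_smul_index (by simp), wienerSum, Finsupp.mul_sum]
  simp_rw [mul_assoc]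

lemma wienerSum_single (τ : ℝ≥0) (ω : ℕ × ℕ → ℝ) :
    wienerSum (Finsupp.single τ 1) ω = brownian τ ω := by
  simp [wienerSum]

lemma stepSum_add (c e : ℝ≥0 →₀ ℝ) (s : ℝ) : stepSum (c + e) s = stepSum c s + stepSum e s :=
  Finsupp.sum_add_index' (by simp) fun _ _ _ => by ring

lemma stepSum_smul (r : ℝ) (c : ℝ≥0 →₀ ℝ) (s : ℝ) : stepSum (r • c) s = r * stepSum c s := by
  rw [stepSum, Finsupp.sum_smul_index (by simp), stepSum, Finsupp.mul_sum]
  simp_rw [mul_assoc]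

lemma stepSum_single (τ : ℝ≥0) (s : ℝ) :
    stepSum (Finsupp.single τ 1) s = (Set.Ioc (0 : ℝ) τ).indicator 1 s := by
  simp [stepSum]

/-- The indicators of (0, i] and (0, j] multiply to that of (0, min(i, j)], whose length is the
Brownian covariance. -/
lemma integral_stepSum_sq (c : ℝ≥0 →₀ ℝ) :
    ∫ s, stepSum c s ^ 2
      = ∑ i ∈ c.support, ∑ j ∈ c.support, c i * c j * min (i : ℝ) j := by
  have hprod : ∀ i j : ℝ≥0, (fun s : ℝ => (Set.Ioc (0 : ℝ) i).indicator (1 : ℝ → ℝ) s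
      * (Set.Ioc (0 : ℝ) j).indicator (1 : ℝ → ℝ) s)
      = (Set.Ioc (0 : ℝ) (min (i : ℝ) j)).indicator 1 := fun i j => by
    ext s
    have : Set.Ioc (0 : ℝ) (min (i : ℝ) j) = Set.Ioc 0 (i : ℝ) ∩ Set.Ioc 0 (j : ℝ) := by
      rw [Set.Ioc_inter_Ioc, max_self]
    rw [this, ← Set.indicator_indicator]
    by_cases hs : s ∈ Set.Ioc (0 : ℝ) i <;> simp [hs]
  have hint : ∀ i j : ℝ≥0, Integrable (fun s : ℝ => (Set.Ioc (0 : ℝ) i).indicator (1 : ℝ → ℝ) s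
      * (Set.Ioc (0 : ℝ) j).indicator (1 : ℝ → ℝ) s) := fun i j => by
    rw [hprod]
    exact (integrable_indicator_iff measurableSet_Ioc).2
      (integrableOn_const (by simp))
  have hval : ∀ i j : ℝ≥0, ∫ s : ℝ, (Set.Ioc (0 : ℝ) i).indicator (1 : ℝ → ℝ) s
      * (Set.Ioc (0 : ℝ) j).indicator (1 : ℝ → ℝ) s = min (i : ℝ) j := fun i j => by
    rw [hprod, integral_indicator measurableSet_Ioc]
    simp
  have : ∀ s, stepSum c s ^ 2 = ∑ i ∈ c.support, ∑ j ∈ c.support, c i * c j *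
      ((Set.Ioc (0 : ℝ) i).indicator (1 : ℝ → ℝ) s
      * (Set.Ioc (0 : ℝ) j).indicator (1 : ℝ → ℝ) s) := fun s => by
    rw [stepSum, Finsupp.sum, sq, Finset.sum_mul_sum]
    refine Finset.sum_congr rfl fun i _ => Finset.sum_congr rfl fun j _ => ?_
    ring
  simp_rw [this]
  rw [integral_finsetSum _ fun i _ => integrable_finsetSum _ fun j _ => (hint i j).const_mul _]
  refine Finset.sum_congr rfl fun i _ => ?_
  rw [integral_finsetSum _ fun j _ => (hint i j).const_mul _]
  refine Finset.sum_congr rfl fun j _ => ?_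
  rw [integral_const_mul, hval]

/-- The variance is expressed as an L² norm in time, the form needed later when the coefficients
come from a frozen path of X. -/
lemma integral_cexp_wienerSum (c : ℝ≥0 →₀ ℝ) :
    ∫ ω, Complex.exp ((wienerSum c ω : ℂ) * Complex.I) ∂gaussianSeq
      = Complex.exp (-((∫ s, stepSum c s ^ 2 : ℝ) : ℂ) / 2) := by
  rw [integral_stepSum_sq]
  exact integral_cexp_sum_brownian c.support c fun i => i

lemma memLp_brownian (t : ℝ≥0) : MemLp (brownian t) 2 gaussianSeq :=
  (isBrownianReal_brownian.isGaussianProcess.hasGaussianLaw_eval t).memLp_two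

lemma measurable_wienerSum (c : ℝ≥0 →₀ ℝ) : Measurable (wienerSum c) :=
  Finset.measurable_sum _ fun i _ => (measurable_brownian i).const_mul _

lemma integral_wienerSum_sq (c : ℝ≥0 →₀ ℝ) :
    ∫ ω, wienerSum c ω ^ 2 ∂gaussianSeq = ∫ s, stepSum c s ^ 2 := by
  have h0 : ∫ ω, wienerSum c ω ∂gaussianSeq = 0 := by
    unfold wienerSum Finsupp.sum
    rw [integral_finsetSum _ fun i _ => (isBrownianReal_brownian.integrable_eval i).const_mul _]
    refine Finset.sum_eq_zero fun i _ => ?_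
    rw [integral_const_mul, isBrownianReal_brownian.integral_eval, mul_zero]
  rw [integral_stepSum_sq, ← variance_of_integral_eq_zero
    (measurable_wienerSum c).aemeasurable h0, ← covariance_self (measurable_wienerSum c).aemeasurable]
  unfold wienerSum Finsupp.sum
  rw [covariance_fun_sum_fun_sum' (fun i _ => (memLp_brownian i).const_mul _)
    fun i _ => (memLp_brownian i).const_mul _]
  refine Finset.sum_congr rfl fun i _ => Finset.sum_congr rfl fun j _ => ?_
  rw [covariance_const_mul_left, covariance_const_mul_right,
    isBrownianReal_brownian.covariance_fun_eval]
  push_cast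
  ring

end LevyHF

namespace LevyHF

/-! ### Products of almost independent factors -/

/-- Peel off the last factor: with H the product of the earlier ones, E[H e y] = E[H e (y - 1)] +
E[H] E[e], by independence of e from the past. The first term is bounded by the hypothesis, and the
factor E[e], of modulus at most 1, does not amplify the earlier error. No independence between e and
y is needed. -/
lemma norm_integral_prod_sub_prod_integral_le {Ω : Type*} {mΩ : MeasurableSpace Ω} {P : Measure Ω}
    [IsProbabilityMeasure P] {𝒢 : ℕ → MeasurableSpace Ω} (hmono : Monotone 𝒢)
    (hle : ∀ b, 𝒢 b ≤ mΩ) {e y : ℕ → Ω → ℂ} (he : ∀ b, Measurable[𝒢 (b + 1)] (e b))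
    (hy : ∀ b, Measurable[𝒢 (b + 1)] (y b)) (he1 : ∀ b ω, ‖e b ω‖ ≤ 1) {ρ δ : ℝ} (hρ : 1 ≤ ρ)
    (hδ0 : 0 ≤ δ) (hyρ : ∀ b ω, ‖y b ω‖ ≤ ρ)
    (hind : ∀ b, Indep (MeasurableSpace.comap (e b) inferInstance) (𝒢 b) P)
    (B : ℕ) (hδ : ∀ b < B, ∀ H : Ω → ℂ, Measurable[𝒢 b] H → (∀ ω, ‖H ω‖ ≤ 1) →
      ‖∫ ω, H ω * (e b ω * (y b ω - 1)) ∂P‖ ≤ δ) :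
    ‖∫ ω, ∏ b ∈ Finset.range B, e b ω * y b ω ∂P - ∏ b ∈ Finset.range B, ∫ ω, e b ω ∂P‖
      ≤ B * ρ ^ B * δ := by
  have hprodm : ∀ j, Measurable[𝒢 j] fun ω => ∏ b ∈ Finset.range j, e b ω * y b ω := fun j => by
    refine Finset.measurable_fun_prod _ fun b hb => ?_
    have hb' : b + 1 ≤ j := Finset.mem_range.1 hb
    exact ((he b).mono (hmono hb') le_rfl).mul ((hy b).mono (hmono hb') le_rfl)
  have hprodn : ∀ j ω, ‖∏ b ∈ Finset.range j, e b ω * y b ω‖ ≤ ρ ^ j := fun j ω => by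
    rw [norm_prod]
    calc ∏ b ∈ Finset.range j, ‖e b ω * y b ω‖ ≤ ∏ _b ∈ Finset.range j, ρ := by
          refine Finset.prod_le_prod (fun _ _ => norm_nonneg _) fun b _ => ?_
          rw [norm_mul]
          calc _ ≤ 1 * ρ := mul_le_mul (he1 b ω) (hyρ b ω) (norm_nonneg _) zero_le_one
            _ = ρ := one_mul _
      _ = ρ ^ j := by simp
  have he1' : ∀ b, ‖∫ ω, e b ω ∂P‖ ≤ 1 := fun b => by
    simpa using norm_integral_le_of_norm_le_const (μ := P) (ae_of_all _ (he1 b))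
  have key : ∀ j ≤ B, ‖∫ ω, ∏ b ∈ Finset.range j, e b ω * y b ω ∂P
      - ∏ b ∈ Finset.range j, ∫ ω, e b ω ∂P‖ ≤ j * ρ ^ B * δ := by
    intro j
    induction j with
    | zero => simp
    | succ j ih =>
      intro hj
      have hρj : 0 < ρ ^ j := by positivity
      set H : Ω → ℂ := fun ω => ∏ b ∈ Finset.range j, e b ω * y b ω with hH
      have hHm : Measurable H := (hprodm j).mono (hle j) le_rfl
      have hem : Measurable (e j) := (he j).mono (hle _) le_rfl
      have hym : Measurable (y j) := (hy j).mono (hle _) le_rfl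
      have hi1 : Integrable (fun ω => H ω * e j ω) P :=
        Integrable.of_bound (hHm.mul hem).aestronglyMeasurable (ρ ^ j * 1)
          (ae_of_all _ fun ω => by
            rw [norm_mul]
            exact mul_le_mul (hprodn j ω) (he1 j ω) (norm_nonneg _) hρj.le)
      have hi2 : Integrable (fun ω => H ω * (e j ω * (y j ω - 1))) P :=
        Integrable.of_bound (by fun_prop) (ρ ^ j * (1 * (ρ + 1)))
          (ae_of_all _ fun ω => by
            rw [norm_mul, norm_mul]
            have : ‖y j ω - 1‖ ≤ ρ + 1 := (norm_sub_le _ _).trans (by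
              rw [norm_one]; linarith [hyρ j ω])
            gcongr
            · exact hprodn j ω
            · exact he1 j ω)
      have hsplit : ∫ ω, ∏ b ∈ Finset.range (j + 1), e b ω * y b ω ∂P
          = ∫ ω, H ω * (e j ω * (y j ω - 1)) ∂P + (∫ ω, H ω ∂P) * ∫ ω, e j ω ∂P := by
        have hI : IndepFun H (e j) P := by
          have : IndepFun (e j) H P :=
            indep_of_indep_of_le_right (hind j) (hprodm j).comap_le
          exact this.symm
        rw [← hI.integral_fun_mul_eq_mul_integral hHm.aestronglyMeasurable
          hem.aestronglyMeasurable, ← integral_add hi2 hi1]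
        refine integral_congr_ae (ae_of_all _ fun ω => ?_)
        simp only [hH, Finset.prod_range_succ]
        ring
      have h1 : ‖∫ ω, H ω * (e j ω * (y j ω - 1)) ∂P‖ ≤ ρ ^ B * δ := by
        -- The partial product is bounded by ρ^j, so the hypothesis is applied to H / ρ^j.
        have := hδ j hj (fun ω => (ρ ^ j : ℂ)⁻¹ * H ω) ((hprodm j).const_mul _) fun ω => by
          rw [norm_mul, norm_inv, norm_pow, Complex.norm_real, Real.norm_of_nonneg (by linarith),
            inv_mul_le_iff₀ hρj, mul_one]
          exact hprodn j ω
        simp_rw [mul_assoc] at this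
        rw [integral_const_mul, norm_mul, norm_inv, norm_pow, Complex.norm_real,
          Real.norm_of_nonneg (by linarith), inv_mul_le_iff₀ hρj] at this
        refine this.trans ?_
        gcongr
        omega
      rw [hsplit, Finset.prod_range_succ, add_sub_assoc, ← sub_mul]
      refine (norm_add_le _ _).trans ?_
      rw [norm_mul]
      have h2 := mul_le_mul (ih (by omega)) (he1' j) (norm_nonneg _) (by positivity)
      push_cast
      linarith
  exact key B le_rfl

/-- Second-order Taylor expansion at z = a + iκU. Since U is centred, the term linear in U and the
cross term of z² integrate to 0, leaving a - E(κU)²/2, the square a²/2, and a cubic remainder. -/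
lemma norm_integral_cexp_sub_one_sub_le {Ω : Type*} {mΩ : MeasurableSpace Ω} {ν : Measure Ω}
    [IsProbabilityMeasure ν] {U : Ω → ℝ} (hU : Measurable U) {a κ θ : ℝ} (hθ : ∀ ω, |κ * U ω| ≤ θ)
    (ha : 0 ≤ a) (haθ : a + θ ≤ 1) (h0 : ∫ ω, κ * U ω ∂ν = 0) :
    ‖∫ ω, (Complex.exp ((a : ℂ) + ((κ * U ω : ℝ) : ℂ) * Complex.I) - 1) ∂ν
      - ((a - (∫ ω, (κ * U ω) ^ 2 ∂ν) / 2 : ℝ) : ℂ)‖ ≤ a ^ 2 + (a + θ) ^ 3 := by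
  have hθ0 : 0 ≤ θ := by
    obtain ⟨ω⟩ := nonempty_of_isProbabilityMeasure ν
    exact (abs_nonneg _).trans (hθ ω)
  set z : Ω → ℂ := fun ω => (a : ℂ) + ((κ * U ω : ℝ) : ℂ) * Complex.I with hz
  have hzm : Measurable z := by fun_prop
  have hzn : ∀ ω, ‖z ω‖ ≤ a + θ := fun ω => by
    refine (norm_add_le _ _).trans ?_
    rw [norm_mul, Complex.norm_I, mul_one, Complex.norm_real, Complex.norm_real,
      Real.norm_of_nonneg ha, Real.norm_eq_abs]
    linarith [hθ ω]
  have hrem : ∀ ω, ‖Complex.exp (z ω) - 1 - (z ω + z ω ^ 2 / 2)‖ ≤ (a + θ) ^ 3 := fun ω => by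
    have h1 := Complex.exp_bound (x := z ω) ((hzn ω).trans haθ) (n := 3) (by norm_num)
    have h2 : ∑ m ∈ Finset.range 3, z ω ^ m / (m.factorial : ℂ) = 1 + (z ω + z ω ^ 2 / 2) := by
      simp [Finset.sum_range_succ, Nat.factorial]; ring
    rw [h2] at h1
    rw [sub_sub]
    refine h1.trans ?_
    have h3 : ‖z ω‖ ^ 3 ≤ (a + θ) ^ 3 := by gcongr; exact hzn ω
    have h4 : ((Nat.succ 3 : ℕ) : ℝ) * ((Nat.factorial 3 : ℕ) * (3 : ℕ) : ℝ)⁻¹ ≤ 1 := by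
      norm_num [Nat.factorial]
    calc _ ≤ ‖z ω‖ ^ 3 * 1 := by gcongr
      _ ≤ _ := by linarith
  have hUi : Integrable (fun ω => κ * U ω) ν :=
    Integrable.of_bound (by fun_prop) θ (ae_of_all _ hθ)
  have hU2i : Integrable (fun ω => (κ * U ω) ^ 2) ν :=
    Integrable.of_bound (by fun_prop) (θ ^ 2) (ae_of_all _ fun ω => by
      rw [Real.norm_eq_abs, abs_pow]
      gcongr
      exact hθ ω)
  have hei : Integrable (fun ω => Complex.exp (z ω) - 1) ν := by
    refine Integrable.of_bound (by fun_prop) (Real.exp (a + θ) + 1) (ae_of_all _ fun ω => ?_)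
    refine (norm_sub_le _ _).trans ?_
    rw [norm_one]
    gcongr
    exact (Complex.norm_exp_le_exp_norm _).trans (Real.exp_le_exp.2 (hzn ω))
  have hzi : Integrable (fun ω => z ω + z ω ^ 2 / 2) ν := by
    refine Integrable.of_bound (by fun_prop) ((a + θ) + (a + θ) ^ 2 / 2) (ae_of_all _ fun ω => ?_)
    refine (norm_add_le _ _).trans ?_
    rw [norm_div, norm_pow, Complex.norm_ofNat]
    gcongr <;> exact hzn ω
  have hzint : ∫ ω, (z ω + z ω ^ 2 / 2) ∂ν
      = ((a - (∫ ω, (κ * U ω) ^ 2 ∂ν) / 2 + a ^ 2 / 2 : ℝ) : ℂ) := by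
    have : ∀ ω, z ω + z ω ^ 2 / 2 = ((a + a ^ 2 / 2 - (κ * U ω) ^ 2 / 2 : ℝ) : ℂ)
        + ((κ * U ω : ℝ) : ℂ) * ((1 + a : ℝ) * Complex.I) := fun ω => by
      simp only [hz]
      push_cast
      linear_combination ((κ * U ω : ℂ) ^ 2 / 2) * Complex.I_sq
    simp_rw [this]
    rw [integral_add, integral_mul_const, integral_complex_ofReal, integral_complex_ofReal, h0,
      integral_sub (integrable_const _) (hU2i.div_const _), integral_div]
    · simp
      ring
    · exact ((integrable_const _).sub (hU2i.div_const _)).ofReal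
    · exact hUi.ofReal.mul_const _
  have h1 : ‖∫ ω, (Complex.exp (z ω) - 1) ∂ν - ∫ ω, (z ω + z ω ^ 2 / 2) ∂ν‖ ≤ (a + θ) ^ 3 := by
    rw [← integral_sub hei hzi]
    simpa using norm_integral_le_of_norm_le_const (μ := ν) (ae_of_all _ hrem)
  rw [hzint] at h1
  have h2 : ((a - (∫ ω, (κ * U ω) ^ 2 ∂ν) / 2 + a ^ 2 / 2 : ℝ) : ℂ)
      = ((a - (∫ ω, (κ * U ω) ^ 2 ∂ν) / 2 : ℝ) : ℂ) + ((a ^ 2 / 2 : ℝ) : ℂ) := by push_cast; ring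
  rw [h2, ← sub_sub] at h1
  have h3 := norm_le_insert' (∫ ω, (Complex.exp (z ω) - 1) ∂ν
    - ((a - (∫ ω, (κ * U ω) ^ 2 ∂ν) / 2 : ℝ) : ℂ)) ((a ^ 2 / 2 : ℝ) : ℂ)
  rw [Complex.norm_real, Real.norm_of_nonneg (by positivity)] at h3
  nlinarith [sq_nonneg a]

/-- Pairs at distance more than m contribute nothing. For the others 2xy ≤ x² + y², and each index
has at most 2m + 1 partners. -/
lemma integral_sq_sum_le_of_orthogonal {Ω : Type*} {mΩ : MeasurableSpace Ω} {P : Measure Ω}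
    (m N : ℕ) {δ : ℕ → Ω → ℝ} (hδ : ∀ i, MemLp (δ i) 2 P)
    (h0 : ∀ i j, i + m < j → ∫ ω, δ i ω * δ j ω ∂P = 0) :
    ∫ ω, (∑ i ∈ Finset.range N, δ i ω) ^ 2 ∂P
      ≤ (2 * m + 1) * ∑ i ∈ Finset.range N, ∫ ω, δ i ω ^ 2 ∂P := by
  have hint : ∀ i j, Integrable (fun ω => δ i ω * δ j ω) P := fun i j =>
    (hδ i).integrable_mul (hδ j)
  have hsq : ∀ i, Integrable (fun ω => δ i ω ^ 2) P := fun i => (hδ i).integrable_sq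
  have h1 : ∫ ω, (∑ i ∈ Finset.range N, δ i ω) ^ 2 ∂P
      = ∑ i ∈ Finset.range N, ∑ j ∈ Finset.range N, ∫ ω, δ i ω * δ j ω ∂P := by
    simp_rw [sq, Finset.sum_mul_sum]
    rw [integral_finsetSum _ fun i _ => integrable_finsetSum _ fun j _ => hint i j]
    refine Finset.sum_congr rfl fun i _ => ?_
    rw [integral_finsetSum _ fun j _ => hint i j]
  rw [h1]
  set c : ℕ → ℕ → ℝ := fun i j => if i ≤ j + m ∧ j ≤ i + m then 1 else 0 with hc
  have hcount : ∀ i, ∑ j ∈ Finset.range N, c i j ≤ 2 * m + 1 := fun i => by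
    simp only [hc]
    rw [Finset.sum_boole]
    have : (Finset.range N).filter (fun j => i ≤ j + m ∧ j ≤ i + m) ⊆ Finset.Icc (i - m) (i + m) := by
      intro j hj
      simp only [Finset.mem_filter, Finset.mem_Icc] at hj ⊢
      omega
    have h2 := Finset.card_le_card this
    rw [Nat.card_Icc] at h2
    have h3 : ((Finset.range N).filter (fun j => i ≤ j + m ∧ j ≤ i + m)).card ≤ 2 * m + 1 := by omega
    exact_mod_cast h3
  have hcs : ∀ i j, c i j = c j i := fun i j => by simp only [hc, and_comm]
  have hterm : ∀ i j, ∫ ω, δ i ω * δ j ω ∂P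
      ≤ c i j * ((∫ ω, δ i ω ^ 2 ∂P) / 2) + c j i * ((∫ ω, δ j ω ^ 2 ∂P) / 2) := fun i j => by
    rw [hcs j i, ← mul_add]
    by_cases h : i ≤ j + m ∧ j ≤ i + m
    · simp only [hc, h, and_self, if_true, one_mul]
      rw [← integral_div, ← integral_div, ← integral_add ((hsq i).div_const _) ((hsq j).div_const _)]
      refine integral_mono (hint i j) (((hsq i).div_const _).add ((hsq j).div_const _)) fun ω => ?_
      nlinarith [sq_nonneg (δ i ω - δ j ω)]
    · have : c i j = 0 := by simp only [hc, h, if_false]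
      rw [this, zero_mul]
      rcases (by omega : i + m < j ∨ j + m < i) with h | h
      · exact (h0 i j h).le
      · simp_rw [mul_comm (δ i _)]
        exact (h0 j i h).le
  calc ∑ i ∈ Finset.range N, ∑ j ∈ Finset.range N, ∫ ω, δ i ω * δ j ω ∂P
      ≤ ∑ i ∈ Finset.range N, ∑ j ∈ Finset.range N,
        (c i j * ((∫ ω, δ i ω ^ 2 ∂P) / 2) + c j i * ((∫ ω, δ j ω ^ 2 ∂P) / 2)) :=
        Finset.sum_le_sum fun i _ => Finset.sum_le_sum fun j _ => hterm i j
    _ = ∑ i ∈ Finset.range N, (∑ j ∈ Finset.range N, c i j) * ∫ ω, δ i ω ^ 2 ∂P := by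
        simp_rw [Finset.sum_add_distrib]
        rw [Finset.sum_comm (f := fun i j => c j i * ((∫ ω, δ j ω ^ 2 ∂P) / 2)),
          ← Finset.sum_add_distrib]
        refine Finset.sum_congr rfl fun i _ => ?_
        rw [← Finset.sum_mul]
        ring
    _ ≤ ∑ i ∈ Finset.range N, (2 * m + 1) * ∫ ω, δ i ω ^ 2 ∂P := by
        refine Finset.sum_le_sum fun i _ => ?_
        have : 0 ≤ ∫ ω, δ i ω ^ 2 ∂P := integral_nonneg fun ω => sq_nonneg _
        exact mul_le_mul_of_nonneg_right (hcount i) this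
    _ = _ := by rw [Finset.mul_sum]

end LevyHF

namespace LevyHF

/-! ### Density of exponentials -/

section Density

variable {Ω T : Type*} {mΩ : MeasurableSpace Ω} {P : Measure Ω} {d : ℕ}

/-- The exponential `exp (i ∑_{t ∈ S} ⟨v_t, X_t⟩)`. -/
noncomputable def phaseExp (X : T → Ω → EuclideanSpace ℝ (Fin d)) (S : Finset T)
    (v : T → EuclideanSpace ℝ (Fin d)) (ω : Ω) : ℂ :=
  Complex.exp (((∑ t ∈ S, inner ℝ (v t) (X t ω) : ℝ) : ℂ) * Complex.I)

lemma norm_phaseExp (X : T → Ω → EuclideanSpace ℝ (Fin d)) (S : Finset T)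
    (v : T → EuclideanSpace ℝ (Fin d)) (ω : Ω) : ‖phaseExp X S v ω‖ = 1 :=
  Complex.norm_exp_ofReal_mul_I _

lemma measurable_phaseExp {X : T → Ω → EuclideanSpace ℝ (Fin d)} (hX : ∀ t, Measurable (X t))
    (S : Finset T) (v : T → EuclideanSpace ℝ (Fin d)) : Measurable (phaseExp X S v) := by
  unfold phaseExp
  have : Measurable fun ω => ∑ t ∈ S, inner ℝ (v t) (X t ω) :=
    Finset.measurable_sum _ fun t _ => (hX t).const_inner
  fun_prop

lemma iSup_comap_eq_comap (X : T → Ω → EuclideanSpace ℝ (Fin d)) :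
    ⨆ t, MeasurableSpace.comap (X t) inferInstance
      = MeasurableSpace.comap (fun ω t => X t ω) MeasurableSpace.pi := by
  simp only [MeasurableSpace.pi, MeasurableSpace.comap_iSup, MeasurableSpace.comap_comp]
  rfl

/-- The characteristic functions determine the finite-dimensional marginals, and these determine a
finite measure on the path space. Linear functionals on a finite product are written through vectors
v_t by Riesz representation. -/
lemma map_eq_map_of_integral_phaseExp_eq {X : T → Ω → EuclideanSpace ℝ (Fin d)}
    (hX : ∀ t, Measurable (X t)) {μ ν : Measure Ω} [IsFiniteMeasure μ] [IsFiniteMeasure ν]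
    (h : ∀ S v, ∫ ω, phaseExp X S v ω ∂μ = ∫ ω, phaseExp X S v ω ∂ν) :
    μ.map (fun ω t => X t ω) = ν.map (fun ω t => X t ω) := by
  have hΦ : Measurable fun ω t => X t ω := measurable_pi_lambda _ hX
  have key : ∀ S : Finset T, (ν.map (fun ω t => X t ω)).map S.restrict
      = (μ.map (fun ω t => X t ω)).map S.restrict := fun S => by
    refine Measure.ext_of_charFunDual (funext fun L => ?_)
    obtain ⟨v, hv⟩ : ∃ v : T → EuclideanSpace ℝ (Fin d), ∀ y : S → EuclideanSpace ℝ (Fin d),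
        L y = ∑ t : S, inner ℝ (v t) (y t) := by
      classical
      refine ⟨fun t => if ht : t ∈ S then (InnerProductSpace.toDual ℝ _).symm
        (L.comp (ContinuousLinearMap.single ℝ (fun _ : S => EuclideanSpace ℝ (Fin d)) ⟨t, ht⟩))
        else 0, fun y => ?_⟩
      conv_lhs => rw [← Finset.univ_sum_single y, map_sum]
      refine Finset.sum_congr rfl fun t _ => ?_
      simp only [Subtype.coe_eta, Finset.coe_mem, dif_pos]
      rw [InnerProductSpace.toDual_symm_apply]
      simp
    have hval : ∀ κ : Measure Ω, charFunDual ((κ.map (fun ω t => X t ω)).map S.restrict) L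
        = ∫ ω, phaseExp X S v ω ∂κ := fun κ => by
      rw [Measure.map_map (Finset.measurable_restrict S) hΦ, charFunDual_apply,
        integral_map ((Finset.measurable_restrict S).comp hΦ).aemeasurable (by fun_prop)]
      refine integral_congr_ae (ae_of_all _ fun ω => ?_)
      simp only [phaseExp, hv, Function.comp_apply, Finset.restrict_def]
      rw [← Finset.sum_coe_sort S]
    rw [hval, hval, h]
  exact IsProjectiveLimit.unique (P := fun S : Finset T => (μ.map (fun ω t => X t ω)).map S.restrict)
    (fun S => rfl) key

/-- The positive and negative parts of r are densities of two finite measures. By hypothesis these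
have the same characteristic functions under X, hence the same image under X, and F factors through
X. -/
lemma integral_mul_eq_zero_of_phaseExp_real [IsProbabilityMeasure P]
    {X : T → Ω → EuclideanSpace ℝ (Fin d)} (hX : ∀ t, Measurable (X t)) {r : Ω → ℝ}
    (hrm : Measurable r) (hri : Integrable r P)
    (h : ∀ S v, ∫ ω, phaseExp X S v ω * r ω ∂P = 0) {F : Ω → ℂ}
    (hF : Measurable[⨆ t, MeasurableSpace.comap (X t) inferInstance] F) {C : ℝ}
    (hFC : ∀ ω, ‖F ω‖ ≤ C) : ∫ ω, F ω * r ω ∂P = 0 := by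
  set p : Ω → ℝ≥0 := fun ω => (r ω).toNNReal with hp
  set q : Ω → ℝ≥0 := fun ω => (-r ω).toNNReal with hq
  have hpm : Measurable p := hrm.real_toNNReal
  have hqm : Measurable q := hrm.neg.real_toNNReal
  have hpq : ∀ ω, (r ω : ℂ) = (p ω : ℂ) - (q ω : ℂ) := fun ω => by
    simp only [hp, hq]
    have : r ω = ((r ω).toNNReal : ℝ) - ((-r ω).toNNReal : ℝ) := by
      simp only [Real.coe_toNNReal', max_comm _ (0 : ℝ)]
      exact (max_zero_sub_eq_self (r ω)).symm.trans (by simp [max_comm])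
    conv_lhs => rw [this]
    push_cast
    rfl
  have hpi : Integrable (fun ω => (p ω : ℂ)) P := (hri.real_toNNReal).ofReal
  have hqi : Integrable (fun ω => (q ω : ℂ)) P := (hri.neg.real_toNNReal).ofReal
  have hfin : ∀ f : Ω → ℝ≥0, Integrable (fun ω => (f ω : ℂ)) P →
      IsFiniteMeasure (P.withDensity fun ω => (f ω : ℝ≥0∞)) := fun f hf => by
    refine isFiniteMeasure_withDensity (ne_of_lt ?_)
    have := hf.2
    rw [hasFiniteIntegral_iff_enorm] at this
    refine lt_of_le_of_lt (lintegral_mono fun ω => ?_) this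
    rw [← ofReal_norm, Complex.norm_real, Real.norm_of_nonneg (f ω).coe_nonneg,
      ENNReal.ofReal_coe_nnreal]
  have := hfin p hpi
  have := hfin q hqi
  have hsm : ∀ (f : Ω → ℝ≥0) (G : Ω → ℂ), ∫ ω, f ω • G ω ∂P = ∫ ω, G ω * f ω ∂P := fun f G => by
    refine integral_congr_ae (ae_of_all _ fun ω => ?_)
    simp only [NNReal.smul_def, Complex.real_smul, mul_comm]
  have hexp : ∀ G : Ω → ℂ, Measurable G → (∀ ω, ‖G ω‖ ≤ max C 1) →
      ∫ ω, G ω * r ω ∂P = ∫ ω, G ω * p ω ∂P - ∫ ω, G ω * q ω ∂P := fun G hG hGb => by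
    rw [← integral_sub]
    · simp_rw [hpq, mul_sub]
    · exact hpi.bdd_mul hG.aestronglyMeasurable (ae_of_all _ hGb)
    · exact hqi.bdd_mul hG.aestronglyMeasurable (ae_of_all _ hGb)
  have hmap := map_eq_map_of_integral_phaseExp_eq hX
    (μ := P.withDensity fun ω => (p ω : ℝ≥0∞)) (ν := P.withDensity fun ω => (q ω : ℝ≥0∞))
    fun S v => by
      rw [integral_withDensity_eq_integral_smul hpm, integral_withDensity_eq_integral_smul hqm,
        hsm, hsm, ← sub_eq_zero, ← hexp _ (measurable_phaseExp hX S v) fun ω => by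
          rw [norm_phaseExp]; exact le_max_right _ _]
      exact h S v
  rw [iSup_comap_eq_comap] at hF
  obtain ⟨F', hF', rfl⟩ := hF.exists_eq_measurable_comp
  have hΦ : Measurable fun ω t => X t ω := measurable_pi_lambda _ hX
  rw [hexp _ (hF'.comp hΦ) fun ω => (hFC ω).trans (le_max_left _ _), sub_eq_zero, ← hsm, ← hsm,
    ← integral_withDensity_eq_integral_smul hpm, ← integral_withDensity_eq_integral_smul hqm]
  simp only [Function.comp_def]
  rw [← integral_map hΦ.aemeasurable (f := F') hF'.aestronglyMeasurable, hmap,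
    integral_map hΦ.aemeasurable hF'.aestronglyMeasurable]

lemma phaseExp_neg (X : T → Ω → EuclideanSpace ℝ (Fin d)) (S : Finset T)
    (v : T → EuclideanSpace ℝ (Fin d)) (ω : Ω) :
    phaseExp X S (-v) ω = starRingEnd ℂ (phaseExp X S v ω) := by
  simp [phaseExp, ← Complex.exp_conj]

/-- Replacing v by -v and conjugating shows that the conjugate of r satisfies the same hypothesis,
hence so do the real and imaginary parts. -/
lemma integral_mul_eq_zero_of_phaseExp [IsProbabilityMeasure P]
    {X : T → Ω → EuclideanSpace ℝ (Fin d)} (hX : ∀ t, Measurable (X t)) {r : Ω → ℂ}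
    (hrm : Measurable r) (hri : Integrable r P)
    (h : ∀ S v, ∫ ω, phaseExp X S v ω * r ω ∂P = 0) {F : Ω → ℂ}
    (hF : Measurable[⨆ t, MeasurableSpace.comap (X t) inferInstance] F) {C : ℝ}
    (hFC : ∀ ω, ‖F ω‖ ≤ C) : ∫ ω, F ω * r ω ∂P = 0 := by
  have hle : ⨆ t, MeasurableSpace.comap (X t) inferInstance ≤ mΩ :=
    iSup_le fun t => (hX t).comap_le
  have hconj : ∀ S v, ∫ ω, phaseExp X S v ω * starRingEnd ℂ (r ω) ∂P = 0 := fun S v => by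
    have := congrArg (starRingEnd ℂ) (h S (-v))
    rw [← integral_conj] at this
    simpa [phaseExp_neg] using this
  have hi : ∀ S v, Integrable (fun ω => phaseExp X S v ω * r ω) P := fun S v =>
    hri.bdd_mul (measurable_phaseExp hX S v).aestronglyMeasurable
      (ae_of_all _ fun ω => (norm_phaseExp X S v ω).le)
  have hric : Integrable (fun ω => starRingEnd ℂ (r ω)) P := by
    refine (integrable_norm_iff ?_).1 ?_
    · exact (Complex.continuous_conj.measurable.comp hrm).aestronglyMeasurable
    · simpa using hri.norm
  have hic : ∀ S v, Integrable (fun ω => phaseExp X S v ω * starRingEnd ℂ (r ω)) P := fun S v =>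
    hric.bdd_mul (measurable_phaseExp hX S v).aestronglyMeasurable
      (ae_of_all _ fun ω => (norm_phaseExp X S v ω).le)
  have h1 := integral_mul_eq_zero_of_phaseExp_real hX (Complex.measurable_re.comp hrm) hri.re
    (fun S v => by
      have : ∀ ω, phaseExp X S v ω * ((Complex.re ∘ r) ω : ℂ) = (1 / 2 : ℂ) *
          (phaseExp X S v ω * r ω + phaseExp X S v ω * starRingEnd ℂ (r ω)) := fun ω => by
        rw [Function.comp_apply, Complex.re_eq_add_conj]; ring
      simp_rw [this]
      rw [integral_const_mul, integral_add (hi S v) (hic S v), h, hconj]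
      simp) hF hFC
  have h2 := integral_mul_eq_zero_of_phaseExp_real hX (Complex.measurable_im.comp hrm) hri.im
    (fun S v => by
      have : ∀ ω, phaseExp X S v ω * ((Complex.im ∘ r) ω : ℂ) = (1 / (2 * Complex.I) : ℂ) *
          (phaseExp X S v ω * r ω - phaseExp X S v ω * starRingEnd ℂ (r ω)) := fun ω => by
        rw [Function.comp_apply, Complex.im_eq_sub_conj]; field_simp
      simp_rw [this]
      rw [integral_const_mul, integral_sub (hi S v) (hic S v), h, hconj]
      simp) hF hFC
  have hFm : Measurable F := hF.mono hle le_rfl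
  have : ∀ ω, F ω * r ω = F ω * ((Complex.re ∘ r) ω : ℂ)
      + (F ω * ((Complex.im ∘ r) ω : ℂ)) * Complex.I := fun ω => by
    conv_lhs => rw [← Complex.re_add_im (r ω)]
    simp only [Function.comp_apply]
    ring
  simp_rw [this]
  rw [integral_add, integral_mul_const, h1, h2]
  · simp
  · exact hri.re.ofReal.bdd_mul hFm.aestronglyMeasurable (ae_of_all _ hFC)
  · exact (hri.im.ofReal.bdd_mul hFm.aestronglyMeasurable (ae_of_all _ hFC)).mul_const _

/-- Whatever is orthogonal in L² to all exponentials is orthogonal to F, by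
`integral_mul_eq_zero_of_phaseExp`; so F lies in their closed span. The common bound K on the D n
makes the approximation error uniform in n. -/
lemma tendsto_integral_mul_zero_of_phaseExp [IsProbabilityMeasure P]
    {X : T → Ω → EuclideanSpace ℝ (Fin d)} (hX : ∀ t, Measurable (X t)) {D : ℕ → Ω → ℂ} {K : ℝ}
    (hDm : ∀ n, AEStronglyMeasurable (D n) P) (hDK : ∀ n, ∀ᵐ ω ∂P, ‖D n ω‖ ≤ K)
    (h : ∀ S v, Tendsto (fun n => ∫ ω, phaseExp X S v ω * D n ω ∂P) atTop (𝓝 0)) {F : Ω → ℂ}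
    (hF : Measurable[⨆ t, MeasurableSpace.comap (X t) inferInstance] F) {C : ℝ}
    (hFC : ∀ ω, ‖F ω‖ ≤ C) : Tendsto (fun n => ∫ ω, F ω * D n ω ∂P) atTop (𝓝 0) := by
  have hK : 0 ≤ K := by
    obtain ⟨ω, hω⟩ := (hDK 0).exists
    exact (norm_nonneg _).trans hω
  have hle : ⨆ t, MeasurableSpace.comap (X t) inferInstance ≤ mΩ :=
    iSup_le fun t => (hX t).comap_le
  have hemem : ∀ S v, MemLp (phaseExp X S v) 2 P := fun S v =>
    MemLp.of_bound (measurable_phaseExp hX S v).aestronglyMeasurable 1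
      (ae_of_all _ fun ω => (norm_phaseExp X S v ω).le)
  have hFmem : MemLp F 2 P := MemLp.of_bound (hF.mono hle le_rfl).aestronglyMeasurable C
    (ae_of_all _ hFC)
  set V : Submodule ℂ (Lp ℂ 2 P) := Submodule.span ℂ
    (Set.range fun q : Finset T × (T → EuclideanSpace ℝ (Fin d)) => (hemem q.1 q.2).toLp _)
  have hint : ∀ (G : Lp ℂ 2 P) n, Integrable (fun ω => G ω * D n ω) P := fun G n =>
    ((Lp.memLp G).integrable one_le_two).mul_bdd (hDm n) (hDK n)
  have hmem : ∀ G ∈ V, Tendsto (fun n => ∫ ω, G ω * D n ω ∂P) atTop (𝓝 0) := fun G hG => by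
    induction hG using Submodule.span_induction with
    | mem G hG =>
      obtain ⟨q, rfl⟩ := hG
      refine (h q.1 q.2).congr fun n => integral_congr_ae ?_
      filter_upwards [(hemem q.1 q.2).coeFn_toLp] with ω hω
      rw [hω]
    | zero =>
      refine tendsto_const_nhds.congr fun n => ?_
      rw [← integral_zero Ω ℂ (μ := P)]
      refine integral_congr_ae ?_
      filter_upwards [Lp.coeFn_zero ℂ 2 P] with ω hω
      rw [hω]; simp
    | add G H _ _ hG hH =>
      refine (add_zero (0 : ℂ) ▸ hG.add hH).congr fun n => ?_
      rw [← integral_add (hint G n) (hint H n)]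
      refine integral_congr_ae ?_
      filter_upwards [Lp.coeFn_add G H] with ω hω
      rw [hω, Pi.add_apply, add_mul]
    | smul c G _ hG =>
      refine (mul_zero c ▸ hG.const_mul c).congr fun n => ?_
      rw [← integral_const_mul]
      refine integral_congr_ae ?_
      filter_upwards [Lp.coeFn_smul c G] with ω hω
      rw [hω, Pi.smul_apply, smul_eq_mul, mul_assoc]
  have hclos : hFmem.toLp F ∈ V.topologicalClosure := by
    rw [← Submodule.orthogonal_orthogonal_eq_closure, Submodule.mem_orthogonal]
    intro G hG
    obtain ⟨G', hG'm, hGG'⟩ := (Lp.aestronglyMeasurable G)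
    have hGi : Integrable (fun ω => starRingEnd ℂ (G' ω)) P := by
      refine (integrable_norm_iff ?_).1 ?_
      · exact (Complex.continuous_conj.measurable.comp hG'm.measurable).aestronglyMeasurable
      · simpa using (((Lp.memLp G).integrable one_le_two).congr hGG').norm
    rw [L2.inner_def]
    have := integral_mul_eq_zero_of_phaseExp (P := P) hX
      (Complex.continuous_conj.measurable.comp hG'm.measurable) hGi (fun S v => by
        have h0 := Submodule.inner_left_of_mem_orthogonal (K := V)
          (Submodule.subset_span ⟨(S, v), rfl⟩) hG
        rw [L2.inner_def] at h0
        rw [← h0]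
        refine integral_congr_ae ?_
        filter_upwards [(hemem S v).coeFn_toLp, hGG'] with ω h1 h2
        rw [h1, h2, RCLike.inner_apply]
        rfl) hF hFC
    rw [← this]
    refine integral_congr_ae ?_
    filter_upwards [hFmem.coeFn_toLp, hGG'] with ω h1 h2
    rw [h1, h2, RCLike.inner_apply]
    rfl
  rw [Metric.tendsto_atTop]
  intro ε hε
  obtain ⟨G, hGV, hG⟩ := Metric.mem_closure_iff.1 hclos (ε / (2 * (K + 1))) (by positivity)
  obtain ⟨N, hN⟩ := Metric.tendsto_atTop.1 (hmem G hGV) (ε / 2) (by positivity)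
  refine ⟨N, fun n hn => ?_⟩
  have hFi : Integrable (fun ω => F ω * D n ω) P :=
    (hFmem.integrable one_le_two).mul_bdd (hDm n) (hDK n)
  have h1 : ‖∫ ω, F ω * D n ω ∂P - ∫ ω, G ω * D n ω ∂P‖ ≤ K * dist (hFmem.toLp F) G := by
    rw [← integral_sub hFi (hint G n)]
    have hd : MemLp (fun ω => F ω - G ω) 2 P := hFmem.sub (Lp.memLp G)
    have h2 : ‖∫ ω, (F ω * D n ω - G ω * D n ω) ∂P‖ ≤ ∫ ω, K * ‖F ω - G ω‖ ∂P := by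
      refine norm_integral_le_of_norm_le ((hd.integrable one_le_two).norm.const_mul K) ?_
      filter_upwards [hDK n] with ω hω
      rw [← sub_mul, norm_mul, mul_comm]
      gcongr
    refine h2.trans ?_
    rw [integral_const_mul]
    gcongr
    rw [dist_eq_norm, Lp.norm_def]
    have h3 : eLpNorm (hFmem.toLp F - G : Lp ℂ 2 P) 2 P = eLpNorm (fun ω => F ω - G ω) 2 P := by
      refine eLpNorm_congr_ae ?_
      filter_upwards [Lp.coeFn_sub (hFmem.toLp F) G, hFmem.coeFn_toLp] with ω h4 h5
      rw [h4, Pi.sub_apply, h5]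
    rw [h3, integral_norm_eq_lintegral_enorm hd.1, ← eLpNorm_one_eq_lintegral_enorm]
    exact ENNReal.toReal_mono hd.2.ne (eLpNorm_le_eLpNorm_of_exponent_le one_le_two hd.1)
  have h2 : K * dist (hFmem.toLp F) G ≤ ε / 2 := by
    have : (K + 1) * dist (hFmem.toLp F) G ≤ (K + 1) * (ε / (2 * (K + 1))) := by gcongr
    have e : (K + 1) * (ε / (2 * (K + 1))) = ε / 2 := by field_simp
    nlinarith [dist_nonneg (x := hFmem.toLp F) (y := G)]
  have h3 := hN n hn
  rw [dist_zero_right] at h3 ⊢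
  have := norm_le_insert' (∫ ω, F ω * D n ω ∂P) (∫ ω, G ω * D n ω ∂P)
  linarith

end Density

end LevyHF

namespace LevyHF

/-! ### Stable convergence from weighted characteristic functions -/

lemma isProbabilityMeasure_withDensity_toNNReal {Ω : Type*} {mΩ : MeasurableSpace Ω} {P : Measure Ω}
    {F : Ω → ℝ} (hFi : Integrable F P) (hF0 : ∀ ω, 0 ≤ F ω) (h1 : ∫ ω, F ω ∂P = 1) :
    IsProbabilityMeasure (P.withDensity fun ω => ((F ω).toNNReal : ℝ≥0∞)) := by
  constructor
  rw [withDensity_apply _ MeasurableSet.univ, Measure.restrict_univ]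
  have := ofReal_integral_eq_lintegral_ofReal hFi (ae_of_all _ hF0)
  rw [h1, ENNReal.ofReal_one] at this
  exact this.symm

lemma integral_withDensity_toNNReal {Ω : Type*} {mΩ : MeasurableSpace Ω} {P : Measure Ω}
    {F : Ω → ℝ} (hF : Measurable F) (hF0 : ∀ ω, 0 ≤ F ω) {V : Type*} [NormedAddCommGroup V]
    [NormedSpace ℝ V] (G : Ω → V) :
    ∫ ω, G ω ∂(P.withDensity fun ω => ((F ω).toNNReal : ℝ≥0∞)) = ∫ ω, F ω • G ω ∂P := by
  rw [integral_withDensity_eq_integral_smul hF.real_toNNReal]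
  refine integral_congr_ae (ae_of_all _ fun ω => ?_)
  simp only [NNReal.smul_def, Real.coe_toNNReal _ (hF0 ω)]

/-- F and F' are probability densities. The hypothesis says that the laws of Y n and Y' under the
tilted measures have converging characteristic functions, so Lévy's continuity theorem gives weak
convergence. -/
lemma tendsto_integral_density_mul {Ω Ω' : Type*} {mΩ : MeasurableSpace Ω}
    {mΩ' : MeasurableSpace Ω'} {P : Measure Ω} {P' : Measure Ω'} [IsProbabilityMeasure P]
    [IsProbabilityMeasure P'] {r : ℕ} {Y : ℕ → Ω → Fin r → ℝ} {Y' : Ω' → Fin r → ℝ}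
    (hY : ∀ n, AEMeasurable (Y n) P) (hY' : AEMeasurable Y' P') {F : Ω → ℝ} {F' : Ω' → ℝ}
    (hF : Measurable F) (hF' : Measurable F') (hF0 : ∀ ω, 0 ≤ F ω) (hF0' : ∀ ω, 0 ≤ F' ω)
    (h1 : ∫ ω, F ω ∂P = 1) (h1' : ∫ ω, F' ω ∂P' = 1)
    (h : ∀ u : Fin r → ℝ, Tendsto
      (fun n => ∫ ω, (F ω : ℂ) * Complex.exp (((∑ j, u j * Y n ω j : ℝ) : ℂ) * Complex.I) ∂P)
      atTop (𝓝 (∫ ω, (F' ω : ℂ) *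
        Complex.exp (((∑ j, u j * Y' ω j : ℝ) : ℂ) * Complex.I) ∂P')))
    (f : BoundedContinuousFunction (Fin r → ℝ) ℝ) :
    Tendsto (fun n => ∫ ω, F ω * f (Y n ω) ∂P) atTop (𝓝 (∫ ω, F' ω * f (Y' ω) ∂P')) := by
  -- A non-integrable function has integral 0 by convention, so an integral equal to 1 forces
  -- integrability.
  have hFi : Integrable F P := by
    by_contra hc; rw [integral_undef hc] at h1; exact zero_ne_one h1
  have hFi' : Integrable F' P' := by
    by_contra hc; rw [integral_undef hc] at h1'; exact zero_ne_one h1'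
  have hQ := isProbabilityMeasure_withDensity_toNNReal hFi hF0 h1
  have hQ' := isProbabilityMeasure_withDensity_toNNReal hFi' hF0' h1'
  set Q := P.withDensity fun ω => ((F ω).toNNReal : ℝ≥0∞) with hQd
  set Q' := P'.withDensity fun ω => ((F' ω).toNNReal : ℝ≥0∞) with hQd'
  have hm : ∀ n, AEMeasurable (fun ω => WithLp.toLp 2 (Y n ω)) Q := fun n =>
    (WithLp.measurable_toLp 2 _).comp_aemeasurable
      ((hY n).mono_ac (withDensity_absolutelyContinuous _ _))
  have hm' : AEMeasurable (fun ω => WithLp.toLp 2 (Y' ω)) Q' :=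
    (WithLp.measurable_toLp 2 _).comp_aemeasurable
      (hY'.mono_ac (withDensity_absolutelyContinuous _ _))
  let μ : ℕ → ProbabilityMeasure (EuclideanSpace ℝ (Fin r)) := fun n =>
    ⟨Q.map fun ω => WithLp.toLp 2 (Y n ω), Measure.isProbabilityMeasure_map (hm n)⟩
  let μ' : ProbabilityMeasure (EuclideanSpace ℝ (Fin r)) :=
    ⟨Q'.map fun ω => WithLp.toLp 2 (Y' ω), Measure.isProbabilityMeasure_map hm'⟩
  have hinner : ∀ (y : Fin r → ℝ) (u : EuclideanSpace ℝ (Fin r)),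
      (inner ℝ (WithLp.toLp 2 y) u : ℝ) = ∑ j, u j * y j := fun y u => by
    simp [PiLp.inner_apply]
  have hconv : Tendsto μ atTop (𝓝 μ') := by
    rw [ProbabilityMeasure.tendsto_iff_tendsto_charFun]
    intro u
    have e1 : ∀ n, charFun (μ n : Measure (EuclideanSpace ℝ (Fin r))) u = ∫ ω, (F ω : ℂ) *
        Complex.exp (((∑ j, u j * Y n ω j : ℝ) : ℂ) * Complex.I) ∂P := fun n => by
      simp only [μ, ProbabilityMeasure.coe_mk]
      rw [charFun_apply, integral_map (hm n) (by fun_prop), hQd,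
        integral_withDensity_toNNReal hF hF0]
      simp_rw [hinner, Complex.real_smul]
    have e2 : charFun (μ' : Measure (EuclideanSpace ℝ (Fin r))) u = ∫ ω, (F' ω : ℂ) *
        Complex.exp (((∑ j, u j * Y' ω j : ℝ) : ℂ) * Complex.I) ∂P' := by
      simp only [μ', ProbabilityMeasure.coe_mk]
      rw [charFun_apply, integral_map hm' (by fun_prop), hQd',
        integral_withDensity_toNNReal hF' hF0']
      simp_rw [hinner, Complex.real_smul]
    simp_rw [e1, e2]
    exact h u
  have := (ProbabilityMeasure.tendsto_iff_forall_integral_tendsto.1 hconv)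
    (f.compContinuous ⟨_, PiLp.continuous_ofLp 2 _⟩)
  simp only [μ, μ', ProbabilityMeasure.coe_mk] at this
  have e1 : ∀ n, ∫ x, (f.compContinuous ⟨_, PiLp.continuous_ofLp 2 fun _ : Fin r => ℝ⟩) x
      ∂(Q.map fun ω => WithLp.toLp 2 (Y n ω)) = ∫ ω, F ω * f (Y n ω) ∂P := fun n => by
    rw [integral_map (hm n) (by fun_prop), hQd, integral_withDensity_toNNReal hF hF0]
    rfl
  have e2 : ∫ x, (f.compContinuous ⟨_, PiLp.continuous_ofLp 2 fun _ : Fin r => ℝ⟩) x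
      ∂(Q'.map fun ω => WithLp.toLp 2 (Y' ω)) = ∫ ω, F' ω * f (Y' ω) ∂P' := by
    rw [integral_map hm' (by fun_prop), hQd', integral_withDensity_toNNReal hF' hF0']
    rfl
  rw [e2] at this
  exact this.congr e1

/-- Both sides are linear in F. Adding C + 1 makes F at least 1, so that it normalises to a density;
the contribution of the constant is subtracted at the end. -/
theorem stablyConverges_of_charFun {Ω Ω' : Type*} {𝒢 : MeasurableSpace Ω} {mΩ : MeasurableSpace Ω}
    {mΩ' : MeasurableSpace Ω'} (h𝒢 : 𝒢 ≤ mΩ) {P : Measure Ω} {P' : Measure Ω'}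
    [IsProbabilityMeasure P] [IsProbabilityMeasure P'] {π : Ω' → Ω} (hπ : MeasurePreserving π P' P)
    {r : ℕ} {Y : ℕ → Ω → Fin r → ℝ} {Y' : Ω' → Fin r → ℝ}
    (hY : ∀ n, AEMeasurable (Y n) P) (hY' : AEMeasurable Y' P')
    (h : ∀ F : Ω → ℝ, Measurable[𝒢] F → (∃ C : ℝ, ∀ ω, |F ω| ≤ C) → ∀ u : Fin r → ℝ, Tendsto
      (fun n => ∫ ω, (F ω : ℂ) * Complex.exp (((∑ j, u j * Y n ω j : ℝ) : ℂ) * Complex.I) ∂P)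
      atTop (𝓝 (∫ ω, (F (π ω) : ℂ) *
        Complex.exp (((∑ j, u j * Y' ω j : ℝ) : ℂ) * Complex.I) ∂P'))) :
    StablyConverges 𝒢 P P' π Y Y' where
  extension := hπ
  aemeasurable := hY
  aemeasurable_limit := hY'
  tendsto f F hF hFC := by
    obtain ⟨C, hC⟩ := hFC
    have hC0 : 0 ≤ C := by
      obtain ⟨ω⟩ := nonempty_of_isProbabilityMeasure P
      exact (abs_nonneg _).trans (hC ω)
    have hpos : ∀ G : Ω → ℝ, Measurable[𝒢] G → (∀ ω, 1 ≤ G ω) → (∃ C : ℝ, ∀ ω, |G ω| ≤ C) →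
        Tendsto (fun n => ∫ ω, G ω * f (Y n ω) ∂P) atTop
          (𝓝 (∫ ω, G (π ω) * f (Y' ω) ∂P')) := fun G hG hG1 hGC => by
      have hGm : Measurable G := hG.mono h𝒢 le_rfl
      obtain ⟨C', hC'⟩ := hGC
      have hGi : Integrable G P := Integrable.of_bound hGm.aestronglyMeasurable C' (ae_of_all _ hC')
      set c := ∫ ω, G ω ∂P
      have hc : 1 ≤ c := by
        have := integral_mono (integrable_const (1 : ℝ)) hGi hG1
        simpa using this
      have hc0 : (0 : ℝ) < c := by linarith
      have hcπ : ∫ ω, G (π ω) ∂P' = c := by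
        have := integral_map (μ := P') hπ.measurable.aemeasurable (f := G)
          hGm.aestronglyMeasurable
        rw [hπ.map_eq] at this
        exact this.symm
      have := tendsto_integral_density_mul hY hY' (F := fun ω => c⁻¹ * G ω)
        (F' := fun ω => c⁻¹ * G (π ω)) (hGm.const_mul _) ((hGm.comp hπ.measurable).const_mul _)
        (fun ω => mul_nonneg (by positivity) (by linarith [hG1 ω]))
        (fun ω => mul_nonneg (by positivity) (by linarith [hG1 (π ω)]))
        (by rw [integral_const_mul]; exact inv_mul_cancel₀ hc0.ne')
        (by rw [integral_const_mul, hcπ]; exact inv_mul_cancel₀ hc0.ne')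
        (fun u => by
          have h0 := (h G hG ⟨C', hC'⟩ u).const_mul (c⁻¹ : ℂ)
          simp_rw [← integral_const_mul, ← mul_assoc] at h0
          simpa only [Complex.ofReal_mul, Complex.ofReal_inv] using h0) f
      have h1 := this.const_mul c
      simp_rw [← integral_const_mul, ← mul_assoc, mul_inv_cancel₀ hc0.ne', one_mul] at h1
      exact h1
    have h1 := hpos (fun ω => F ω + (C + 1)) (hF.add_const _) (fun ω => by
      linarith [neg_abs_le (F ω), hC ω]) ⟨C + (C + 1), fun ω => (abs_add_le _ _).trans
        (add_le_add (hC ω) (abs_of_nonneg (by linarith)).le)⟩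
    have h2 := (hpos (fun _ => 1) measurable_const (fun _ => le_rfl) ⟨1, by simp⟩).const_mul (C + 1)
    have hfi : ∀ n, Integrable (fun ω => f (Y n ω)) P := fun n =>
      Integrable.of_bound (f.continuous.measurable.comp_aemeasurable (hY n)).aestronglyMeasurable
        ‖f‖ (ae_of_all _ fun ω => f.norm_coe_le_norm _)
    have hfi' : Integrable (fun ω => f (Y' ω)) P' :=
      Integrable.of_bound (f.continuous.measurable.comp_aemeasurable hY').aestronglyMeasurable
        ‖f‖ (ae_of_all _ fun ω => f.norm_coe_le_norm _)
    have hFm : Measurable F := hF.mono h𝒢 le_rfl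
    have hsub := h1.sub h2
    have e1 : ∀ n, ∫ ω, (F ω + (C + 1)) * f (Y n ω) ∂P - (C + 1) * ∫ ω, 1 * f (Y n ω) ∂P
        = ∫ ω, F ω * f (Y n ω) ∂P := fun n => by
      rw [← integral_const_mul, ← integral_sub]
      · refine integral_congr_ae (ae_of_all _ fun ω => ?_)
        simp only
        ring
      · exact (hfi n).bdd_mul (c := C + (C + 1)) (by fun_prop) (ae_of_all _ fun ω =>
          (abs_add_le _ _).trans (add_le_add (hC ω) (abs_of_nonneg (by linarith)).le))
      · simpa using (hfi n).const_mul (C + 1)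
    have e2 : ∫ ω, (F (π ω) + (C + 1)) * f (Y' ω) ∂P' - (C + 1) * ∫ ω, 1 * f (Y' ω) ∂P'
        = ∫ ω, F (π ω) * f (Y' ω) ∂P' := by
      have hFπ : Measurable fun ω => F (π ω) := hFm.comp hπ.measurable
      rw [← integral_const_mul, ← integral_sub]
      · refine integral_congr_ae (ae_of_all _ fun ω => ?_)
        simp only
        ring
      · exact hfi'.bdd_mul (c := C + (C + 1)) (hFπ.add_const _).aestronglyMeasurable (ae_of_all _ fun ω =>
          (abs_add_le _ _).trans (add_le_add (hC _) (abs_of_nonneg (by linarith)).le))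
      · simpa using hfi'.const_mul (C + 1)
    rw [e2] at hsub
    exact hsub.congr e1

end LevyHF

namespace LevyHF

/-! ### Covariances of moving windows of an i.i.d. sequence -/

section Window

variable {S : Type*} [MeasurableSpace S] (μ : Measure S) [IsProbabilityMeasure μ] {m : ℕ}
  (f : (Fin (m + 1) → S) → ℝ)

/-- The function `f` of the window of length `m + 1` starting at position `i`. -/
def window (i : ℕ) (c : ℕ → S) : ℝ := f fun k => c (i + k)

/-- The law of an i.i.d. sequence with marginal `μ`. -/
noncomputable def iidLaw : Measure (ℕ → S) := Measure.infinitePi fun _ : ℕ => μ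

instance : IsProbabilityMeasure (iidLaw μ) := by unfold iidLaw; infer_instance

/-- The covariance of the windows at distance `j`. -/
noncomputable def windowCov (j : ℤ) : ℝ :=
  covariance (fun c : ℤ → S => f fun k : Fin (m + 1) => c (1 + (k : ℕ)))
    (fun c : ℤ → S => f fun k : Fin (m + 1) => c (j + 1 + (k : ℕ)))
    (Measure.infinitePi fun _ : ℤ => μ)

variable {f}

lemma measurable_window (hf : Measurable f) (i : ℕ) : Measurable (window f i) :=
  hf.comp (by fun_prop)

/-- The injection l ↦ l + 1 - i of ℕ into ℤ pulls i.i.d. sequences over ℤ back to i.i.d. sequences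
over ℕ, and moves the window at i to the one starting at 1. -/
lemma covariance_window (hf : Measurable f) (i j : ℕ) :
    covariance (window f i) (window f j) (iidLaw μ) = windowCov μ f ((j : ℤ) - i) := by
  have hinj : Function.Injective fun l : ℕ => (l : ℤ) + 1 - i := fun a b h => by
    simp only at h; omega
  have hmap := Measure.map_infinitePi_infinitePi_of_inj (P := fun _ : ℤ => μ) hinj
  rw [iidLaw, ← hmap, covariance_map (measurable_window hf i).aestronglyMeasurable
    (measurable_window hf j).aestronglyMeasurable (Measurable.aemeasurable (by fun_prop)), windowCov]
  congr 1
  · ext c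
    simp only [window, Function.comp_apply]
    congr 1
    ext k
    congr 1
    push_cast
    ring
  · ext c
    simp only [window, Function.comp_apply]
    congr 1
    ext k
    congr 1
    push_cast
    ring

lemma memLp_window (hf : Measurable f) {C : ℝ} (hC : ∀ y, |f y| ≤ C) (i : ℕ) :
    MemLp (window f i) 2 (iidLaw μ) :=
  MemLp.of_bound (measurable_window hf i).aestronglyMeasurable C (ae_of_all _ fun _ => hC _)

/-- Windows at distance more than m read disjoint sets of coordinates. -/
lemma covariance_window_eq_zero (hf : Measurable f) {C : ℝ} (hC : ∀ y, |f y| ≤ C) {i j : ℕ} (hij : i + m < j) :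
    covariance (window f i) (window f j) (iidLaw μ) = 0 := by
  have h : iIndepFun (fun (l : ℕ) (c : ℕ → S) => c l) (iidLaw μ) :=
    iIndepFun_infinitePi (X := fun _ x => x) fun _ => measurable_id
  have h2 := h.indepFun_finset (Finset.Icc i (i + m)) (Finset.Icc j (j + m))
    (Finset.disjoint_left.2 fun a ha hb => by
      simp only [Finset.mem_Icc] at ha hb; omega) (fun l => by fun_prop)
  have hm1 : ∀ i, Measurable fun y : Finset.Icc i (i + m) → S =>
      f fun k => y ⟨i + k, by simp; omega⟩ := fun i => hf.comp (by fun_prop)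
  have h3 : IndepFun (window f i) (window f j) (iidLaw μ) := h2.comp (hm1 i) (hm1 j)
  exact h3.covariance_eq_zero (memLp_window μ hf hC i) (memLp_window μ hf hC j)

lemma windowCov_eq_zero (hf : Measurable f) {C : ℝ} (hC : ∀ y, |f y| ≤ C) {j : ℤ} (hj : (m : ℤ) < |j|) :
    windowCov μ f j = 0 := by
  rcases le_total 0 j with h | h
  · rw [abs_of_nonneg h] at hj
    have := covariance_window μ hf 0 j.toNat
    rw [covariance_window_eq_zero μ hf hC (by omega)] at this
    rw [this]; congr 1; simp [h]
  · rw [abs_of_nonpos h] at hj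
    have := covariance_window μ hf (-j).toNat 0
    rw [covariance_comm, covariance_window_eq_zero μ hf hC (by omega)] at this
    rw [this]; congr 1; simp; omega

lemma integral_window (hf : Measurable f) (i : ℕ) :
    ∫ c, window f i c ∂(iidLaw μ) = ∫ c, window f 0 c ∂(iidLaw μ) := by
  have hinj : Function.Injective fun l : ℕ => l + i := add_left_injective i
  have hmap := Measure.map_infinitePi_infinitePi_of_inj (P := fun _ : ℕ => μ) hinj
  conv_rhs => rw [iidLaw, ← hmap]
  rw [integral_map (Measurable.aemeasurable (by fun_prop))
    (measurable_window hf 0).aestronglyMeasurable, iidLaw]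
  simp [window, add_comm]

lemma abs_integral_le_of_bounded {Ω : Type*} {mΩ : MeasurableSpace Ω} {P : Measure Ω}
    [IsProbabilityMeasure P] {Z : Ω → ℝ} {K : ℝ} (h : ∀ ω, |Z ω| ≤ K) : |∫ ω, Z ω ∂P| ≤ K := by
  have h' : ∀ ω, ‖Z ω‖ ≤ K := h
  simpa using norm_integral_le_of_norm_le_const (μ := P) (ae_of_all _ h')

lemma abs_covariance_le_of_bounded {Ω : Type*} {mΩ : MeasurableSpace Ω} {P : Measure Ω}
    [IsProbabilityMeasure P] {X Y : Ω → ℝ} (hX : Measurable X) (hY : Measurable Y) {C : ℝ}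
    (hXC : ∀ ω, |X ω| ≤ C) (hYC : ∀ ω, |Y ω| ≤ C) :
    |covariance X Y P| ≤ 2 * C ^ 2 := by
  obtain ⟨ω₀⟩ := nonempty_of_isProbabilityMeasure P
  have hC : 0 ≤ C := (abs_nonneg _).trans (hXC ω₀)
  rw [covariance_eq_sub (MemLp.of_bound hX.aestronglyMeasurable C (ae_of_all _ hXC))
    (MemLp.of_bound hY.aestronglyMeasurable C (ae_of_all _ hYC))]
  have h1 : |P[X * Y]| ≤ C * C := by
    simpa using norm_integral_le_of_norm_le_const (μ := P) (ae_of_all _ fun ω =>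
      show ‖(X * Y) ω‖ ≤ C * C by
        rw [Pi.mul_apply, norm_mul]
        exact mul_le_mul (hXC ω) (hYC ω) (norm_nonneg _) hC)
  have h2 : |P[X]| ≤ C := abs_integral_le_of_bounded hXC
  have h3 : |P[Y]| ≤ C := abs_integral_le_of_bounded hYC
  calc _ ≤ |P[X * Y]| + |P[X] * P[Y]| := abs_sub _ _
    _ ≤ C * C + C * C := by
        rw [abs_mul]; gcongr
    _ = _ := by ring

lemma abs_windowCov_le (hf : Measurable f) {C : ℝ} (hC : ∀ y, |f y| ≤ C) (j : ℤ) :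
    |windowCov μ f j| ≤ 2 * C ^ 2 :=
  abs_covariance_le_of_bounded (hf.comp (by fun_prop)) (hf.comp (by fun_prop)) (fun _ => hC _)
    fun _ => hC _

lemma integral_sq_sum_window (hf : Measurable f) {C : ℝ} (hC : ∀ y, |f y| ≤ C) (q : ℕ) :
    ∫ c, (∑ l ∈ Finset.range q, (window f l c - ∫ c', window f 0 c' ∂(iidLaw μ))) ^ 2 ∂(iidLaw μ)
      = ∑ i ∈ Finset.range q, ∑ j ∈ Finset.range q, windowCov μ f ((j : ℤ) - i) := by
  have h : ∀ c, (∑ l ∈ Finset.range q, (window f l c - ∫ c', window f 0 c' ∂(iidLaw μ))) ^ 2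
      = ∑ i ∈ Finset.range q, ∑ j ∈ Finset.range q,
        (window f i c - ∫ c', window f i c' ∂(iidLaw μ)) *
        (window f j c - ∫ c', window f j c' ∂(iidLaw μ)) := fun c => by
    rw [sq, Finset.sum_mul_sum]
    simp_rw [integral_window μ hf]
  simp_rw [h]
  have hi : ∀ i j, Integrable (fun c => (window f i c - ∫ c', window f i c' ∂(iidLaw μ)) *
        (window f j c - ∫ c', window f j c' ∂(iidLaw μ))) (iidLaw μ) := fun i j =>
    ((memLp_window μ hf hC i).sub (memLp_const _)).integrable_mul
      ((memLp_window μ hf hC j).sub (memLp_const _))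
  rw [integral_finsetSum _ fun i _ => integrable_finsetSum _ fun j _ => hi i j]
  refine Finset.sum_congr rfl fun i _ => ?_
  rw [integral_finsetSum _ fun j _ => hi i j]
  refine Finset.sum_congr rfl fun j _ => ?_
  rw [← covariance_window μ hf, covariance]

/-- Row i of the q × q matrix contains the whole band |j - i| ≤ m unless i < m or q ≤ i + m. In
these at most 2m rows, no more than 2m + 1 entries are missing, each bounded by 2C². -/
lemma abs_sum_windowCov_sub_le (hf : Measurable f) {C : ℝ} (hC : ∀ y, |f y| ≤ C) (q : ℕ) :
    |∑ i ∈ Finset.range q, ∑ j ∈ Finset.range q, windowCov μ f ((j : ℤ) - i)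
      - q * ∑ j ∈ Finset.Icc (-(m : ℤ)) m, windowCov μ f j|
      ≤ 2 * m * ((2 * m + 1) * (2 * C ^ 2)) := by
  have hrow : ∀ i : ℕ, ∑ j ∈ Finset.range q, windowCov μ f ((j : ℤ) - i)
      = ∑ l ∈ Finset.Icc (-(m : ℤ)) m,
        if -(i : ℤ) ≤ l ∧ l < q - i then windowCov μ f l else 0 := fun i => by
    have h1 : ∑ j ∈ Finset.range q, windowCov μ f ((j : ℤ) - i)
        = ∑ l ∈ Finset.Ico (-(i : ℤ)) (q - i), windowCov μ f l := by
      refine Finset.sum_bij' (fun j _ => (j : ℤ) - i) (fun l _ => (l + i).toNat) ?_ ?_ ?_ ?_ ?_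
      · intro j hj; simp only [Finset.mem_range, Finset.mem_Ico] at *; omega
      · intro l hl; simp only [Finset.mem_range, Finset.mem_Ico] at *; omega
      · intro j hj; simp
      · intro l hl; simp only [Finset.mem_Ico] at hl; omega
      · intro j hj; rfl
    rw [h1, ← Finset.sum_filter]
    symm
    refine Finset.sum_subset (fun l hl => ?_) fun l hl hl' => ?_
    · simp only [Finset.mem_filter, Finset.mem_Ico] at *; exact hl.2
    · refine windowCov_eq_zero μ hf hC ?_
      simp only [Finset.mem_filter, Finset.mem_Ico, Finset.mem_Icc] at *
      rw [lt_abs]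
      omega
  have hdiff : ∀ i ∈ Finset.range q, |∑ j ∈ Finset.range q, windowCov μ f ((j : ℤ) - i)
      - ∑ j ∈ Finset.Icc (-(m : ℤ)) m, windowCov μ f j|
      ≤ if i < m ∨ q ≤ i + m then (2 * m + 1) * (2 * C ^ 2) else 0 := fun i _ => by
    rw [hrow, ← Finset.sum_sub_distrib]
    split_ifs with h
    · refine (Finset.abs_sum_le_sum_abs _ _).trans ?_
      have : ∀ l ∈ Finset.Icc (-(m : ℤ)) m, |(if -(i : ℤ) ≤ l ∧ l < q - i then windowCov μ f l
          else 0) - windowCov μ f l| ≤ 2 * C ^ 2 := fun l _ => by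
        split_ifs
        · simp; positivity
        · rw [zero_sub, abs_neg]; exact abs_windowCov_le μ hf hC l
      refine (Finset.sum_le_card_nsmul _ _ _ this).trans (le_of_eq ?_)
      rw [Int.card_Icc, nsmul_eq_mul]
      congr 1
      have : ((m : ℤ) + 1 - -(m : ℤ)).toNat = 2 * m + 1 := by omega
      rw [this]; push_cast; ring
    · rw [Finset.sum_eq_zero, abs_zero]
      intro l hl
      rw [Finset.mem_Icc] at hl
      rw [if_pos (by omega), sub_self]
  have hcard : ∑ i ∈ Finset.range q, (if i < m ∨ q ≤ i + m then (2 * m + 1) * (2 * C ^ 2) else 0)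
      ≤ 2 * m * ((2 * m + 1) * (2 * C ^ 2)) := by
    rw [← Finset.sum_filter, Finset.sum_const, nsmul_eq_mul]
    gcongr
    have : (Finset.range q).filter (fun i => i < m ∨ q ≤ i + m)
        ⊆ Finset.range m ∪ Finset.Ico (q - m) q := by
      intro i hi
      simp only [Finset.mem_filter, Finset.mem_union, Finset.mem_range, Finset.mem_Ico] at *
      omega
    have h2 := (Finset.card_le_card this).trans (Finset.card_union_le _ _)
    rw [Finset.card_range, Nat.card_Ico] at h2
    have h3 : ((Finset.range q).filter (fun i => i < m ∨ q ≤ i + m)).card ≤ 2 * m := by omega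
    exact_mod_cast h3
  have hq : (q : ℝ) * ∑ j ∈ Finset.Icc (-(m : ℤ)) m, windowCov μ f j
      = ∑ _i ∈ Finset.range q, ∑ j ∈ Finset.Icc (-(m : ℤ)) m, windowCov μ f j := by simp
  rw [hq, ← Finset.sum_sub_distrib]
  exact (Finset.abs_sum_le_sum_abs _ _).trans ((Finset.sum_le_sum hdiff).trans hcard)

/-- The variance of a sum of q windows is nonnegative and differs from q times this sum by a bounded
amount, so a negative value is impossible for large q. It makes √𝔤 meaningful. -/
lemma sum_windowCov_nonneg (hf : Measurable f) {C : ℝ} (hC : ∀ y, |f y| ≤ C) :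
    0 ≤ ∑ j ∈ Finset.Icc (-(m : ℤ)) m, windowCov μ f j := by
  by_contra! hneg
  set s := ∑ j ∈ Finset.Icc (-(m : ℤ)) m, windowCov μ f j
  set K := 2 * m * ((2 * m + 1) * (2 * C ^ 2))
  obtain ⟨q, hq⟩ := exists_nat_gt (K / -s)
  rw [div_lt_iff₀ (by linarith)] at hq
  have h1 := abs_sum_windowCov_sub_le μ hf hC q
  have h2 : 0 ≤ ∑ i ∈ Finset.range q, ∑ j ∈ Finset.range q, windowCov μ f ((j : ℤ) - i) := by
    rw [← integral_sq_sum_window μ hf hC]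
    exact integral_nonneg fun _ => sq_nonneg _
  have h3 := (abs_le.1 h1).2
  linarith

/-- Use XY - X'Y' = X(Y - Y') + (X - X')Y', once under the expectation and once for the means. This
transfers Lipschitz continuity from g to 𝔤_n, uniformly in n. -/
lemma abs_covariance_sub_le {Ω : Type*} {mΩ : MeasurableSpace Ω} {P : Measure Ω}
    [IsProbabilityMeasure P] {X Y X' Y' : Ω → ℝ} (hX : Measurable X) (hY : Measurable Y)
    (hX' : Measurable X') (hY' : Measurable Y') {C D : ℝ} (hXC : ∀ ω, |X ω| ≤ C)
    (hYC : ∀ ω, |Y ω| ≤ C) (hXC' : ∀ ω, |X' ω| ≤ C) (hYC' : ∀ ω, |Y' ω| ≤ C)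
    (hXD : ∀ ω, |X ω - X' ω| ≤ D) (hYD : ∀ ω, |Y ω - Y' ω| ≤ D) :
    |covariance X Y P - covariance X' Y' P| ≤ 4 * C * D := by
  obtain ⟨ω₀⟩ := nonempty_of_isProbabilityMeasure P
  have hC : 0 ≤ C := (abs_nonneg _).trans (hXC ω₀)
  have hm : ∀ {Z : Ω → ℝ}, Measurable Z → (∀ ω, |Z ω| ≤ C) → MemLp Z 2 P := fun hZ hZC =>
    MemLp.of_bound hZ.aestronglyMeasurable C (ae_of_all _ hZC)
  have hi : ∀ {Z : Ω → ℝ}, Measurable Z → (∀ ω, |Z ω| ≤ C) → Integrable Z P := fun hZ hZC =>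
    (hm hZ hZC).integrable one_le_two
  rw [covariance_eq_sub (hm hX hXC) (hm hY hYC), covariance_eq_sub (hm hX' hXC') (hm hY' hYC')]
  have hb : ∀ {Z : Ω → ℝ} {K : ℝ}, (∀ ω, |Z ω| ≤ K) → |P[Z]| ≤ K := fun hZ =>
    abs_integral_le_of_bounded hZ
  have h1 : |P[X * Y] - P[X' * Y']| ≤ 2 * C * D := by
    rw [← integral_sub ((hm hX hXC).integrable_mul (hm hY hYC))
      ((hm hX' hXC').integrable_mul (hm hY' hYC'))]
    refine hb fun ω => ?_
    have e : (X * Y) ω - (X' * Y') ω = X ω * (Y ω - Y' ω) + (X ω - X' ω) * Y' ω := by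
      simp only [Pi.mul_apply]; ring
    rw [e]
    refine (abs_add_le _ _).trans ?_
    rw [abs_mul, abs_mul]
    have h1 := mul_le_mul (hXC ω) (hYD ω) (abs_nonneg _) hC
    have h2 := mul_le_mul (hXD ω) (hYC' ω) (abs_nonneg _) ((abs_nonneg _).trans (hXD ω))
    linarith
  have hXY : ∀ {Z Z' : Ω → ℝ}, Measurable Z → (∀ ω, |Z ω| ≤ C) → Measurable Z' →
      (∀ ω, |Z' ω| ≤ C) → (∀ ω, |Z ω - Z' ω| ≤ D) → |P[Z] - P[Z']| ≤ D :=
    fun hZ hZC hZ' hZC' h => by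
      rw [← integral_sub (hi hZ hZC) (hi hZ' hZC')]
      exact hb h
  have h2 : |P[X] * P[Y] - P[X'] * P[Y']| ≤ 2 * C * D := by
    have e : P[X] * P[Y] - P[X'] * P[Y'] = P[X] * (P[Y] - P[Y']) + (P[X] - P[X']) * P[Y'] := by
      ring
    rw [e]
    refine (abs_add_le _ _).trans ?_
    rw [abs_mul, abs_mul]
    have h1 := mul_le_mul (hb hXC) (hXY hY hYC hY' hYC' hYD) (abs_nonneg _) hC
    have h2 := mul_le_mul (hXY hX hXC hX' hXC' hXD) (hb hYC') (abs_nonneg _)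
      ((abs_nonneg _).trans (hXD ω₀))
    linarith
  have e : P[X * Y] - P[X] * P[Y] - (P[X' * Y'] - P[X'] * P[Y'])
      = (P[X * Y] - P[X' * Y']) - (P[X] * P[Y] - P[X'] * P[Y']) := by ring
  rw [e]
  refine (abs_sub _ _).trans ?_
  linarith

lemma abs_sum_windowCov_sub_sum_le (hf : Measurable f) {f' : (Fin (m + 1) → S) → ℝ}
    (hf' : Measurable f') {C D : ℝ} (hC : ∀ y, |f y| ≤ C) (hC' : ∀ y, |f' y| ≤ C)
    (hD : ∀ y, |f y - f' y| ≤ D) :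
    |∑ j ∈ Finset.Icc (-(m : ℤ)) m, windowCov μ f j
      - ∑ j ∈ Finset.Icc (-(m : ℤ)) m, windowCov μ f' j| ≤ (2 * m + 1) * (4 * C * D) := by
  rw [← Finset.sum_sub_distrib]
  refine (Finset.abs_sum_le_sum_abs _ _).trans ?_
  refine (Finset.sum_le_card_nsmul _ _ (4 * C * D) fun j _ => ?_).trans (le_of_eq ?_)
  · exact abs_covariance_sub_le (hf.comp (by fun_prop)) (hf.comp (by fun_prop))
      (hf'.comp (by fun_prop)) (hf'.comp (by fun_prop)) (fun _ => hC _) (fun _ => hC _)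
      (fun _ => hC' _) (fun _ => hC' _) (fun _ => hD _) fun _ => hD _
  · rw [Int.card_Icc, nsmul_eq_mul]
    congr 1
    have : ((m : ℤ) + 1 - -(m : ℤ)).toNat = 2 * m + 1 := by omega
    rw [this]; push_cast; ring

end Window

end LevyHF

namespace LevyHF

/-! ### The modulus of continuity of a Lévy process with light small jumps -/

/-- Layer-cake formula on (0, 1], cut at δ = h^{1/β}. Below δ the probability is bounded by 1, above
it by the tail; since β > 1 and h δ^{1-β} = δ, both parts are of order δ. -/
lemma integral_min_one_abs_le {Ω : Type*} {mΩ : MeasurableSpace Ω} {P : Measure Ω}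
    [IsProbabilityMeasure P] {Z : Ω → ℝ} (hZ : AEMeasurable Z P) {κ β h : ℝ} (hκ : 0 ≤ κ)
    (hβ : 1 < β) (h0 : 0 ≤ h) (h1 : h ≤ 1)
    (htail : ∀ s : ℝ, 0 < s → s ≤ 1 → P.real {ω | s ≤ |Z ω|} ≤ κ * h * s ^ (-β)) :
    ∫ ω, min 1 |Z ω| ∂P ≤ (1 + κ / (β - 1)) * h ^ (1 / β) := by
  have hint : Integrable (fun ω => min 1 |Z ω|) P :=
    Integrable.of_bound (by fun_prop) 1 (ae_of_all _ fun ω => by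
      rw [Real.norm_of_nonneg (le_min zero_le_one (abs_nonneg _))]; exact min_le_left _ _)
  rw [hint.integral_eq_integral_Ioc_meas_le (M := 1)
    (ae_of_all _ fun ω => le_min zero_le_one (abs_nonneg _)) (ae_of_all _ fun ω => min_le_left _ _)]
  have hset : ∀ t ∈ Set.Ioc (0 : ℝ) 1, P.real {ω | t ≤ min 1 |Z ω|} ≤ κ * h * t ^ (-β) := by
    intro t ht
    have : {ω | t ≤ min 1 |Z ω|} = {ω | t ≤ |Z ω|} := by
      ext ω; simp [ht.2]
    rw [this]
    exact htail t ht.1 ht.2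
  have hanti : AntitoneOn (fun t : ℝ => P.real {ω | t ≤ min 1 |Z ω|}) (Set.Icc 0 1) :=
    fun s _ t _ hst => measureReal_mono fun ω hω => hst.trans hω
  have hintg : IntegrableOn (fun t : ℝ => P.real {ω | t ≤ min 1 |Z ω|}) (Set.Ioc 0 1) :=
    (hanti.integrableOn_isCompact isCompact_Icc).mono_set Set.Ioc_subset_Icc_self
  -- For h = 0 the cut point degenerates to 0, but the tail bound then makes every probability zero.
  rcases h0.eq_or_lt with rfl | hpos
  · rw [Real.zero_rpow (by positivity), mul_zero]
    refine setIntegral_nonpos measurableSet_Ioc fun t ht => ?_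
    simpa using hset t ht
  set δ := h ^ (1 / β) with hδ
  have hδ0 : 0 < δ := Real.rpow_pos_of_pos hpos _
  have hδ1 : δ ≤ 1 := Real.rpow_le_one h0 h1 (by positivity)
  rw [← Set.Ioc_union_Ioc_eq_Ioc hδ0.le hδ1, setIntegral_union
    (Set.Ioc_disjoint_Ioc_of_le le_rfl) measurableSet_Ioc
    (hintg.mono_set (Set.Ioc_subset_Ioc_right hδ1)) (hintg.mono_set (Set.Ioc_subset_Ioc_left hδ0.le))]
  have e1 : ∫ t in Set.Ioc 0 δ, P.real {ω | t ≤ min 1 |Z ω|} ≤ δ := by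
    have := setIntegral_mono_on (hintg.mono_set (Set.Ioc_subset_Ioc_right hδ1))
      (integrableOn_const (C := (1 : ℝ)) (by simp)) measurableSet_Ioc
      fun t _ => measureReal_le_one (μ := P) (s := {ω | t ≤ min 1 |Z ω|})
    simpa [hδ0.le] using this
  have e2 : ∫ t in Set.Ioc δ 1, P.real {ω | t ≤ min 1 |Z ω|} ≤ κ / (β - 1) * δ := by
    have hpi : IntegrableOn (fun t : ℝ => κ * h * t ^ (-β)) (Set.Ioc δ 1) := by
      refine (ContinuousOn.integrableOn_Icc ?_).mono_set Set.Ioc_subset_Icc_self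
      refine continuousOn_const.mul (ContinuousOn.rpow_const continuousOn_id fun t ht => ?_)
      exact Or.inl (hδ0.trans_le ht.1).ne'
    refine (setIntegral_mono_on (hintg.mono_set (Set.Ioc_subset_Ioc_left hδ0.le)) hpi
      measurableSet_Ioc fun t ht => hset t ⟨hδ0.trans ht.1, ht.2⟩).trans ?_
    rw [integral_const_mul, ← intervalIntegral.integral_of_le hδ1,
      integral_rpow (Or.inr ⟨by linarith, by
        rw [Set.uIcc_of_le hδ1]; exact fun h => absurd h.1 (not_le.2 hδ0)⟩), Real.one_rpow]
    have hδh : h * δ ^ (-β + 1) = δ := by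
      rw [Real.rpow_add hδ0, Real.rpow_one, hδ, ← Real.rpow_mul h0]
      have : 1 / β * -β = -1 := by field_simp
      rw [this, Real.rpow_neg_one]
      field_simp
    have e3 : κ * h * ((1 - δ ^ (-β + 1)) / (-β + 1)) = κ / (β - 1) * (h * δ ^ (-β + 1) - h) := by
      have : -β + 1 = -(β - 1) := by ring
      have hb : β - 1 ≠ 0 := by linarith
      rw [this]
      field_simp
      ring
    rw [e3, hδh]
    have : 0 ≤ κ / (β - 1) := div_nonneg hκ (by linarith)
    gcongr
    linarith
  linarith

lemma min_one_sum_le {ι : Type*} (s : Finset ι) {a : ι → ℝ} (ha : ∀ i, 0 ≤ a i) :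
    min 1 (∑ i ∈ s, a i) ≤ ∑ i ∈ s, min 1 (a i) := by
  classical
  induction s using Finset.induction_on with
  | empty => simp
  | insert i s hi ih =>
    rw [Finset.sum_insert hi, Finset.sum_insert hi]
    have h1 : 0 ≤ ∑ i ∈ s, a i := Finset.sum_nonneg fun i _ => ha i
    have := ha i
    grind

lemma norm_le_sum_abs {d : ℕ} (y : EuclideanSpace ℝ (Fin d)) : ‖y‖ ≤ ∑ j, |y j| := by
  rw [EuclideanSpace.norm_eq]
  refine Real.sqrt_le_iff.2 ⟨Finset.sum_nonneg fun _ _ => abs_nonneg _, ?_⟩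
  simpa using Finset.sum_sq_le_sq_sum_of_nonneg (s := Finset.univ) (f := fun j => |y j|)
    fun _ _ => abs_nonneg _

variable {Ω : Type*} {mΩ : MeasurableSpace Ω} {P : Measure Ω} {d : ℕ}

/-- `X` has truncated first moment increments of order `γ`: `E min(1, |X_t - X_s|) ≤ C (t-s)^γ`. -/
def HasModulus (X : ℝ≥0 → Ω → EuclideanSpace ℝ (Fin d)) (P : Measure Ω) (C γ : ℝ) : Prop :=
  ∀ s t : ℝ≥0, s ≤ t → ∫ ω, min 1 ‖X t ω - X s ω‖ ∂P ≤ C * ((t : ℝ) - s) ^ γ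

lemma IsLevyProcess.measurable {ℱ : Filtration ℝ≥0 mΩ} {X : ℝ≥0 → Ω → EuclideanSpace ℝ (Fin d)}
    (hX : IsLevyProcess ℱ X P) (t : ℝ≥0) : Measurable (X t) :=
  (hX.adapted t).mono (ℱ.le t) le_rfl

/-- The exponent α is raised to β = max(α, 3/2), which lies in (1, 2); this is harmless because only
levels s ≤ 1 matter, where s^{-α} ≤ s^{-β}. Then γ = 1/β > 1/2, the decisive inequality of the whole
argument. Time differences of at least 1 are covered by C ≥ 1. -/
lemma IsLevyProcess.exists_hasModulus [IsProbabilityMeasure P] {ℱ : Filtration ℝ≥0 mΩ}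
    {X : ℝ≥0 → Ω → EuclideanSpace ℝ (Fin d)} (hX : IsLevyProcess ℱ X P) {α κ : ℝ}
    (hα : α ∈ Set.Ioo (0 : ℝ) 2) (hκ : 0 < κ)
    (htail : ∀ (j : Fin d) (t : ℝ≥0) (s : ℝ), 0 < s →
      P.real {ω | s ≤ |X t ω j|} ≤ κ * t * s ^ (-α)) :
    ∃ C γ : ℝ, 0 ≤ C ∧ 1 / 2 < γ ∧ HasModulus X P C γ := by
  set β := max α (3 / 2) with hβ
  have hβ1 : 1 < β := lt_of_lt_of_le (by norm_num) (le_max_right _ _)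
  have hβ2 : β < 2 := max_lt hα.2 (by norm_num)
  set C := max 1 (d * (1 + κ / (β - 1)))
  have hC1 : 1 ≤ C := le_max_left _ _
  refine ⟨C, 1 / β, by linarith, one_div_lt_one_div_of_lt (by linarith) hβ2, fun s t hst => ?_⟩
  have hst' : (s : ℝ) ≤ t := hst
  rcases le_total ((t : ℝ) - s) 1 with h1 | h1
  · obtain ⟨h, rfl⟩ := exists_add_of_le hst
    have hid := hX.stationary s h
    have e : ∫ ω, min 1 ‖X (s + h) ω - X s ω‖ ∂P = ∫ ω, min 1 ‖X h ω‖ ∂P :=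
      (hid.comp (u := fun y => min 1 ‖y‖) (by fun_prop)).integral_eq
    have hh : ((s + h : ℝ≥0) : ℝ) - s = h := by push_cast; ring
    rw [hh] at h1
    rw [e, hh]
    have hm : ∀ j, Measurable fun ω => X h ω j := fun j => by
      have := hX.measurable h
      fun_prop
    have hi : ∀ j, Integrable (fun ω => min 1 |X h ω j|) P := fun j => by
      have : Measurable fun ω => min 1 |X h ω j| := measurable_const.min (hm j).abs
      exact Integrable.of_bound this.aestronglyMeasurable 1 (ae_of_all _ fun ω => by
        rw [Real.norm_of_nonneg (le_min zero_le_one (abs_nonneg _))]; exact min_le_left _ _)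
    calc ∫ ω, min 1 ‖X h ω‖ ∂P ≤ ∫ ω, ∑ j, min 1 |X h ω j| ∂P := by
          refine integral_mono_of_nonneg
            (ae_of_all _ fun ω => le_min zero_le_one (norm_nonneg _))
            (integrable_finsetSum _ fun j _ => hi j) (ae_of_all _ fun ω => ?_)
          exact (min_le_min le_rfl (norm_le_sum_abs _)).trans
            (min_one_sum_le _ fun _ => abs_nonneg _)
      _ = ∑ j, ∫ ω, min 1 |X h ω j| ∂P := integral_finsetSum _ fun j _ => hi j
      _ ≤ ∑ _j : Fin d, (1 + κ / (β - 1)) * (h : ℝ) ^ (1 / β) := by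
          refine Finset.sum_le_sum fun j _ => integral_min_one_abs_le (hm j).aemeasurable hκ.le
            hβ1 h.coe_nonneg h1 fun s hs hs1 => (htail j h s hs).trans ?_
          exact mul_le_mul_of_nonneg_left (Real.rpow_le_rpow_of_exponent_ge hs hs1
            (neg_le_neg (le_max_left _ _))) (by positivity)
      _ = d * (1 + κ / (β - 1)) * (h : ℝ) ^ (1 / β) := by simp; ring
      _ ≤ C * (h : ℝ) ^ (1 / β) := by gcongr; exact le_max_right _ _
  · have e1 : ∫ ω, min 1 ‖X t ω - X s ω‖ ∂P ≤ 1 :=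
      (le_abs_self _).trans (abs_integral_le_of_bounded fun ω => by
        rw [abs_of_nonneg (le_min zero_le_one (norm_nonneg _))]; exact min_le_left _ _)
    have e2 : (1 : ℝ) ≤ ((t : ℝ) - s) ^ (1 / β) := Real.one_le_rpow h1 (by positivity)
    nlinarith

/-! ### Regularity of the test function -/

/-- Bounded partial derivatives give a Lipschitz bound in x and boundedness of g caps it. The
truncated form is the useful one, since X need not have a first moment. -/
lemma HypothesisH1.exists_lipschitz {m : ℕ} {X : ℝ≥0 → Ω → EuclideanSpace ℝ (Fin d)} {a : ℕ → ℝ}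
    {g : EuclideanSpace ℝ (Fin d) → (Fin (m + 1) → EuclideanSpace ℝ (Fin d)) → ℝ} {α : ℝ}
    (h : HypothesisH1 P X a g α) :
    ∃ C L : ℝ, 0 ≤ C ∧ 0 ≤ L ∧ (∀ x y, |g x y| ≤ C) ∧
      ∀ x x' y, |g x y - g x' y| ≤ L * min 1 ‖x - x'‖ := by
  obtain ⟨C, hC⟩ := h.bounded
  choose K hK using h.bounded_deriv
  have hC0 : 0 ≤ C := (abs_nonneg _).trans (hC 0 0)
  have hK0 : ∀ i, 0 ≤ K i := fun i => (abs_nonneg _).trans (hK i 0 0)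
  have hlip : ∀ x x' y, |g x y - g x' y| ≤ (∑ i, K i) * ‖x - x'‖ := fun x x' y => by
    have hd : Differentiable ℝ fun z => g z y := by
      have : (fun z => g z y) = Function.uncurry g ∘ fun z => (z, y) := rfl
      rw [this]
      exact (h.contDiff.differentiable (by norm_num)).comp (by fun_prop)
    refine Convex.norm_image_sub_le_of_norm_fderiv_le (𝕜 := ℝ) (f := fun z => g z y)
      (fun z _ => hd z) (fun z _ => ?_) convex_univ (Set.mem_univ x') (Set.mem_univ x)
    refine ContinuousLinearMap.opNorm_le_bound _ (Finset.sum_nonneg fun i _ => hK0 i) fun v => ?_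
    have hv : v = ∑ i, v i • EuclideanSpace.single i (1 : ℝ) := by
      ext j; simp [Pi.single_apply]
    conv_lhs => rw [hv, map_sum]
    rw [Finset.sum_mul]
    refine (norm_sum_le _ _).trans (Finset.sum_le_sum fun i _ => ?_)
    rw [map_smul, norm_smul, mul_comm]
    exact mul_le_mul (hK i z y) (PiLp.norm_apply_le v i) (norm_nonneg _) (hK0 i)
  have hS : 0 ≤ ∑ i, K i := Finset.sum_nonneg fun i _ => hK0 i
  refine ⟨C, max (2 * C) (∑ i, K i), hC0, le_max_of_le_right hS, hC, fun x x' y => ?_⟩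
  rcases le_total 1 ‖x - x'‖ with h1 | h1
  · rw [min_eq_left h1, mul_one]
    refine le_trans ?_ (le_max_left _ _)
    exact (abs_sub _ _).trans (by linarith [hC x y, hC x' y])
  · rw [min_eq_right h1]
    refine (hlip x x' y).trans ?_
    gcongr
    exact le_max_right _ _

/-! ### Independence of the future increments from the past -/

/-- The sequence of the increments of `X` over the grid of mesh `1 / n` after time `i / n`. -/
noncomputable def futureIncrements (X : ℝ≥0 → Ω → EuclideanSpace ℝ (Fin d)) (n i : ℕ) (ω : Ω) (k : ℕ) :
    EuclideanSpace ℝ (Fin d) :=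
  X (((i + k + 1 : ℕ) : ℝ≥0) / n) ω - X (((i + k : ℕ) : ℝ≥0) / n) ω

lemma grid_le {n i j : ℕ} (h : i ≤ j) : ((i : ℕ) : ℝ≥0) / n ≤ ((j : ℕ) : ℝ≥0) / n := by
  gcongr

section Increments

variable {ℱ : Filtration ℝ≥0 mΩ} {X : ℝ≥0 → Ω → EuclideanSpace ℝ (Fin d)}

lemma IsLevyProcess.measurable_futureIncrements (hX : IsLevyProcess ℱ X P) (n i : ℕ) :
    Measurable (futureIncrements X n i) :=
  measurable_pi_lambda _ fun _ => (hX.measurable _).sub (hX.measurable _)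

lemma IsLevyProcess.measurable_futureIncrements_apply (hX : IsLevyProcess ℱ X P) (n i k : ℕ)
    {t : ℝ≥0} (ht : ((i + k + 1 : ℕ) : ℝ≥0) / n ≤ t) :
    Measurable[ℱ t] fun ω => futureIncrements X n i ω k := by
  refine Measurable.sub ?_ ?_
  · exact (hX.adapted _).mono (ℱ.mono ht) le_rfl
  · refine (hX.adapted _).mono (ℱ.mono ((grid_le (Nat.le_succ _)).trans ht)) le_rfl

/-- Each increment runs over a time step of length 1/n. For n = 0 all the quotients are 0 and the
identity persists. -/
lemma IsLevyProcess.map_futureIncrements_apply (hX : IsLevyProcess ℱ X P) (n i k : ℕ) : P.map (fun ω => futureIncrements X n i ω k) = P.map (X (1 / (n : ℝ≥0))) := by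
  have := (hX.stationary (((i + k : ℕ) : ℝ≥0) / n) (1 / (n : ℝ≥0))).map_eq
  rw [← this]
  congr 1
  ext1 ω
  rw [futureIncrements, ← add_div]
  push_cast
  rfl

/-- Induction on p: the event A together with the first p increments is known at time (i + p)/n, and
the next increment is independent of that past. -/
lemma IsLevyProcess.measure_inter_futureIncrements (hX : IsLevyProcess ℱ X P) (n : ℕ)
    (i : ℕ) {A : Set Ω} (hA : MeasurableSet[ℱ ((i : ℝ≥0) / n)] A)
    {B : ℕ → Set (EuclideanSpace ℝ (Fin d))} (hB : ∀ k, MeasurableSet (B k)) (p : ℕ) :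
    P (A ∩ ⋂ k ∈ Finset.range p, (fun ω => futureIncrements X n i ω k) ⁻¹' B k)
      = P A * ∏ k ∈ Finset.range p, (P.map (X (1 / (n : ℝ≥0)))) (B k) := by
  induction p with
  | zero => simp
  | succ p ih =>
    have hmeas : MeasurableSet[ℱ (((i + p : ℕ) : ℝ≥0) / n)]
        (A ∩ ⋂ k ∈ Finset.range p, (fun ω => futureIncrements X n i ω k) ⁻¹' B k) := by
      refine MeasurableSet.inter ?_ (Finset.measurableSet_biInter _ fun k hk => ?_)
      · exact ℱ.mono (grid_le (Nat.le_add_right i p)) _ hA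
      · refine hX.measurable_futureIncrements_apply n i k ?_ (hB k)
        have := Finset.mem_range.1 hk
        exact grid_le (by omega)
    have hind := hX.indep_increments (((i + p : ℕ) : ℝ≥0) / n) (((i + p + 1 : ℕ) : ℝ≥0) / n)
      (grid_le (Nat.le_succ _))
    have h1 := (Indep_iff _ _ _).1 hind.symm _ _ hmeas ⟨B p, hB p, rfl⟩
    have h2 : A ∩ ⋂ k ∈ Finset.range (p + 1), (fun ω => futureIncrements X n i ω k) ⁻¹' B k
        = (A ∩ ⋂ k ∈ Finset.range p, (fun ω => futureIncrements X n i ω k) ⁻¹' B k)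
          ∩ (fun ω => futureIncrements X n i ω p) ⁻¹' B p := by
      rw [Finset.range_add_one, Finset.set_biInter_insert, Set.inter_assoc,
        Set.inter_comm (_ ⁻¹' B p)]
    rw [h2]
    refine h1.trans ?_
    rw [ih, Finset.prod_range_succ, mul_assoc]
    congr 2
    rw [← hX.map_futureIncrements_apply n i p,
      Measure.map_apply ((measurable_pi_iff.1 (hX.measurable_futureIncrements n i)) p) (hB p)]
    rfl

variable [IsProbabilityMeasure P]

/-- Conditionally on an event A of positive probability, cylinder sets have product probabilities,
so the conditional law of the whole sequence is the product measure. -/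
lemma IsLevyProcess.measure_inter_futureIncrements_preimage (hX : IsLevyProcess ℱ X P) (n : ℕ)
    (i : ℕ) {A : Set Ω} (hA : MeasurableSet[ℱ ((i : ℝ≥0) / n)] A)
    {D : Set (ℕ → EuclideanSpace ℝ (Fin d))} (hD : MeasurableSet D) :
    P (A ∩ futureIncrements X n i ⁻¹' D) = P A * iidLaw (P.map (X (1 / (n : ℝ≥0)))) D := by
  have := Measure.isProbabilityMeasure_map (μ := P) (hX.measurable (1 / (n : ℝ≥0))).aemeasurable
  have hAm : MeasurableSet A := ℱ.le _ _ hA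
  have hJ := hX.measurable_futureIncrements n i
  rcases eq_or_ne (P A) 0 with h0 | h0
  · rw [h0, zero_mul]
    exact measure_mono_null Set.inter_subset_left h0
  have hprob : IsProbabilityMeasure ((P A)⁻¹ • (P.restrict A).map (futureIncrements X n i)) := by
    constructor
    rw [Measure.smul_apply, Measure.map_apply hJ MeasurableSet.univ, Set.preimage_univ,
      Measure.restrict_apply_univ, smul_eq_mul, ENNReal.inv_mul_cancel h0 (measure_ne_top _ _)]
  have key : (P A)⁻¹ • (P.restrict A).map (futureIncrements X n i)
      = iidLaw (P.map (X (1 / (n : ℝ≥0)))) := by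
    refine Measure.eq_infinitePi _ fun s t ht => ?_
    classical
    -- A cylinder over an arbitrary finite set s is completed by the full space to one over an
    -- initial segment of ℕ.
    set B : ℕ → Set (EuclideanSpace ℝ (Fin d)) := fun k => if k ∈ s then t k else Set.univ
    have hB : ∀ k, MeasurableSet (B k) := fun k => by
      simp only [B]
      split_ifs with h
      · exact ht k
      · exact MeasurableSet.univ
    obtain ⟨p, hp⟩ := s.exists_nat_subset_range
    have h1 := hX.measure_inter_futureIncrements n i hA hB p
    have h2 : ∏ k ∈ Finset.range p, (P.map (X (1 / (n : ℝ≥0)))) (B k)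
        = ∏ k ∈ s, (P.map (X (1 / (n : ℝ≥0)))) (t k) := by
      rw [← Finset.prod_subset hp]
      · exact Finset.prod_congr rfl fun k hk => by simp [B, hk]
      · intro k _ hk
        simp only [B, hk, if_false]
        exact measure_univ
    have h3 : ⋂ k ∈ Finset.range p, (fun ω => futureIncrements X n i ω k) ⁻¹' B k
        = futureIncrements X n i ⁻¹' (Set.pi s t) := by
      ext ω
      simp only [Set.mem_iInter, Set.mem_preimage, Set.mem_pi, B]
      constructor
      · intro h k hk
        simpa [show k ∈ s from hk] using h k (hp hk)
      · intro h k _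
        split_ifs with hk
        · exact h k hk
        · trivial
    rw [Measure.smul_apply, Measure.map_apply hJ (MeasurableSet.pi s.countable_toSet fun k _ =>
      ht k), Measure.restrict_apply (hJ (MeasurableSet.pi s.countable_toSet fun k _ =>
      ht k)), Set.inter_comm, ← h3, h1, h2, smul_eq_mul, ← mul_assoc,
      ENNReal.inv_mul_cancel h0 (measure_ne_top _ _), one_mul]
  rw [← key, Measure.smul_apply, Measure.map_apply hJ hD, Measure.restrict_apply (hJ hD),
    smul_eq_mul, ← mul_assoc, ENNReal.mul_inv_cancel h0 (measure_ne_top _ _), one_mul,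
    Set.inter_comm]

lemma IsLevyProcess.map_futureIncrements (hX : IsLevyProcess ℱ X P) (n : ℕ) (i : ℕ) :
    P.map (futureIncrements X n i) = iidLaw (P.map (X (1 / (n : ℝ≥0)))) := by
  ext D hD
  rw [Measure.map_apply (hX.measurable_futureIncrements n i) hD]
  simpa using hX.measure_inter_futureIncrements_preimage n i MeasurableSet.univ hD

lemma IsLevyProcess.indep_futureIncrements (hX : IsLevyProcess ℱ X P) (n : ℕ)
    (i : ℕ) : Indep (ℱ ((i : ℝ≥0) / n))
      (MeasurableSpace.comap (futureIncrements X n i) inferInstance) P := by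
  rw [Indep_iff]
  rintro A _ hA ⟨D, hD, rfl⟩
  rw [hX.measure_inter_futureIncrements_preimage n i hA hD, ← hX.map_futureIncrements n i,
    Measure.map_apply (hX.measurable_futureIncrements n i) hD]

/-- Freezing lemma: by independence the pair formed by Y and the future increments has a product
law, and Fubini integrates the increments with Y fixed. -/
lemma IsLevyProcess.integral_comp_futureIncrements (hX : IsLevyProcess ℱ X P) (n : ℕ)
    (i : ℕ) {S : Type*} [MeasurableSpace S] {Y : Ω → S}
    (hY : Measurable[ℱ ((i : ℝ≥0) / n)] Y) {V : Type*} [NormedAddCommGroup V] [NormedSpace ℝ V]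
    {Φ : S → (ℕ → EuclideanSpace ℝ (Fin d)) → V} (hΦ : StronglyMeasurable (Function.uncurry Φ))
    {C : ℝ} (hC : ∀ ω c, ‖Φ (Y ω) c‖ ≤ C) :
    ∫ ω, Φ (Y ω) (futureIncrements X n i ω) ∂P
      = ∫ ω, ∫ c, Φ (Y ω) c ∂(iidLaw (P.map (X (1 / (n : ℝ≥0))))) ∂P := by
  have := Measure.isProbabilityMeasure_map (μ := P) (hX.measurable (1 / (n : ℝ≥0))).aemeasurable
  have hYm : Measurable Y := hY.mono (ℱ.le _) le_rfl
  have := Measure.isProbabilityMeasure_map (μ := P) hYm.aemeasurable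
  have hJ := hX.measurable_futureIncrements n i
  have hind : IndepFun Y (futureIncrements X n i) P :=
    indep_of_indep_of_le_left (hX.indep_futureIncrements n i) hY.comap_le
  have hmap := (indepFun_iff_map_prod_eq_prod_map_map hYm.aemeasurable hJ.aemeasurable).1 hind
  rw [hX.map_futureIncrements n i] at hmap
  have h1 : ∫ ω, Φ (Y ω) (futureIncrements X n i ω) ∂P
      = ∫ q, Function.uncurry Φ q ∂(P.map fun ω => (Y ω, futureIncrements X n i ω)) := by
    rw [integral_map (hYm.prodMk hJ).aemeasurable hΦ.aestronglyMeasurable]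
    rfl
  have hint : Integrable (Function.uncurry Φ)
      (P.map fun ω => (Y ω, futureIncrements X n i ω)) := by
    refine (integrable_map_measure hΦ.aestronglyMeasurable (hYm.prodMk hJ).aemeasurable).2 ?_
    exact Integrable.of_bound (hΦ.comp_measurable (hYm.prodMk hJ)).aestronglyMeasurable C
      (ae_of_all _ fun ω => hC ω _)
  rw [hmap] at hint
  rw [h1, hmap, integral_prod _ hint, integral_map hYm.aemeasurable]
  · rfl
  · exact (hΦ.integral_prod_right').aestronglyMeasurable

end Increments

end LevyHF

namespace LevyHF

/-! ### Centred summands -/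

section Centred

variable {Ω : Type*} {mΩ : MeasurableSpace Ω} {P : Measure Ω} {d m : ℕ}
  {X : ℝ≥0 → Ω → EuclideanSpace ℝ (Fin d)} {a : ℕ → ℝ}
  {g : EuclideanSpace ℝ (Fin d) → (Fin (m + 1) → EuclideanSpace ℝ (Fin d)) → ℝ}

/-- The function `y ↦ g (x, a_n y)`. -/
def scaled (a : ℕ → ℝ)
    (g : EuclideanSpace ℝ (Fin d) → (Fin (m + 1) → EuclideanSpace ℝ (Fin d)) → ℝ) (n : ℕ)
    (x : EuclideanSpace ℝ (Fin d)) (y : Fin (m + 1) → EuclideanSpace ℝ (Fin d)) : ℝ :=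
  g x fun k => a n • y k

/-- The law of the increments of `X` over the grid of mesh `1 / n`. -/
noncomputable def gridLaw (P : Measure Ω) (X : ℝ≥0 → Ω → EuclideanSpace ℝ (Fin d)) (n : ℕ) :
    Measure (ℕ → EuclideanSpace ℝ (Fin d)) := iidLaw (P.map (X (1 / (n : ℝ≥0))))

/-- The mean of `g (x, 𝓘_{i,n})`. -/
noncomputable def meanG (P : Measure Ω) (X : ℝ≥0 → Ω → EuclideanSpace ℝ (Fin d)) (a : ℕ → ℝ)
    (g : EuclideanSpace ℝ (Fin d) → (Fin (m + 1) → EuclideanSpace ℝ (Fin d)) → ℝ) (n : ℕ)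
    (x : EuclideanSpace ℝ (Fin d)) : ℝ :=
  ∫ c, window (scaled a g n x) 0 c ∂(gridLaw P X n)

/-- The centred function of the window of length `m + 1` starting at `l`. -/
noncomputable def centred (P : Measure Ω) (X : ℝ≥0 → Ω → EuclideanSpace ℝ (Fin d)) (a : ℕ → ℝ)
    (g : EuclideanSpace ℝ (Fin d) → (Fin (m + 1) → EuclideanSpace ℝ (Fin d)) → ℝ) (n : ℕ)
    (x : EuclideanSpace ℝ (Fin d)) (l : ℕ) (c : ℕ → EuclideanSpace ℝ (Fin d)) : ℝ :=
  window (scaled a g n x) l c - meanG P X a g n x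

lemma window_futureIncrements (f : (Fin (m + 1) → EuclideanSpace ℝ (Fin d)) → ℝ) (n i l : ℕ)
    (ω : Ω) : window f l (futureIncrements X n i ω)
      = window f 0 (futureIncrements X n (i + l) ω) := by
  simp only [window, futureIncrements, Nat.zero_add, Nat.add_assoc]

lemma g_increments_eq_window (n i : ℕ) (x : EuclideanSpace ℝ (Fin d)) (ω : Ω) :
    g x (increments X a m n i ω) = window (scaled a g n x) 0 (futureIncrements X n i ω) := by
  simp only [window, scaled, futureIncrements, Nat.zero_add]
  rfl

lemma centred_futureIncrements (n i l : ℕ) (x : EuclideanSpace ℝ (Fin d)) (ω : Ω) :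
    centred P X a g n x l (futureIncrements X n i ω)
      = centred P X a g n x 0 (futureIncrements X n (i + l) ω) := by
  rw [centred, window_futureIncrements, centred]

lemma gn_eq_sum_windowCov (n : ℕ) (x : EuclideanSpace ℝ (Fin d)) :
    gn P X a g n x
      = ∑ j ∈ Finset.Icc (-(m : ℤ)) m, windowCov (P.map (X (1 / (n : ℝ≥0)))) (scaled a g n x) j :=
  rfl

lemma measurable_scaled (hg : Continuous (Function.uncurry g)) (n : ℕ)
    (x : EuclideanSpace ℝ (Fin d)) : Measurable (scaled a g n x) := by
  have : Continuous (scaled a g n x) :=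
    hg.comp (f := fun y : Fin (m + 1) → EuclideanSpace ℝ (Fin d) => (x, fun k => a n • y k))
      (by fun_prop)
  exact this.measurable

lemma measurable_scaled_comp (hg : Continuous (Function.uncurry g)) (n : ℕ) {S : Type*}
    [MeasurableSpace S] {x : S → EuclideanSpace ℝ (Fin d)}
    {y : S → Fin (m + 1) → EuclideanSpace ℝ (Fin d)} (hx : Measurable x)
    (hy : ∀ k, Measurable fun s => y s k) : Measurable fun s => scaled a g n (x s) (y s) := by
  refine hg.measurable.comp (hx.prodMk (measurable_pi_lambda _ fun k => ?_))
  exact (hy k).const_smul (a n)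

variable [IsProbabilityMeasure P] {C L : ℝ}

lemma isProbabilityMeasure_gridLaw (hX : ∀ t, Measurable (X t)) (n : ℕ) :
    IsProbabilityMeasure (gridLaw P X n) := by
  have := Measure.isProbabilityMeasure_map (μ := P) (hX (1 / (n : ℝ≥0))).aemeasurable
  unfold gridLaw
  infer_instance

lemma integrable_window_scaled (hX : ∀ t, Measurable (X t)) (hg : Continuous (Function.uncurry g))
    (hC : ∀ x y, |g x y| ≤ C) (n l : ℕ) (x : EuclideanSpace ℝ (Fin d)) :
    Integrable (window (scaled a g n x) l) (gridLaw P X n) := by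
  have := isProbabilityMeasure_gridLaw (P := P) hX n
  exact Integrable.of_bound (measurable_window (measurable_scaled hg n x) l).aestronglyMeasurable C
    (ae_of_all _ fun _ => hC _ _)

lemma abs_centred_le (hX : ∀ t, Measurable (X t)) (hC : ∀ x y, |g x y| ≤ C) (n l : ℕ)
    (x : EuclideanSpace ℝ (Fin d)) (c : ℕ → EuclideanSpace ℝ (Fin d)) :
    |centred P X a g n x l c| ≤ 2 * C := by
  have := isProbabilityMeasure_gridLaw (P := P) hX n
  have h1 : |meanG P X a g n x| ≤ C := abs_integral_le_of_bounded fun _ => hC _ _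
  refine (abs_sub _ _).trans ?_
  have h2 : |window (scaled a g n x) l c| ≤ C := hC _ _
  linarith

/-- The window function and its mean each vary by at most L min(1, |x - x'|), whence the factor 2.
-/
lemma abs_centred_sub_le (hX : ∀ t, Measurable (X t)) (hg : Continuous (Function.uncurry g))
    (hC : ∀ x y, |g x y| ≤ C) (hL : ∀ x x' y, |g x y - g x' y| ≤ L * min 1 ‖x - x'‖) (n l : ℕ)
    (x x' : EuclideanSpace ℝ (Fin d)) (c : ℕ → EuclideanSpace ℝ (Fin d)) :
    |centred P X a g n x l c - centred P X a g n x' l c| ≤ 2 * L * min 1 ‖x - x'‖ := by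
  have := isProbabilityMeasure_gridLaw (P := P) hX n
  have h1 : |meanG P X a g n x - meanG P X a g n x'| ≤ L * min 1 ‖x - x'‖ := by
    rw [meanG, meanG, ← integral_sub (integrable_window_scaled hX hg hC n 0 x)
      (integrable_window_scaled hX hg hC n 0 x')]
    exact abs_integral_le_of_bounded fun _ => hL _ _ _
  have h2 : |window (scaled a g n x) l c - window (scaled a g n x') l c| ≤ L * min 1 ‖x - x'‖ :=
    hL _ _ _
  have e : centred P X a g n x l c - centred P X a g n x' l c
      = (window (scaled a g n x) l c - window (scaled a g n x') l c)
        - (meanG P X a g n x - meanG P X a g n x') := by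
    simp only [centred]; ring
  rw [e]
  refine (abs_sub _ _).trans ?_
  linarith

lemma integral_centred (hX : ∀ t, Measurable (X t)) (hg : Continuous (Function.uncurry g))
    (hC : ∀ x y, |g x y| ≤ C) (n l : ℕ) (x : EuclideanSpace ℝ (Fin d)) :
    ∫ c, centred P X a g n x l c ∂(gridLaw P X n) = 0 := by
  have := isProbabilityMeasure_gridLaw (P := P) hX n
  have := Measure.isProbabilityMeasure_map (μ := P) (hX (1 / (n : ℝ≥0))).aemeasurable
  simp only [centred]
  rw [integral_sub (integrable_window_scaled hX hg hC n l x) (integrable_const _), gridLaw,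
    integral_window _ (measurable_scaled hg n x)]
  have : IsProbabilityMeasure (iidLaw (P.map (X (1 / (n : ℝ≥0))))) := by
    unfold iidLaw; infer_instance
  rw [integral_const, probReal_univ, one_smul, meanG, gridLaw, sub_self]

lemma measurable_meanG (hX : ∀ t, Measurable (X t)) (hg : Continuous (Function.uncurry g))
    (n : ℕ) : Measurable (meanG P X a g n) := by
  have := isProbabilityMeasure_gridLaw (P := P) hX n
  have h : Measurable fun q : EuclideanSpace ℝ (Fin d) × (ℕ → EuclideanSpace ℝ (Fin d)) =>
      window (scaled a g n q.1) 0 q.2 :=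
    measurable_scaled_comp hg n measurable_fst fun k => by fun_prop
  exact (StronglyMeasurable.integral_prod_right' (f := fun q : EuclideanSpace ℝ (Fin d) ×
    (ℕ → EuclideanSpace ℝ (Fin d)) => window (scaled a g n q.1) 0 q.2)
    h.stronglyMeasurable).measurable

lemma measurable_centred (hX : ∀ t, Measurable (X t)) (hg : Continuous (Function.uncurry g))
    (n l : ℕ) : Measurable fun q : EuclideanSpace ℝ (Fin d) × (ℕ → EuclideanSpace ℝ (Fin d)) =>
      centred P X a g n q.1 l q.2 :=
  (measurable_scaled_comp hg n measurable_fst fun k => by fun_prop).sub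
    ((measurable_meanG hX hg n).comp measurable_fst)

lemma measurable_centred_comp (hX : ∀ t, Measurable (X t)) (hg : Continuous (Function.uncurry g))
    (n l : ℕ) {S : Type*} [MeasurableSpace S] {Y : S → EuclideanSpace ℝ (Fin d)}
    {c : S → ℕ → EuclideanSpace ℝ (Fin d)} (hY : Measurable Y)
    (hc : ∀ k ≤ l + m, Measurable fun s => c s k) :
    Measurable fun s => centred P X a g n (Y s) l (c s) :=
  (measurable_scaled_comp hg n hY fun k => hc _ (by omega)).sub ((measurable_meanG hX hg n).comp hY)

variable {ℱ : Filtration ℝ≥0 mΩ}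

lemma IsLevyProcess.measurable_centred (hX : IsLevyProcess ℱ X P)
    (hg : Continuous (Function.uncurry g)) (n i l : ℕ) {t : ℝ≥0}
    (ht : ((i + l + m + 1 : ℕ) : ℝ≥0) / n ≤ t) {Y : Ω → EuclideanSpace ℝ (Fin d)}
    (hY : Measurable[ℱ t] Y) :
    Measurable[ℱ t] fun ω => centred P X a g n (Y ω) l (futureIncrements X n i ω) :=
  @measurable_centred_comp Ω mΩ P d m X a g _ hX.measurable hg n l Ω (ℱ t) Y _ hY
    fun k hk => hX.measurable_futureIncrements_apply n i k ((grid_le (by omega)).trans ht)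

/-- The weight H and the state Y are both known at time i/n, so they are frozen together as a pair.
-/
lemma IsLevyProcess.integral_mul_comp_futureIncrements (hX : IsLevyProcess ℱ X P) (n i : ℕ)
    {𝕜 : Type*} [RCLike 𝕜] {Y : Ω → EuclideanSpace ℝ (Fin d)}
    (hY : Measurable[ℱ ((i : ℝ≥0) / n)] Y) {H : Ω → 𝕜} (hH : Measurable[ℱ ((i : ℝ≥0) / n)] H)
    {K : ℝ} (hK : ∀ ω, ‖H ω‖ ≤ K)
    {Φ : EuclideanSpace ℝ (Fin d) → (ℕ → EuclideanSpace ℝ (Fin d)) → 𝕜}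
    (hΦ : Measurable (Function.uncurry Φ)) {M : ℝ} (hM : ∀ x c, ‖Φ x c‖ ≤ M) :
    ∫ ω, H ω * Φ (Y ω) (futureIncrements X n i ω) ∂P
      = ∫ ω, H ω * ∫ c, Φ (Y ω) c ∂(gridLaw P X n) ∂P := by
  have := hX.integral_comp_futureIncrements n i (Y := fun ω => (H ω, Y ω)) (hH.prodMk hY)
    (Φ := fun q c => q.1 * Φ q.2 c) (C := K * M) ?_ fun ω c => ?_
  · simp only at this
    rw [this]
    simp_rw [integral_const_mul]
    rfl
  · refine Measurable.stronglyMeasurable ?_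
    exact (measurable_fst.comp measurable_fst).mul
      (hΦ.comp ((measurable_snd.comp measurable_fst).prodMk measurable_snd))
  · rw [norm_mul]
    exact mul_le_mul (hK ω) (hM _ _) (norm_nonneg _) ((norm_nonneg _).trans (hK ω))

lemma IsLevyProcess.integral_mul_centred_eq_zero (hX : IsLevyProcess ℱ X P)
    (hg : Continuous (Function.uncurry g)) (hC : ∀ x y, |g x y| ≤ C) (n i l : ℕ)
    {Y : Ω → EuclideanSpace ℝ (Fin d)}
    (hY : Measurable[ℱ ((i : ℝ≥0) / n)] Y) {H : Ω → ℝ} (hH : Measurable[ℱ ((i : ℝ≥0) / n)] H)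
    {K : ℝ} (hK : ∀ ω, ‖H ω‖ ≤ K) :
    ∫ ω, H ω * centred P X a g n (Y ω) l (futureIncrements X n i ω) ∂P = 0 := by
  rw [hX.integral_mul_comp_futureIncrements n i hY hH hK
    (Φ := fun x c => centred P X a g n x l c) (LevyHF.measurable_centred hX.measurable hg n l)
    (M := 2 * C) fun x c => abs_centred_le hX.measurable hC n l x c]
  simp [integral_centred hX.measurable hg hC]

/-- Centred windows started at i are orthogonal to indicators of events before i/n. This identifies
the conditional expectation with the mean at the frozen state. -/
lemma IsLevyProcess.condExp_g_increments (hX : IsLevyProcess ℱ X P)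
    (hg : Continuous (Function.uncurry g)) (hC : ∀ x y, |g x y| ≤ C) (n i : ℕ) :
    P[fun ω => g (X ((i : ℝ≥0) / n) ω) (increments X a m n i ω) | ℱ ((i : ℝ≥0) / n)]
      =ᵐ[P] fun ω => meanG P X a g n (X ((i : ℝ≥0) / n) ω) := by
  have hY := hX.adapted ((i : ℝ≥0) / n)
  have hYm := hX.measurable ((i : ℝ≥0) / n)
  have := isProbabilityMeasure_gridLaw (P := P) hX.measurable n
  have hmean : Measurable[ℱ ((i : ℝ≥0) / n)] fun ω => meanG P X a g n (X ((i : ℝ≥0) / n) ω) :=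
    (measurable_meanG hX.measurable hg n).comp hY
  have hgm : Measurable fun ω => g (X ((i : ℝ≥0) / n) ω) (increments X a m n i ω) := by
    simp_rw [g_increments_eq_window]
    exact measurable_scaled_comp hg n hYm fun k =>
      (measurable_pi_iff.1 (hX.measurable_futureIncrements n i)) _
  have hgi : Integrable (fun ω => g (X ((i : ℝ≥0) / n) ω) (increments X a m n i ω)) P :=
    Integrable.of_bound hgm.aestronglyMeasurable C (ae_of_all _ fun _ => hC _ _)
  have hmi : Integrable (fun ω => meanG P X a g n (X ((i : ℝ≥0) / n) ω)) P :=
    Integrable.of_bound (hmean.mono (ℱ.le _) le_rfl).aestronglyMeasurable C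
      (ae_of_all _ fun _ => abs_integral_le_of_bounded fun _ => hC _ _)
  refine (ae_eq_condExp_of_forall_setIntegral_eq (ℱ.le _) hgi (fun _ _ _ => hmi.integrableOn)
    (fun A hA _ => ?_) hmean.stronglyMeasurable.aestronglyMeasurable).symm
  have hAm := ℱ.le _ _ hA
  rw [← sub_eq_zero, ← neg_eq_zero, neg_sub, ← integral_sub hgi.integrableOn hmi.integrableOn,
    ← integral_indicator hAm]
  have := hX.integral_mul_centred_eq_zero (a := a) hg hC n i 0 hY (H := A.indicator 1)
    ((measurable_const (a := (1 : ℝ))).indicator hA) (K := 1) fun ω => by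
      by_cases h : ω ∈ A <;> simp [h]
  rw [← this]
  refine integral_congr_ae (ae_of_all _ fun ω => ?_)
  simp only [g_increments_eq_window, centred]
  by_cases h : ω ∈ A <;> simp [h]

lemma IsLevyProcess.statZ_ae_eq (hX : IsLevyProcess ℱ X P)
    (hg : Continuous (Function.uncurry g)) (hC : ∀ x y, |g x y| ≤ C) (n : ℕ) (t : ℝ≥0) :
    statZ P ℱ X a g n t =ᵐ[P] fun ω => (√n)⁻¹ * ∑ i ∈ Finset.range ⌊(n : ℝ≥0) * t⌋₊,
      centred P X a g n (X ((i : ℝ≥0) / n) ω) 0 (futureIncrements X n i ω) := by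
  have h : ∀ᵐ ω ∂P, ∀ i : ℕ,
      (P[fun ω => g (X ((i : ℝ≥0) / n) ω) (increments X a m n i ω) | ℱ ((i : ℝ≥0) / n)]) ω
      = meanG P X a g n (X ((i : ℝ≥0) / n) ω) :=
    ae_all_iff.2 fun i => hX.condExp_g_increments hg hC n i
  filter_upwards [h] with ω hω
  rw [statZ]
  congr 1
  exact Finset.sum_congr rfl fun i _ => by rw [hω i, g_increments_eq_window (g := g), centred]

end Centred

end LevyHF

namespace LevyHF

/-! ### Quantitative form of the hypotheses -/

section Setting

/-- The consequences of the hypotheses that are used in the proof of the limit theorem, with a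
single constant `L`. -/
structure LimitSetting {Ω : Type*} {mΩ : MeasurableSpace Ω} (P : Measure Ω)
    (ℱ : Filtration ℝ≥0 mΩ) {d m : ℕ} (X : ℝ≥0 → Ω → EuclideanSpace ℝ (Fin d)) (a : ℕ → ℝ)
    (g : EuclideanSpace ℝ (Fin d) → (Fin (m + 1) → EuclideanSpace ℝ (Fin d)) → ℝ)
    (𝔤 : EuclideanSpace ℝ (Fin d) → ℝ) (L γ : ℝ) : Prop where
  levy : IsLevyProcess ℱ X P
  continuous : Continuous (Function.uncurry g)
  bound : ∀ x y, |g x y| ≤ L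
  lipschitz : ∀ x x' y, |g x y - g x' y| ≤ L * min 1 ‖x - x'‖
  nonneg : ∀ x, 0 ≤ 𝔤 x
  limit_le : ∀ x, 𝔤 x ≤ L
  limit_lipschitz : ∀ x x', |𝔤 x - 𝔤 x'| ≤ L * min 1 ‖x - x'‖
  modulus : HasModulus X P L γ
  half_lt : 1 / 2 < γ
  uniform : ∀ ε > 0, ∀ᶠ n in atTop, ∀ x, |gn P X a g n x - 𝔤 x| ≤ ε

variable {Ω : Type*} {mΩ : MeasurableSpace Ω} {P : Measure Ω} [IsProbabilityMeasure P]
  {ℱ : Filtration ℝ≥0 mΩ} {d m : ℕ}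
  {X : ℝ≥0 → Ω → EuclideanSpace ℝ (Fin d)} {a : ℕ → ℝ}
  {g : EuclideanSpace ℝ (Fin d) → (Fin (m + 1) → EuclideanSpace ℝ (Fin d)) → ℝ}
  {𝔤 : EuclideanSpace ℝ (Fin d) → ℝ} {L γ : ℝ}

/-- Boundedness and Lipschitz continuity of 𝔤_n hold with constants free of n and pass to the
pointwise limit, as does nonnegativity from `sum_windowCov_nonneg`. -/
theorem exists_limitSetting (hX : IsLevyProcess ℱ X P) {α : ℝ} (hα : α ∈ Set.Ioo (0 : ℝ) 2)
    (hH1 : HypothesisH1 P X a g α)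
    (h𝔤 : ∀ x, Tendsto (fun n => gn P X a g n x) atTop (𝓝 (𝔤 x)))
    (hunif : Tendsto (fun n => ⨆ x, ‖gn P X a g n x - 𝔤 x‖ₑ) atTop (𝓝 0)) :
    ∃ L γ, LimitSetting P ℱ X a g 𝔤 L γ := by
  obtain ⟨κ, hκ, htail⟩ := hH1.tail
  obtain ⟨C₁, γ, hC₁, hγ, hmod⟩ := hX.exists_hasModulus hα hκ htail
  obtain ⟨C, L₀, hC, hL₀, hgC, hgL⟩ := hH1.exists_lipschitz
  have hgc : Continuous (Function.uncurry g) := hH1.contDiff.continuous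
  have hpr : ∀ n : ℕ, IsProbabilityMeasure (P.map (X (1 / (n : ℝ≥0)))) := fun n =>
    Measure.isProbabilityMeasure_map (hX.measurable _).aemeasurable
  have hM : ∀ n x, |gn P X a g n x| ≤ (2 * m + 1) * (2 * C ^ 2) := fun n x => by
    have := hpr n
    rw [gn_eq_sum_windowCov]
    refine (Finset.abs_sum_le_sum_abs _ _).trans ((Finset.sum_le_card_nsmul _ _ (2 * C ^ 2)
      fun j _ => abs_windowCov_le _ (measurable_scaled hgc n x) (fun _ => hgC _ _) j).trans
        (le_of_eq ?_))
    rw [Int.card_Icc, nsmul_eq_mul]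
    congr 1
    have : ((m : ℤ) + 1 - -(m : ℤ)).toNat = 2 * m + 1 := by omega
    rw [this]; push_cast; ring
  have hlip : ∀ n x x', |gn P X a g n x - gn P X a g n x'|
      ≤ (2 * m + 1) * (4 * C * (L₀ * min 1 ‖x - x'‖)) := fun n x x' => by
    have := hpr n
    rw [gn_eq_sum_windowCov, gn_eq_sum_windowCov]
    exact abs_sum_windowCov_sub_sum_le _ (measurable_scaled hgc n x) (measurable_scaled hgc n x')
      (fun _ => hgC _ _) (fun _ => hgC _ _) fun _ => hgL _ _ _
  have hmin : ∀ x x' : EuclideanSpace ℝ (Fin d), 0 ≤ min 1 ‖x - x'‖ := fun x x' =>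
    le_min zero_le_one (norm_nonneg _)
  -- A sum of nonnegative constants, so that each individual bound holds with L in place of its own
  -- constant.
  set L := C + L₀ + C₁ + (2 * m + 1) * (2 * C ^ 2) + (2 * m + 1) * (4 * C * L₀) with hL
  have p1 : 0 ≤ (2 * (m : ℝ) + 1) * (2 * C ^ 2) := by positivity
  have p2 : 0 ≤ (2 * (m : ℝ) + 1) * (4 * C * L₀) := by positivity
  refine ⟨L, γ, hX, hgc, fun x y => (hgC x y).trans (by linarith), fun x x' y =>
    (hgL x x' y).trans (mul_le_mul_of_nonneg_right (by linarith) (hmin _ _)), fun x => ?_,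
    fun x => ?_, fun x x' => ?_, fun s t hst => (hmod s t hst).trans ?_, hγ, fun ε hε => ?_⟩
  · refine ge_of_tendsto' (h𝔤 x) fun n => ?_
    have := hpr n
    rw [gn_eq_sum_windowCov]
    exact sum_windowCov_nonneg _ (measurable_scaled hgc n x) fun _ => hgC _ _
  · exact le_of_tendsto' (h𝔤 x) fun n => ((le_abs_self _).trans (hM n x)).trans (by linarith)
  · refine le_of_tendsto' ((h𝔤 x).sub (h𝔤 x')).abs fun n => (hlip n x x').trans ?_
    calc (2 * (m : ℝ) + 1) * (4 * C * (L₀ * min 1 ‖x - x'‖))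
        = ((2 * (m : ℝ) + 1) * (4 * C * L₀)) * min 1 ‖x - x'‖ := by ring
      _ ≤ _ := mul_le_mul_of_nonneg_right (by linarith) (hmin _ _)
  · refine mul_le_mul_of_nonneg_right (by linarith) (Real.rpow_nonneg ?_ _)
    have : (s : ℝ) ≤ t := hst
    linarith
  · have h := hunif.eventually (gt_mem_nhds (ENNReal.ofReal_pos.2 hε))
    filter_upwards [h] with n hn x
    have h1 : ‖gn P X a g n x - 𝔤 x‖ₑ ≤ ENNReal.ofReal ε :=
      (le_iSup (fun x => ‖gn P X a g n x - 𝔤 x‖ₑ) x).trans hn.le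
    rw [Real.enorm_eq_ofReal_abs] at h1
    exact (ENNReal.ofReal_le_ofReal_iff hε.le).1 h1

namespace LimitSetting

lemma const_nonneg (h : LimitSetting P ℱ X a g 𝔤 L γ) : 0 ≤ L :=
  (h.nonneg 0).trans (h.limit_le 0)

lemma measurable (h : LimitSetting P ℱ X a g 𝔤 L γ) (t : ℝ≥0) : Measurable (X t) :=
  h.levy.measurable t

lemma continuous_limit (h : LimitSetting P ℱ X a g 𝔤 L γ) : Continuous 𝔤 := by
  refine (LipschitzWith.of_dist_le_mul (K := ⟨L, h.const_nonneg⟩) fun x y => ?_).continuous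
  rw [Real.dist_eq, dist_eq_norm]
  exact (h.limit_lipschitz x y).trans
    (mul_le_mul_of_nonneg_left (min_le_right _ _) h.const_nonneg)

lemma integral_min_le (h : LimitSetting P ℱ X a g 𝔤 L γ) {s t δ : ℝ≥0} (hst : s ≤ t)
    (hδ : t ≤ s + δ) : ∫ ω, min 1 ‖X t ω - X s ω‖ ∂P ≤ L * (δ : ℝ) ^ γ := by
  refine (h.modulus s t hst).trans (mul_le_mul_of_nonneg_left ?_ h.const_nonneg)
  have h1 : (s : ℝ) ≤ t := hst
  have h2 : (t : ℝ) ≤ s + δ := by exact_mod_cast hδ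
  exact Real.rpow_le_rpow (by linarith) (by linarith) (by linarith [h.half_lt])

lemma integrable_min (h : LimitSetting P ℱ X a g 𝔤 L γ) (s t : ℝ≥0) :
    Integrable (fun ω => min 1 ‖X t ω - X s ω‖) P :=
  Integrable.of_bound (measurable_const.min
    ((h.measurable t).sub (h.measurable s)).norm).aestronglyMeasurable 1
    (ae_of_all _ fun ω => by
      rw [Real.norm_of_nonneg (le_min zero_le_one (norm_nonneg _))]; exact min_le_left _ _)

end LimitSetting

end Setting

/-! ### Comparison with sums over blocks -/

section Blocks

/-- The number of blocks of `p` grid points needed to cover `[0, t]`. -/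
noncomputable def numBlocks (n p : ℕ) (t : ℝ≥0) : ℕ := ⌈(n : ℝ≥0) * t / p⌉₊

lemma le_numBlocks_mul {n p : ℕ} (hp : p ≠ 0) (t : ℝ≥0) :
    (n : ℝ≥0) * t ≤ ((numBlocks n p t * p : ℕ) : ℝ≥0) := by
  have hp' : (0 : ℝ≥0) < p := by positivity
  have := Nat.le_ceil ((n : ℝ≥0) * t / p)
  rw [div_le_iff₀ hp'] at this
  push_cast
  exact this

lemma numBlocks_mul_le {n p : ℕ} (hp : p ≠ 0) (t : ℝ≥0) :
    ((numBlocks n p t * p : ℕ) : ℝ≥0) ≤ n * t + p := by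
  have hp' : (0 : ℝ≥0) < p := by positivity
  have := (Nat.ceil_lt_add_one (zero_le (a := (n : ℝ≥0) * t / p))).le
  have h2 := mul_le_mul_of_nonneg_right this hp'.le
  rw [add_mul, div_mul_cancel₀ _ hp'.ne', one_mul] at h2
  push_cast
  exact h2

lemma le_numBlocks_mul_div {n p : ℕ} (hn : n ≠ 0) (hp : p ≠ 0) (t : ℝ≥0) :
    t ≤ ((numBlocks n p t * p : ℕ) : ℝ≥0) / n := by
  rw [le_div_iff₀ (by positivity), mul_comm]
  exact le_numBlocks_mul hp t

lemma numBlocks_mul_div_le {n p : ℕ} (hn : n ≠ 0) (hp : p ≠ 0) (t : ℝ≥0) :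
    ((numBlocks n p t * p : ℕ) : ℝ≥0) / n ≤ t + p / n := by
  have hn' : (0 : ℝ≥0) < n := by positivity
  rw [div_le_iff₀ hn', add_mul, div_mul_cancel₀ _ hn'.ne', mul_comm t]
  exact numBlocks_mul_le hp t

lemma numBlocks_mono {n p : ℕ} {s t : ℝ≥0} (h : s ≤ t) : numBlocks n p s ≤ numBlocks n p t :=
  Nat.ceil_mono (by gcongr)

lemma sum_range_mul {M : Type*} [AddCommMonoid M] (K p : ℕ) (f : ℕ → M) :
    ∑ i ∈ Finset.range (K * p), f i
      = ∑ b ∈ Finset.range K, ∑ l ∈ Finset.range p, f (b * p + l) := by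
  induction K with
  | zero => simp
  | succ K ih => rw [add_mul, one_mul, Finset.sum_range_add, ih, Finset.sum_range_succ]

variable {Ω : Type*} {mΩ : MeasurableSpace Ω} {P : Measure Ω}
  {ℱ : Filtration ℝ≥0 mΩ} {d m : ℕ}
  {X : ℝ≥0 → Ω → EuclideanSpace ℝ (Fin d)} {a : ℕ → ℝ}
  {g : EuclideanSpace ℝ (Fin d) → (Fin (m + 1) → EuclideanSpace ℝ (Fin d)) → ℝ}
  {𝔤 : EuclideanSpace ℝ (Fin d) → ℝ} {L γ : ℝ}

/-- The sum of the first `p - m` centred windows. -/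
noncomputable def blockSum (P : Measure Ω) (X : ℝ≥0 → Ω → EuclideanSpace ℝ (Fin d)) (a : ℕ → ℝ)
    (g : EuclideanSpace ℝ (Fin d) → (Fin (m + 1) → EuclideanSpace ℝ (Fin d)) → ℝ) (n p : ℕ)
    (x : EuclideanSpace ℝ (Fin d)) (c : ℕ → EuclideanSpace ℝ (Fin d)) : ℝ :=
  ∑ l ∈ Finset.range (p - m), centred P X a g n x l c

/-- The difference between the `i`-th summand of the statistic and its block counterpart. -/
noncomputable def blockError (P : Measure Ω) (X : ℝ≥0 → Ω → EuclideanSpace ℝ (Fin d)) (a : ℕ → ℝ)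
    (g : EuclideanSpace ℝ (Fin d) → (Fin (m + 1) → EuclideanSpace ℝ (Fin d)) → ℝ) (n p i : ℕ)
    (ω : Ω) : ℝ :=
  centred P X a g n (X ((i : ℝ≥0) / n) ω) 0 (futureIncrements X n i ω)
    - if i % p < p - m then
        centred P X a g n (X (((i / p * p : ℕ) : ℝ≥0) / n) ω) 0 (futureIncrements X n i ω) else 0

/-- Write i = bp + l with l < p: the quotient i / p finds the block, the remainder tells whether the
window is kept, and windows with l ≥ p - m have no counterpart. -/
lemma sum_blockError {n p : ℕ} (K : ℕ) (ω : Ω) :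
    ∑ i ∈ Finset.range (K * p), blockError P X a g n p i ω
      = ∑ i ∈ Finset.range (K * p),
          centred P X a g n (X ((i : ℝ≥0) / n) ω) 0 (futureIncrements X n i ω)
        - ∑ b ∈ Finset.range K, blockSum P X a g n p (X (((b * p : ℕ) : ℝ≥0) / n) ω)
            (futureIncrements X n (b * p) ω) := by
  simp only [blockError]
  rw [Finset.sum_sub_distrib]
  congr 1
  rw [sum_range_mul]
  refine Finset.sum_congr rfl fun b _ => ?_
  have h1 : ∀ l ∈ Finset.range p, (b * p + l) % p = l ∧ (b * p + l) / p = b := fun l hl => by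
    have hl := Finset.mem_range.1 hl
    constructor
    · rw [Nat.mul_add_mod_of_lt hl]
    · rw [Nat.mul_comm, Nat.mul_add_div (by omega), Nat.div_eq_of_lt hl, add_zero]
  rw [Finset.sum_congr rfl fun l hl => by rw [(h1 l hl).1, (h1 l hl).2], blockSum,
    ← Finset.sum_filter]
  refine Finset.sum_congr ?_ fun l _ => (centred_futureIncrements _ _ _ _ _).symm
  ext l
  simp only [Finset.mem_filter, Finset.mem_range]
  omega

variable [IsProbabilityMeasure P]

namespace LimitSetting

lemma abs_centred_le (h : LimitSetting P ℱ X a g 𝔤 L γ) (n l : ℕ)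
    (x : EuclideanSpace ℝ (Fin d)) (c : ℕ → EuclideanSpace ℝ (Fin d)) :
    |centred P X a g n x l c| ≤ 2 * L :=
  LevyHF.abs_centred_le h.levy.measurable h.bound n l x c

lemma measurable_blockError (h : LimitSetting P ℱ X a g 𝔤 L γ) (n p i : ℕ) :
    Measurable[ℱ (((i + m + 1 : ℕ) : ℝ≥0) / n)] (blockError P X a g n p i) := by
  refine Measurable.sub ?_ ?_
  · exact h.levy.measurable_centred h.continuous n i 0 (grid_le (by omega))
      ((h.levy.adapted _).mono (ℱ.mono (grid_le (by omega))) le_rfl)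
  · split_ifs
    · refine h.levy.measurable_centred h.continuous n i 0 (grid_le (by omega))
        ((h.levy.adapted _).mono (ℱ.mono (grid_le ?_)) le_rfl)
      have := Nat.div_mul_le_self i p
      omega
    · exact measurable_const

lemma abs_blockError_le (h : LimitSetting P ℱ X a g 𝔤 L γ) (n p i : ℕ) (ω : Ω) :
    |blockError P X a g n p i ω| ≤ 4 * L := by
  have := h.const_nonneg
  refine (abs_sub _ _).trans ?_
  have h1 := h.abs_centred_le n 0 (X ((i : ℝ≥0) / n) ω) (futureIncrements X n i ω)
  split_ifs
  · have h2 := h.abs_centred_le n 0 (X (((i / p * p : ℕ) : ℝ≥0) / n) ω) (futureIncrements X n i ω)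
    linarith
  · rw [abs_zero]; linarith

/-- Error i is known at time (i + m + 1)/n ≤ j/n. Error j is a combination of centred windows
starting at j, with states known by time j/n, so it has mean zero given that past. -/
lemma integral_blockError_mul_eq_zero (h : LimitSetting P ℱ X a g 𝔤 L γ) (n p : ℕ) {i j : ℕ}
    (hij : i + m < j) : ∫ ω, blockError P X a g n p i ω * blockError P X a g n p j ω ∂P = 0 := by
  have hH : Measurable[ℱ ((j : ℝ≥0) / n)] (blockError P X a g n p i) :=
    (h.measurable_blockError n p i).mono (ℱ.mono (grid_le (by omega))) le_rfl
  have hHm : Measurable (blockError P X a g n p i) := hH.mono (ℱ.le _) le_rfl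
  have key : ∀ k ≤ j, Integrable (fun ω => blockError P X a g n p i ω *
        centred P X a g n (X ((k : ℝ≥0) / n) ω) 0 (futureIncrements X n j ω)) P ∧
      ∫ ω, blockError P X a g n p i ω *
        centred P X a g n (X ((k : ℝ≥0) / n) ω) 0 (futureIncrements X n j ω) ∂P = 0 := by
    intro k hk
    refine ⟨Integrable.of_bound (hHm.mul (measurable_centred_comp h.levy.measurable h.continuous n 0
      (h.measurable _) fun k _ => measurable_pi_iff.1 (h.levy.measurable_futureIncrements n j) k)
      ).aestronglyMeasurable (4 * L * (2 * L)) (ae_of_all _ fun ω => ?_),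
      h.levy.integral_mul_centred_eq_zero h.continuous h.bound n j 0
        ((h.levy.adapted _).mono (ℱ.mono (grid_le hk)) le_rfl) hH (h.abs_blockError_le n p i)⟩
    rw [norm_mul]
    exact mul_le_mul (h.abs_blockError_le n p i ω) (h.abs_centred_le _ _ _ _) (norm_nonneg _)
      (by linarith [h.const_nonneg])
  obtain ⟨i1, z1⟩ := key j le_rfl
  obtain ⟨i2, z2⟩ := key (j / p * p) (Nat.div_mul_le_self _ _)
  by_cases hc : j % p < p - m
  · simp only [blockError, hc, if_true, mul_sub] at i1 i2 z1 z2 ⊢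
    rw [integral_sub i1 i2, z1, z2, sub_zero]
  · simp only [blockError, hc, if_false, sub_zero] at z1 ⊢
    exact z1

/-- A kept window is off by at most 2L min(1, |ΔX|) over a time at most p/n. The square of the
truncated increment is bounded by the increment itself, so the modulus applies. A dropped window is
bounded crudely by (2L)². -/
lemma integral_blockError_sq_le (h : LimitSetting P ℱ X a g 𝔤 L γ) {n p : ℕ} (hn : n ≠ 0)
    (hp : p ≠ 0) (i : ℕ) : ∫ ω, blockError P X a g n p i ω ^ 2 ∂P
      ≤ (if i % p < p - m then 0 else 4 * L ^ 2) + 4 * L ^ 3 * ((p : ℝ) / n) ^ γ := by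
  have hL := h.const_nonneg
  have hpn : 0 ≤ 4 * L ^ 3 * ((p : ℝ) / n) ^ γ := by positivity
  by_cases hc : i % p < p - m
  · rw [if_pos hc, zero_add]
    have hlt : i ≤ i / p * p + p := by
      have := Nat.div_add_mod' i p
      have := Nat.mod_lt i (Nat.pos_of_ne_zero hp)
      omega
    have h1 : ∫ ω, 4 * L ^ 2 * min 1 ‖X ((i : ℝ≥0) / n) ω - X (((i / p * p : ℕ) : ℝ≥0) / n) ω‖ ∂P
        ≤ 4 * L ^ 3 * ((p : ℝ) / n) ^ γ := by
      rw [integral_const_mul]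
      have := h.integral_min_le (δ := (p : ℝ≥0) / n)
        (grid_le (n := n) (Nat.div_mul_le_self i p)) (by
          rw [← add_div]
          have := grid_le (n := n) hlt
          push_cast at this ⊢
          exact this)
      calc _ ≤ 4 * L ^ 2 * (L * (((p : ℝ≥0) / n : ℝ≥0) : ℝ) ^ γ) :=
            mul_le_mul_of_nonneg_left this (by positivity)
        _ = _ := by push_cast; ring
    refine le_trans (integral_mono_of_nonneg (ae_of_all _ fun ω => sq_nonneg _)
      ((h.integrable_min _ _).const_mul _) (ae_of_all _ fun ω => ?_)) h1
    simp only [blockError, hc, if_true]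
    set q := min 1 ‖X ((i : ℝ≥0) / n) ω - X (((i / p * p : ℕ) : ℝ≥0) / n) ω‖ with hq
    have h2 := abs_centred_sub_le (P := P) (a := a) h.levy.measurable h.continuous h.bound h.lipschitz n 0
      (X ((i : ℝ≥0) / n) ω) (X (((i / p * p : ℕ) : ℝ≥0) / n) ω) (futureIncrements X n i ω)
    have hq0 : 0 ≤ q := le_min zero_le_one (norm_nonneg _)
    have hq1 : q ≤ 1 := min_le_left _ _
    rw [← sq_abs]
    calc _ ≤ (2 * L * q) ^ 2 := pow_le_pow_left₀ (abs_nonneg _) h2 2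
      _ = 4 * L ^ 2 * (q * q) := by ring
      _ ≤ 4 * L ^ 2 * (q * 1) := by gcongr
      _ = _ := by rw [mul_one]
  · rw [if_neg hc]
    refine le_trans ?_ (le_add_of_nonneg_right hpn)
    refine (le_abs_self _).trans (abs_integral_le_of_bounded fun ω => ?_)
    simp only [blockError, hc, if_false, sub_zero]
    rw [abs_of_nonneg (sq_nonneg _), ← sq_abs]
    calc _ ≤ (2 * L) ^ 2 := pow_le_pow_left₀ (abs_nonneg _) (h.abs_centred_le _ _ _ _) 2
      _ = _ := by ring

/-- Orthogonality at distance more than m reduces the square to its diagonal. Each block has m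
dropped windows, and each of its p positions is charged for freezing. -/
lemma integral_sq_sum_blockError_le (h : LimitSetting P ℱ X a g 𝔤 L γ) {n p : ℕ} (hn : n ≠ 0)
    (hp : m < p) (K : ℕ) :
    ∫ ω, (∑ i ∈ Finset.range (K * p), blockError P X a g n p i ω) ^ 2 ∂P
      ≤ (2 * m + 1) * (K * (m * (4 * L ^ 2) + p * (4 * L ^ 3 * ((p : ℝ) / n) ^ γ))) := by
  have hp0 : p ≠ 0 := by omega
  refine (integral_sq_sum_le_of_orthogonal m _ (fun i => MemLp.of_bound
    ((h.measurable_blockError n p i).mono (ℱ.le _) le_rfl).aestronglyMeasurable (4 * L)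
    (ae_of_all _ fun ω => h.abs_blockError_le n p i ω))
    fun i j hij => h.integral_blockError_mul_eq_zero n p hij).trans ?_
  refine mul_le_mul_of_nonneg_left ?_ (by positivity)
  refine (Finset.sum_le_sum fun i _ => h.integral_blockError_sq_le hn hp0 i).trans (le_of_eq ?_)
  rw [sum_range_mul, Finset.sum_congr rfl fun b _ => ?_, Finset.sum_const, Finset.card_range,
    nsmul_eq_mul]
  rw [Finset.sum_add_distrib, Finset.sum_const, Finset.card_range, nsmul_eq_mul]
  congr 1
  rw [Finset.sum_congr rfl fun l hl => show _ = if l < p - m then 0 else 4 * L ^ 2 by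
    rw [Nat.mul_add_mod_of_lt (Finset.mem_range.1 hl)], Finset.sum_ite, Finset.sum_const_zero, zero_add, Finset.sum_const, nsmul_eq_mul]
  congr 2
  have : {l ∈ Finset.range p | ¬ l < p - m} = Finset.Ico (p - m) p := by
    ext l; simp only [Finset.mem_filter, Finset.mem_range, Finset.mem_Ico]; omega
  rw [this, Nat.card_Ico]
  omega

end LimitSetting

end Blocks

end LevyHF

namespace LevyHF

/-! ### L¹ comparison of the statistic with its block sums -/

section BlockComparison

variable {Ω : Type*} {mΩ : MeasurableSpace Ω} {P : Measure Ω} [IsProbabilityMeasure P]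
  {ℱ : Filtration ℝ≥0 mΩ} {d m : ℕ}
  {X : ℝ≥0 → Ω → EuclideanSpace ℝ (Fin d)} {a : ℕ → ℝ}
  {g : EuclideanSpace ℝ (Fin d) → (Fin (m + 1) → EuclideanSpace ℝ (Fin d)) → ℝ}
  {𝔤 : EuclideanSpace ℝ (Fin d) → ℝ} {L γ : ℝ}

/-- The statistic with the conditional expectations replaced by their explicit values. -/
noncomputable def centredSum (P : Measure Ω) (X : ℝ≥0 → Ω → EuclideanSpace ℝ (Fin d)) (a : ℕ → ℝ)
    (g : EuclideanSpace ℝ (Fin d) → (Fin (m + 1) → EuclideanSpace ℝ (Fin d)) → ℝ) (n : ℕ)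
    (t : ℝ≥0) (ω : Ω) : ℝ :=
  (√n)⁻¹ * ∑ i ∈ Finset.range ⌊(n : ℝ≥0) * t⌋₊,
    centred P X a g n (X ((i : ℝ≥0) / n) ω) 0 (futureIncrements X n i ω)

/-- The block sum attached to the `b`-th block of length `p`. -/
noncomputable def blockTerm (P : Measure Ω) (X : ℝ≥0 → Ω → EuclideanSpace ℝ (Fin d)) (a : ℕ → ℝ)
    (g : EuclideanSpace ℝ (Fin d) → (Fin (m + 1) → EuclideanSpace ℝ (Fin d)) → ℝ) (n p b : ℕ)
    (ω : Ω) : ℝ :=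
  blockSum P X a g n p (X (((b * p : ℕ) : ℝ≥0) / n) ω) (futureIncrements X n (b * p) ω)

lemma integral_abs_le_sqrt {f : Ω → ℝ} (hf : MemLp f 2 P) {c : ℝ} (hc : ∫ ω, f ω ^ 2 ∂P ≤ c) :
    ∫ ω, |f ω| ∂P ≤ √c := by
  refine Real.le_sqrt_of_sq_le (le_trans ?_ hc)
  have := variance_nonneg (fun ω => |f ω|) P
  rw [variance_eq_sub (X := fun ω => |f ω|) hf.abs] at this
  simp only [Pi.pow_apply, sq_abs] at this
  linarith

namespace LimitSetting

/-- A window starting at l < p - m ends inside its block, so the block sum is known at the end of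
the block. This is the reason for dropping m windows. -/
lemma measurable_blockTerm (h : LimitSetting P ℱ X a g 𝔤 L γ) (n p b : ℕ) (hp : m < p) :
    Measurable[ℱ ((((b + 1) * p : ℕ) : ℝ≥0) / n)] (blockTerm P X a g n p b) := by
  unfold blockTerm blockSum
  refine Finset.measurable_fun_sum _ fun l hl => ?_
  have hl := Finset.mem_range.1 hl
  refine h.levy.measurable_centred h.continuous n (b * p) l (grid_le ?_)
    ((h.levy.adapted _).mono (ℱ.mono (grid_le ?_)) le_rfl)
  · rw [add_mul, one_mul]; omega
  · gcongr; omega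

lemma measurable_centredSum (h : LimitSetting P ℱ X a g 𝔤 L γ) (n : ℕ) (t : ℝ≥0) :
    Measurable (centredSum P X a g n t) := by
  refine (Finset.measurable_fun_sum _ fun i _ => ?_).const_mul _
  exact measurable_centred_comp h.levy.measurable h.continuous n 0 (h.measurable _) fun k _ =>
    measurable_pi_iff.1 (h.levy.measurable_futureIncrements n i) k

/-- Rounding up to full blocks overshoots ⌊nt⌋ by at most p + 1 grid points, each contributing at
most 2L. -/
lemma abs_centredSum_sub_le (h : LimitSetting P ℱ X a g 𝔤 L γ) {n p : ℕ}
    (hp : p ≠ 0) (t : ℝ≥0) (ω : Ω) :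
    |centredSum P X a g n t ω
        - (√n)⁻¹ * ∑ b ∈ Finset.range (numBlocks n p t), blockTerm P X a g n p b ω|
      ≤ (√n)⁻¹ * (|∑ i ∈ Finset.range (numBlocks n p t * p), blockError P X a g n p i ω|
        + (p + 1) * (2 * L)) := by
  set N := ⌊(n : ℝ≥0) * t⌋₊ with hN
  set K := numBlocks n p t with hK
  have h1 : N ≤ K * p := by
    have : ((N : ℕ) : ℝ≥0) ≤ ((K * p : ℕ) : ℝ≥0) :=
      (Nat.floor_le (zero_le (a := (n : ℝ≥0) * t))).trans (le_numBlocks_mul hp t)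
    exact_mod_cast this
  have h2 : K * p ≤ N + (p + 1) := by
    have : ((K * p : ℕ) : ℝ≥0) ≤ ((N + 1 + p : ℕ) : ℝ≥0) := by
      refine (numBlocks_mul_le hp t).trans ?_
      have := (Nat.lt_floor_add_one ((n : ℝ≥0) * t)).le
      push_cast
      gcongr
    have : K * p ≤ N + 1 + p := by exact_mod_cast this
    omega
  rw [centredSum, ← mul_sub, abs_mul, abs_of_nonneg (by positivity : 0 ≤ (√(n : ℝ))⁻¹)]
  refine mul_le_mul_of_nonneg_left ?_ (by positivity)
  have h3 := Finset.sum_range_add_sum_Ico (fun i =>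
    centred P X a g n (X ((i : ℝ≥0) / n) ω) 0 (futureIncrements X n i ω)) h1
  have h4 := sum_blockError (P := P) (X := X) (a := a) (g := g) (n := n) (p := p) K ω
  rw [← h3] at h4
  have h5 : ∑ i ∈ Finset.range N,
        centred P X a g n (X ((i : ℝ≥0) / n) ω) 0 (futureIncrements X n i ω)
      - ∑ b ∈ Finset.range K, blockTerm P X a g n p b ω
      = ∑ i ∈ Finset.range (K * p), blockError P X a g n p i ω
        - ∑ i ∈ Finset.Ico N (K * p),
          centred P X a g n (X ((i : ℝ≥0) / n) ω) 0 (futureIncrements X n i ω) := by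
    rw [h4]; simp only [blockTerm]; ring
  rw [h5]
  refine (abs_sub _ _).trans (add_le_add_right ?_ _)
  refine (Finset.abs_sum_le_sum_abs _ _).trans ((Finset.sum_le_card_nsmul _ _ (2 * L)
    fun i _ => h.abs_centred_le _ _ _ _).trans ?_)
  rw [Nat.card_Ico, nsmul_eq_mul]
  refine mul_le_mul_of_nonneg_right ?_ (by linarith [h.const_nonneg])
  have : K * p - N ≤ p + 1 := by omega
  exact_mod_cast this

/-- The statistic is close in `L¹` to the sum over blocks of length `p`. -/
theorem exists_integral_centredSum_sub_le (h : LimitSetting P ℱ X a g 𝔤 L γ) (t : ℝ≥0) :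
    ∃ c : ℝ, ∀ p, m < p → ∀ᶠ n : ℕ in atTop,
      ∫ ω, |centredSum P X a g n t ω
        - (√n)⁻¹ * ∑ b ∈ Finset.range (numBlocks n p t), blockTerm P X a g n p b ω| ∂P
        ≤ c / √p := by
  have hL := h.const_nonneg
  -- Once p ≤ n there are at most n(t + 1)/p blocks, and once p (p/n)^γ ≤ 1 each carries squared
  -- error at most m·4L² + 4L³. The extra 1 in √c₀ + 1 absorbs the overshoot at the end, which
  -- vanishes as n grows.
  set c₀ : ℝ := (2 * m + 1) * ((t + 1) * (m * (4 * L ^ 2) + 4 * L ^ 3)) with hc₀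
  refine ⟨√c₀ + 1, fun p hp => ?_⟩
  have hp0 : p ≠ 0 := by omega
  have hpp : (0 : ℝ) < p := by positivity
  have lim0 : Tendsto (fun n : ℕ => (p : ℝ) / n) atTop (𝓝 0) := tendsto_const_div_atTop_nhds_zero_nat _
  have lim1 : Tendsto (fun n : ℕ => p * ((p : ℝ) / n) ^ γ) atTop (𝓝 0) := by
    have := (lim0.rpow_const (p := γ) (Or.inr (by linarith [h.half_lt]))).const_mul (p : ℝ)
    rwa [Real.zero_rpow (by linarith [h.half_lt]), mul_zero] at this
  have lim2 : Tendsto (fun n : ℕ => (√(n : ℝ))⁻¹ * ((p + 1) * (2 * L))) atTop (𝓝 0) := by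
    have : Tendsto (fun n : ℕ => (√(n : ℝ))⁻¹) atTop (𝓝 0) :=
      (Real.tendsto_sqrt_atTop.comp tendsto_natCast_atTop_atTop).inv_tendsto_atTop
    simpa using this.mul_const ((p + 1) * (2 * L))
  have hsp : 0 < 1 / √(p : ℝ) := by positivity
  filter_upwards [eventually_ge_atTop p, lim1.eventually (gt_mem_nhds zero_lt_one),
    lim2.eventually (gt_mem_nhds hsp)] with n hn hn1 hn2
  have hn0 : n ≠ 0 := by omega
  have hnn : (0 : ℝ) < n := by positivity
  set K := numBlocks n p t with hK
  set S : Ω → ℝ := fun ω => ∑ i ∈ Finset.range (K * p), blockError P X a g n p i ω with hS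
  have hSm : Measurable S := Finset.measurable_fun_sum _ fun i _ =>
    (h.measurable_blockError n p i).mono (ℱ.le _) le_rfl
  have hSL : MemLp S 2 P := MemLp.of_bound hSm.aestronglyMeasurable ((K * p : ℕ) * (4 * L))
    (ae_of_all _ fun ω => (norm_sum_le _ _).trans ((Finset.sum_le_card_nsmul _ _ (4 * L)
      fun i _ => h.abs_blockError_le n p i ω).trans (by simp)))
  have hKn : (K : ℝ) ≤ n * ((t + 1) / p) := by
    have h1 : ((K * p : ℕ) : ℝ) ≤ n * t + p := by exact_mod_cast numBlocks_mul_le (n := n) hp0 t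
    have h2 : (p : ℝ) ≤ n := by exact_mod_cast hn
    push_cast at h1
    rw [mul_div_assoc', le_div_iff₀ hpp]
    linarith
  have hS2 : ∫ ω, S ω ^ 2 ∂P ≤ n * (c₀ / p) := by
    refine (h.integral_sq_sum_blockError_le hn0 hp K).trans ?_
    have e : m * (4 * L ^ 2) + p * (4 * L ^ 3 * ((p : ℝ) / n) ^ γ)
        ≤ m * (4 * L ^ 2) + 4 * L ^ 3 := by
      have : p * (4 * L ^ 3 * ((p : ℝ) / n) ^ γ) = 4 * L ^ 3 * (p * ((p : ℝ) / n) ^ γ) := by ring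
      rw [this]
      have : 4 * L ^ 3 * (p * ((p : ℝ) / n) ^ γ) ≤ 4 * L ^ 3 * 1 := by gcongr
      linarith
    calc (2 * m + 1) * (K * (m * (4 * L ^ 2) + p * (4 * L ^ 3 * ((p : ℝ) / n) ^ γ)))
        ≤ (2 * m + 1) * ((n * ((t + 1) / p)) * (m * (4 * L ^ 2) + 4 * L ^ 3)) := by gcongr
      _ = _ := by rw [hc₀]; ring
  have hSi := integral_abs_le_sqrt hSL hS2
  have hSI : Integrable (fun ω => |S ω|) P := (hSL.integrable one_le_two).abs
  calc _ ≤ ∫ ω, (√(n : ℝ))⁻¹ * (|S ω| + (p + 1) * (2 * L)) ∂P :=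
        integral_mono_of_nonneg (ae_of_all _ fun _ => abs_nonneg _)
          ((hSI.add (integrable_const _)).const_mul _)
          (ae_of_all _ fun ω => h.abs_centredSum_sub_le hp0 t ω)
    _ = (√(n : ℝ))⁻¹ * ∫ ω, |S ω| ∂P + (√(n : ℝ))⁻¹ * ((p + 1) * (2 * L)) := by
        rw [integral_const_mul, integral_add hSI (integrable_const _)]
        simp [mul_add]
    _ ≤ (√(n : ℝ))⁻¹ * √(n * (c₀ / p)) + 1 / √p := by gcongr
    _ = _ := by
        rw [Real.sqrt_mul hnn.le, ← mul_assoc, inv_mul_cancel₀ (by positivity), one_mul,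
          Real.sqrt_div' _ hpp.le, ← add_div]

end LimitSetting

end BlockComparison

end LevyHF

namespace LevyHF

/-! ### The contribution of one block -/

lemma norm_cexp_mul_I_sub_one_le (x : ℝ) : ‖Complex.exp ((x : ℂ) * Complex.I) - 1‖ ≤ |x| := by
  rw [mul_comm]
  exact Real.norm_exp_I_mul_ofReal_sub_one_le

lemma norm_cexp_mul_I_sub_one_le_two (x : ℝ) :
    ‖Complex.exp ((x : ℂ) * Complex.I) - 1‖ ≤ 2 := by
  refine (norm_sub_le _ _).trans ?_
  rw [Complex.norm_exp_ofReal_mul_I, norm_one]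
  norm_num

lemma norm_cexp_inner_sub_one_le {E : Type*} [NormedAddCommGroup E] [InnerProductSpace ℝ E]
    (v y : E) : ‖Complex.exp ((inner ℝ v y : ℝ) * Complex.I) - 1‖ ≤ (2 + ‖v‖) * min 1 ‖y‖ := by
  rcases le_total 1 ‖y‖ with hy | hy
  · rw [min_eq_left hy]
    refine (norm_cexp_mul_I_sub_one_le_two _).trans ?_
    linarith [norm_nonneg v]
  · rw [min_eq_right hy]
    refine (norm_cexp_mul_I_sub_one_le _).trans ((abs_real_inner_le_norm v y).trans ?_)
    exact mul_le_mul_of_nonneg_right (by linarith) (norm_nonneg _)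

section OneBlock

variable {Ω : Type*} {mΩ : MeasurableSpace Ω} {P : Measure Ω}
  {ℱ : Filtration ℝ≥0 mΩ} {d m : ℕ}
  {X : ℝ≥0 → Ω → EuclideanSpace ℝ (Fin d)} {a : ℕ → ℝ}
  {g : EuclideanSpace ℝ (Fin d) → (Fin (m + 1) → EuclideanSpace ℝ (Fin d)) → ℝ}
  {𝔤 : EuclideanSpace ℝ (Fin d) → ℝ} {L γ : ℝ}

/-- The exponential of the normalised block sum with its compensator. -/
noncomputable def blockExp (P : Measure Ω) (X : ℝ≥0 → Ω → EuclideanSpace ℝ (Fin d)) (a : ℕ → ℝ)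
    (g : EuclideanSpace ℝ (Fin d) → (Fin (m + 1) → EuclideanSpace ℝ (Fin d)) → ℝ)
    (𝔤 : EuclideanSpace ℝ (Fin d) → ℝ) (n p : ℕ) (w : ℝ)
    (x : EuclideanSpace ℝ (Fin d)) (c : ℕ → EuclideanSpace ℝ (Fin d)) : ℂ :=
  Complex.exp (((w ^ 2 / 2 * (p / n) * 𝔤 x : ℝ) : ℂ)
    + ((w / √n * blockSum P X a g n p x c : ℝ) : ℂ) * Complex.I)

variable [IsProbabilityMeasure P]

namespace LimitSetting

lemma measurable_blockSum (h : LimitSetting P ℱ X a g 𝔤 L γ) (n p : ℕ) :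
    Measurable fun q : EuclideanSpace ℝ (Fin d) × (ℕ → EuclideanSpace ℝ (Fin d)) =>
      blockSum P X a g n p q.1 q.2 := by
  unfold blockSum
  exact Finset.measurable_fun_sum _ fun l _ => measurable_centred h.levy.measurable h.continuous n l

lemma measurable_blockExp (h : LimitSetting P ℱ X a g 𝔤 L γ) (n p : ℕ) (w : ℝ) :
    Measurable fun q : EuclideanSpace ℝ (Fin d) × (ℕ → EuclideanSpace ℝ (Fin d)) =>
      blockExp P X a g 𝔤 n p w q.1 q.2 := by
  have h1 := h.measurable_blockSum n p
  have h2 := h.continuous_limit.measurable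
  unfold blockExp
  fun_prop

lemma abs_blockSum_le (h : LimitSetting P ℱ X a g 𝔤 L γ) (n p : ℕ)
    (x : EuclideanSpace ℝ (Fin d)) (c : ℕ → EuclideanSpace ℝ (Fin d)) :
    |blockSum P X a g n p x c| ≤ p * (2 * L) := by
  refine (Finset.abs_sum_le_sum_abs _ _).trans ((Finset.sum_le_card_nsmul _ _ (2 * L)
    fun i _ => h.abs_centred_le _ _ _ _).trans ?_)
  rw [Finset.card_range, nsmul_eq_mul]
  have : ((p - m : ℕ) : ℝ) ≤ p := by exact_mod_cast Nat.sub_le p m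
  exact mul_le_mul_of_nonneg_right this (by linarith [h.const_nonneg])

lemma integral_blockSum (h : LimitSetting P ℱ X a g 𝔤 L γ) (n p : ℕ)
    (x : EuclideanSpace ℝ (Fin d)) : ∫ c, blockSum P X a g n p x c ∂(gridLaw P X n) = 0 := by
  have := isProbabilityMeasure_gridLaw (P := P) h.levy.measurable n
  unfold blockSum
  rw [integral_finsetSum]
  · exact Finset.sum_eq_zero fun l _ =>
      integral_centred h.levy.measurable h.continuous h.bound n l x
  · intro l _
    exact (integrable_window_scaled h.levy.measurable h.continuous h.bound n l x).sub
      (integrable_const _)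

lemma abs_integral_blockSum_sq_sub_le (h : LimitSetting P ℱ X a g 𝔤 L γ) (n p : ℕ)
    (x : EuclideanSpace ℝ (Fin d)) :
    |∫ c, blockSum P X a g n p x c ^ 2 ∂(gridLaw P X n) - (p - m : ℕ) * gn P X a g n x|
      ≤ 2 * m * ((2 * m + 1) * (2 * L ^ 2)) := by
  have := Measure.isProbabilityMeasure_map (μ := P) (h.measurable (1 / (n : ℝ≥0))).aemeasurable
  have h1 := integral_sq_sum_window (P.map (X (1 / (n : ℝ≥0))))
    (measurable_scaled (a := a) h.continuous n x) (C := L) (fun _ => h.bound _ _) (p - m)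
  have h2 := abs_sum_windowCov_sub_le (P.map (X (1 / (n : ℝ≥0))))
    (measurable_scaled (a := a) h.continuous n x) (C := L) (fun _ => h.bound _ _) (p - m)
  rw [gn_eq_sum_windowCov]
  rw [← h1] at h2
  exact h2

/-- The compensated block exponential has mean close to `1`. -/
lemma norm_integral_blockExp_sub_one_le (h : LimitSetting P ℱ X a g 𝔤 L γ) {n p : ℕ} (hn : n ≠ 0)
    (hp : m < p) {w W D : ℝ} (hw : |w| ≤ W) (hD : W ^ 2 / 2 * p * L + W * (p * (2 * L)) = D)
    (hDn : D / √n ≤ 1) (x : EuclideanSpace ℝ (Fin d)) :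
    ‖∫ c, (blockExp P X a g 𝔤 n p w x c - 1) ∂(gridLaw P X n)‖
      ≤ W ^ 2 / 2 / n * (m * L + p * |gn P X a g n x - 𝔤 x| + 2 * m * ((2 * m + 1) * (2 * L ^ 2)))
        + (D ^ 2 / n ^ 2 + (D / √n) ^ 3) := by
  have hL := h.const_nonneg
  have := isProbabilityMeasure_gridLaw (P := P) h.levy.measurable n
  have hn0 : (0 : ℝ) < n := by positivity
  have hsn : 0 < √(n : ℝ) := by positivity
  have hW : 0 ≤ W := (abs_nonneg _).trans hw
  have hw2 : w ^ 2 ≤ W ^ 2 := sq_le_sq' (by linarith [neg_abs_le w]) ((le_abs_self w).trans hw)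
  have hU : Measurable (blockSum P X a g n p x) :=
    (h.measurable_blockSum n p).comp measurable_prodMk_left
  have h𝔤0 := h.nonneg x
  have h𝔤L := h.limit_le x
  -- A is the compensator, of order p/n, and θ bounds the oscillating part, of order p/√n. Together
  -- they stay below D/√n.
  set A := w ^ 2 / 2 * (p / n) * 𝔤 x with hA
  have hA0 : 0 ≤ A := by positivity
  have hAle : A ≤ W ^ 2 / 2 * p * L / n := by
    calc A ≤ W ^ 2 / 2 * (p / n) * L := by rw [hA]; gcongr
      _ = _ := by ring
  set θ := W * (p * (2 * L)) / √n with hθ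
  have hθ0 : 0 ≤ θ := by positivity
  have hAD : A ≤ D / n := by
    refine hAle.trans ?_
    rw [← hD]
    have : 0 ≤ W * (p * (2 * L)) := by positivity
    gcongr
    linarith
  have hn1 : (1 : ℝ) ≤ n := by exact_mod_cast Nat.one_le_iff_ne_zero.2 hn
  have hsnn : √(n : ℝ) ≤ n := by
    rw [Real.sqrt_le_left hn0.le]
    nlinarith
  have hsum : A + θ ≤ D / √n := by
    rw [← hD, add_div]
    refine add_le_add (hAle.trans ?_) le_rfl
    exact div_le_div_of_nonneg_left (by positivity) hsn hsnn
  have hbd : ∀ c, |w / √n * blockSum P X a g n p x c| ≤ θ := fun c => by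
    rw [abs_mul, abs_div, abs_of_pos hsn, hθ, mul_div_right_comm]
    gcongr
    exact h.abs_blockSum_le n p x c
  have h0 : ∫ c, w / √n * blockSum P X a g n p x c ∂(gridLaw P X n) = 0 := by
    rw [integral_const_mul, h.integral_blockSum, mul_zero]
  have main := norm_integral_cexp_sub_one_sub_le hU hbd hA0 (hsum.trans hDn) h0
  have hV := h.abs_integral_blockSum_sq_sub_le n p x
  set V := ∫ c, blockSum P X a g n p x c ^ 2 ∂(gridLaw P X n) with hVdef
  have hsq : ∫ c, (w / √n * blockSum P X a g n p x c) ^ 2 ∂(gridLaw P X n) = w ^ 2 / n * V := by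
    simp_rw [mul_pow]
    rw [integral_const_mul, div_pow, Real.sq_sqrt hn0.le]
  rw [hsq] at main
  have hgap : |p * 𝔤 x - V| ≤ m * L + p * |gn P X a g n x - 𝔤 x|
      + 2 * m * ((2 * m + 1) * (2 * L ^ 2)) := by
    have hq : ((p - m : ℕ) : ℝ) = p - m := by rw [Nat.cast_sub hp.le]
    rw [hq] at hV
    -- Three sources of mismatch: the m dropped windows, the deviation of 𝔤_n from 𝔤, and the edge
    -- effect in the variance of a finite sum of windows.
    have e : p * 𝔤 x - V = m * 𝔤 x + ((p - m) * -(gn P X a g n x - 𝔤 x)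
        + -(V - (p - m) * gn P X a g n x)) := by ring
    rw [e]
    have hpm : (0 : ℝ) ≤ p - m := by rw [← hq]; positivity
    refine (abs_add_le _ _).trans ?_
    rw [add_assoc]
    refine add_le_add ?_ ((abs_add_le _ _).trans (add_le_add ?_ (by rwa [abs_neg])))
    · rw [abs_of_nonneg (by positivity)]; gcongr
    · rw [abs_mul, abs_neg, abs_of_nonneg hpm]
      gcongr
      linarith [(Nat.cast_nonneg m : (0 : ℝ) ≤ m)]
  have hlead : |A - w ^ 2 / n * V / 2| ≤ W ^ 2 / 2 / n * (m * L + p * |gn P X a g n x - 𝔤 x|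
      + 2 * m * ((2 * m + 1) * (2 * L ^ 2))) := by
    have e : A - w ^ 2 / n * V / 2 = w ^ 2 / 2 / n * (p * 𝔤 x - V) := by rw [hA]; ring
    rw [e, abs_mul, abs_of_nonneg (by positivity)]
    gcongr
  have htri := norm_le_insert' (∫ c, (blockExp P X a g 𝔤 n p w x c - 1) ∂(gridLaw P X n))
    ((A - w ^ 2 / n * V / 2 : ℝ) : ℂ)
  rw [Complex.norm_real, Real.norm_eq_abs] at htri
  refine htri.trans (add_le_add hlead (main.trans (add_le_add ?_ ?_)))
  · rw [← div_pow]
    gcongr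
  · gcongr

lemma norm_blockExp_sub_one_le (h : LimitSetting P ℱ X a g 𝔤 L γ) {n p : ℕ} (hn : n ≠ 0)
    {w W D : ℝ} (hw : |w| ≤ W) (hD : W ^ 2 / 2 * p * L + W * (p * (2 * L)) = D)
    (hDn : D / √n ≤ 1) (x : EuclideanSpace ℝ (Fin d)) (c : ℕ → EuclideanSpace ℝ (Fin d)) :
    ‖blockExp P X a g 𝔤 n p w x c - 1‖ ≤ 2 * (D / √n) := by
  have hL := h.const_nonneg
  have hn0 : (0 : ℝ) < n := by positivity
  have hsn : 0 < √(n : ℝ) := by positivity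
  have hW : 0 ≤ W := (abs_nonneg _).trans hw
  have hw2 : w ^ 2 ≤ W ^ 2 := sq_le_sq' (by linarith [neg_abs_le w]) ((le_abs_self w).trans hw)
  have h𝔤0 := h.nonneg x
  have h𝔤L := h.limit_le x
  have hn1 : (1 : ℝ) ≤ n := by exact_mod_cast Nat.one_le_iff_ne_zero.2 hn
  have hsnn : √(n : ℝ) ≤ n := by
    rw [Real.sqrt_le_left hn0.le]
    nlinarith
  have key : ‖((w ^ 2 / 2 * (p / n) * 𝔤 x : ℝ) : ℂ)
      + ((w / √n * blockSum P X a g n p x c : ℝ) : ℂ) * Complex.I‖ ≤ D / √n := by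
    refine (norm_add_le _ _).trans ?_
    rw [norm_mul, Complex.norm_I, mul_one, Complex.norm_real, Complex.norm_real,
      Real.norm_of_nonneg (by positivity), Real.norm_eq_abs, ← hD, add_div, abs_mul, abs_div,
      abs_of_pos hsn]
    refine add_le_add ?_ ?_
    · calc w ^ 2 / 2 * (p / n) * 𝔤 x ≤ W ^ 2 / 2 * (p / n) * L := by gcongr
        _ = W ^ 2 / 2 * p * L / n := by ring
        _ ≤ _ := div_le_div_of_nonneg_left (by positivity) hsn hsnn
    · rw [mul_div_right_comm]
      gcongr
      exact h.abs_blockSum_le n p x c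
  exact (Complex.norm_exp_sub_one_le (key.trans hDn)).trans
    (mul_le_mul_of_nonneg_left key zero_le_two)

/-- The contribution of one block is `O(1 / n)`, with a constant that does not depend on the
length of the block. -/
theorem exists_norm_integral_block_le (h : LimitSetting P ℱ X a g 𝔤 L γ) (W V : ℝ) :
    ∃ c : ℝ, 0 ≤ c ∧ ∀ p, m < p → ∀ᶠ n : ℕ in atTop, ∀ (b : ℕ) (w : ℝ)
      (v : EuclideanSpace ℝ (Fin d)), |w| ≤ W → ‖v‖ ≤ V → ∀ H : Ω → ℂ,
      Measurable[ℱ (((b * p : ℕ) : ℝ≥0) / n)] H → (∀ ω, ‖H ω‖ ≤ 1) →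
      ‖∫ ω, H ω * (Complex.exp ((inner ℝ v (X ((((b + 1) * p : ℕ) : ℝ≥0) / n) ω
          - X (((b * p : ℕ) : ℝ≥0) / n) ω) : ℝ) * Complex.I)
        * (blockExp P X a g 𝔤 n p w (X (((b * p : ℕ) : ℝ≥0) / n) ω)
          (futureIncrements X n (b * p) ω) - 1)) ∂P‖ ≤ c / n := by
  have hL := h.const_nonneg
  have hγ := h.half_lt
  -- This bounds n times the leading error once p |𝔤_n - 𝔤| ≤ 1. The 3 added below covers the cross
  -- term and two Taylor remainders, each less than 1/n eventually; p enters only through how large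
  -- n must be.
  set c₁ : ℝ := W ^ 2 / 2 * (m * L + 1 + 2 * m * ((2 * m + 1) * (2 * L ^ 2))) with hc₁
  refine ⟨c₁ + 3, by positivity, fun p hp => ?_⟩
  have hp0 : p ≠ 0 := by omega
  have hpp : (0 : ℝ) < p := by positivity
  set D := W ^ 2 / 2 * p * L + W * (p * (2 * L)) with hD
  have limS : Tendsto (fun n : ℕ => (√(n : ℝ))⁻¹) atTop (𝓝 0) :=
    (Real.tendsto_sqrt_atTop.comp tendsto_natCast_atTop_atTop).inv_tendsto_atTop
  have lim1 : Tendsto (fun n : ℕ => D / √(n : ℝ)) atTop (𝓝 0) := by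
    simpa [div_eq_mul_inv] using limS.const_mul D
  have lim2 : Tendsto (fun n : ℕ => D ^ 2 / (n : ℝ)) atTop (𝓝 0) :=
    tendsto_const_div_atTop_nhds_zero_nat _
  have lim3 : Tendsto (fun n : ℕ => D ^ 3 * (√(n : ℝ))⁻¹) atTop (𝓝 0) := by
    simpa using limS.const_mul (D ^ 3)
  -- n times the cross term is of order n^{1/2 - γ}, which vanishes because γ > 1/2.
  have lim4 : Tendsto (fun n : ℕ => (2 + V) * L * (2 * D) * (p : ℝ) ^ γ * (n : ℝ) ^ (-(γ - 1 / 2)))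
      atTop (𝓝 0) := by
    have := ((tendsto_rpow_neg_atTop (y := γ - 1 / 2) (by linarith)).comp
      tendsto_natCast_atTop_atTop).const_mul ((2 + V) * L * (2 * D) * (p : ℝ) ^ γ)
    simpa using this
  filter_upwards [eventually_ne_atTop 0, lim1.eventually (gt_mem_nhds zero_lt_one),
    lim2.eventually (gt_mem_nhds zero_lt_one), lim3.eventually (gt_mem_nhds zero_lt_one),
    lim4.eventually (gt_mem_nhds zero_lt_one), h.uniform (1 / p) (by positivity)]
    with n hn hn1 hn2 hn3 hn4 hn5 b w v hw hv H hH hH1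
  have hn0 : (0 : ℝ) < n := by positivity
  have hsn : 0 < √(n : ℝ) := by positivity
  have hW : 0 ≤ W := (abs_nonneg _).trans hw
  have hV : 0 ≤ V := (norm_nonneg _).trans hv
  have hD0 : 0 ≤ D := by positivity
  set T₀ : ℝ≥0 := ((b * p : ℕ) : ℝ≥0) / n with hT₀
  set T₁ : ℝ≥0 := (((b + 1) * p : ℕ) : ℝ≥0) / n with hT₁
  have hT : T₀ ≤ T₁ := grid_le (by rw [add_mul]; omega)
  have hTδ : T₁ ≤ T₀ + (p : ℝ≥0) / n := by
    rw [hT₀, hT₁, ← add_div]; push_cast; rw [add_mul, one_mul]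
  set e : Ω → ℂ := fun ω => Complex.exp ((inner ℝ v (X T₁ ω - X T₀ ω) : ℝ) * Complex.I) with he
  set Y : Ω → ℂ := fun ω => blockExp P X a g 𝔤 n p w (X T₀ ω) (futureIncrements X n (b * p) ω) - 1
    with hY
  have hm0 := h.measurable T₀
  have hm1 := h.measurable T₁
  have hHm : Measurable H := hH.mono (ℱ.le _) le_rfl
  have hem : Measurable e := by
    have : Measurable fun ω => inner ℝ v (X T₁ ω - X T₀ ω) := by fun_prop
    fun_prop
  have hYm : Measurable Y := ((h.measurable_blockExp n p w).comp
    (hm0.prodMk (h.levy.measurable_futureIncrements n (b * p)))).sub_const 1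
  have hYb : ∀ ω, ‖Y ω‖ ≤ 2 * (D / √n) := fun ω =>
    h.norm_blockExp_sub_one_le hn hw hD.symm hn1.le _ _
  have heb : ∀ ω, ‖e ω - 1‖ ≤ (2 + V) * min 1 ‖X T₁ ω - X T₀ ω‖ := fun ω =>
    (norm_cexp_inner_sub_one_le v _).trans
      (mul_le_mul_of_nonneg_right (by linarith) (le_min zero_le_one (norm_nonneg _)))
  have heb2 : ∀ ω, ‖e ω - 1‖ ≤ 2 := fun ω => norm_cexp_mul_I_sub_one_le_two _
  have hi1 : Integrable (fun ω => H ω * ((e ω - 1) * Y ω)) P :=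
    Integrable.of_bound (by fun_prop) (1 * (2 * (2 * (D / √n)))) (ae_of_all _ fun ω => by
      rw [norm_mul, norm_mul]
      gcongr
      · exact hH1 ω
      · exact heb2 ω
      · exact hYb ω)
  have hi2 : Integrable (fun ω => H ω * Y ω) P :=
    Integrable.of_bound (by fun_prop) (1 * (2 * (D / √n))) (ae_of_all _ fun ω => by
      rw [norm_mul]
      gcongr
      · exact hH1 ω
      · exact hYb ω)
  -- In the second integral the phase is gone and the compensation acts; the first is a product of
  -- two small factors.
  have hsplit : ∫ ω, H ω * (e ω * Y ω) ∂P
      = ∫ ω, H ω * ((e ω - 1) * Y ω) ∂P + ∫ ω, H ω * Y ω ∂P := by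
    rw [← integral_add hi1 hi2]
    refine integral_congr_ae (ae_of_all _ fun ω => ?_)
    simp only
    ring
  -- Here Y is small uniformly, of order n^{-1/2}, while e - 1 is small only in mean, of order
  -- (p/n)^γ.
  have hb1 : ‖∫ ω, H ω * ((e ω - 1) * Y ω) ∂P‖ ≤ 1 / n := by
    have : ‖∫ ω, H ω * ((e ω - 1) * Y ω) ∂P‖
        ≤ ∫ ω, (2 + V) * (2 * (D / √n)) * min 1 ‖X T₁ ω - X T₀ ω‖ ∂P := by
      refine norm_integral_le_of_norm_le ((h.integrable_min T₀ T₁).const_mul _)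
        (ae_of_all _ fun ω => ?_)
      rw [norm_mul, norm_mul]
      calc ‖H ω‖ * (‖e ω - 1‖ * ‖Y ω‖)
          ≤ 1 * (((2 + V) * min 1 ‖X T₁ ω - X T₀ ω‖) * (2 * (D / √n))) := by
            have : 0 ≤ min 1 ‖X T₁ ω - X T₀ ω‖ := le_min zero_le_one (norm_nonneg _)
            gcongr
            · exact hH1 ω
            · exact heb ω
            · exact hYb ω
        _ = _ := by ring
    refine this.trans ?_
    rw [integral_const_mul]
    have h1 := h.integral_min_le hT hTδ
    have h2 : (((p : ℝ≥0) / n : ℝ≥0) : ℝ) ^ γ = (p : ℝ) ^ γ / (n : ℝ) ^ γ := by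
      push_cast
      exact Real.div_rpow hpp.le hn0.le γ
    rw [h2] at h1
    calc (2 + V) * (2 * (D / √n)) * ∫ ω, min 1 ‖X T₁ ω - X T₀ ω‖ ∂P
        ≤ (2 + V) * (2 * (D / √n)) * (L * ((p : ℝ) ^ γ / (n : ℝ) ^ γ)) := by gcongr
      _ = ((2 + V) * L * (2 * D) * (p : ℝ) ^ γ * (n : ℝ) ^ (-(γ - 1 / 2))) / n := by
          have e1 : (n : ℝ) ^ (-(γ - 1 / 2)) = √n / (n : ℝ) ^ γ := by
            rw [neg_sub, Real.rpow_sub hn0, Real.sqrt_eq_rpow]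
          rw [e1]
          have e2 : √(n : ℝ) / n = 1 / √n := by
            rw [div_eq_div_iff hn0.ne' hsn.ne', one_mul, Real.mul_self_sqrt hn0.le]
          calc _ = (2 + V) * (2 * D) * L * (p : ℝ) ^ γ / (n : ℝ) ^ γ * (1 / √n) := by ring
            _ = _ := by rw [← e2]; ring
      _ ≤ 1 / n := by gcongr
  -- The state at the start of the block is frozen, so the one-block mean estimate applies for each
  -- value of it.
  have hb2 : ‖∫ ω, H ω * Y ω ∂P‖ ≤ (c₁ + 2) / n := by
    have := h.levy.integral_mul_comp_futureIncrements n (b * p) (Y := X T₀)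
      (h.levy.adapted _) hH hH1 (Φ := fun x c => blockExp P X a g 𝔤 n p w x c - 1)
      ((h.measurable_blockExp n p w).sub_const 1)
      fun x c => h.norm_blockExp_sub_one_le hn hw hD.symm hn1.le x c
    rw [show ∫ ω, H ω * Y ω ∂P = _ from this]
    have hfin : ∀ ω, ‖H ω * ∫ c, (blockExp P X a g 𝔤 n p w (X T₀ ω) c - 1) ∂(gridLaw P X n)‖
        ≤ (c₁ + 2) / n := fun ω => by
      rw [norm_mul]
      refine (mul_le_of_le_one_left (norm_nonneg _) (hH1 ω)).trans ?_
      refine (h.norm_integral_blockExp_sub_one_le hn hp hw hD.symm hn1.le _).trans ?_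
      have e1 : p * |gn P X a g n (X T₀ ω) - 𝔤 (X T₀ ω)| ≤ 1 := by
        have := mul_le_mul_of_nonneg_left (hn5 (X T₀ ω)) hpp.le
        rwa [mul_one_div_cancel hpp.ne'] at this
      calc _ ≤ W ^ 2 / 2 / n * (m * L + 1 + 2 * m * ((2 * m + 1) * (2 * L ^ 2)))
            + (D ^ 2 / n ^ 2 + (D / √n) ^ 3) := by gcongr
        _ = (c₁ + D ^ 2 / n + D ^ 3 * (√n)⁻¹) / n := by
            have : (√(n : ℝ)) ^ 3 = √n * n := by rw [pow_succ', Real.sq_sqrt hn0.le]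
            rw [div_pow, this, hc₁]
            ring
        _ ≤ _ := div_le_div_of_nonneg_right (by linarith) hn0.le
    simpa using norm_integral_le_of_norm_le_const (μ := P) (ae_of_all _ hfin)
  rw [hsplit]
  refine (norm_add_le _ _).trans ((add_le_add hb1 hb2).trans (le_of_eq ?_))
  ring

end LimitSetting

end OneBlock

end LevyHF

namespace LevyHF

/-! ### Time integrals along the paths -/

section TimeIntegral

variable {Ω : Type*} {mΩ : MeasurableSpace Ω} {P : Measure Ω} [IsProbabilityMeasure P]
  {ℱ : Filtration ℝ≥0 mΩ} {d m : ℕ}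
  {X : ℝ≥0 → Ω → EuclideanSpace ℝ (Fin d)} {a : ℕ → ℝ}
  {g : EuclideanSpace ℝ (Fin d) → (Fin (m + 1) → EuclideanSpace ℝ (Fin d)) → ℝ}
  {𝔤 : EuclideanSpace ℝ (Fin d) → ℝ} {L γ : ℝ}

/-- The discretised times approach s from the right, so right-continuity of the paths is enough. -/
lemma tendsto_ceil_div (s : ℝ≥0) :
    Tendsto (fun k : ℕ => (⌈((k : ℝ≥0) + 1) * s⌉₊ : ℝ≥0) / ((k : ℝ≥0) + 1)) atTop (𝓝[≥] s) := by
  refine tendsto_nhdsWithin_iff.2 ⟨?_, Eventually.of_forall fun k => ?_⟩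
  · refine tendsto_of_tendsto_of_tendsto_of_le_of_le (g := fun _ => s)
      (h := fun k : ℕ => s + 1 / ((k : ℝ≥0) + 1)) tendsto_const_nhds ?_ (fun k => ?_) fun k => ?_
    · have : Tendsto (fun k : ℕ => 1 / ((k : ℝ≥0) + 1)) atTop (𝓝 0) := by
        rw [← NNReal.tendsto_coe]
        push_cast
        exact tendsto_one_div_add_atTop_nhds_zero_nat
      simpa using tendsto_const_nhds.add this
    · simp only
      rw [le_div_iff₀ (by positivity), mul_comm]
      exact Nat.le_ceil _
    · simp only
      rw [div_le_iff₀ (by positivity), add_mul s, one_div, inv_mul_cancel₀ (by positivity),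
        mul_comm s]
      exact (Nat.ceil_lt_add_one (zero_le (a := ((k : ℝ≥0) + 1) * s))).le
  · rw [Set.mem_Ici, le_div_iff₀ (by positivity), mul_comm]
    exact Nat.le_ceil _

/-- With time rounded up to a countable grid, X is jointly measurable; these approximations converge
wherever the path is right-continuous. -/
lemma IsLevyProcess.aestronglyMeasurable_uncurry (hX : IsLevyProcess ℱ X P) (μ : Measure ℝ)
    [SFinite μ] : AEStronglyMeasurable (fun q : ℝ × Ω => X q.1.toNNReal q.2) (μ.prod P) := by
  refine aestronglyMeasurable_of_tendsto_ae atTop (f := fun (k : ℕ) (q : ℝ × Ω) =>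
    X ((⌈((k : ℝ≥0) + 1) * q.1.toNNReal⌉₊ : ℝ≥0) / ((k : ℝ≥0) + 1)) q.2) (fun k => ?_) ?_
  · have h1 : Measurable fun q : ℕ × Ω => X ((q.1 : ℝ≥0) / ((k : ℝ≥0) + 1)) q.2 :=
      measurable_from_prod_countable_right fun j =>
        hX.measurable ((j : ℝ≥0) / ((k : ℝ≥0) + 1))
    have h2 : Measurable fun q : ℝ × Ω => (⌈((k : ℝ≥0) + 1) * q.1.toNNReal⌉₊, q.2) :=
      (Nat.measurable_ceil.comp ((measurable_real_toNNReal.comp measurable_fst).const_mul _)).prodMk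
        measurable_snd
    exact (h1.comp h2).aestronglyMeasurable
  · have := Measure.quasiMeasurePreserving_snd (μ := μ) (ν := P) |>.ae hX.cadlag
    filter_upwards [this] with q hq
    exact (hq q.1.toNNReal).1.tendsto.comp (tendsto_ceil_div _)

/-- The time integral `∫_0^t 𝔤(X_s) ds`. -/
noncomputable def timeIntegral (X : ℝ≥0 → Ω → EuclideanSpace ℝ (Fin d))
    (𝔤 : EuclideanSpace ℝ (Fin d) → ℝ) (t : ℝ≥0) (ω : Ω) : ℝ :=
  ∫ s in (0 : ℝ)..t, 𝔤 (X s.toNNReal ω)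

namespace LimitSetting

lemma aestronglyMeasurable_limit (h : LimitSetting P ℱ X a g 𝔤 L γ) (μ : Measure ℝ) [SFinite μ] :
    AEStronglyMeasurable (fun q : ℝ × Ω => 𝔤 (X q.1.toNNReal q.2)) (μ.prod P) :=
  h.continuous_limit.comp_aestronglyMeasurable (h.levy.aestronglyMeasurable_uncurry μ)

lemma abs_limit_le (h : LimitSetting P ℱ X a g 𝔤 L γ) (x : EuclideanSpace ℝ (Fin d)) :
    |𝔤 x| ≤ L := by
  rw [abs_of_nonneg (h.nonneg x)]
  exact h.limit_le x

lemma ae_intervalIntegrable (h : LimitSetting P ℱ X a g 𝔤 L γ) :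
    ∀ᵐ ω ∂P, ∀ s t : ℝ, IntervalIntegrable (fun s => 𝔤 (X s.toNNReal ω)) volume s t := by
  have h1 : ∀ᵐ ω ∂P, AEStronglyMeasurable (fun s : ℝ => 𝔤 (X s.toNNReal ω)) volume := by
    have := (h.aestronglyMeasurable_limit volume).prod_swap
    exact this.prodMk_left
  filter_upwards [h1] with ω hω s t
  rw [intervalIntegrable_iff]
  exact Measure.integrableOn_of_bounded (M := L) (by simp) hω
    (ae_of_all _ fun s => h.abs_limit_le _)

lemma abs_timeIntegral_le (h : LimitSetting P ℱ X a g 𝔤 L γ) (t : ℝ≥0) (ω : Ω) :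
    |timeIntegral X 𝔤 t ω| ≤ L * t := by
  have := intervalIntegral.norm_integral_le_of_norm_le_const (a := 0) (b := (t : ℝ)) (C := L)
    (f := fun s => 𝔤 (X s.toNNReal ω)) fun s _ => h.abs_limit_le _
  simpa [timeIntegral] using this

lemma aestronglyMeasurable_integral (h : LimitSetting P ℱ X a g 𝔤 L γ) (s t : ℝ≥0) :
    AEStronglyMeasurable (fun ω => ∫ r in (s : ℝ)..t, 𝔤 (X r.toNNReal ω)) P := by
  simp only [intervalIntegral]
  exact (h.aestronglyMeasurable_limit _).prod_swap.integral_prod_right'.sub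
    (h.aestronglyMeasurable_limit _).prod_swap.integral_prod_right'

lemma aestronglyMeasurable_timeIntegral (h : LimitSetting P ℱ X a g 𝔤 L γ) (t : ℝ≥0) :
    AEStronglyMeasurable (timeIntegral X 𝔤 t) P := by
  have := h.aestronglyMeasurable_integral 0 t
  rwa [NNReal.coe_zero] at this

/-- Fubini moves the expectation inside the time integral, where the modulus applies at each fixed
time. -/
lemma integral_integral_min_le (h : LimitSetting P ℱ X a g 𝔤 L γ) {s t : ℝ≥0} (hst : s ≤ t) :
    Integrable (fun ω => ∫ r in Set.Ioc (s : ℝ) t, min 1 ‖X r.toNNReal ω - X s ω‖) P ∧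
    ∫ ω, (∫ r in Set.Ioc (s : ℝ) t, min 1 ‖X r.toNNReal ω - X s ω‖) ∂P
      ≤ ((t : ℝ) - s) * (L * ((t : ℝ) - s) ^ γ) := by
  have hL := h.const_nonneg
  have hst' : (s : ℝ) ≤ t := hst
  have hint : Integrable (fun q : ℝ × Ω => min 1 ‖X q.1.toNNReal q.2 - X s q.2‖)
      ((volume.restrict (Set.Ioc (s : ℝ) t)).prod P) := by
    refine Integrable.of_bound ?_ 1 (ae_of_all _ fun q => ?_)
    · have h1 := h.levy.aestronglyMeasurable_uncurry (volume.restrict (Set.Ioc (s : ℝ) t))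
      have h2 : AEStronglyMeasurable (fun q : ℝ × Ω => X s q.2)
          ((volume.restrict (Set.Ioc (s : ℝ) t)).prod P) :=
        ((h.measurable s).comp measurable_snd).aestronglyMeasurable
      have hc : Continuous fun y : EuclideanSpace ℝ (Fin d) => min 1 ‖y‖ := by fun_prop
      exact hc.comp_aestronglyMeasurable (h1.sub h2)
    · rw [Real.norm_of_nonneg (le_min zero_le_one (norm_nonneg _))]
      exact min_le_left _ _
  refine ⟨hint.integral_prod_right, ?_⟩
  have hswap := integral_integral_swap (f := fun ω r => min 1 ‖X r.toNNReal ω - X s ω‖)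
    (μ := P) (ν := volume.restrict (Set.Ioc (s : ℝ) t)) hint.swap
  have hleft : Integrable (fun r : ℝ => ∫ ω, min 1 ‖X r.toNNReal ω - X s ω‖ ∂P)
    (volume.restrict (Set.Ioc (s : ℝ) t)) := hint.integral_prod_left
  have hb : ∀ r ∈ Set.Ioc (s : ℝ) t, ∫ ω, min 1 ‖X r.toNNReal ω - X s ω‖ ∂P
      ≤ L * ((t : ℝ) - s) ^ γ := fun r hr => by
    have hr0 : (0 : ℝ) ≤ r := s.coe_nonneg.trans hr.1.le
    have h1 := h.modulus s r.toNNReal (by rw [← NNReal.coe_le_coe, Real.coe_toNNReal _ hr0]; exact hr.1.le)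
    rw [Real.coe_toNNReal _ hr0] at h1
    refine h1.trans (mul_le_mul_of_nonneg_left ?_ hL)
    exact Real.rpow_le_rpow (by linarith [hr.1]) (by linarith [hr.2]) (by linarith [h.half_lt])
  have hconst : IntegrableOn (fun _ : ℝ => L * ((t : ℝ) - s) ^ γ) (Set.Ioc (s : ℝ) t) :=
    integrableOn_const (by simp)
  refine hswap.le.trans ((setIntegral_mono_on hleft hconst measurableSet_Ioc hb).trans
    (le_of_eq ?_))
  rw [setIntegral_const, Real.volume_real_Ioc_of_le hst', smul_eq_mul]

lemma integral_abs_riemann_sub_le (h : LimitSetting P ℱ X a g 𝔤 L γ) {s t : ℝ≥0} (hst : s ≤ t) :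
    ∫ ω, |((t : ℝ) - s) * 𝔤 (X s ω) - ∫ r in (s : ℝ)..t, 𝔤 (X r.toNNReal ω)| ∂P
      ≤ L * (((t : ℝ) - s) * (L * ((t : ℝ) - s) ^ γ)) := by
  have hst' : (s : ℝ) ≤ t := hst
  obtain ⟨hi, hb⟩ := h.integral_integral_min_le hst
  refine (integral_mono_of_nonneg (ae_of_all _ fun _ => abs_nonneg _) (hi.const_mul L) ?_).trans ?_
  · have hmeas : ∀ᵐ ω ∂P, AEStronglyMeasurable (fun r : ℝ => X r.toNNReal ω) volume :=
      (h.levy.aestronglyMeasurable_uncurry volume).prod_swap.prodMk_left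
    filter_upwards [h.ae_intervalIntegrable, hmeas] with ω hω hm
    have e : ((t : ℝ) - s) * 𝔤 (X s ω) = ∫ _r in (s : ℝ)..t, 𝔤 (X s ω) := by simp
    rw [e, ← intervalIntegral.integral_sub intervalIntegrable_const (hω _ _)]
    refine (intervalIntegral.abs_integral_le_integral_abs hst').trans ?_
    rw [intervalIntegral.integral_of_le hst', ← integral_const_mul]
    refine integral_mono_of_nonneg (ae_of_all _ fun _ => abs_nonneg _) ?_ (ae_of_all _ fun r => ?_)
    · refine Integrable.const_mul (Integrable.of_bound ?_ 1 (ae_of_all _ fun r => ?_)) L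
      · have hc : Continuous fun y : EuclideanSpace ℝ (Fin d) => min 1 ‖y - X s ω‖ := by fun_prop
        exact hc.comp_aestronglyMeasurable hm.restrict
      · rw [Real.norm_of_nonneg (le_min zero_le_one (norm_nonneg _))]
        exact min_le_left _ _
    · simp only
      rw [abs_sub_comm]
      exact h.limit_lipschitz _ _
  · rw [integral_const_mul]
    exact mul_le_mul_of_nonneg_left hb h.const_nonneg

/-- The Riemann sum of `𝔤(X)` over blocks of length `p / n`. -/
noncomputable def _root_.LevyHF.riemannSum (X : ℝ≥0 → Ω → EuclideanSpace ℝ (Fin d))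
    (𝔤 : EuclideanSpace ℝ (Fin d) → ℝ) (n p : ℕ) (t : ℝ≥0) (ω : Ω) : ℝ :=
  ∑ b ∈ Finset.range (numBlocks n p t), (p : ℝ) / n * 𝔤 (X (((b * p : ℕ) : ℝ≥0) / n) ω)

lemma measurable_riemannSum (h : LimitSetting P ℱ X a g 𝔤 L γ) (n p : ℕ) (t : ℝ≥0) :
    Measurable[⨆ t, MeasurableSpace.comap (X t) inferInstance] (riemannSum X 𝔤 n p t) := by
  refine Finset.measurable_fun_sum _ fun b _ => Measurable.const_mul ?_ _
  have h1 : Measurable[⨆ t, MeasurableSpace.comap (X t) inferInstance]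
      (X (((b * p : ℕ) : ℝ≥0) / n)) :=
    (comap_measurable _).mono (le_iSup (fun t => MeasurableSpace.comap (X t) inferInstance) _) le_rfl
  exact h.continuous_limit.measurable.comp h1

lemma riemannSum_nonneg (h : LimitSetting P ℱ X a g 𝔤 L γ) (n p : ℕ) (t : ℝ≥0) (ω : Ω) :
    0 ≤ riemannSum X 𝔤 n p t ω :=
  Finset.sum_nonneg fun b _ => mul_nonneg (by positivity) (h.nonneg _)

lemma riemannSum_le (h : LimitSetting P ℱ X a g 𝔤 L γ) {n p : ℕ} (hn : n ≠ 0) (hp : p ≠ 0)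
    (t : ℝ≥0) (ω : Ω) : riemannSum X 𝔤 n p t ω ≤ L * (t + p / n) := by
  have h1 : (((numBlocks n p t * p : ℕ) : ℝ≥0) / n : ℝ≥0) ≤ ((t + p / n : ℝ≥0) : ℝ) :=
    numBlocks_mul_div_le hn hp t
  push_cast at h1
  calc riemannSum X 𝔤 n p t ω
      ≤ ∑ b ∈ Finset.range (numBlocks n p t), (p : ℝ) / n * L :=
        Finset.sum_le_sum fun b _ => mul_le_mul_of_nonneg_left (h.limit_le _) (by positivity)
    _ = L * (numBlocks n p t * p / n) := by
        rw [Finset.sum_const, Finset.card_range, nsmul_eq_mul]; ring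
    _ ≤ _ := mul_le_mul_of_nonneg_left h1 h.const_nonneg

/-- There is one freezing error for each block, and the overshoot of the last block beyond t costs
at most L p/n. -/
lemma integral_abs_riemannSum_sub_le (h : LimitSetting P ℱ X a g 𝔤 L γ) {n p : ℕ} (hn : n ≠ 0)
    (hp : p ≠ 0) (t : ℝ≥0) :
    ∫ ω, |riemannSum X 𝔤 n p t ω - timeIntegral X 𝔤 t ω| ∂P
      ≤ L ^ 2 * (t + p / n) * ((p : ℝ) / n) ^ γ + L * (p / n) := by
  have hL := h.const_nonneg
  have hn0 : (0 : ℝ) < n := by positivity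
  set K := numBlocks n p t with hK
  set T : ℕ → ℝ≥0 := fun b => ((b * p : ℕ) : ℝ≥0) / n with hT
  have hTs : ∀ b, T b ≤ T (b + 1) := fun b => grid_le (by rw [add_mul]; omega)
  have hTd : ∀ b, ((T (b + 1) : ℝ≥0) : ℝ) - T b = p / n := fun b => by
    simp only [hT]; push_cast; ring
  have ht1 : (t : ℝ) ≤ T K := le_numBlocks_mul_div hn hp t
  have ht2 : (T K : ℝ) ≤ t + p / n := by
    have : (T K : ℝ) ≤ ((t + p / n : ℝ≥0) : ℝ) := numBlocks_mul_div_le hn hp t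
    simpa using this
  set D : ℕ → Ω → ℝ := fun b ω => (((T (b + 1) : ℝ≥0) : ℝ) - T b) * 𝔤 (X (T b) ω)
    - ∫ r in (T b : ℝ)..T (b + 1), 𝔤 (X r.toNNReal ω) with hD
  have hDi : ∀ b, Integrable (fun ω => |D b ω|) P := fun b => by
    refine (Integrable.sub ?_ ?_).abs
    · exact (Integrable.of_bound (h.continuous_limit.measurable.comp
        (h.measurable _)).aestronglyMeasurable L (ae_of_all _ fun ω => h.abs_limit_le _)).const_mul _
    · exact Integrable.of_bound (h.aestronglyMeasurable_integral _ _) (L * |(T (b+1) : ℝ) - T b|)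
        (ae_of_all _ fun ω => intervalIntegral.norm_integral_le_of_norm_le_const
          (f := fun r => 𝔤 (X r.toNNReal ω)) fun s _ => h.abs_limit_le _)
  have hsum : ∀ᵐ ω ∂P, |riemannSum X 𝔤 n p t ω - timeIntegral X 𝔤 t ω|
      ≤ ∑ b ∈ Finset.range K, |D b ω| + L * (p / n) := by
    filter_upwards [h.ae_intervalIntegrable] with ω hω
    have h1 : ∑ b ∈ Finset.range K, ∫ r in (T b : ℝ)..T (b + 1), 𝔤 (X r.toNNReal ω)
        = ∫ r in (0 : ℝ)..T K, 𝔤 (X r.toNNReal ω) := by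
      rw [intervalIntegral.sum_integral_adjacent_intervals fun b _ => hω _ _]
      simp [hT]
    have h2 := intervalIntegral.integral_add_adjacent_intervals (hω 0 t) (hω t (T K))
    have h3 : riemannSum X 𝔤 n p t ω - timeIntegral X 𝔤 t ω
        = ∑ b ∈ Finset.range K, D b ω + ∫ r in (t : ℝ)..T K, 𝔤 (X r.toNNReal ω) := by
      simp only [hD, hTd]
      rw [Finset.sum_sub_distrib, h1, ← h2, riemannSum, timeIntegral]
      ring
    rw [h3]
    refine (abs_add_le _ _).trans (add_le_add (Finset.abs_sum_le_sum_abs _ _) ?_)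
    refine (intervalIntegral.norm_integral_le_of_norm_le_const (C := L)
      (f := fun r => 𝔤 (X r.toNNReal ω)) fun s _ => h.abs_limit_le _).trans (mul_le_mul_of_nonneg_left ?_ hL)
    rw [abs_of_nonneg (by linarith)]
    linarith
  have hKp : (K : ℝ) * (p / n) ≤ t + p / n := by
    have : (T K : ℝ) = K * (p / n) := by simp only [hT]; push_cast; ring
    rw [← this]; exact ht2
  refine (integral_mono_of_nonneg (ae_of_all _ fun _ => abs_nonneg _)
    ((integrable_finsetSum _ fun b _ => hDi b).add (integrable_const _)) hsum).trans ?_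
  simp only [Pi.add_apply]
  rw [integral_add (integrable_finsetSum _ fun b _ => hDi b) (integrable_const _),
    integral_finsetSum _ fun b _ => hDi b, integral_const, probReal_univ, one_smul]
  refine add_le_add ?_ le_rfl
  refine (Finset.sum_le_sum fun b _ => h.integral_abs_riemann_sub_le (hTs b)).trans ?_
  simp only [hTd]
  rw [Finset.sum_const, Finset.card_range, nsmul_eq_mul]
  calc (K : ℝ) * (L * ((p : ℝ) / n * (L * ((p : ℝ) / n) ^ γ)))
      = L ^ 2 * (K * (p / n)) * ((p : ℝ) / n) ^ γ := by ring
    _ ≤ _ := by gcongr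

/-- The Riemann sums converge in `L¹` to the time integral. -/
theorem tendsto_integral_abs_riemannSum_sub (h : LimitSetting P ℱ X a g 𝔤 L γ) {p : ℕ}
    (hp : p ≠ 0) (t : ℝ≥0) :
    Tendsto (fun n => ∫ ω, |riemannSum X 𝔤 n p t ω - timeIntegral X 𝔤 t ω| ∂P) atTop (𝓝 0) := by
  have lim0 : Tendsto (fun n : ℕ => (p : ℝ) / n) atTop (𝓝 0) := tendsto_const_div_atTop_nhds_zero_nat _
  have hγ : γ ≠ 0 := by linarith [h.half_lt]
  have lim1 : Tendsto (fun n : ℕ => ((p : ℝ) / n) ^ γ) atTop (𝓝 0) := by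
    have := lim0.rpow_const (p := γ) (Or.inr (by linarith [h.half_lt]))
    rwa [Real.zero_rpow hγ] at this
  have lim2 : Tendsto (fun n : ℕ => L ^ 2 * (t + (p : ℝ) / n) * ((p : ℝ) / n) ^ γ + L * (p / n))
      atTop (𝓝 0) := by
    have := (((lim0.const_add (t : ℝ)).const_mul (L ^ 2)).mul lim1).add (lim0.const_mul L)
    simpa using this
  refine squeeze_zero' (Eventually.of_forall fun n => integral_nonneg fun _ => abs_nonneg _) ?_ lim2
  filter_upwards [eventually_ne_atTop 0] with n hn
  exact h.integral_abs_riemannSum_sub_le hn hp t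

end LimitSetting

end TimeIntegral

end LevyHF

namespace LevyHF

/-! ### Convergence of the conditional characteristic functions -/

/-- Writing e^{i(x+y)} - 1 = e^{ix}(e^{iy} - 1) + (e^{ix} - 1), phases of modulus 1 do not amplify
the error. -/
lemma norm_cexp_sum_sub_one_le {ι : Type*} (s : Finset ι) (x : ι → ℝ) :
    ‖Complex.exp (((∑ i ∈ s, x i : ℝ) : ℂ) * Complex.I) - 1‖
      ≤ ∑ i ∈ s, ‖Complex.exp ((x i : ℂ) * Complex.I) - 1‖ := by
  classical
  induction s using Finset.induction_on with
  | empty => simp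
  | insert i s hi ih =>
    rw [Finset.sum_insert hi, Finset.sum_insert hi, Complex.ofReal_add, add_mul, Complex.exp_add]
    have e : Complex.exp ((x i : ℂ) * Complex.I)
        * Complex.exp (((∑ i ∈ s, x i : ℝ) : ℂ) * Complex.I) - 1
        = Complex.exp ((x i : ℂ) * Complex.I)
          * (Complex.exp (((∑ i ∈ s, x i : ℝ) : ℂ) * Complex.I) - 1)
          + (Complex.exp ((x i : ℂ) * Complex.I) - 1) := by ring
    rw [e, add_comm ‖Complex.exp ((x i : ℂ) * Complex.I) - 1‖]
    refine (norm_add_le _ _).trans (add_le_add ?_ le_rfl)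
    rw [norm_mul, Complex.norm_exp_ofReal_mul_I, one_mul]
    exact ih

lemma norm_cexp_mul_I_sub_le (x y : ℝ) :
    ‖Complex.exp ((x : ℂ) * Complex.I) - Complex.exp ((y : ℂ) * Complex.I)‖
      = ‖Complex.exp (((x - y : ℝ) : ℂ) * Complex.I) - 1‖ := by
  have e : Complex.exp ((x : ℂ) * Complex.I) - Complex.exp ((y : ℂ) * Complex.I)
      = Complex.exp ((y : ℂ) * Complex.I) * (Complex.exp (((x - y : ℝ) : ℂ) * Complex.I) - 1) := by
    rw [mul_sub, ← Complex.exp_add, mul_one]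
    congr 2
    push_cast; ring
  rw [e, norm_mul, Complex.norm_exp_ofReal_mul_I, one_mul]

lemma abs_exp_sub_exp_le {a b M : ℝ} (ha : a ≤ M) (hb : b ≤ M) :
    |Real.exp a - Real.exp b| ≤ Real.exp M * |a - b| := by
  wlog h : b ≤ a generalizing a b
  · rw [abs_sub_comm, abs_sub_comm a]
    exact this hb ha (le_of_not_ge h)
  rw [abs_of_nonneg (sub_nonneg.2 (Real.exp_le_exp.2 h)), abs_of_nonneg (sub_nonneg.2 h)]
  have h1 : 1 - Real.exp (b - a) ≤ a - b := by linarith [Real.add_one_le_exp (b - a)]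
  have h2 : Real.exp b = Real.exp a * Real.exp (b - a) := by rw [← Real.exp_add]; ring_nf
  calc Real.exp a - Real.exp b = Real.exp a * (1 - Real.exp (b - a)) := by rw [h2]; ring
    _ ≤ Real.exp a * (a - b) := by gcongr
    _ ≤ _ := by gcongr

lemma norm_cexp_sub_cexp_le {a b x y M : ℝ} (ha : a ≤ M) (hb : b ≤ M) :
    ‖Complex.exp ((a : ℂ) + (x : ℂ) * Complex.I) - Complex.exp ((b : ℂ) + (y : ℂ) * Complex.I)‖
      ≤ Real.exp M * (|x - y| + |a - b|) := by
  rw [Complex.exp_add, Complex.exp_add]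
  have e : Complex.exp (a : ℂ) * Complex.exp ((x : ℂ) * Complex.I)
      - Complex.exp (b : ℂ) * Complex.exp ((y : ℂ) * Complex.I)
      = Complex.exp (a : ℂ) * (Complex.exp ((x : ℂ) * Complex.I) - Complex.exp ((y : ℂ) * Complex.I))
        + ((Real.exp a - Real.exp b : ℝ) : ℂ) * Complex.exp ((y : ℂ) * Complex.I) := by
    push_cast; ring
  rw [e, mul_add]
  refine (norm_add_le _ _).trans (add_le_add ?_ ?_)
  · rw [norm_mul, norm_cexp_mul_I_sub_le, Complex.norm_exp_ofReal]
    gcongr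
    exact norm_cexp_mul_I_sub_one_le _
  · rw [norm_mul, Complex.norm_exp_ofReal_mul_I, mul_one, Complex.norm_real]
    exact abs_exp_sub_exp_le ha hb

section Product

variable {Ω : Type*} {mΩ : MeasurableSpace Ω} {P : Measure Ω} [IsProbabilityMeasure P]
  {ℱ : Filtration ℝ≥0 mΩ} {d m : ℕ}
  {X : ℝ≥0 → Ω → EuclideanSpace ℝ (Fin d)} {a : ℕ → ℝ}
  {g : EuclideanSpace ℝ (Fin d) → (Fin (m + 1) → EuclideanSpace ℝ (Fin d)) → ℝ}
  {𝔤 : EuclideanSpace ℝ (Fin d) → ℝ} {L γ : ℝ}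

namespace LimitSetting

lemma norm_blockExp_le (h : LimitSetting P ℱ X a g 𝔤 L γ) (n p : ℕ) {w W : ℝ} (hw : |w| ≤ W)
    (x : EuclideanSpace ℝ (Fin d)) (c : ℕ → EuclideanSpace ℝ (Fin d)) :
    ‖blockExp P X a g 𝔤 n p w x c‖ ≤ Real.exp (W ^ 2 / 2 * (p / n) * L) := by
  have hw2 : w ^ 2 ≤ W ^ 2 :=
    sq_le_sq' (by linarith [neg_abs_le w]) ((le_abs_self w).trans hw)
  rw [blockExp, Complex.exp_add, norm_mul, Complex.norm_exp_ofReal_mul_I, mul_one,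
    Complex.norm_exp_ofReal]
  have := h.limit_le x
  have := h.nonneg x
  gcongr

/-- Of order n/p block errors of size O(1/n) add up to O(1/p), with the product of the compensators
bounded uniformly in n and p. -/
theorem exists_norm_integral_prod_le (h : LimitSetting P ℱ X a g 𝔤 L γ) (W V T : ℝ) :
    ∃ c : ℝ, ∀ p, m < p → ∀ᶠ n : ℕ in atTop, ∀ (B : ℕ) (w : ℕ → ℝ)
      (v : ℕ → EuclideanSpace ℝ (Fin d)), (∀ b, |w b| ≤ W) → (∀ b, ‖v b‖ ≤ V) →
      (B : ℝ) * p ≤ n * T →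
      ‖∫ ω, (∏ b ∈ Finset.range B, Complex.exp ((inner ℝ (v b)
            (X ((((b + 1) * p : ℕ) : ℝ≥0) / n) ω - X (((b * p : ℕ) : ℝ≥0) / n) ω) : ℝ) * Complex.I))
          * (∏ b ∈ Finset.range B, blockExp P X a g 𝔤 n p (w b) (X (((b * p : ℕ) : ℝ≥0) / n) ω)
            (futureIncrements X n (b * p) ω) - 1) ∂P‖ ≤ c / p := by
  have hL := h.const_nonneg
  obtain ⟨c, hc0, hc⟩ := h.exists_norm_integral_block_le W V
  refine ⟨T * Real.exp (W ^ 2 / 2 * L * T) * c, fun p hp => ?_⟩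
  filter_upwards [hc p hp, eventually_ne_atTop 0] with n hn hn0 B w v hw hv hB
  have hnn : (0 : ℝ) < n := by positivity
  have hpp : (0 : ℝ) < p := by
    have : p ≠ 0 := by omega
    positivity
  have hT : 0 ≤ T := by
    have : 0 ≤ (n : ℝ) * T := le_trans (by positivity) hB
    exact nonneg_of_mul_nonneg_right this hnn
  set 𝒢 : ℕ → MeasurableSpace Ω := fun b => ℱ (((b * p : ℕ) : ℝ≥0) / n) with h𝒢
  have hmono : Monotone 𝒢 := fun b b' hb => ℱ.mono (grid_le (Nat.mul_le_mul_right p hb))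
  have hle : ∀ b, 𝒢 b ≤ mΩ := fun b => ℱ.le _
  set e : ℕ → Ω → ℂ := fun b ω => Complex.exp ((inner ℝ (v b)
    (X ((((b + 1) * p : ℕ) : ℝ≥0) / n) ω - X (((b * p : ℕ) : ℝ≥0) / n) ω) : ℝ) * Complex.I) with he
  set y : ℕ → Ω → ℂ := fun b ω => blockExp P X a g 𝔤 n p (w b) (X (((b * p : ℕ) : ℝ≥0) / n) ω)
    (futureIncrements X n (b * p) ω) with hy
  have hfun : ∀ b, Measurable fun x : EuclideanSpace ℝ (Fin d) =>
      Complex.exp ((inner ℝ (v b) x : ℝ) * Complex.I) := fun b => by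
    have : Measurable fun x : EuclideanSpace ℝ (Fin d) => inner ℝ (v b) x := by fun_prop
    fun_prop
  have hX0 : ∀ b, Measurable[𝒢 b] (X (((b * p : ℕ) : ℝ≥0) / n)) := fun b => h.levy.adapted _
  have hem : ∀ b, Measurable[𝒢 (b + 1)] (e b) := fun b =>
    (hfun b).comp (Measurable.sub (hX0 (b + 1)) ((hX0 b).mono (hmono (Nat.le_succ b)) le_rfl))
  have hym : ∀ b, Measurable[𝒢 (b + 1)] (y b) := fun b => by
    have h1 : Measurable[𝒢 (b + 1)] (blockTerm P X a g n p b) := h.measurable_blockTerm n p b hp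
    have h2 : Measurable[𝒢 (b + 1)] fun ω => 𝔤 (X (((b * p : ℕ) : ℝ≥0) / n) ω) :=
      h.continuous_limit.measurable.comp ((hX0 b).mono (hmono (Nat.le_succ b)) le_rfl)
    refine Complex.measurable_exp.comp (Measurable.add ?_ (Measurable.mul_const ?_ _))
    · exact Complex.measurable_ofReal.comp (h2.const_mul _)
    · exact Complex.measurable_ofReal.comp (h1.const_mul _)
  have he1 : ∀ b ω, ‖e b ω‖ ≤ 1 := fun b ω => (Complex.norm_exp_ofReal_mul_I _).le
  set ρ : ℝ := Real.exp (W ^ 2 / 2 * (p / n) * L) with hρ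
  have hρ1 : 1 ≤ ρ := Real.one_le_exp (by positivity)
  have hyρ : ∀ b ω, ‖y b ω‖ ≤ ρ := fun b ω => h.norm_blockExp_le n p (hw b) _ _
  have hind : ∀ b, Indep (MeasurableSpace.comap (e b) inferInstance) (𝒢 b) P := fun b => by
    refine indep_of_indep_of_le_left (h.levy.indep_increments (((b * p : ℕ) : ℝ≥0) / n)
      ((((b + 1) * p : ℕ) : ℝ≥0) / n) (grid_le (by rw [add_mul]; omega))) ?_
    have : e b = (fun x : EuclideanSpace ℝ (Fin d) =>
        Complex.exp ((inner ℝ (v b) x : ℝ) * Complex.I)) ∘ fun ω =>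
        X ((((b + 1) * p : ℕ) : ℝ≥0) / n) ω - X (((b * p : ℕ) : ℝ≥0) / n) ω := rfl
    rw [this]
    exact (Measurable.comp (hfun b) (comap_measurable _)).comap_le
  have key := norm_integral_prod_sub_prod_integral_le hmono hle hem hym he1 hρ1
    (δ := c / n) (by positivity) hyρ hind B fun b _ H hH hH1 => hn b (w b) (v b) (hw b) (hv b) H hH hH1
  -- With y = 1 and δ = 0 the same estimate gives E ∏ e_b = ∏ E e_b exactly, so the product of means
  -- can be put back as an expectation and subtracted.
  have key1 := norm_integral_prod_sub_prod_integral_le (y := fun _ _ => (1 : ℂ)) hmono hle hem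
    (fun b => measurable_const) he1 le_rfl (δ := 0) le_rfl (fun _ _ => by simp) hind B
    fun b _ H hH hH1 => by simp
  rw [mul_zero, norm_le_zero_iff, sub_eq_zero] at key1
  simp only [mul_one] at key1
  rw [← key1, ← integral_sub] at key
  · have hB2 : (B : ℝ) * ρ ^ B * (c / n) ≤ T * Real.exp (W ^ 2 / 2 * L * T) * c / p := by
      -- There are B ≤ nT/p factors, each at most exp(W² p L / (2n)); the dependence on n and p
      -- cancels.
      have h1 : ρ ^ B ≤ Real.exp (W ^ 2 / 2 * L * T) := by
        rw [hρ, ← Real.exp_nat_mul]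
        refine Real.exp_le_exp.2 ?_
        have : (B : ℝ) * p / n ≤ T := by rw [div_le_iff₀ hnn]; linarith
        calc (B : ℝ) * (W ^ 2 / 2 * (p / n) * L) = W ^ 2 / 2 * L * (B * p / n) := by ring
          _ ≤ _ := by gcongr
      have h2 : (B : ℝ) ≤ n * T / p := by rwa [le_div_iff₀ hpp]
      calc (B : ℝ) * ρ ^ B * (c / n) ≤ (n * T / p) * Real.exp (W ^ 2 / 2 * L * T) * (c / n) := by
            gcongr
        _ = _ := by field_simp
    refine le_trans (le_of_eq ?_) (key.trans hB2)
    congr 2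
    ext ω
    rw [Finset.prod_mul_distrib, mul_sub, mul_one]
  · refine Integrable.of_bound (Finset.measurable_fun_prod _ fun b _ => ((hem b).mono (hle _)
      le_rfl).mul ((hym b).mono (hle _) le_rfl)).aestronglyMeasurable (∏ _b ∈ Finset.range B, 1 * ρ)
      (ae_of_all _ fun ω => ?_)
    rw [norm_prod]
    refine Finset.prod_le_prod (fun _ _ => norm_nonneg _) fun b _ => ?_
    rw [norm_mul]
    exact mul_le_mul (he1 b ω) (hyρ b ω) (norm_nonneg _) zero_le_one
  · refine Integrable.of_bound (Finset.measurable_fun_prod _ fun b _ => ((hem b).mono (hle _)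
      le_rfl)).aestronglyMeasurable (∏ _b ∈ Finset.range B, 1) (ae_of_all _ fun ω => ?_)
    rw [norm_prod]
    exact Finset.prod_le_prod (fun _ _ => norm_nonneg _) fun b _ => he1 b ω

end LimitSetting

end Product

end LevyHF

namespace LevyHF

/-! ### Distributing weights at several times over the blocks -/

section Algebra

lemma sum_range_ite_lt {M : Type*} [AddCommMonoid M] {K B : ℕ} (h : K ≤ B) (f : ℕ → M) :
    ∑ b ∈ Finset.range B, (if b < K then f b else 0) = ∑ b ∈ Finset.range K, f b := by
  rw [← Finset.sum_filter]
  congr 1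
  ext b
  simp only [Finset.mem_filter, Finset.mem_range]
  omega

/-- The vector v_s is carried by the blocks before time s, over which the increments telescope; so a
phase in values of X becomes a product of phases of block increments. -/
lemma sum_inner_telescope {E ι : Type*} [NormedAddCommGroup E] [InnerProductSpace ℝ E]
    (S : Finset ι) (v : ι → E) (K : ι → ℕ) {B : ℕ} (hK : ∀ s ∈ S, K s ≤ B) (x : ℕ → E) :
    ∑ b ∈ Finset.range B, inner ℝ (∑ s ∈ S, if b < K s then v s else 0) (x (b + 1) - x b)
      = ∑ s ∈ S, inner ℝ (v s) (x (K s) - x 0) := by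
  simp_rw [sum_inner]
  rw [Finset.sum_comm]
  refine Finset.sum_congr rfl fun s hs => ?_
  rw [← Finset.sum_range_sub x (K s), inner_sum, ← sum_range_ite_lt (hK s hs)]
  refine Finset.sum_congr rfl fun b _ => ?_
  split_ifs <;> simp

lemma sum_mul_ite_lt {ι : Type*} [Fintype ι] (u : ι → ℝ) (K : ι → ℕ) {B : ℕ} (hK : ∀ j, K j ≤ B)
    (f : ℕ → ℝ) : ∑ b ∈ Finset.range B, (∑ j, if b < K j then u j else 0) * f b
      = ∑ j, u j * ∑ b ∈ Finset.range (K j), f b := by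
  simp_rw [Finset.sum_mul]
  rw [Finset.sum_comm]
  refine Finset.sum_congr rfl fun j _ => ?_
  rw [Finset.mul_sum, ← sum_range_ite_lt (hK j)]
  refine Finset.sum_congr rfl fun b _ => ?_
  split_ifs <;> simp

/-- Block b lies before both times j and l exactly when b < min(K_j, K_l). -/
lemma sum_sq_mul_ite_lt {ι : Type*} [Fintype ι] (u : ι → ℝ) (K : ι → ℕ) {B : ℕ}
    (hK : ∀ j, K j ≤ B) (f : ℕ → ℝ) :
    ∑ b ∈ Finset.range B, (∑ j, if b < K j then u j else 0) ^ 2 * f b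
      = ∑ j, ∑ l, u j * u l * ∑ b ∈ Finset.range (min (K j) (K l)), f b := by
  simp_rw [sq, Finset.sum_mul_sum, Finset.sum_mul]
  rw [Finset.sum_comm]
  refine Finset.sum_congr rfl fun j _ => ?_
  rw [Finset.sum_comm]
  refine Finset.sum_congr rfl fun l _ => ?_
  rw [Finset.mul_sum, ← sum_range_ite_lt ((min_le_left _ _).trans (hK j))]
  refine Finset.sum_congr rfl fun b _ => ?_
  by_cases h1 : b < K j <;> by_cases h2 : b < K l <;> simp [h1, h2]

lemma abs_sum_sum_mul_min_le {r : ℕ} {f : ℝ≥0 → ℝ} {c : ℝ} (u : Fin r → ℝ) (τ : Fin r → ℝ≥0)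
    (hf : ∀ j l, |f (min (τ j) (τ l))| ≤ c) :
    |∑ j, ∑ l, u j * u l * f (min (τ j) (τ l))| ≤ (∑ j, ∑ l, |u j| * |u l|) * c := by
  rw [Finset.sum_mul]
  refine (Finset.abs_sum_le_sum_abs _ _).trans (Finset.sum_le_sum fun j _ => ?_)
  rw [Finset.sum_mul]
  refine (Finset.abs_sum_le_sum_abs _ _).trans (Finset.sum_le_sum fun l _ => ?_)
  rw [abs_mul, abs_mul]
  exact mul_le_mul_of_nonneg_left (hf j l) (by positivity)

end Algebra

/-! ### The limiting quadratic form and its Riemann sums -/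

section CharFun

variable {Ω : Type*} {mΩ : MeasurableSpace Ω} {P : Measure Ω} [IsProbabilityMeasure P]
  {ℱ : Filtration ℝ≥0 mΩ} {d m r : ℕ}
  {X : ℝ≥0 → Ω → EuclideanSpace ℝ (Fin d)} {a : ℕ → ℝ}
  {g : EuclideanSpace ℝ (Fin d) → (Fin (m + 1) → EuclideanSpace ℝ (Fin d)) → ℝ}
  {𝔤 : EuclideanSpace ℝ (Fin d) → ℝ} {L γ : ℝ}

/-- The conditional variance of `∑_j u_j ∫_0^{τ_j} √𝔤(X_s) dW_s` given `X`. -/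
noncomputable def quadVar (X : ℝ≥0 → Ω → EuclideanSpace ℝ (Fin d))
    (𝔤 : EuclideanSpace ℝ (Fin d) → ℝ) (u : Fin r → ℝ) (τ : Fin r → ℝ≥0) (ω : Ω) : ℝ :=
  ∑ j, ∑ l, u j * u l * timeIntegral X 𝔤 (min (τ j) (τ l)) ω

/-- The approximation of `quadVar` by Riemann sums. -/
noncomputable def riemannQuad (X : ℝ≥0 → Ω → EuclideanSpace ℝ (Fin d))
    (𝔤 : EuclideanSpace ℝ (Fin d) → ℝ) (n p : ℕ) (u : Fin r → ℝ) (τ : Fin r → ℝ≥0) (ω : Ω) : ℝ :=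
  ∑ j, ∑ l, u j * u l * riemannSum X 𝔤 n p (min (τ j) (τ l)) ω

namespace LimitSetting

lemma measurable_riemannQuad (h : LimitSetting P ℱ X a g 𝔤 L γ) (n p : ℕ) (u : Fin r → ℝ)
    (τ : Fin r → ℝ≥0) :
    Measurable[⨆ t, MeasurableSpace.comap (X t) inferInstance] (riemannQuad X 𝔤 n p u τ) := by
  unfold riemannQuad
  exact Finset.measurable_fun_sum _ fun j _ => Finset.measurable_fun_sum _ fun l _ =>
    (h.measurable_riemannSum n p _).const_mul _

lemma aestronglyMeasurable_quadVar (h : LimitSetting P ℱ X a g 𝔤 L γ) (u : Fin r → ℝ)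
    (τ : Fin r → ℝ≥0) : AEStronglyMeasurable (quadVar X 𝔤 u τ) P := by
  unfold quadVar
  exact Finset.aestronglyMeasurable_fun_sum _ fun j _ => Finset.aestronglyMeasurable_fun_sum _
    fun l _ => (h.aestronglyMeasurable_timeIntegral _).const_mul _

lemma iSup_comap_le (h : LimitSetting P ℱ X a g 𝔤 L γ) :
    ⨆ t, MeasurableSpace.comap (X t) inferInstance ≤ mΩ :=
  iSup_le fun t => (h.measurable t).comap_le

lemma integrable_riemannSum_sub (h : LimitSetting P ℱ X a g 𝔤 L γ) {n p : ℕ} (hn : n ≠ 0)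
    (hp : p ≠ 0) (t : ℝ≥0) :
    Integrable (fun ω => riemannSum X 𝔤 n p t ω - timeIntegral X 𝔤 t ω) P := by
  refine Integrable.sub (Integrable.of_bound ((h.measurable_riemannSum n p t).mono
    h.iSup_comap_le le_rfl).aestronglyMeasurable (L * (t + p / n)) (ae_of_all _ fun ω => ?_))
    (Integrable.of_bound (h.aestronglyMeasurable_timeIntegral t) (L * t)
      (ae_of_all _ fun ω => h.abs_timeIntegral_le t ω))
  rw [Real.norm_of_nonneg (h.riemannSum_nonneg n p t ω)]
  exact h.riemannSum_le hn hp t ω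

lemma integrable_riemannQuad_sub (h : LimitSetting P ℱ X a g 𝔤 L γ) {n p : ℕ} (hn : n ≠ 0)
    (hp : p ≠ 0) (u : Fin r → ℝ) (τ : Fin r → ℝ≥0) :
    Integrable (fun ω => riemannQuad X 𝔤 n p u τ ω - quadVar X 𝔤 u τ ω) P := by
  have e : (fun ω => riemannQuad X 𝔤 n p u τ ω - quadVar X 𝔤 u τ ω)
      = fun ω => ∑ j, ∑ l, u j * u l * (riemannSum X 𝔤 n p (min (τ j) (τ l)) ω
        - timeIntegral X 𝔤 (min (τ j) (τ l)) ω) := by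
    ext ω
    simp only [riemannQuad, quadVar, mul_sub, Finset.sum_sub_distrib]
  rw [e]
  exact integrable_finsetSum _ fun j _ => integrable_finsetSum _ fun l _ =>
    (h.integrable_riemannSum_sub hn hp _).const_mul _

theorem tendsto_integral_abs_riemannQuad_sub (h : LimitSetting P ℱ X a g 𝔤 L γ) {p : ℕ}
    (hp : p ≠ 0) (u : Fin r → ℝ) (τ : Fin r → ℝ≥0) :
    Tendsto (fun n => ∫ ω, |riemannQuad X 𝔤 n p u τ ω - quadVar X 𝔤 u τ ω| ∂P) atTop (𝓝 0) := by
  have lim : Tendsto (fun n => ∑ j, ∑ l, |u j * u l| *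
      ∫ ω, |riemannSum X 𝔤 n p (min (τ j) (τ l)) ω - timeIntegral X 𝔤 (min (τ j) (τ l)) ω| ∂P)
      atTop (𝓝 0) := by
    have := tendsto_finsetSum Finset.univ fun j _ => tendsto_finsetSum Finset.univ fun l _ =>
      (h.tendsto_integral_abs_riemannSum_sub hp (min (τ j) (τ l))).const_mul |u j * u l|
    simpa using this
  refine squeeze_zero' (Eventually.of_forall fun n => integral_nonneg fun _ => abs_nonneg _) ?_ lim
  filter_upwards [eventually_ne_atTop 0] with n hn
  have hi : ∀ j l, Integrable (fun ω => |u j * u l| * |riemannSum X 𝔤 n p (min (τ j) (τ l)) ω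
      - timeIntegral X 𝔤 (min (τ j) (τ l)) ω|) P := fun j l =>
    (h.integrable_riemannSum_sub hn hp _).abs.const_mul _
  simp_rw [← integral_const_mul]
  rw [Finset.sum_congr rfl fun j _ => (integral_finsetSum _ fun l _ => hi j l).symm,
    ← integral_finsetSum _ fun j _ => integrable_finsetSum _ fun l _ => hi j l]
  refine integral_mono_of_nonneg (ae_of_all _ fun _ => abs_nonneg _)
    (integrable_finsetSum _ fun j _ => integrable_finsetSum _ fun l _ => hi j l)
    (ae_of_all _ fun ω => ?_)
  simp only [riemannQuad, quadVar, ← Finset.sum_sub_distrib, ← mul_sub]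
  refine (Finset.abs_sum_le_sum_abs _ _).trans (Finset.sum_le_sum fun j _ => ?_)
  refine (Finset.abs_sum_le_sum_abs _ _).trans (Finset.sum_le_sum fun l _ => ?_)
  rw [abs_mul]

/-- The product of the block factors in closed form. -/
lemma integral_prod_eq (S : Finset ℝ≥0) (v : ℝ≥0 → EuclideanSpace ℝ (Fin d))
    (u : Fin r → ℝ) (τ : Fin r → ℝ≥0) (n p B : ℕ) (hS : ∀ s ∈ S, numBlocks n p s ≤ B)
    (hτ : ∀ j, numBlocks n p (τ j) ≤ B) (ω : Ω) :
    (∏ b ∈ Finset.range B, Complex.exp ((inner ℝ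
          (∑ s ∈ S, if b < numBlocks n p s then v s else 0)
          (X ((((b + 1) * p : ℕ) : ℝ≥0) / n) ω - X (((b * p : ℕ) : ℝ≥0) / n) ω) : ℝ) * Complex.I))
        * (∏ b ∈ Finset.range B, blockExp P X a g 𝔤 n p
            (∑ j, if b < numBlocks n p (τ j) then u j else 0) (X (((b * p : ℕ) : ℝ≥0) / n) ω)
            (futureIncrements X n (b * p) ω) - 1)
      = Complex.exp (((∑ s ∈ S, inner ℝ (v s)
          (X (((numBlocks n p s * p : ℕ) : ℝ≥0) / n) ω - X 0 ω) : ℝ) : ℂ) * Complex.I)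
        * (Complex.exp (((riemannQuad X 𝔤 n p u τ ω / 2 : ℝ) : ℂ) + ((∑ j, u j *
            ((√n)⁻¹ * ∑ b ∈ Finset.range (numBlocks n p (τ j)), blockTerm P X a g n p b ω) : ℝ) : ℂ)
            * Complex.I) - 1) := by
  congr 2
  · rw [← Complex.exp_sum, ← Finset.sum_mul, ← Complex.ofReal_sum]
    have := sum_inner_telescope S v (numBlocks n p) hS (fun b => X (((b * p : ℕ) : ℝ≥0) / n) ω)
    rw [this]
    simp
  · simp only [blockExp]
    rw [← Complex.exp_sum, Finset.sum_add_distrib, ← Finset.sum_mul, ← Complex.ofReal_sum,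
      ← Complex.ofReal_sum]
    congr 4
    · have h1 := sum_sq_mul_ite_lt u (fun j => numBlocks n p (τ j)) hτ
        (fun b => (p : ℝ) / n * 𝔤 (X (((b * p : ℕ) : ℝ≥0) / n) ω))
      -- The number of blocks is monotone in time and therefore commutes with minima.
      have h2 : ∀ j l, min (numBlocks n p (τ j)) (numBlocks n p (τ l))
          = numBlocks n p (min (τ j) (τ l)) := fun j l =>
        (Monotone.map_min (f := numBlocks n p) fun s t hst => numBlocks_mono hst).symm
      simp only [h2] at h1
      rw [riemannQuad]
      simp only [riemannSum]
      rw [← h1, Finset.sum_div]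
      exact Finset.sum_congr rfl fun b _ => by ring
    · have h1 := sum_mul_ite_lt u (fun j => numBlocks n p (τ j)) hτ
        (fun b => (√(n : ℝ))⁻¹ * blockTerm P X a g n p b ω)
      simp only [Finset.mul_sum] at h1 ⊢
      rw [← h1]
      refine Finset.sum_congr rfl fun b _ => ?_
      rw [blockTerm]
      ring

end LimitSetting

end CharFun

end LevyHF

namespace LevyHF

/-! ### Passage to the limit in the weighted characteristic functions -/

section CharFunLimit

variable {Ω : Type*} {mΩ : MeasurableSpace Ω} {P : Measure Ω} [IsProbabilityMeasure P]
  {ℱ : Filtration ℝ≥0 mΩ} {d m r : ℕ}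
  {X : ℝ≥0 → Ω → EuclideanSpace ℝ (Fin d)} {a : ℕ → ℝ}
  {g : EuclideanSpace ℝ (Fin d) → (Fin (m + 1) → EuclideanSpace ℝ (Fin d)) → ℝ}
  {𝔤 : EuclideanSpace ℝ (Fin d) → ℝ} {L γ : ℝ}

/-- The exponential `exp (R / 2 + i ∑_j u_j Z_{τ_j})` minus one, where `R` is the limiting
conditional variance. -/
noncomputable def compensatedExp (P : Measure Ω) (X : ℝ≥0 → Ω → EuclideanSpace ℝ (Fin d))
    (a : ℕ → ℝ) (g : EuclideanSpace ℝ (Fin d) → (Fin (m + 1) → EuclideanSpace ℝ (Fin d)) → ℝ)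
    (𝔤 : EuclideanSpace ℝ (Fin d) → ℝ) (u : Fin r → ℝ) (τ : Fin r → ℝ≥0) (n : ℕ) (ω : Ω) : ℂ :=
  Complex.exp (((quadVar X 𝔤 u τ ω / 2 : ℝ) : ℂ)
    + ((∑ j, u j * centredSum P X a g n (τ j) ω : ℝ) : ℂ) * Complex.I) - 1

/-- A bound for half the limiting conditional variance. -/
noncomputable def quadBound (u : Fin r → ℝ) (τ : Fin r → ℝ≥0) (L : ℝ) : ℝ :=
  (∑ j, ∑ l, |u j| * |u l|) * (L * (∑ j, (τ j : ℝ) + 1))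

lemma le_sum_of_fin (τ : Fin r → ℝ≥0) (j : Fin r) : (τ j : ℝ) ≤ ∑ j, (τ j : ℝ) :=
  Finset.single_le_sum (f := fun j => (τ j : ℝ)) (fun _ _ => NNReal.coe_nonneg _)
    (Finset.mem_univ j)

namespace LimitSetting

lemma abs_quadVar_le (h : LimitSetting P ℱ X a g 𝔤 L γ) (u : Fin r → ℝ) (τ : Fin r → ℝ≥0)
    (ω : Ω) : |quadVar X 𝔤 u τ ω| ≤ quadBound u τ L := by
  have hL := h.const_nonneg
  refine abs_sum_sum_mul_min_le (f := fun t => timeIntegral X 𝔤 t ω) u τ fun j l =>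
    (h.abs_timeIntegral_le _ ω).trans (mul_le_mul_of_nonneg_left ?_ hL)
  have h1 : ((min (τ j) (τ l) : ℝ≥0) : ℝ) ≤ τ j := min_le_left _ _
  linarith [le_sum_of_fin τ j]

lemma abs_riemannQuad_le (h : LimitSetting P ℱ X a g 𝔤 L γ) {n p : ℕ} (hp : p ≠ 0) (hn : p ≤ n)
    (u : Fin r → ℝ) (τ : Fin r → ℝ≥0) (ω : Ω) :
    |riemannQuad X 𝔤 n p u τ ω| ≤ quadBound u τ L := by
  have hL := h.const_nonneg
  refine abs_sum_sum_mul_min_le (f := fun t => riemannSum X 𝔤 n p t ω) u τ fun j l => ?_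
  rw [abs_of_nonneg (h.riemannSum_nonneg _ _ _ _)]
  refine (h.riemannSum_le (by omega) hp _ ω).trans (mul_le_mul_of_nonneg_left ?_ hL)
  have h1 : ((min (τ j) (τ l) : ℝ≥0) : ℝ) ≤ τ j := min_le_left _ _
  have h2 : (p : ℝ) / n ≤ 1 := div_le_one_of_le₀ (by exact_mod_cast hn) (by positivity)
  linarith [le_sum_of_fin τ j]

lemma quadBound_nonneg (h : LimitSetting P ℱ X a g 𝔤 L γ) (u : Fin r → ℝ) (τ : Fin r → ℝ≥0) :
    0 ≤ quadBound u τ L := by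
  have hL := h.const_nonneg
  unfold quadBound
  positivity

lemma norm_compensatedExp_le (h : LimitSetting P ℱ X a g 𝔤 L γ) (u : Fin r → ℝ) (τ : Fin r → ℝ≥0)
    (n : ℕ) (ω : Ω) :
    ‖compensatedExp P X a g 𝔤 u τ n ω‖ ≤ Real.exp (quadBound u τ L) + 1 := by
  refine (norm_sub_le _ _).trans ?_
  rw [norm_one, Complex.exp_add, norm_mul, Complex.norm_exp_ofReal_mul_I, mul_one,
    Complex.norm_exp_ofReal]
  have h1 := (le_abs_self _).trans (h.abs_quadVar_le u τ ω)
  have h2 := h.quadBound_nonneg u τ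
  gcongr
  linarith

lemma aestronglyMeasurable_compensatedExp (h : LimitSetting P ℱ X a g 𝔤 L γ) (u : Fin r → ℝ)
    (τ : Fin r → ℝ≥0) (n : ℕ) : AEStronglyMeasurable (compensatedExp P X a g 𝔤 u τ n) P := by
  have h1 : AEMeasurable (quadVar X 𝔤 u τ) P := (h.aestronglyMeasurable_quadVar u τ).aemeasurable
  have h2 : Measurable fun ω => ∑ j, u j * centredSum P X a g n (τ j) ω :=
    Finset.measurable_fun_sum _ fun j _ => (h.measurable_centredSum n (τ j)).const_mul _
  exact ((Complex.measurable_exp.comp_aemeasurable ((Complex.measurable_ofReal.comp_aemeasurable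
    (h1.div_const 2)).add ((Complex.measurable_ofReal.comp h2).aemeasurable.mul_const
      Complex.I))).sub_const 1).aestronglyMeasurable

lemma norm_phaseExp_sub_le {S : Finset ℝ≥0} {v : ℝ≥0 → EuclideanSpace ℝ (Fin d)}
    {t : ℝ≥0 → ℝ≥0} {ω : Ω} (h0 : X 0 ω = 0) :
    ‖phaseExp X S v ω
        - Complex.exp (((∑ s ∈ S, inner ℝ (v s) (X (t s) ω - X 0 ω) : ℝ) : ℂ) * Complex.I)‖
      ≤ ∑ s ∈ S, (2 + ‖v s‖) * min 1 ‖X (t s) ω - X s ω‖ := by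
  rw [phaseExp, norm_cexp_mul_I_sub_le, ← Finset.sum_sub_distrib]
  refine (norm_cexp_sum_sub_one_le _ _).trans (Finset.sum_le_sum fun s _ => ?_)
  rw [← inner_sub_right, h0, sub_zero, norm_sub_rev (X (t s) ω)]
  exact norm_cexp_inner_sub_one_le _ _

/-- The integrand is compared with the telescoped block product through three errors: moving the
times s to the block grid, replacing the statistic by block sums, and replacing the time integrals
by Riemann sums. The first and third vanish as n grows; the second is O(p^{-1/2}). -/
theorem exists_norm_integral_phaseExp_mul_le (h : LimitSetting P ℱ X a g 𝔤 L γ) (u : Fin r → ℝ)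
    (τ : Fin r → ℝ≥0) (S : Finset ℝ≥0) (v : ℝ≥0 → EuclideanSpace ℝ (Fin d)) :
    ∃ c : ℝ, ∀ p, m < p → ∀ᶠ n : ℕ in atTop,
      ‖∫ ω, phaseExp X S v ω * compensatedExp P X a g 𝔤 u τ n ω ∂P‖ ≤ c / √p := by
  have hL := h.const_nonneg
  have hγ : 0 < γ := by linarith [h.half_lt]
  -- A horizon beyond all the times involved. Rounding it up to full blocks costs at most 1 when p ≤
  -- n, hence T + 1 below.
  set T : ℝ≥0 := ∑ s ∈ S, s + ∑ j, τ j with hT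
  have hTS : ∀ s ∈ S, s ≤ T := fun s hs =>
    (Finset.single_le_sum (f := fun s : ℝ≥0 => s) (fun _ _ => zero_le) hs).trans
      (le_add_of_nonneg_right zero_le)
  have hTτ : ∀ j, τ j ≤ T := fun j =>
    (Finset.single_le_sum (f := τ) (fun _ _ => zero_le) (Finset.mem_univ j)).trans
      (le_add_of_nonneg_left zero_le)
  obtain ⟨c₀, hc₀⟩ := h.exists_norm_integral_prod_le (∑ j, |u j|) (∑ s ∈ S, ‖v s‖) (T + 1)
  choose c₁ hc₁ using fun j => h.exists_integral_centredSum_sub_le (τ j)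
  set M := quadBound u τ L with hM
  have hM0 : 0 ≤ M := h.quadBound_nonneg u τ
  -- The constant c₀ comes from the block product, the two units from the vanishing errors, and the
  -- sum from the block approximation of the statistic at each τ_j.
  refine ⟨|c₀| + 1 + Real.exp M * ∑ j, |u j| * c₁ j + 1, fun p hp => ?_⟩
  have hp0 : p ≠ 0 := by omega
  have hpp : (0 : ℝ) < p := by positivity
  have hsp : 0 < 1 / √(p : ℝ) := by positivity
  have lim1 : Tendsto (fun n : ℕ => (Real.exp M + 1) *
      ∑ s ∈ S, (2 + ‖v s‖) * (L * ((p : ℝ) / n) ^ γ)) atTop (𝓝 0) := by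
    have h0 : Tendsto (fun n : ℕ => ((p : ℝ) / n) ^ γ) atTop (𝓝 0) := by
      have := (tendsto_const_div_atTop_nhds_zero_nat (p : ℝ)).rpow_const (p := γ) (Or.inr hγ.le)
      rwa [Real.zero_rpow hγ.ne'] at this
    have := (tendsto_finsetSum S fun s _ =>
      (h0.const_mul L).const_mul (2 + ‖v s‖)).const_mul (Real.exp M + 1)
    simpa using this
  have lim2 : Tendsto (fun n : ℕ => Real.exp M *
      ∫ ω, |riemannQuad X 𝔤 n p u τ ω - quadVar X 𝔤 u τ ω| ∂P) atTop (𝓝 0) := by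
    simpa using (h.tendsto_integral_abs_riemannQuad_sub hp0 u τ).const_mul (Real.exp M)
  filter_upwards [eventually_ge_atTop p, hc₀ p hp, eventually_all.2 fun j => hc₁ j p hp,
    lim1.eventually (gt_mem_nhds hsp), lim2.eventually (gt_mem_nhds hsp)] with n hn hn0 hn1 hn2 hn3
  have hnz : n ≠ 0 := by omega
  have hnn : (0 : ℝ) < n := by positivity
  set t : ℝ≥0 → ℝ≥0 := fun s => ((numBlocks n p s * p : ℕ) : ℝ≥0) / n with ht
  set E : Ω → ℂ := fun ω => Complex.exp
    (((∑ s ∈ S, inner ℝ (v s) (X (t s) ω - X 0 ω) : ℝ) : ℂ) * Complex.I) with hE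
  set Zp : Fin r → Ω → ℝ := fun j ω => (√n)⁻¹ *
    ∑ b ∈ Finset.range (numBlocks n p (τ j)), blockTerm P X a g n p b ω with hZp
  set D' : Ω → ℂ := fun ω => Complex.exp (((riemannQuad X 𝔤 n p u τ ω / 2 : ℝ) : ℂ)
    + ((∑ j, u j * Zp j ω : ℝ) : ℂ) * Complex.I) - 1 with hD'
  -- the telescoped product
  have main : ‖∫ ω, E ω * D' ω ∂P‖ ≤ c₀ / p := by
    have hB : (numBlocks n p T : ℝ) * p ≤ n * (T + 1) := by
      have h1 : ((numBlocks n p T * p : ℕ) : ℝ) ≤ n * T + p := by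
        exact_mod_cast numBlocks_mul_le (n := n) hp0 T
      have h2 : (p : ℝ) ≤ n := by exact_mod_cast hn
      push_cast at h1
      linarith
    have := hn0 (numBlocks n p T) (fun b => ∑ j, if b < numBlocks n p (τ j) then u j else 0)
      (fun b => ∑ s ∈ S, if b < numBlocks n p s then v s else 0) (fun b => ?_) (fun b => ?_) hB
    · simp_rw [integral_prod_eq S v u τ n p (numBlocks n p T)
        (fun s hs => numBlocks_mono (hTS s hs)) (fun j => numBlocks_mono (hTτ j))] at this
      exact this
    · refine (Finset.abs_sum_le_sum_abs _ _).trans (Finset.sum_le_sum fun j _ => ?_)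
      split_ifs <;> simp
    · refine (norm_sum_le _ _).trans (Finset.sum_le_sum fun s _ => ?_)
      split_ifs <;> simp
  -- measurability and integrability
  have hBm : ∀ j, Measurable (Zp j) := fun j => (Finset.measurable_fun_sum _ fun b _ =>
    (h.measurable_blockTerm n p b hp).mono (ℱ.le _) le_rfl).const_mul _
  have hRm : Measurable (riemannQuad X 𝔤 n p u τ) :=
    (h.measurable_riemannQuad n p u τ).mono h.iSup_comap_le le_rfl
  have hEm : Measurable E := by
    have : Measurable fun ω => ∑ s ∈ S, inner ℝ (v s) (X (t s) ω - X 0 ω) :=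
      Finset.measurable_fun_sum _ fun s _ => ((h.measurable _).sub (h.measurable _)).const_inner
    fun_prop
  have hD'm : Measurable D' := by
    have : Measurable fun ω => ∑ j, u j * Zp j ω :=
      Finset.measurable_fun_sum _ fun j _ => (hBm j).const_mul _
    fun_prop
  have hR1 : ∀ ω, riemannQuad X 𝔤 n p u τ ω / 2 ≤ M := fun ω => by
    have := (le_abs_self _).trans (h.abs_riemannQuad_le hp0 hn u τ ω)
    linarith
  have hR2 : ∀ ω, quadVar X 𝔤 u τ ω / 2 ≤ M := fun ω => by
    have := (le_abs_self _).trans (h.abs_quadVar_le u τ ω)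
    linarith
  have hD'b : ∀ ω, ‖D' ω‖ ≤ Real.exp M + 1 := fun ω => by
    refine (norm_sub_le _ _).trans ?_
    rw [norm_one, Complex.exp_add, norm_mul, Complex.norm_exp_ofReal_mul_I, mul_one,
      Complex.norm_exp_ofReal]
    have := hR1 ω
    gcongr
  have hE1 : ∀ ω, ‖E ω‖ = 1 := fun ω => Complex.norm_exp_ofReal_mul_I _
  have hi1 : Integrable (fun ω => E ω * D' ω) P :=
    Integrable.of_bound (by fun_prop) (1 * (Real.exp M + 1)) (ae_of_all _ fun ω => by
      rw [norm_mul, hE1 ω]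
      exact mul_le_mul_of_nonneg_left (hD'b ω) zero_le_one)
  have hi2 : Integrable (fun ω => phaseExp X S v ω * compensatedExp P X a g 𝔤 u τ n ω) P :=
    Integrable.of_bound ((measurable_phaseExp h.levy.measurable S v).aestronglyMeasurable.mul
      (h.aestronglyMeasurable_compensatedExp u τ n)) (1 * (Real.exp M + 1))
      (ae_of_all _ fun ω => by
        rw [norm_mul, norm_phaseExp]
        exact mul_le_mul_of_nonneg_left (h.norm_compensatedExp_le u τ n ω) zero_le_one)
  have hCi : ∀ j, Integrable (fun ω => |centredSum P X a g n (τ j) ω - Zp j ω|) P := fun j => by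
    refine (Integrable.of_bound ((h.measurable_centredSum n (τ j)).sub (hBm j)).aestronglyMeasurable
      ((√n)⁻¹ * (⌊(n : ℝ≥0) * τ j⌋₊ * (2 * L)) + (√n)⁻¹ * (numBlocks n p (τ j) * (p * (2 * L))))
      (ae_of_all _ fun ω => ?_)).abs
    have hb : ∀ {f : ℕ → ℝ} {N : ℕ} {q : ℝ}, (∀ i, |f i| ≤ q) →
        ‖(√(n : ℝ))⁻¹ * ∑ i ∈ Finset.range N, f i‖ ≤ (√n)⁻¹ * (N * q) := fun {f N q} hf => by
      rw [norm_mul, Real.norm_of_nonneg (by positivity)]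
      refine mul_le_mul_of_nonneg_left ((norm_sum_le _ _).trans
        ((Finset.sum_le_card_nsmul _ _ q fun i _ => hf i).trans ?_)) (by positivity)
      simp
    exact (norm_sub_le _ _).trans (add_le_add (hb fun i => h.abs_centred_le _ _ _ _)
      (hb fun i => h.abs_blockSum_le _ _ _ _))
  -- the pointwise comparison
  set F₁ : Ω → ℝ := fun ω => ∑ s ∈ S, (2 + ‖v s‖) * min 1 ‖X (t s) ω - X s ω‖ with hF₁
  set F₂ : Ω → ℝ := fun ω => ∑ j, |u j| * |centredSum P X a g n (τ j) ω - Zp j ω| with hF₂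
  set F₃ : Ω → ℝ := fun ω => |riemannQuad X 𝔤 n p u τ ω - quadVar X 𝔤 u τ ω| with hF₃
  have hF₁i : Integrable F₁ P := integrable_finsetSum _ fun s _ => (h.integrable_min _ _).const_mul _
  have hF₂i : Integrable F₂ P := integrable_finsetSum _ fun j _ => (hCi j).const_mul _
  have hF₃i : Integrable F₃ P := (h.integrable_riemannQuad_sub hnz hp0 u τ).abs
  have hpt : ∀ᵐ ω ∂P, ‖phaseExp X S v ω * compensatedExp P X a g 𝔤 u τ n ω - E ω * D' ω‖
      ≤ (Real.exp M + 1) * F₁ ω + Real.exp M * F₂ ω + Real.exp M * F₃ ω := by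
    -- Telescoping produces X_t - X_0; the phase involves X_t alone, and X_0 = 0 holds almost
    -- surely.
    filter_upwards [h.levy.zero] with ω h0
    have e : phaseExp X S v ω * compensatedExp P X a g 𝔤 u τ n ω - E ω * D' ω
        = (phaseExp X S v ω - E ω) * compensatedExp P X a g 𝔤 u τ n ω
          + E ω * (compensatedExp P X a g 𝔤 u τ n ω - D' ω) := by ring
    rw [e, add_assoc]
    refine (norm_add_le _ _).trans (add_le_add ?_ ?_)
    · rw [norm_mul, mul_comm]
      exact mul_le_mul (h.norm_compensatedExp_le u τ n ω) (norm_phaseExp_sub_le h0)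
        (norm_nonneg _) (by positivity)
    · rw [norm_mul, hE1 ω, one_mul, ← mul_add]
      have e2 : compensatedExp P X a g 𝔤 u τ n ω - D' ω
          = Complex.exp (((quadVar X 𝔤 u τ ω / 2 : ℝ) : ℂ)
              + ((∑ j, u j * centredSum P X a g n (τ j) ω : ℝ) : ℂ) * Complex.I)
            - Complex.exp (((riemannQuad X 𝔤 n p u τ ω / 2 : ℝ) : ℂ)
              + ((∑ j, u j * Zp j ω : ℝ) : ℂ) * Complex.I) := by
        simp only [compensatedExp, hD']; ring
      rw [e2]
      refine (norm_cexp_sub_cexp_le (hR2 ω) (hR1 ω)).trans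
        (mul_le_mul_of_nonneg_left (add_le_add ?_ ?_) (Real.exp_pos M).le)
      · rw [← Finset.sum_sub_distrib]
        refine (Finset.abs_sum_le_sum_abs _ _).trans (Finset.sum_le_sum fun j _ => ?_)
        rw [← mul_sub, abs_mul]
      · have e3 : quadVar X 𝔤 u τ ω / 2 - riemannQuad X 𝔤 n p u τ ω / 2
            = -((riemannQuad X 𝔤 n p u τ ω - quadVar X 𝔤 u τ ω) / 2) := by ring
        rw [e3, abs_neg, abs_div, abs_two]
        exact half_le_self (abs_nonneg _)
  have hdiff : ‖∫ ω, phaseExp X S v ω * compensatedExp P X a g 𝔤 u τ n ω ∂P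
      - ∫ ω, E ω * D' ω ∂P‖
      ≤ (Real.exp M + 1) * ∫ ω, F₁ ω ∂P + Real.exp M * ∫ ω, F₂ ω ∂P + Real.exp M * ∫ ω, F₃ ω ∂P := by
    rw [← integral_sub hi2 hi1]
    refine (norm_integral_le_of_norm_le (((hF₁i.const_mul _).add (hF₂i.const_mul _)).add
      (hF₃i.const_mul _)) hpt).trans (le_of_eq ?_)
    simp only [Pi.add_apply]
    rw [integral_add (f := fun ω => (Real.exp M + 1) * F₁ ω + Real.exp M * F₂ ω)
      ((hF₁i.const_mul _).add (hF₂i.const_mul _)) (hF₃i.const_mul _),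
      integral_add (hF₁i.const_mul _) (hF₂i.const_mul _), integral_const_mul, integral_const_mul,
      integral_const_mul]
  have b1 : (Real.exp M + 1) * ∫ ω, F₁ ω ∂P ≤ 1 / √p := by
    refine le_trans (mul_le_mul_of_nonneg_left ?_ (by positivity)) hn2.le
    rw [integral_finsetSum _ fun s _ => (h.integrable_min _ _).const_mul _]
    refine Finset.sum_le_sum fun s _ => ?_
    rw [integral_const_mul]
    refine mul_le_mul_of_nonneg_left ?_ (by positivity)
    have := h.integral_min_le (le_numBlocks_mul_div hnz hp0 s) (numBlocks_mul_div_le hnz hp0 s)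
    push_cast at this
    simpa [ht] using this
  have b2 : ∫ ω, F₂ ω ∂P ≤ (∑ j, |u j| * c₁ j) / √p := by
    rw [integral_finsetSum _ fun j _ => (hCi j).const_mul _, Finset.sum_div]
    refine Finset.sum_le_sum fun j _ => ?_
    rw [integral_const_mul, mul_div_assoc]
    exact mul_le_mul_of_nonneg_left (hn1 j) (abs_nonneg _)
  have b0 : c₀ / p ≤ |c₀| / √p := by
    have h1 : (1 : ℝ) ≤ p := by exact_mod_cast Nat.one_le_iff_ne_zero.2 hp0
    have h2 : √(p : ℝ) ≤ p := by
      rw [Real.sqrt_le_left hpp.le]; nlinarith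
    refine (div_le_div_of_nonneg_right (le_abs_self c₀) hpp.le).trans ?_
    exact div_le_div_of_nonneg_left (abs_nonneg _) (by positivity) h2
  have b2' := mul_le_mul_of_nonneg_left b2 (Real.exp_pos M).le
  have hfin := norm_le_insert' (∫ ω, phaseExp X S v ω * compensatedExp P X a g 𝔤 u τ n ω ∂P)
    (∫ ω, E ω * D' ω ∂P)
  have e : (|c₀| + 1 + Real.exp M * ∑ j, |u j| * c₁ j + 1) / √(p : ℝ)
      = |c₀| / √p + 1 / √p + Real.exp M * ((∑ j, |u j| * c₁ j) / √p) + 1 / √p := by ring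
  rw [e]
  linarith

theorem tendsto_integral_phaseExp_mul (h : LimitSetting P ℱ X a g 𝔤 L γ) (u : Fin r → ℝ)
    (τ : Fin r → ℝ≥0) (S : Finset ℝ≥0) (v : ℝ≥0 → EuclideanSpace ℝ (Fin d)) :
    Tendsto (fun n => ∫ ω, phaseExp X S v ω * compensatedExp P X a g 𝔤 u τ n ω ∂P) atTop
      (𝓝 0) := by
  obtain ⟨c, hc⟩ := h.exists_norm_integral_phaseExp_mul_le u τ S v
  rw [Metric.tendsto_atTop]
  intro ε hε
  have lim : Tendsto (fun p : ℕ => c / √(p : ℝ)) atTop (𝓝 0) := by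
    have : Tendsto (fun p : ℕ => (√(p : ℝ))⁻¹) atTop (𝓝 0) :=
      (Real.tendsto_sqrt_atTop.comp tendsto_natCast_atTop_atTop).inv_tendsto_atTop
    simpa [div_eq_mul_inv] using this.const_mul c
  -- The integral does not involve p: the block length is fixed first to make the bound small, and
  -- then n is taken large.
  obtain ⟨p, hp1, hp2⟩ := ((lim.eventually (gt_mem_nhds hε)).and (eventually_gt_atTop m)).exists
  obtain ⟨N, hN⟩ := eventually_atTop.1 (hc p hp2)
  refine ⟨N, fun n hn => ?_⟩
  rw [dist_zero_right]
  exact (hN n hn).trans_lt hp1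

/-- Joint convergence of the statistic with the process `X`, in terms of characteristic
functions. -/
theorem tendsto_integral_mul_cexp (h : LimitSetting P ℱ X a g 𝔤 L γ) (u : Fin r → ℝ)
    (τ : Fin r → ℝ≥0) {F : Ω → ℝ}
    (hF : Measurable[⨆ t, MeasurableSpace.comap (X t) inferInstance] F) {C : ℝ}
    (hFC : ∀ ω, |F ω| ≤ C) :
    Tendsto (fun n => ∫ ω, (F ω : ℂ) *
        Complex.exp (((∑ j, u j * centredSum P X a g n (τ j) ω : ℝ) : ℂ) * Complex.I) ∂P) atTop
      (𝓝 (∫ ω, (F ω : ℂ) * Complex.exp ((-(quadVar X 𝔤 u τ ω / 2) : ℝ) : ℂ) ∂P)) := by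
  set M := quadBound u τ L with hM
  have hM0 : 0 ≤ M := h.quadBound_nonneg u τ
  have hC0 : 0 ≤ C := by
    obtain ⟨ω⟩ := nonempty_of_isProbabilityMeasure P
    exact (abs_nonneg _).trans (hFC ω)
  have hFm : Measurable F := hF.mono h.iSup_comap_le le_rfl
  have hVm : AEMeasurable (quadVar X 𝔤 u τ) P := (h.aestronglyMeasurable_quadVar u τ).aemeasurable
  have hZm : ∀ n, Measurable fun ω => ∑ j, u j * centredSum P X a g n (τ j) ω := fun n =>
    Finset.measurable_fun_sum _ fun j _ => (h.measurable_centredSum n (τ j)).const_mul _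
  have hexpb : ∀ {x : ℝ}, |x| ≤ M → ‖Complex.exp ((-(x / 2) : ℝ) : ℂ)‖ ≤ Real.exp M := fun {x} hx => by
    rw [Complex.norm_exp_ofReal]
    gcongr
    linarith [neg_abs_le x]
  -- The intended weight is F exp(-Q/2), but Q is only shown to be a.e. measurable. Its Riemann
  -- approximation of mesh 1/k, with blocks of length one, is σ(X)-measurable as it stands.
  have hdens : ∀ k : ℕ, k ≠ 0 → Tendsto (fun n => ∫ ω, ((F ω : ℂ) *
      Complex.exp ((-(riemannQuad X 𝔤 k 1 u τ ω / 2) : ℝ) : ℂ)) * compensatedExp P X a g 𝔤 u τ n ω ∂P)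
      atTop (𝓝 0) := fun k hk => by
    refine tendsto_integral_mul_zero_of_phaseExp h.levy.measurable
      (h.aestronglyMeasurable_compensatedExp u τ)
      (fun n => ae_of_all _ (h.norm_compensatedExp_le u τ n)) (h.tendsto_integral_phaseExp_mul u τ)
      (C := C * Real.exp M) ?_ fun ω => ?_
    · have := h.measurable_riemannQuad k 1 u τ
      refine Measurable.mul (Complex.measurable_ofReal.comp hF) (Complex.measurable_exp.comp
        (Complex.measurable_ofReal.comp (this.div_const 2).neg))
    · rw [norm_mul, Complex.norm_real]
      exact mul_le_mul (hFC ω) (hexpb (h.abs_riemannQuad_le one_ne_zero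
        (Nat.one_le_iff_ne_zero.2 hk) u τ ω)) (norm_nonneg _) hC0
  -- The Riemann sums are exchanged for Q with an error uniform in n, because the compensated
  -- exponentials are bounded.
  have hlim0 : Tendsto (fun n => ∫ ω, ((F ω : ℂ) *
      Complex.exp ((-(quadVar X 𝔤 u τ ω / 2) : ℝ) : ℂ)) * compensatedExp P X a g 𝔤 u τ n ω ∂P)
      atTop (𝓝 0) := by
    set c := C * Real.exp M * (Real.exp M + 1) with hc
    have hc0 : 0 ≤ c := by positivity
    have hlimk := (h.tendsto_integral_abs_riemannQuad_sub one_ne_zero u τ).const_mul c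
    rw [mul_zero] at hlimk
    rw [Metric.tendsto_atTop]
    intro ε hε
    obtain ⟨k, hk1, hk⟩ := ((hlimk.eventually (gt_mem_nhds (half_pos hε))).and
      (eventually_ne_atTop 0)).exists
    obtain ⟨N, hN⟩ := Metric.tendsto_atTop.1 (hdens k hk) (ε / 2) (half_pos hε)
    refine ⟨N, fun n hn => ?_⟩
    have hNn := hN n hn
    rw [dist_zero_right] at hNn ⊢
    have hRm : Measurable (riemannQuad X 𝔤 k 1 u τ) :=
      (h.measurable_riemannQuad k 1 u τ).mono h.iSup_comap_le le_rfl
    have hcm := (h.aestronglyMeasurable_compensatedExp (P := P) (a := a) (g := g) u τ n).aemeasurable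
    have hint : ∀ {f : Ω → ℝ}, AEMeasurable f P → (∀ ω, |f ω| ≤ M) →
        Integrable (fun ω => ((F ω : ℂ) * Complex.exp ((-(f ω / 2) : ℝ) : ℂ)) *
          compensatedExp P X a g 𝔤 u τ n ω) P := fun {f} hf hfM => by
      refine Integrable.of_bound (AEMeasurable.aestronglyMeasurable (by fun_prop))
        (C * Real.exp M * (Real.exp M + 1)) (ae_of_all _ fun ω => ?_)
      rw [norm_mul, norm_mul, Complex.norm_real]
      exact mul_le_mul (mul_le_mul (hFC ω) (hexpb (hfM ω)) (norm_nonneg _) hC0)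
        (h.norm_compensatedExp_le u τ n ω) (norm_nonneg _) (by positivity)
    have hd : ‖∫ ω, ((F ω : ℂ) * Complex.exp ((-(quadVar X 𝔤 u τ ω / 2) : ℝ) : ℂ)) *
          compensatedExp P X a g 𝔤 u τ n ω ∂P
        - ∫ ω, ((F ω : ℂ) * Complex.exp ((-(riemannQuad X 𝔤 k 1 u τ ω / 2) : ℝ) : ℂ)) *
          compensatedExp P X a g 𝔤 u τ n ω ∂P‖ < ε / 2 := by
      rw [← integral_sub (hint hVm (h.abs_quadVar_le u τ)) (hint hRm.aemeasurable
        (h.abs_riemannQuad_le one_ne_zero (Nat.one_le_iff_ne_zero.2 hk) u τ))]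
      refine lt_of_le_of_lt ?_ hk1
      rw [← integral_const_mul]
      refine norm_integral_le_of_norm_le ((h.integrable_riemannQuad_sub hk one_ne_zero u
        τ).abs.const_mul _) (ae_of_all _ fun ω => ?_)
      rw [← sub_mul, ← mul_sub, norm_mul, norm_mul, Complex.norm_real]
      have e1 : ‖Complex.exp ((-(quadVar X 𝔤 u τ ω / 2) : ℝ) : ℂ)
          - Complex.exp ((-(riemannQuad X 𝔤 k 1 u τ ω / 2) : ℝ) : ℂ)‖
          ≤ Real.exp M * |riemannQuad X 𝔤 k 1 u τ ω - quadVar X 𝔤 u τ ω| := by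
        rw [← Complex.ofReal_exp, ← Complex.ofReal_exp, ← Complex.ofReal_sub, Complex.norm_real]
        have h1 := h.abs_quadVar_le u τ ω
        have h2 := h.abs_riemannQuad_le one_ne_zero (Nat.one_le_iff_ne_zero.2 hk) u τ ω
        refine (abs_exp_sub_exp_le (M := M) (by linarith [neg_abs_le (quadVar X 𝔤 u τ ω)])
          (by linarith [neg_abs_le (riemannQuad X 𝔤 k 1 u τ ω)])).trans ?_
        refine mul_le_mul_of_nonneg_left ?_ (Real.exp_pos M).le
        have e3 : -(quadVar X 𝔤 u τ ω / 2) - -(riemannQuad X 𝔤 k 1 u τ ω / 2)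
            = (riemannQuad X 𝔤 k 1 u τ ω - quadVar X 𝔤 u τ ω) / 2 := by ring
        rw [e3, abs_div, abs_two]
        exact half_le_self (abs_nonneg _)
      calc _ ≤ C * (Real.exp M * |riemannQuad X 𝔤 k 1 u τ ω - quadVar X 𝔤 u τ ω|)
            * (Real.exp M + 1) :=
            mul_le_mul (mul_le_mul (hFC ω) e1 (norm_nonneg _) hC0)
              (h.norm_compensatedExp_le u τ n ω) (norm_nonneg _) (by positivity)
        _ = _ := by rw [hc]; ring
    have := norm_le_insert' (∫ ω, ((F ω : ℂ) * Complex.exp ((-(quadVar X 𝔤 u τ ω / 2) : ℝ) : ℂ)) *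
          compensatedExp P X a g 𝔤 u τ n ω ∂P)
      (∫ ω, ((F ω : ℂ) * Complex.exp ((-(riemannQuad X 𝔤 k 1 u τ ω / 2) : ℝ) : ℂ)) *
          compensatedExp P X a g 𝔤 u τ n ω ∂P)
    linarith
  have hi1 : Integrable (fun ω => (F ω : ℂ) * Complex.exp ((-(quadVar X 𝔤 u τ ω / 2) : ℝ) : ℂ)) P :=
    Integrable.of_bound (AEMeasurable.aestronglyMeasurable (by fun_prop)) (C * Real.exp M)
      (ae_of_all _ fun ω => by
        rw [norm_mul, Complex.norm_real]
        exact mul_le_mul (hFC ω) (hexpb (h.abs_quadVar_le u τ ω)) (norm_nonneg _) hC0)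
  have hi2 : ∀ n, Integrable (fun ω => (F ω : ℂ) * Complex.exp
      (((∑ j, u j * centredSum P X a g n (τ j) ω : ℝ) : ℂ) * Complex.I)) P := fun n => by
    have := hZm n
    refine Integrable.of_bound (Measurable.aestronglyMeasurable (by fun_prop)) C
      (ae_of_all _ fun ω => ?_)
    rw [norm_mul, Complex.norm_real, Complex.norm_exp_ofReal_mul_I, mul_one]
    exact hFC ω
  -- The compensator cancels: exp(-Q/2) (exp(Q/2 + iZ) - 1) = exp(iZ) - exp(-Q/2).
  rw [← tendsto_sub_nhds_zero_iff]
  refine hlim0.congr fun n => ?_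
  rw [← integral_sub (hi2 n) hi1]
  refine integral_congr_ae (ae_of_all _ fun ω => ?_)
  simp only [compensatedExp]
  rw [mul_sub, mul_one, mul_assoc, ← Complex.exp_add]
  congr 3
  push_cast
  ring_nf

end LimitSetting

end CharFunLimit

end LevyHF

namespace LevyHF

/-! ### The extension carrying an independent Brownian motion -/

/-- It suffices to test on the π-system of rectangles, where an event C of the second factor turns A
× B into A × (C ∩ B). -/
lemma indep_prod_of_indep {Ω Ω₂ : Type*} {m₁ : MeasurableSpace Ω} {m₂ 𝒜 : MeasurableSpace Ω₂}
    {mΩ : MeasurableSpace Ω} {mΩ₂ : MeasurableSpace Ω₂} (h₁ : m₁ ≤ mΩ) (h₂ : m₂ ≤ mΩ₂)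
    (hA : 𝒜 ≤ mΩ₂) {P : Measure Ω} {Q : Measure Ω₂} [IsProbabilityMeasure P]
    [IsProbabilityMeasure Q] (h : Indep 𝒜 m₂ Q) :
    Indep (𝒜.comap Prod.snd) (m₁.prod m₂) (P.prod Q) := by
  have hgen : m₁.prod m₂ = MeasurableSpace.generateFrom
      (Set.image2 (· ×ˢ ·) {s : Set Ω | MeasurableSet[m₁] s} {t : Set Ω₂ | MeasurableSet[m₂] t}) :=
    (@generateFrom_prod Ω Ω₂ m₁ m₂).symm
  refine IndepSets.indep (p1 := {s | MeasurableSet[𝒜.comap Prod.snd] s}) ?_ ?_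
    (@MeasurableSpace.isPiSystem_measurableSet _ (𝒜.comap Prod.snd)) (@isPiSystem_prod Ω Ω₂ m₁ m₂)
    (@MeasurableSpace.generateFrom_measurableSet _ (𝒜.comap Prod.snd)).symm hgen ?_
  · exact (MeasurableSpace.comap_mono hA).trans le_sup_right
  · exact sup_le_sup (MeasurableSpace.comap_mono h₁) (MeasurableSpace.comap_mono h₂)
  · rw [IndepSets_iff]
    rintro _ _ ⟨C, hC, rfl⟩ ⟨A, hA', B, hB, rfl⟩
    have e1 : Prod.snd ⁻¹' C ∩ A ×ˢ B = A ×ˢ (C ∩ B) := by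
      ext ⟨x, y⟩
      simp only [Set.mem_inter_iff, Set.mem_preimage, Set.mem_prod]
      tauto
    have e2 : (Prod.snd ⁻¹' C : Set (Ω × Ω₂)) = Set.univ ×ˢ C := by
      ext ⟨x, y⟩; simp
    rw [e1, e2, Measure.prod_prod, Measure.prod_prod, Measure.prod_prod, measure_univ, one_mul,
      (Indep_iff _ _ _).1 h C B hC hB]
    ring

section Extension

variable {Ω : Type*} {mΩ : MeasurableSpace Ω}

/-- The `σ`-algebra generated by the Brownian motion up to time `t`. -/
@[reducible]
noncomputable def brownianPast (t : ℝ≥0) : MeasurableSpace (ℕ × ℕ → ℝ) :=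
  ⨆ s : Set.Iic t, MeasurableSpace.comap (brownian s) inferInstance

lemma brownianPast_le (t : ℝ≥0) : brownianPast t ≤ MeasurableSpace.pi :=
  iSup_le fun s => (measurable_brownian s).comap_le

lemma brownianPast_mono {s t : ℝ≥0} (h : s ≤ t) : brownianPast s ≤ brownianPast t :=
  iSup_le fun r => le_iSup (fun s : Set.Iic t => MeasurableSpace.comap (brownian s) inferInstance)
    ⟨r, r.2.trans h⟩

lemma measurable_brownianPast {s t : ℝ≥0} (h : s ≤ t) : Measurable[brownianPast t] (brownian s) :=
  (comap_measurable _).mono (le_iSup (fun s : Set.Iic t =>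
    MeasurableSpace.comap (brownian s) inferInstance) ⟨s, h⟩) le_rfl

/-- The whole shifted process is independent of the past, and the increment is its coordinate at t -
s. -/
lemma indep_brownian_sub {s t : ℝ≥0} (h : s ≤ t) :
    Indep (MeasurableSpace.comap (fun ω => brownian t ω - brownian s ω) inferInstance)
      (brownianPast s) gaussianSeq := by
  have h1 := isBrownianReal_brownian.indepFun_shift s
  refine indep_of_indep_of_le_left (indep_of_indep_of_le_right h1 ?_) ?_
  · refine iSup_le fun r => ?_
    have : brownian r = (fun y : Set.Iic s → ℝ => y r) ∘ fun ω (t : Set.Iic s) => brownian t ω := rfl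
    rw [this]
    exact (Measurable.comp (g := fun y : Set.Iic s → ℝ => y r) (measurable_pi_apply r)
      (comap_measurable _)).comap_le
  · have : (fun ω => brownian t ω - brownian s ω) = (fun y : ℝ≥0 → ℝ => y (t - s)) ∘
        fun ω r => brownian (s + r) ω - brownian s ω := by
      ext ω; simp [add_tsub_cancel_of_le h]
    rw [this]
    exact (Measurable.comp (g := fun y : ℝ≥0 → ℝ => y (t - s)) (measurable_pi_apply _)
      (comap_measurable _)).comap_le

/-- The product filtration on the extension. -/
noncomputable def extFiltration (ℱ : Filtration ℝ≥0 mΩ) :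
    Filtration ℝ≥0 (mΩ.prod (MeasurableSpace.pi (X := fun _ : ℕ × ℕ => ℝ))) where
  seq t := (ℱ t).prod (brownianPast t)
  mono' _ _ h := sup_le_sup (MeasurableSpace.comap_mono (ℱ.mono h))
    (MeasurableSpace.comap_mono (brownianPast_mono h))
  le' t := sup_le_sup (MeasurableSpace.comap_mono (ℱ.le t))
    (MeasurableSpace.comap_mono (brownianPast_le t))

lemma comap_fst_le_extFiltration (ℱ : Filtration ℝ≥0 mΩ) (t : ℝ≥0) :
    (ℱ t).comap Prod.fst ≤ extFiltration ℱ t := le_sup_left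

lemma isBrownianReal_snd (P : Measure Ω) [IsProbabilityMeasure P] :
    IsBrownianReal (fun t (ω : Ω × (ℕ × ℕ → ℝ)) => brownian t ω.2) (P.prod gaussianSeq) where
  hasLaw I := (isBrownianReal_brownian.hasLaw I).comp measurePreserving_snd.hasLaw
  cont := measurePreserving_snd.quasiMeasurePreserving.ae isBrownianReal_brownian.cont

lemma isBrownianFor_snd (P : Measure Ω) [IsProbabilityMeasure P] (ℱ : Filtration ℝ≥0 mΩ) :
    IsBrownianFor (extFiltration ℱ) (fun t (ω : Ω × (ℕ × ℕ → ℝ)) => brownian t ω.2)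
      (P.prod gaussianSeq) where
  isBrownian := isBrownianReal_snd P
  adapted t := (measurable_brownianPast le_rfl).comp
    ((comap_measurable Prod.snd).mono le_sup_right le_rfl)
  indep_increments s t h := by
    have h1 := indep_prod_of_indep (P := P) (ℱ.le s) (brownianPast_le s)
      ((measurable_brownian t).sub (measurable_brownian s)).comap_le (indep_brownian_sub h)
    rw [MeasurableSpace.comap_comp] at h1
    exact h1

lemma indepFun_brownian_snd (P : Measure Ω) [IsProbabilityMeasure P] {E : Type*}
    [MeasurableSpace E] {X : ℝ≥0 → Ω → E} (hX : ∀ t, Measurable (X t)) :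
    IndepFun (fun (ω : Ω × (ℕ × ℕ → ℝ)) t => brownian t ω.2) (fun ω t => X t ω.1)
      (P.prod gaussianSeq) :=
  (indepFun_prod (X := fun ω t => X t ω) (Y := fun ω t => brownian t ω)
    (measurable_pi_lambda _ hX) (measurable_pi_lambda _ measurable_brownian)).symm

end Extension

end LevyHF

namespace LevyHF

/-! ### Simple processes approximating `√𝔤(X)` -/

section WienerSums

lemma wienerSum_sum {ι : Type*} (s : Finset ι) (c : ι → ℝ≥0 →₀ ℝ) (ω : ℕ × ℕ → ℝ) :
    wienerSum (∑ i ∈ s, c i) ω = ∑ i ∈ s, wienerSum (c i) ω :=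
  map_sum (AddMonoidHom.mk' (fun c => wienerSum c ω) fun c e => wienerSum_add c e ω) c s

lemma stepSum_sum {ι : Type*} (s : Finset ι) (c : ι → ℝ≥0 →₀ ℝ) (r : ℝ) :
    stepSum (∑ i ∈ s, c i) r = ∑ i ∈ s, stepSum (c i) r :=
  map_sum (AddMonoidHom.mk' (fun c => stepSum c r) fun c e => stepSum_add c e r) c s

lemma wienerSum_sub (c e : ℝ≥0 →₀ ℝ) (ω : ℕ × ℕ → ℝ) :
    wienerSum (c - e) ω = wienerSum c ω - wienerSum e ω :=
  map_sub (AddMonoidHom.mk' (fun c => wienerSum c ω) fun c e => wienerSum_add c e ω) c e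

lemma stepSum_sub (c e : ℝ≥0 →₀ ℝ) (r : ℝ) : stepSum (c - e) r = stepSum c r - stepSum e r :=
  map_sub (AddMonoidHom.mk' (fun c => stepSum c r) fun c e => stepSum_add c e r) c e

end WienerSums

lemma tendsto_eLpNorm_two_of_integral_sq {α ι : Type*} {mα : MeasurableSpace α} {μ : Measure α}
    {l : Filter ι} {f : ι → α → ℝ} (hf : ∀ i, MemLp (f i) 2 μ)
    (h : Tendsto (fun i => ∫ x, f i x ^ 2 ∂μ) l (𝓝 0)) :
    Tendsto (fun i => eLpNorm (f i) 2 μ) l (𝓝 0) := by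
  have h1 : ∀ i, eLpNorm (f i) 2 μ = ENNReal.ofReal ((∫ x, f i x ^ 2 ∂μ) ^ (2⁻¹ : ℝ)) := fun i => by
    rw [(hf i).eLpNorm_eq_integral_rpow_norm two_ne_zero ENNReal.ofNat_ne_top]
    simp
  simp_rw [h1]
  have h2 := (h.rpow_const (p := (2⁻¹ : ℝ)) (Or.inr (by norm_num)))
  rw [Real.zero_rpow (by norm_num)] at h2
  simpa using ENNReal.tendsto_ofReal h2

lemma eLpNorm_two_eq_of_integral_sq_eq {α β : Type*} {mα : MeasurableSpace α}
    {mβ : MeasurableSpace β} {μ : Measure α} {ν : Measure β} {f : α → ℝ} {g : β → ℝ}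
    (hf : MemLp f 2 μ) (hg : MemLp g 2 ν) (h : ∫ x, f x ^ 2 ∂μ = ∫ x, g x ^ 2 ∂ν) :
    eLpNorm f 2 μ = eLpNorm g 2 ν := by
  rw [hf.eLpNorm_eq_integral_rpow_norm two_ne_zero ENNReal.ofNat_ne_top,
    hg.eLpNorm_eq_integral_rpow_norm two_ne_zero ENNReal.ofNat_ne_top]
  simp [h]

section GridLeft

/-- The largest point of the grid of mesh `1 / (k + 1)` that lies strictly before `s`. -/
noncomputable def gridLeft (k : ℕ) (s : ℝ≥0) : ℝ≥0 :=
  ((⌈((k : ℝ≥0) + 1) * s⌉₊ - 1 : ℕ) : ℝ≥0) / ((k : ℝ≥0) + 1)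

lemma gridLeft_le (k : ℕ) (s : ℝ≥0) : gridLeft k s ≤ s := by
  rw [gridLeft, div_le_iff₀ (by positivity), mul_comm s]
  rcases Nat.eq_zero_or_pos ⌈((k : ℝ≥0) + 1) * s⌉₊ with h | h
  · rw [h]; simp
  · have h1 := Nat.ceil_lt_add_one (zero_le (a := ((k : ℝ≥0) + 1) * s))
    have h2 : ((⌈((k : ℝ≥0) + 1) * s⌉₊ : ℕ) : ℝ≥0)
        = ((⌈((k : ℝ≥0) + 1) * s⌉₊ - 1 : ℕ) : ℝ≥0) + 1 := by
      obtain ⟨j, hj⟩ := Nat.exists_eq_succ_of_ne_zero h.ne'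
      rw [hj]; simp
    rw [h2] at h1
    exact (lt_of_add_lt_add_right h1).le

lemma le_gridLeft_add (k : ℕ) (s : ℝ≥0) : s ≤ gridLeft k s + 1 / ((k : ℝ≥0) + 1) := by
  rw [gridLeft, ← add_div, le_div_iff₀ (by positivity), mul_comm s]
  refine (Nat.le_ceil _).trans ?_
  rw [← Nat.cast_add_one]
  exact_mod_cast (by omega)

end GridLeft

section PathValue

variable {Ω : Type*} {mΩ : MeasurableSpace Ω} {P : Measure Ω} [IsProbabilityMeasure P]
  {ℱ : Filtration ℝ≥0 mΩ} {d m r : ℕ}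
  {X : ℝ≥0 → Ω → EuclideanSpace ℝ (Fin d)} {a : ℕ → ℝ}
  {g : EuclideanSpace ℝ (Fin d) → (Fin (m + 1) → EuclideanSpace ℝ (Fin d)) → ℝ}
  {𝔤 : EuclideanSpace ℝ (Fin d) → ℝ} {L γ : ℝ}

/-- The grid points of mesh `1 / (k + 1)`. -/
noncomputable def gridPoint (k j : ℕ) : ℝ≥0 := (j : ℝ≥0) / ((k : ℝ≥0) + 1)

lemma gridPoint_mono (k : ℕ) : Monotone (gridPoint k) := fun i j h => by
  unfold gridPoint
  gcongr

/-- The left-endpoint approximation of `√𝔤(X)` on the grid of mesh `1 / (k + 1)`. -/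
noncomputable def pathValue (X : ℝ≥0 → Ω → EuclideanSpace ℝ (Fin d))
    (𝔤 : EuclideanSpace ℝ (Fin d) → ℝ) (k : ℕ) (s : ℝ≥0) (ω : Ω) : ℝ :=
  ∑ j ∈ Finset.range ((k + 1) ^ 2), (Set.Ioc (gridPoint k j) (gridPoint k (j + 1))).indicator
    (fun _ => √(𝔤 (X (gridPoint k j) ω))) s

/-- Exactly one grid interval, open on the left, contains s; its index is ⌈(k + 1)s⌉ - 1. The (k +
1)² intervals of length 1/(k + 1) together reach up to k + 1. -/
lemma pathValue_eq {k : ℕ} {s : ℝ≥0} (hs : 0 < s) (hsk : s ≤ (k : ℝ≥0) + 1) (ω : Ω) :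
    pathValue X 𝔤 k s ω = √(𝔤 (X (gridLeft k s) ω)) := by
  have hk : (0 : ℝ≥0) < (k : ℝ≥0) + 1 := by positivity
  set N := ⌈((k : ℝ≥0) + 1) * s⌉₊ with hN
  have hpos : 0 < N := Nat.ceil_pos.2 (by positivity)
  have hgl : gridLeft k s = gridPoint k (N - 1) := rfl
  have hle : N ≤ (k + 1) ^ 2 := by
    refine Nat.ceil_le.2 ?_
    push_cast
    rw [sq]
    gcongr
  have hmem : ∀ j, s ∈ Set.Ioc (gridPoint k j) (gridPoint k (j + 1)) ↔ j = N - 1 := fun j => by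
    rw [Set.mem_Ioc, gridPoint, gridPoint, div_lt_iff₀ hk, le_div_iff₀ hk, mul_comm s]
    rw [← Nat.lt_ceil, ← Nat.ceil_le, ← hN]
    omega
  rw [pathValue, Finset.sum_eq_single (N - 1)]
  · rw [Set.indicator_of_mem ((hmem _).2 rfl), hgl]
  · intro j _ hj
    exact Set.indicator_of_notMem (fun h => hj ((hmem j).1 h)) _
  · intro h
    exact absurd (Finset.mem_range.2 (by omega)) h

/-- The Finsupp describing the Wiener integral of the left-endpoint approximation up to `t`. -/
noncomputable def pathCoeffs (X : ℝ≥0 → Ω → EuclideanSpace ℝ (Fin d))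
    (𝔤 : EuclideanSpace ℝ (Fin d) → ℝ) (k : ℕ) (t : ℝ≥0) (ω : Ω) : ℝ≥0 →₀ ℝ :=
  ∑ j ∈ Finset.range ((k + 1) ^ 2), √(𝔤 (X (gridPoint k j) ω)) •
    (Finsupp.single (min (gridPoint k (j + 1)) t) 1 - Finsupp.single (min (gridPoint k j) t) 1)

/-- Capping both grid points at t truncates the step function to (0, t]; intervals beyond t collapse
and contribute nothing. -/
lemma stepSum_pathCoeffs (k : ℕ) (t : ℝ≥0) (ω : Ω) (s : ℝ) :
    stepSum (pathCoeffs X 𝔤 k t ω) s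
      = (Set.Ioc (0 : ℝ) t).indicator (fun s => pathValue X 𝔤 k s.toNNReal ω) s := by
  rw [pathCoeffs, stepSum_sum]
  simp only [stepSum_smul, stepSum_sub, stepSum_single, pathValue]
  rcases le_or_gt s 0 with hs | hs
  · rw [Set.indicator_of_notMem (fun h => absurd h.1 (not_lt.2 hs))]
    refine Finset.sum_eq_zero fun j _ => ?_
    rw [Set.indicator_of_notMem (fun h => absurd h.1 (not_lt.2 hs)),
      Set.indicator_of_notMem (fun h => absurd h.1 (not_lt.2 hs)), sub_zero, mul_zero]
  · lift s to ℝ≥0 using hs.le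
    have e : ∀ b : ℝ≥0, (Set.Ioc (0 : ℝ) b).indicator (1 : ℝ → ℝ) s = if s ≤ b then 1 else 0 := by
      intro b
      simp only [Set.indicator_apply, Set.mem_Ioc, hs, true_and, NNReal.coe_le_coe, Pi.one_apply]
    simp only [e, le_min_iff]
    simp only [Set.indicator_apply, Real.toNNReal_coe, Set.mem_Ioc, hs, true_and, NNReal.coe_le_coe]
    by_cases hst : s ≤ t
    · simp only [hst, and_true, if_true]
      refine Finset.sum_congr rfl fun j _ => ?_
      have hmono := gridPoint_mono k (Nat.le_succ j)
      by_cases h1 : s ≤ gridPoint k j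
      · simp [h1, h1.trans hmono, not_lt.2 h1]
      · by_cases h2 : s ≤ gridPoint k (j + 1)
        · simp [h1, h2, not_le.1 h1]
        · simp [h1, h2]
    · simp [hst]

namespace LimitSetting

lemma measurable_pathValue (h : LimitSetting P ℱ X a g 𝔤 L γ) (k : ℕ) :
    Measurable fun q : ℝ × Ω => pathValue X 𝔤 k q.1.toNNReal q.2 := by
  unfold pathValue
  refine Finset.measurable_fun_sum _ fun j _ => ?_
  have h1 : Measurable fun q : ℝ × Ω => √(𝔤 (X (gridPoint k j) q.2)) :=
    ((h.continuous_limit.measurable.comp ((h.measurable _).comp measurable_snd))).sqrt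
  have h2 : MeasurableSet {q : ℝ × Ω | q.1.toNNReal ∈
      Set.Ioc (gridPoint k j) (gridPoint k (j + 1))} :=
    (measurable_real_toNNReal.comp measurable_fst) measurableSet_Ioc
  exact h1.indicator h2

lemma abs_pathValue_le (h : LimitSetting P ℱ X a g 𝔤 L γ) (k : ℕ) (s : ℝ≥0) (ω : Ω) :
    |pathValue X 𝔤 k s ω| ≤ ((k + 1) ^ 2 : ℕ) * √L := by
  refine (Finset.abs_sum_le_sum_abs _ _).trans ((Finset.sum_le_card_nsmul _ _ (√L)
    fun j _ => ?_).trans (by simp))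
  rw [Set.indicator_apply]
  split_ifs
  · rw [abs_of_nonneg (Real.sqrt_nonneg _)]
    exact Real.sqrt_le_sqrt (h.limit_le _)
  · simp

lemma aestronglyMeasurable_sqrt (h : LimitSetting P ℱ X a g 𝔤 L γ) (μ : Measure ℝ) [SFinite μ] :
    AEStronglyMeasurable (fun q : ℝ × Ω => √(𝔤 (X q.1.toNNReal q.2))) (μ.prod P) :=
  Real.continuous_sqrt.comp_aestronglyMeasurable (h.aestronglyMeasurable_limit μ)

lemma memLp_pathValue_sub (h : LimitSetting P ℱ X a g 𝔤 L γ) (k : ℕ) (μ : Measure ℝ)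
    [IsFiniteMeasure μ] : MemLp (fun q : ℝ × Ω => pathValue X 𝔤 k q.1.toNNReal q.2
      - √(𝔤 (X q.1.toNNReal q.2))) 2 (μ.prod P) := by
  refine MemLp.of_bound ((h.measurable_pathValue k).aestronglyMeasurable.sub
    (h.aestronglyMeasurable_sqrt μ)) (((k + 1) ^ 2 : ℕ) * √L + √L) (ae_of_all _ fun q => ?_)
  refine (norm_sub_le _ _).trans (add_le_add (h.abs_pathValue_le _ _ _) ?_)
  rw [Real.norm_of_nonneg (Real.sqrt_nonneg _)]
  exact Real.sqrt_le_sqrt (h.limit_le _)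

lemma integrable_pathValue_sq_sub (h : LimitSetting P ℱ X a g 𝔤 L γ) (k : ℕ) (μ : Measure ℝ)
    [IsFiniteMeasure μ] : Integrable (fun q : ℝ × Ω => |pathValue X 𝔤 k q.1.toNNReal q.2 ^ 2
      - 𝔤 (X q.1.toNNReal q.2)|) (μ.prod P) := by
  refine (Integrable.of_bound (((h.measurable_pathValue k).pow_const 2).aestronglyMeasurable.sub
    (h.aestronglyMeasurable_limit μ)) ((((k + 1) ^ 2 : ℕ) * √L) ^ 2 + L)
    (ae_of_all _ fun q => ?_)).abs
  refine (norm_sub_le _ _).trans (add_le_add ?_ (h.abs_limit_le _))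
  rw [norm_pow]
  exact pow_le_pow_left₀ (norm_nonneg _) (h.abs_pathValue_le _ _ _) 2

/-- The squares of the left-endpoint approximations converge in `L¹`. -/
theorem tendsto_integral_abs_pathValue_sq_sub (h : LimitSetting P ℱ X a g 𝔤 L γ) (t : ℝ≥0) :
    Tendsto (fun k => ∫ q : ℝ × Ω, |pathValue X 𝔤 k q.1.toNNReal q.2 ^ 2
      - 𝔤 (X q.1.toNNReal q.2)| ∂((volume.restrict (Set.Ioc (0 : ℝ) t)).prod P)) atTop (𝓝 0) := by
  have hL := h.const_nonneg
  have hγ : 0 < γ := by linarith [h.half_lt]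
  have lim : Tendsto (fun k : ℕ => t * (L * (L * (1 / ((k : ℝ) + 1)) ^ γ))) atTop (𝓝 0) := by
    have := (tendsto_one_div_add_atTop_nhds_zero_nat (𝕜 := ℝ)).rpow_const (p := γ) (Or.inr hγ.le)
    rw [Real.zero_rpow hγ.ne'] at this
    simpa using ((this.const_mul L).const_mul L).const_mul (t : ℝ)
  refine squeeze_zero' (Eventually.of_forall fun k => integral_nonneg fun _ => abs_nonneg _) ?_ lim
  filter_upwards [eventually_ge_atTop ⌈t⌉₊] with k hk
  have htk : t ≤ (k : ℝ≥0) + 1 := by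
    have : t ≤ (k : ℝ≥0) := (Nat.le_ceil t).trans (by exact_mod_cast hk)
    exact this.trans (by simp)
  have hint := h.integrable_pathValue_sq_sub k (volume.restrict (Set.Ioc (0 : ℝ) t))
  rw [integral_prod _ hint]
  have hb : ∀ s ∈ Set.Ioc (0 : ℝ) t, ∫ ω, |pathValue X 𝔤 k s.toNNReal ω ^ 2
      - 𝔤 (X s.toNNReal ω)| ∂P ≤ L * (L * (1 / ((k : ℝ) + 1)) ^ γ) := fun s hs => by
    have hs0 : 0 < s.toNNReal := Real.toNNReal_pos.2 hs.1
    have hst : s.toNNReal ≤ t := Real.toNNReal_le_iff_le_coe.2 hs.2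
    have h1 := h.integral_min_le (gridLeft_le k s.toNNReal) (le_gridLeft_add k s.toNNReal)
    have h2 : ∫ ω, |pathValue X 𝔤 k s.toNNReal ω ^ 2 - 𝔤 (X s.toNNReal ω)| ∂P
        ≤ ∫ ω, L * min 1 ‖X s.toNNReal ω - X (gridLeft k s.toNNReal) ω‖ ∂P := by
      refine integral_mono_of_nonneg (ae_of_all _ fun _ => abs_nonneg _)
        ((h.integrable_min _ _).const_mul _) (ae_of_all _ fun ω => ?_)
      simp only
      -- Squares are compared rather than roots, because the Lipschitz bound is available for 𝔤 and
      -- not for √𝔤.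
      rw [pathValue_eq hs0 (hst.trans htk), Real.sq_sqrt (h.nonneg _), abs_sub_comm]
      exact h.limit_lipschitz _ _
    refine h2.trans ?_
    rw [integral_const_mul]
    refine mul_le_mul_of_nonneg_left (h1.trans (le_of_eq ?_)) hL
    push_cast
    rfl
  have hconst : IntegrableOn (fun _ : ℝ => L * (L * (1 / ((k : ℝ) + 1)) ^ γ)) (Set.Ioc (0 : ℝ) t) :=
    integrableOn_const (by simp)
  refine (setIntegral_mono_on hint.integral_prod_left hconst measurableSet_Ioc hb).trans
    (le_of_eq ?_)
  rw [setIntegral_const, Real.volume_real_Ioc_of_le t.coe_nonneg, smul_eq_mul, sub_zero]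

/-- For nonnegative numbers |a - b| ≤ a + b. Hence L¹ convergence of the squares gives L²
convergence of the roots. -/
lemma _root_.LevyHF.sq_sub_le_abs_sq_sub {a b : ℝ} (ha : 0 ≤ a) (hb : 0 ≤ b) :
    (a - b) ^ 2 ≤ |a ^ 2 - b ^ 2| := by
  have e : a ^ 2 - b ^ 2 = (a - b) * (a + b) := by ring
  rw [e, abs_mul, ← sq_abs, sq]
  refine mul_le_mul_of_nonneg_left ?_ (abs_nonneg _)
  rw [abs_of_nonneg (add_nonneg ha hb)]
  exact abs_sub_le_iff.2 ⟨by linarith, by linarith⟩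

lemma _root_.LevyHF.pathValue_nonneg (k : ℕ) (s : ℝ≥0) (ω : Ω) : 0 ≤ pathValue X 𝔤 k s ω :=
  Finset.sum_nonneg fun _ _ => Set.indicator_nonneg (fun _ _ => Real.sqrt_nonneg _) _

/-- The left-endpoint approximations converge in `L²`. -/
theorem tendsto_eLpNorm_pathValue_sub (h : LimitSetting P ℱ X a g 𝔤 L γ) (t : ℝ≥0) :
    Tendsto (fun k => eLpNorm (fun q : ℝ × Ω => pathValue X 𝔤 k q.1.toNNReal q.2
      - √(𝔤 (X q.1.toNNReal q.2))) 2 ((volume.restrict (Set.Ioc (0 : ℝ) t)).prod P)) atTop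
      (𝓝 0) := by
  refine tendsto_eLpNorm_two_of_integral_sq (fun k => h.memLp_pathValue_sub k _)
    (squeeze_zero (fun k => integral_nonneg fun _ => sq_nonneg _) (fun k => ?_)
      (h.tendsto_integral_abs_pathValue_sq_sub t))
  refine integral_mono_of_nonneg (ae_of_all _ fun _ => sq_nonneg _)
    (h.integrable_pathValue_sq_sub k _) (ae_of_all _ fun q => ?_)
  refine (sq_sub_le_abs_sq_sub (pathValue_nonneg _ _ _) (Real.sqrt_nonneg _)).trans (le_of_eq ?_)
  simp only
  rw [Real.sq_sqrt (h.nonneg _)]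

end LimitSetting

end PathValue

end LevyHF

namespace LevyHF

/-! ### The Itô integral of `√𝔤(X)` -/

section Ito

variable {Ω : Type*} {mΩ : MeasurableSpace Ω} {P : Measure Ω} [IsProbabilityMeasure P]
  {ℱ : Filtration ℝ≥0 mΩ} {d m r : ℕ}
  {X : ℝ≥0 → Ω → EuclideanSpace ℝ (Fin d)} {a : ℕ → ℝ}
  {g : EuclideanSpace ℝ (Fin d) → (Fin (m + 1) → EuclideanSpace ℝ (Fin d)) → ℝ}
  {𝔤 : EuclideanSpace ℝ (Fin d) → ℝ} {L γ : ℝ}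

/-- The Wiener integral of the left-endpoint approximation of `√𝔤(X)` over `[0, t]`. -/
noncomputable def itoSum (X : ℝ≥0 → Ω → EuclideanSpace ℝ (Fin d))
    (𝔤 : EuclideanSpace ℝ (Fin d) → ℝ) (k : ℕ) (t : ℝ≥0) (ω : Ω × (ℕ × ℕ → ℝ)) : ℝ :=
  wienerSum (pathCoeffs X 𝔤 k t ω.1) ω.2

lemma itoSum_eq (k : ℕ) (t : ℝ≥0) (ω : Ω × (ℕ × ℕ → ℝ)) :
    itoSum X 𝔤 k t ω = ∑ j ∈ Finset.range ((k + 1) ^ 2), √(𝔤 (X (gridPoint k j) ω.1)) *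
      (brownian (min (gridPoint k (j + 1)) t) ω.2 - brownian (min (gridPoint k j) t) ω.2) := by
  rw [itoSum, pathCoeffs, wienerSum_sum]
  refine Finset.sum_congr rfl fun j _ => ?_
  rw [wienerSum_smul, wienerSum_sub, wienerSum_single, wienerSum_single]

namespace LimitSetting

/-- The left-endpoint approximation of `√𝔤(X)` as a simple process on the extension. -/
noncomputable def itoApprox (h : LimitSetting P ℱ X a g 𝔤 L γ) (k : ℕ) :
    SimpleProcess (extFiltration ℱ) where
  N := (k + 1) ^ 2
  time := gridPoint k
  time_mono := gridPoint_mono k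
  coef j ω := √(𝔤 (X (gridPoint k j) ω.1))
  coef_measurable j := by
    have h1 : Measurable[ℱ (gridPoint k j)] fun ω => √(𝔤 (X (gridPoint k j) ω)) :=
      (h.continuous_limit.measurable.comp (h.levy.adapted _)).sqrt
    exact h1.comp ((comap_measurable Prod.fst).mono le_sup_left le_rfl)
  coef_bounded j := ⟨√L, fun ω => by
    rw [abs_of_nonneg (Real.sqrt_nonneg _)]
    exact Real.sqrt_le_sqrt (h.limit_le _)⟩

lemma itoApprox_integral (h : LimitSetting P ℱ X a g 𝔤 L γ) (k : ℕ) (t : ℝ≥0)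
    (ω : Ω × (ℕ × ℕ → ℝ)) :
    (h.itoApprox k).integral (fun t ω => brownian t ω.2) t ω = itoSum X 𝔤 k t ω := by
  rw [itoSum_eq]; rfl

lemma measurable_itoSum (h : LimitSetting P ℱ X a g 𝔤 L γ) (k : ℕ) (t : ℝ≥0) :
    Measurable (itoSum X 𝔤 k t) := by
  have : itoSum X 𝔤 k t = fun ω => _ := funext fun ω => itoSum_eq k t ω
  rw [this]
  refine Finset.measurable_fun_sum _ fun j _ => Measurable.mul ?_ (Measurable.sub ?_ ?_)
  · exact (h.continuous_limit.measurable.comp ((h.measurable _).comp measurable_fst)).sqrt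
  · exact (measurable_brownian _).comp measurable_snd
  · exact (measurable_brownian _).comp measurable_snd

lemma memLp_itoSum (h : LimitSetting P ℱ X a g 𝔤 L γ) (k : ℕ) (t : ℝ≥0) :
    MemLp (itoSum X 𝔤 k t) 2 (P.prod gaussianSeq) := by
  have : itoSum X 𝔤 k t = fun ω => _ := funext fun ω => itoSum_eq k t ω
  rw [this]
  have hW : ∀ s, MemLp (fun ω : Ω × (ℕ × ℕ → ℝ) => brownian s ω.2) 2 (P.prod gaussianSeq) :=
    fun s => (memLp_brownian s).comp_measurePreserving measurePreserving_snd
  refine memLp_finsetSum _ fun j _ => ?_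
  refine MemLp.of_le_mul (c := √L)
    ((hW (min (gridPoint k (j + 1)) t)).sub (hW (min (gridPoint k j) t))) ?_ (ae_of_all _ fun ω => ?_)
  · refine Measurable.aestronglyMeasurable (Measurable.mul ?_ (Measurable.sub ?_ ?_))
    · exact (h.continuous_limit.measurable.comp ((h.measurable _).comp measurable_fst)).sqrt
    · exact (measurable_brownian _).comp measurable_snd
    · exact (measurable_brownian _).comp measurable_snd
  · rw [norm_mul, Real.norm_of_nonneg (Real.sqrt_nonneg _)]
    exact mul_le_mul_of_nonneg_right (Real.sqrt_le_sqrt (h.limit_le _)) (norm_nonneg _)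

lemma memLp_pathValue (h : LimitSetting P ℱ X a g 𝔤 L γ) (k : ℕ) (μ : Measure ℝ)
    [IsFiniteMeasure μ] : MemLp (fun q : ℝ × Ω => pathValue X 𝔤 k q.1.toNNReal q.2) 2 (μ.prod P) :=
  MemLp.of_bound (h.measurable_pathValue k).aestronglyMeasurable (((k + 1) ^ 2 : ℕ) * √L)
    (ae_of_all _ fun _ => h.abs_pathValue_le _ _ _)

/-- The Itô isometry for the left-endpoint approximations. -/
lemma eLpNorm_itoSum_sub (h : LimitSetting P ℱ X a g 𝔤 L γ) (k l : ℕ) (t : ℝ≥0) :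
    eLpNorm (itoSum X 𝔤 k t - itoSum X 𝔤 l t) 2 (P.prod gaussianSeq)
      = eLpNorm (fun q : ℝ × Ω => pathValue X 𝔤 k q.1.toNNReal q.2
        - pathValue X 𝔤 l q.1.toNNReal q.2) 2 ((volume.restrict (Set.Ioc (0 : ℝ) t)).prod P) := by
  have hm := (h.memLp_itoSum k t).sub (h.memLp_itoSum l t)
  have hm' : MemLp (fun q : ℝ × Ω => pathValue X 𝔤 k q.1.toNNReal q.2
      - pathValue X 𝔤 l q.1.toNNReal q.2) 2 ((volume.restrict (Set.Ioc (0 : ℝ) t)).prod P) :=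
    (h.memLp_pathValue k _).sub (h.memLp_pathValue l _)
  refine eLpNorm_two_eq_of_integral_sq_eq hm hm' ?_
  -- For a frozen path of X both sums are Wiener integrals of step functions. The isometry holds
  -- path by path and is then integrated over Ω.
  rw [integral_prod _ hm.integrable_sq, integral_prod_symm _ hm'.integrable_sq]
  refine integral_congr_ae (ae_of_all _ fun ω => ?_)
  simp only [Pi.sub_apply, itoSum, ← wienerSum_sub]
  rw [integral_wienerSum_sq, ← integral_indicator measurableSet_Ioc]
  refine integral_congr_ae (ae_of_all _ fun s => ?_)
  simp only [stepSum_sub, stepSum_pathCoeffs]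
  by_cases hs : s ∈ Set.Ioc (0 : ℝ) t <;> simp [hs]

/-- By the isometry, convergence of the left-endpoint approximations in L² of time and Ω makes the
sums Cauchy in L² of the extension. -/
theorem exists_tendsto_itoSum (h : LimitSetting P ℱ X a g 𝔤 L γ) (t : ℝ≥0) :
    ∃ I : Ω × (ℕ × ℕ → ℝ) → ℝ, MemLp I 2 (P.prod gaussianSeq) ∧
      Tendsto (fun k => eLpNorm (itoSum X 𝔤 k t - I) 2 (P.prod gaussianSeq)) atTop (𝓝 0) := by
  have hcs : CauchySeq fun k => (h.memLp_itoSum k t).toLp (itoSum X 𝔤 k t) := by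
    rw [Lp.cauchySeq_Lp_iff_cauchySeq_eLpNorm]
    have hlim := h.tendsto_eLpNorm_pathValue_sub t
    have hlim2 : Tendsto (fun n : ℕ × ℕ =>
        eLpNorm (fun q : ℝ × Ω => pathValue X 𝔤 n.1 q.1.toNNReal q.2
          - √(𝔤 (X q.1.toNNReal q.2))) 2 ((volume.restrict (Set.Ioc (0 : ℝ) t)).prod P)
        + eLpNorm (fun q : ℝ × Ω => pathValue X 𝔤 n.2 q.1.toNNReal q.2
          - √(𝔤 (X q.1.toNNReal q.2))) 2 ((volume.restrict (Set.Ioc (0 : ℝ) t)).prod P))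
        atTop (𝓝 0) := by
      rw [← prod_atTop_atTop_eq]
      simpa using (hlim.comp tendsto_fst).add (hlim.comp tendsto_snd)
    refine tendsto_of_tendsto_of_tendsto_of_le_of_le tendsto_const_nhds hlim2
      (fun _ => zero_le) fun n => ?_
    have e : eLpNorm (⇑((h.memLp_itoSum n.1 t).toLp (itoSum X 𝔤 n.1 t))
        - ⇑((h.memLp_itoSum n.2 t).toLp (itoSum X 𝔤 n.2 t))) 2 (P.prod gaussianSeq)
        = eLpNorm (itoSum X 𝔤 n.1 t - itoSum X 𝔤 n.2 t) 2 (P.prod gaussianSeq) :=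
      eLpNorm_congr_ae ((MemLp.coeFn_toLp _).sub (MemLp.coeFn_toLp _))
    simp only
    rw [e, h.eLpNorm_itoSum_sub]
    have e2 : (fun q : ℝ × Ω => pathValue X 𝔤 n.1 q.1.toNNReal q.2
        - pathValue X 𝔤 n.2 q.1.toNNReal q.2)
        = (fun q : ℝ × Ω => pathValue X 𝔤 n.1 q.1.toNNReal q.2 - √(𝔤 (X q.1.toNNReal q.2)))
          - fun q : ℝ × Ω => pathValue X 𝔤 n.2 q.1.toNNReal q.2 - √(𝔤 (X q.1.toNNReal q.2)) := by
      ext q; simp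
    rw [e2]
    exact eLpNorm_sub_le (h.memLp_pathValue_sub _ _).1 (h.memLp_pathValue_sub _ _).1 one_le_two
  obtain ⟨J, hJ⟩ := cauchySeq_tendsto_of_complete hcs
  refine ⟨J, Lp.memLp J, ?_⟩
  rw [Lp.tendsto_Lp_iff_tendsto_eLpNorm'] at hJ
  refine hJ.congr fun k => eLpNorm_congr_ae ?_
  exact (MemLp.coeFn_toLp _).sub (ae_eq_refl _)

/-- The Itô integral of `√𝔤(X)` with respect to the Brownian motion of the extension. -/
noncomputable def itoIntegral (h : LimitSetting P ℱ X a g 𝔤 L γ) (t : ℝ≥0) :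
    Ω × (ℕ × ℕ → ℝ) → ℝ := (h.exists_tendsto_itoSum t).choose

lemma memLp_itoIntegral (h : LimitSetting P ℱ X a g 𝔤 L γ) (t : ℝ≥0) :
    MemLp (h.itoIntegral t) 2 (P.prod gaussianSeq) := (h.exists_tendsto_itoSum t).choose_spec.1

lemma tendsto_itoSum (h : LimitSetting P ℱ X a g 𝔤 L γ) (t : ℝ≥0) :
    Tendsto (fun k => eLpNorm (itoSum X 𝔤 k t - h.itoIntegral t) 2 (P.prod gaussianSeq)) atTop
      (𝓝 0) := (h.exists_tendsto_itoSum t).choose_spec.2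

theorem isItoIntegral_itoIntegral (h : LimitSetting P ℱ X a g 𝔤 L γ) :
    IsItoIntegral (extFiltration ℱ) (fun t ω => brownian t ω.2) (fun s ω => √(𝔤 (X s ω.1)))
      h.itoIntegral (P.prod gaussianSeq) := by
  have hmp : ∀ t : ℝ≥0, MeasurePreserving
      (fun q : ℝ × (Ω × (ℕ × ℕ → ℝ)) => (q.1, q.2.1))
      ((volume.restrict (Set.Icc (0 : ℝ) t)).prod (P.prod gaussianSeq))
      ((volume.restrict (Set.Icc (0 : ℝ) t)).prod P) := fun t =>
    (MeasurePreserving.id _).prod measurePreserving_fst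
  refine ⟨fun t => ⟨?_, (h.memLp_itoIntegral t).1⟩, h.itoApprox, fun t => ⟨?_, ?_⟩⟩
  · exact (h.aestronglyMeasurable_sqrt (volume.restrict (Set.Icc (0 : ℝ) t))
      ).comp_measurePreserving (hmp t)
  · have h1 := h.tendsto_eLpNorm_pathValue_sub t
    rw [Measure.restrict_congr_set Ioc_ae_eq_Icc] at h1
    refine h1.congr fun k => ?_
    exact (eLpNorm_comp_measurePreserving (h.memLp_pathValue_sub k _).1 (hmp t)).symm
  · refine (h.tendsto_itoSum t).congr fun k => ?_
    congr 1
    ext ω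
    rw [Pi.sub_apply, h.itoApprox_integral]

end LimitSetting

end Ito

end LevyHF

namespace LevyHF

/-! ### The characteristic function of the Itô integral given `X` -/

section ItoCharFun

variable {Ω : Type*} {mΩ : MeasurableSpace Ω} {P : Measure Ω} [IsProbabilityMeasure P]
  {ℱ : Filtration ℝ≥0 mΩ} {d m r : ℕ}
  {X : ℝ≥0 → Ω → EuclideanSpace ℝ (Fin d)} {a : ℕ → ℝ}
  {g : EuclideanSpace ℝ (Fin d) → (Fin (m + 1) → EuclideanSpace ℝ (Fin d)) → ℝ}
  {𝔤 : EuclideanSpace ℝ (Fin d) → ℝ} {L γ : ℝ}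

/-- The time integral of the squared left-endpoint approximation. -/
noncomputable def pathIntegral (X : ℝ≥0 → Ω → EuclideanSpace ℝ (Fin d))
    (𝔤 : EuclideanSpace ℝ (Fin d) → ℝ) (k : ℕ) (t : ℝ≥0) (ω : Ω) : ℝ :=
  ∫ s in Set.Ioc (0 : ℝ) t, pathValue X 𝔤 k s.toNNReal ω ^ 2

/-- The conditional variance of `∑_j u_j` times the approximating sums given `X`. -/
noncomputable def pathQuad (X : ℝ≥0 → Ω → EuclideanSpace ℝ (Fin d))
    (𝔤 : EuclideanSpace ℝ (Fin d) → ℝ) (k : ℕ) (u : Fin r → ℝ) (τ : Fin r → ℝ≥0) (ω : Ω) : ℝ :=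
  ∑ j, ∑ l, u j * u l * pathIntegral X 𝔤 k (min (τ j) (τ l)) ω

namespace LimitSetting

lemma integrableOn_pathValue_sq (h : LimitSetting P ℱ X a g 𝔤 L γ) (k : ℕ) (t : ℝ≥0) (ω : Ω) :
    IntegrableOn (fun s : ℝ => pathValue X 𝔤 k s.toNNReal ω ^ 2) (Set.Ioc (0 : ℝ) t) := by
  have hm : Measurable fun s : ℝ => pathValue X 𝔤 k s.toNNReal ω ^ 2 :=
    ((h.measurable_pathValue k).comp (measurable_id.prodMk measurable_const)).pow_const 2
  refine Measure.integrableOn_of_bounded (M := (((k + 1) ^ 2 : ℕ) * √L) ^ 2) (by simp)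
    hm.aestronglyMeasurable (ae_of_all _ fun s => ?_)
  rw [norm_pow]
  exact pow_le_pow_left₀ (norm_nonneg _) (h.abs_pathValue_le _ _ _) 2

/-- The combination over j is again a single step function, and the truncations at τ_j and τ_l
multiply to a truncation at their minimum. -/
lemma integral_stepSum_pathCoeffs_sq (h : LimitSetting P ℱ X a g 𝔤 L γ) (k : ℕ) (u : Fin r → ℝ)
    (τ : Fin r → ℝ≥0) (ω : Ω) :
    ∫ s, stepSum (∑ j, u j • pathCoeffs X 𝔤 k (τ j) ω) s ^ 2 = pathQuad X 𝔤 k u τ ω := by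
  have e : ∀ s, stepSum (∑ j, u j • pathCoeffs X 𝔤 k (τ j) ω) s ^ 2
      = ∑ j, ∑ l, u j * u l * (Set.Ioc (0 : ℝ) (min (τ j) (τ l) : ℝ≥0)).indicator
        (fun s => pathValue X 𝔤 k s.toNNReal ω ^ 2) s := fun s => by
    simp only [stepSum_sum, stepSum_smul, stepSum_pathCoeffs]
    rw [sq, Finset.sum_mul_sum]
    refine Finset.sum_congr rfl fun j _ => Finset.sum_congr rfl fun l _ => ?_
    rw [mul_mul_mul_comm, ← Set.inter_indicator_mul, Set.Ioc_inter_Ioc]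
    simp only [sup_idem, NNReal.coe_min, sq]
  have hi : ∀ t : ℝ≥0, Integrable ((Set.Ioc (0 : ℝ) t).indicator
      (fun s => pathValue X 𝔤 k s.toNNReal ω ^ 2)) := fun t =>
    (h.integrableOn_pathValue_sq k t ω).integrable_indicator measurableSet_Ioc
  simp only [e]
  rw [integral_finsetSum _ fun j _ => integrable_finsetSum _ fun l _ => (hi _).const_mul _]
  refine Finset.sum_congr rfl fun j _ => ?_
  rw [integral_finsetSum _ fun l _ => (hi _).const_mul _]
  refine Finset.sum_congr rfl fun l _ => ?_
  rw [integral_const_mul, integral_indicator measurableSet_Ioc, pathIntegral]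

lemma pathQuad_nonneg (h : LimitSetting P ℱ X a g 𝔤 L γ) (k : ℕ) (u : Fin r → ℝ)
    (τ : Fin r → ℝ≥0) (ω : Ω) : 0 ≤ pathQuad X 𝔤 k u τ ω := by
  rw [← h.integral_stepSum_pathCoeffs_sq]
  exact integral_nonneg fun _ => sq_nonneg _

lemma aestronglyMeasurable_pathIntegral (h : LimitSetting P ℱ X a g 𝔤 L γ) (k : ℕ) (t : ℝ≥0) :
    AEStronglyMeasurable (pathIntegral X 𝔤 k t) P :=
  ((h.measurable_pathValue k).pow_const 2).aestronglyMeasurable.prod_swap.integral_prod_right'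

lemma aestronglyMeasurable_pathQuad (h : LimitSetting P ℱ X a g 𝔤 L γ) (k : ℕ) (u : Fin r → ℝ)
    (τ : Fin r → ℝ≥0) : AEStronglyMeasurable (pathQuad X 𝔤 k u τ) P :=
  Finset.aestronglyMeasurable_fun_sum _ fun _ _ => Finset.aestronglyMeasurable_fun_sum _
    fun _ _ => (h.aestronglyMeasurable_pathIntegral _ _).const_mul _

lemma integrable_pathIntegral_sub (h : LimitSetting P ℱ X a g 𝔤 L γ) (k : ℕ) (t : ℝ≥0) :
    Integrable (fun ω => |pathIntegral X 𝔤 k t ω - timeIntegral X 𝔤 t ω|) P ∧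
    ∫ ω, |pathIntegral X 𝔤 k t ω - timeIntegral X 𝔤 t ω| ∂P
      ≤ ∫ q : ℝ × Ω, |pathValue X 𝔤 k q.1.toNNReal q.2 ^ 2 - 𝔤 (X q.1.toNNReal q.2)|
        ∂((volume.restrict (Set.Ioc (0 : ℝ) t)).prod P) := by
  have hint := h.integrable_pathValue_sq_sub k (volume.restrict (Set.Ioc (0 : ℝ) t))
  have hle : ∀ᵐ ω ∂P, |pathIntegral X 𝔤 k t ω - timeIntegral X 𝔤 t ω|
      ≤ ∫ s in Set.Ioc (0 : ℝ) t, |pathValue X 𝔤 k s.toNNReal ω ^ 2 - 𝔤 (X s.toNNReal ω)| := by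
    filter_upwards [h.ae_intervalIntegrable] with ω hω
    rw [pathIntegral, timeIntegral, intervalIntegral.integral_of_le t.coe_nonneg,
      ← integral_sub (h.integrableOn_pathValue_sq k t ω) (hω 0 t).1]
    exact abs_integral_le_integral_abs
  have hm := (h.aestronglyMeasurable_pathIntegral k t).sub (h.aestronglyMeasurable_timeIntegral t)
  have hI : Integrable (fun ω => |pathIntegral X 𝔤 k t ω - timeIntegral X 𝔤 t ω|) P := by
    refine (hint.integral_prod_right).mono' hm.norm ?_
    filter_upwards [hle] with ω hω
    rw [Real.norm_eq_abs, abs_abs]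
    exact hω
  exact ⟨hI, (integral_mono_ae hI hint.integral_prod_right hle).trans_eq
    (integral_prod_symm _ hint).symm⟩

lemma tendsto_integral_abs_pathIntegral_sub (h : LimitSetting P ℱ X a g 𝔤 L γ) (t : ℝ≥0) :
    Tendsto (fun k => ∫ ω, |pathIntegral X 𝔤 k t ω - timeIntegral X 𝔤 t ω| ∂P) atTop (𝓝 0) :=
  squeeze_zero (fun _ => integral_nonneg fun _ => abs_nonneg _)
    (fun k => (h.integrable_pathIntegral_sub k t).2) (h.tendsto_integral_abs_pathValue_sq_sub t)

/-- By Fubini, for fixed ω the exponent is a Wiener integral with deterministic coefficients, whose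
characteristic function is known. -/
lemma integral_cexp_itoSum (h : LimitSetting P ℱ X a g 𝔤 L γ) (k : ℕ) (u : Fin r → ℝ)
    (τ : Fin r → ℝ≥0) {F : Ω → ℝ} (hF : Measurable F) {C : ℝ} (hFC : ∀ ω, |F ω| ≤ C) :
    ∫ ω : Ω × (ℕ × ℕ → ℝ), (F ω.1 : ℂ) *
        Complex.exp (((∑ j, u j * itoSum X 𝔤 k (τ j) ω : ℝ) : ℂ) * Complex.I) ∂(P.prod gaussianSeq)
      = ∫ ω, (F ω : ℂ) * Complex.exp ((-(pathQuad X 𝔤 k u τ ω / 2) : ℝ) : ℂ) ∂P := by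
  have hm : Measurable fun ω : Ω × (ℕ × ℕ → ℝ) => (F ω.1 : ℂ) *
      Complex.exp (((∑ j, u j * itoSum X 𝔤 k (τ j) ω : ℝ) : ℂ) * Complex.I) := by
    refine (Complex.measurable_ofReal.comp (hF.comp measurable_fst)).mul
      (Complex.measurable_exp.comp ((Complex.measurable_ofReal.comp ?_).mul_const _))
    exact Finset.measurable_fun_sum _ fun j _ => (h.measurable_itoSum k _).const_mul _
  have hint : Integrable (fun ω : Ω × (ℕ × ℕ → ℝ) => (F ω.1 : ℂ) *
      Complex.exp (((∑ j, u j * itoSum X 𝔤 k (τ j) ω : ℝ) : ℂ) * Complex.I))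
      (P.prod gaussianSeq) := by
    refine Integrable.of_bound hm.aestronglyMeasurable C (ae_of_all _ fun ω => ?_)
    rw [norm_mul, Complex.norm_exp_ofReal_mul_I, mul_one, Complex.norm_real]
    exact hFC _
  rw [integral_prod _ hint]
  refine integral_congr_ae (ae_of_all _ fun ω => ?_)
  simp only
  rw [integral_const_mul]
  congr 1
  have e : ∀ ω' : ℕ × ℕ → ℝ, ∑ j, u j * itoSum X 𝔤 k (τ j) (ω, ω')
      = wienerSum (∑ j, u j • pathCoeffs X 𝔤 k (τ j) ω) ω' := fun ω' => by
    simp only [wienerSum_sum, wienerSum_smul, itoSum]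
  simp only [e]
  rw [integral_cexp_wienerSum, h.integral_stepSum_pathCoeffs_sq]
  congr 1
  push_cast
  ring

/-- The exponents are bounded above: the approximating variance is nonnegative as the integral of a
square, and the limit is bounded. There the exponential is Lipschitz, and L¹ convergence of the time
integrals suffices. -/
lemma tendsto_integral_cexp_pathQuad (h : LimitSetting P ℱ X a g 𝔤 L γ) (u : Fin r → ℝ)
    (τ : Fin r → ℝ≥0) {F : Ω → ℝ} (hF : Measurable F) {C : ℝ} (hFC : ∀ ω, |F ω| ≤ C) :
    Tendsto (fun k => ∫ ω, (F ω : ℂ) *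
        Complex.exp ((-(pathQuad X 𝔤 k u τ ω / 2) : ℝ) : ℂ) ∂P) atTop
      (𝓝 (∫ ω, (F ω : ℂ) * Complex.exp ((-(quadVar X 𝔤 u τ ω / 2) : ℝ) : ℂ) ∂P)) := by
  set M := quadBound u τ L with hM
  have hM0 : 0 ≤ M := h.quadBound_nonneg u τ
  have hint : ∀ Q : Ω → ℝ, AEStronglyMeasurable Q P → (∀ ω, -(Q ω / 2) ≤ M) →
      Integrable (fun ω => (F ω : ℂ) * Complex.exp ((-(Q ω / 2) : ℝ) : ℂ)) P := fun Q hQ hQM => by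
    refine Integrable.of_bound (C := C * Real.exp M) ?_ (ae_of_all _ fun ω => ?_)
    · exact (Complex.measurable_ofReal.comp hF).aestronglyMeasurable.mul
        (Complex.continuous_exp.comp_aestronglyMeasurable
          (Complex.continuous_ofReal.comp_aestronglyMeasurable
            (hQ.aemeasurable.div_const 2).neg.aestronglyMeasurable))
    · rw [norm_mul, Complex.norm_exp, Complex.norm_real, Complex.ofReal_re]
      exact mul_le_mul (hFC ω) (Real.exp_le_exp.2 (hQM ω)) (Real.exp_nonneg _)
        ((abs_nonneg _).trans (hFC ω))
  have hb1 : ∀ k ω, -(pathQuad X 𝔤 k u τ ω / 2) ≤ M := fun k ω => by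
    linarith [h.pathQuad_nonneg k u τ ω]
  have hb2 : ∀ ω, -(quadVar X 𝔤 u τ ω / 2) ≤ M := fun ω => by
    linarith [(abs_le.1 (h.abs_quadVar_le u τ ω)).1]
  rw [tendsto_iff_norm_sub_tendsto_zero]
  have lim : Tendsto (fun k => C * Real.exp M * ∑ j, ∑ l, |u j * u l| *
      ∫ ω, |pathIntegral X 𝔤 k (min (τ j) (τ l)) ω - timeIntegral X 𝔤 (min (τ j) (τ l)) ω| ∂P)
      atTop (𝓝 0) := by
    have := tendsto_finsetSum (Finset.univ : Finset (Fin r)) fun j _ =>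
      tendsto_finsetSum (Finset.univ : Finset (Fin r)) fun l _ =>
        (h.tendsto_integral_abs_pathIntegral_sub (min (τ j) (τ l))).const_mul |u j * u l|
    simpa using this.const_mul (C * Real.exp M)
  refine squeeze_zero (fun _ => norm_nonneg _) (fun k => ?_) lim
  have hC : 0 ≤ C := (abs_nonneg _).trans (hFC (Measure.nonempty_of_neZero P).some)
  have hI : ∀ j l, Integrable (fun ω => |u j * u l| * |pathIntegral X 𝔤 k (min (τ j) (τ l)) ω
      - timeIntegral X 𝔤 (min (τ j) (τ l)) ω|) P := fun j l =>
    (h.integrable_pathIntegral_sub k _).1.const_mul _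
  rw [← integral_sub (hint _ (h.aestronglyMeasurable_pathQuad k u τ) (hb1 k))
    (hint _ (h.aestronglyMeasurable_quadVar u τ) hb2)]
  calc ‖∫ ω, ((F ω : ℂ) * Complex.exp ((-(pathQuad X 𝔤 k u τ ω / 2) : ℝ) : ℂ)
        - (F ω : ℂ) * Complex.exp ((-(quadVar X 𝔤 u τ ω / 2) : ℝ) : ℂ)) ∂P‖
      ≤ ∫ ω, C * Real.exp M * ∑ j, ∑ l, |u j * u l| *
        |pathIntegral X 𝔤 k (min (τ j) (τ l)) ω - timeIntegral X 𝔤 (min (τ j) (τ l)) ω| ∂P := by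
        refine norm_integral_le_of_norm_le ((integrable_finsetSum _ fun j _ =>
          integrable_finsetSum _ fun l _ => hI j l).const_mul _) (ae_of_all _ fun ω => ?_)
        rw [← mul_sub, norm_mul, Complex.norm_real, ← Complex.ofReal_exp, ← Complex.ofReal_exp,
          ← Complex.ofReal_sub, Complex.norm_real, mul_assoc]
        refine mul_le_mul (hFC ω) ((abs_exp_sub_exp_le (hb1 k ω) (hb2 ω)).trans
          (mul_le_mul_of_nonneg_left ?_ (Real.exp_nonneg _))) (norm_nonneg _) hC
        have e : pathQuad X 𝔤 k u τ ω - quadVar X 𝔤 u τ ω = ∑ j, ∑ l, u j * u l *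
            (pathIntegral X 𝔤 k (min (τ j) (τ l)) ω
              - timeIntegral X 𝔤 (min (τ j) (τ l)) ω) := by
          simp only [pathQuad, quadVar, mul_sub, Finset.sum_sub_distrib]
        have e2 : |-(pathQuad X 𝔤 k u τ ω / 2) - -(quadVar X 𝔤 u τ ω / 2)|
            ≤ |pathQuad X 𝔤 k u τ ω - quadVar X 𝔤 u τ ω| := by
          rw [show -(pathQuad X 𝔤 k u τ ω / 2) - -(quadVar X 𝔤 u τ ω / 2)
            = -((pathQuad X 𝔤 k u τ ω - quadVar X 𝔤 u τ ω) / 2) by ring, abs_neg, abs_div, abs_two]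
          exact half_le_self (abs_nonneg _)
        refine e2.trans ?_
        rw [e]
        refine (Finset.abs_sum_le_sum_abs _ _).trans (Finset.sum_le_sum fun j _ =>
          (Finset.abs_sum_le_sum_abs _ _).trans (Finset.sum_le_sum fun l _ => ?_))
        rw [abs_mul]
    _ = _ := by
        rw [integral_const_mul, integral_finsetSum _ fun j _ =>
          integrable_finsetSum _ fun l _ => hI j l]
        congr 1
        refine Finset.sum_congr rfl fun j _ => ?_
        rw [integral_finsetSum _ fun l _ => hI j l]
        simp only [integral_const_mul]

/-- Convergence in L² implies convergence in L¹ under a probability measure, and x ↦ e^{ix} is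
1-Lipschitz. -/
lemma tendsto_integral_cexp_itoSum (h : LimitSetting P ℱ X a g 𝔤 L γ) (u : Fin r → ℝ)
    (τ : Fin r → ℝ≥0) {F : Ω → ℝ} (hF : Measurable F) {C : ℝ} (hFC : ∀ ω, |F ω| ≤ C) :
    Tendsto (fun k => ∫ ω : Ω × (ℕ × ℕ → ℝ), (F ω.1 : ℂ) *
        Complex.exp (((∑ j, u j * itoSum X 𝔤 k (τ j) ω : ℝ) : ℂ) * Complex.I)
        ∂(P.prod gaussianSeq)) atTop
      (𝓝 (∫ ω : Ω × (ℕ × ℕ → ℝ), (F ω.1 : ℂ) *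
        Complex.exp (((∑ j, u j * h.itoIntegral (τ j) ω : ℝ) : ℂ) * Complex.I)
        ∂(P.prod gaussianSeq))) := by
  have hint : ∀ Y : Fin r → Ω × (ℕ × ℕ → ℝ) → ℝ,
      (∀ j, AEStronglyMeasurable (Y j) (P.prod gaussianSeq)) →
      Integrable (fun ω : Ω × (ℕ × ℕ → ℝ) => (F ω.1 : ℂ) *
        Complex.exp (((∑ j, u j * Y j ω : ℝ) : ℂ) * Complex.I)) (P.prod gaussianSeq) :=
    fun Y hY => by
    refine Integrable.of_bound (C := C) ?_ (ae_of_all _ fun ω => ?_)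
    · refine (Complex.measurable_ofReal.comp (hF.comp measurable_fst)).aestronglyMeasurable.mul
        (Complex.continuous_exp.comp_aestronglyMeasurable
          ((Complex.continuous_ofReal.comp_aestronglyMeasurable ?_).mul_const _))
      exact Finset.aestronglyMeasurable_fun_sum _ fun j _ => (hY j).const_mul _
    · rw [norm_mul, Complex.norm_exp_ofReal_mul_I, mul_one, Complex.norm_real]
      exact hFC _
  have hL1 : ∀ k t, Integrable (fun ω => |itoSum X 𝔤 k t ω - h.itoIntegral t ω|)
      (P.prod gaussianSeq) := fun k t =>
    (((h.memLp_itoSum k t).sub (h.memLp_itoIntegral t)).integrable one_le_two).abs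
  have hlim : ∀ t, Tendsto (fun k => ∫ ω, |itoSum X 𝔤 k t ω - h.itoIntegral t ω|
      ∂(P.prod gaussianSeq)) atTop (𝓝 0) := fun t => by
    have h2 := (ENNReal.tendsto_toReal ENNReal.zero_ne_top).comp (h.tendsto_itoSum t)
    rw [ENNReal.toReal_zero] at h2
    refine squeeze_zero (fun _ => integral_nonneg fun _ => abs_nonneg _) (fun k => ?_) h2
    have hm := (h.memLp_itoSum k t).sub (h.memLp_itoIntegral t)
    have e : ∫ ω, |itoSum X 𝔤 k t ω - h.itoIntegral t ω| ∂(P.prod gaussianSeq)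
        = (eLpNorm (itoSum X 𝔤 k t - h.itoIntegral t) 1 (P.prod gaussianSeq)).toReal := by
      rw [eLpNorm_one_eq_lintegral_enorm, ← integral_norm_eq_lintegral_enorm hm.1]
      rfl
    rw [e]
    exact ENNReal.toReal_mono hm.2.ne (eLpNorm_le_eLpNorm_of_exponent_le one_le_two hm.1)
  rw [tendsto_iff_norm_sub_tendsto_zero]
  have lim : Tendsto (fun k => C * ∑ j, |u j| * ∫ ω, |itoSum X 𝔤 k (τ j) ω - h.itoIntegral (τ j) ω|
      ∂(P.prod gaussianSeq)) atTop (𝓝 0) := by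
    have := tendsto_finsetSum (Finset.univ : Finset (Fin r)) fun j _ =>
      (hlim (τ j)).const_mul |u j|
    simpa using this.const_mul C
  refine squeeze_zero (fun _ => norm_nonneg _) (fun k => ?_) lim
  have hC : 0 ≤ C := (abs_nonneg _).trans (hFC (Measure.nonempty_of_neZero P).some)
  rw [← integral_sub (hint _ fun j => (h.memLp_itoSum k (τ j)).1)
    (hint _ fun j => (h.memLp_itoIntegral (τ j)).1)]
  calc ‖∫ ω : Ω × (ℕ × ℕ → ℝ), ((F ω.1 : ℂ) *
          Complex.exp (((∑ j, u j * itoSum X 𝔤 k (τ j) ω : ℝ) : ℂ) * Complex.I)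
        - (F ω.1 : ℂ) * Complex.exp (((∑ j, u j * h.itoIntegral (τ j) ω : ℝ) : ℂ) * Complex.I))
        ∂(P.prod gaussianSeq)‖
      ≤ ∫ ω, C * ∑ j, |u j| * |itoSum X 𝔤 k (τ j) ω - h.itoIntegral (τ j) ω|
        ∂(P.prod gaussianSeq) := by
        refine norm_integral_le_of_norm_le ((integrable_finsetSum _ fun j _ =>
          (hL1 k (τ j)).const_mul _).const_mul _) (ae_of_all _ fun ω => ?_)
        rw [← mul_sub, norm_mul, Complex.norm_real, norm_cexp_mul_I_sub_le]
        refine mul_le_mul (hFC _) ?_ (norm_nonneg _) hC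
        refine (norm_cexp_mul_I_sub_one_le _).trans ?_
        rw [← Finset.sum_sub_distrib]
        refine (Finset.abs_sum_le_sum_abs _ _).trans (Finset.sum_le_sum fun j _ => ?_)
        rw [← mul_sub, abs_mul]
    _ = _ := by
        rw [integral_const_mul, integral_finsetSum _ fun j _ => (hL1 k (τ j)).const_mul _]
        simp only [integral_const_mul]

/-- The characteristic function of the Itô integral given `X` is Gaussian. -/
theorem integral_cexp_itoIntegral (h : LimitSetting P ℱ X a g 𝔤 L γ) (u : Fin r → ℝ)
    (τ : Fin r → ℝ≥0) {F : Ω → ℝ} (hF : Measurable F) {C : ℝ} (hFC : ∀ ω, |F ω| ≤ C) :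
    ∫ ω : Ω × (ℕ × ℕ → ℝ), (F ω.1 : ℂ) *
        Complex.exp (((∑ j, u j * h.itoIntegral (τ j) ω : ℝ) : ℂ) * Complex.I)
        ∂(P.prod gaussianSeq)
      = ∫ ω, (F ω : ℂ) * Complex.exp ((-(quadVar X 𝔤 u τ ω / 2) : ℝ) : ℂ) ∂P := by
  refine tendsto_nhds_unique (h.tendsto_integral_cexp_itoSum u τ hF hFC) ?_
  simp only [fun k => h.integral_cexp_itoSum k u τ hF hFC]
  exact h.tendsto_integral_cexp_pathQuad u τ hF hFC

end LimitSetting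

end ItoCharFun

end LevyHF

/-! ### The limit theorem -/

theorem theorem3p2 {Ω : Type u} {mΩ : MeasurableSpace Ω} (P : Measure Ω) [IsProbabilityMeasure P]
    (ℱ : Filtration ℝ≥0 mΩ) (d m : ℕ) (X : ℝ≥0 → Ω → EuclideanSpace ℝ (Fin d))
    (hX : LevyHF.IsLevyProcess ℱ X P) (hXc : LevyHF.HasIIDComponents X P)
    (a : ℕ → ℝ)
    (g : EuclideanSpace ℝ (Fin d) → (Fin (m + 1) → EuclideanSpace ℝ (Fin d)) → ℝ)
    (α : ℝ) (hα : α ∈ Set.Ioo (0 : ℝ) 2) (hH1 : LevyHF.HypothesisH1 P X a g α)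
    (𝔤 : EuclideanSpace ℝ (Fin d) → ℝ)
    (h𝔤 : ∀ x, Tendsto (fun n => LevyHF.gn P X a g n x) atTop (𝓝 (𝔤 x)))
    (hunif : Tendsto (fun n => ⨆ x, ‖LevyHF.gn P X a g n x - 𝔤 x‖ₑ) atTop (𝓝 0)) :
    ∃ (Ω' : Type u) (mΩ' : MeasurableSpace Ω') (P' : Measure Ω') (π : Ω' → Ω)
      (ℋ : Filtration ℝ≥0 mΩ') (W I : ℝ≥0 → Ω' → ℝ),
      -- `(Ω', P')` is an extension of the filtered probability space `(Ω, P)`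
      IsProbabilityMeasure P' ∧ MeasurePreserving π P' P ∧
      (∀ t, (ℱ t).comap π ≤ ℋ t) ∧
      -- `W` is a Brownian motion, independent of `X`
      LevyHF.IsBrownianFor ℋ W P' ∧
      IndepFun (fun (ω' : Ω') (t : ℝ≥0) => W t ω') (fun (ω' : Ω') (t : ℝ≥0) => X t (π ω')) P' ∧
      -- `I t = ∫_0^t √(A_s) dW_s` with `A_s = 𝔤(X_s)`
      LevyHF.IsItoIntegral ℋ W (fun s ω' => Real.sqrt (𝔤 (X s (π ω')))) I P' ∧
      -- stable convergence of the finite-dimensional distributions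
      ∀ (r : ℕ) (τ : Fin r → ℝ≥0),
        LevyHF.StablyConverges (⨆ t, MeasurableSpace.comap (X t) inferInstance) P P' π
          (fun n ω l => LevyHF.statZ P ℱ X a g n (τ l) ω) (fun ω' l => I (τ l) ω') := by
  obtain ⟨L, γ, h⟩ := LevyHF.exists_limitSetting hX hα hH1 h𝔤 hunif
  have hZ : ∀ n t, LevyHF.statZ P ℱ X a g n t =ᵐ[P] LevyHF.centredSum P X a g n t := fun n t =>
    hX.statZ_ae_eq h.continuous h.bound n t
  -- A product extension: the Brownian motion depends on the second coordinate only and X on the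
  -- first, so they are independent.
  refine ⟨Ω × (ℕ × ℕ → ℝ), inferInstance, P.prod LevyHF.gaussianSeq, Prod.fst,
    LevyHF.extFiltration ℱ, fun t ω => LevyHF.brownian t ω.2, h.itoIntegral, inferInstance,
    measurePreserving_fst, LevyHF.comap_fst_le_extFiltration ℱ, LevyHF.isBrownianFor_snd P ℱ,
    LevyHF.indepFun_brownian_snd P h.measurable, h.isItoIntegral_itoIntegral, fun r τ => ?_⟩
  refine LevyHF.stablyConverges_of_charFun h.iSup_comap_le measurePreserving_fst (fun n => ?_) ?_
    fun F hF hFC u => ?_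
  · exact aemeasurable_pi_lambda _ fun j =>
      (h.measurable_centredSum n (τ j)).aemeasurable.congr (hZ n (τ j)).symm
  · exact aemeasurable_pi_lambda _ fun j => (h.memLp_itoIntegral (τ j)).1.aemeasurable
  · obtain ⟨C, hC⟩ := hFC
    -- Both sides are brought to E[F exp(-Q/2)]. The conditional expectations in the statistic equal
    -- the explicit means almost surely, which does not affect the integrals.
    rw [h.integral_cexp_itoIntegral u τ (hF.mono h.iSup_comap_le le_rfl) hC]
    refine (h.tendsto_integral_mul_cexp u τ hF hC).congr fun n => integral_congr_ae ?_
    filter_upwards [ae_all_iff.2 fun j => hZ n (τ j)] with ω hω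
    simp only [hω]
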